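/- **Setting.** All manifolds are smooth, closed and not necessarily connected. Let $\Sigma$ be an oriented surface and $\pi\colon V\to\Sigma$ a smooth fibre bundle with fibre $M$, $\dim M=2n-1\ge 1$; put $M_b=\pi^{-1}(b)$. A *contact fibre bundle* on $\pi$ is a cooriented hyperplane field $\eta=\ker\alpha$ on $V$ inducing a contact structure $\xi_b=\eta\cap TM_b$ on each fibre. Its contact connection $\mathcal H\subset\eta$ is the $d\alpha$-orthogonal in $\eta$ of the planes of the $\xi_b$. A *flat contact bundle* is a contact fibre bundle $\eta_0$ on $\pi$ whose contact connection $\mathcal H_0$ has zero curvature. For another contact fibre bundle $\eta$ inducing the same cooriented contact structures on the fibres, the *potential* $A$ assigns to $u\in T_b\Sigma$ the vector field $A_u=\widehat u-\widehat u^{\,0}$ on $M_b$, the difference of the horizontal lifts of $u$ for $\eta$ and for $\eta_0$. Then $\eta$ is a *Bourgeois contact structure* on $(\pi,\eta_0)$ if it is a positive contact structure on $V$ ($M_b$ being oriented by $\xi_b$, and $V$ by the fibres followed by $\Sigma$) and $d_\nabla A=0$, i.e. $[\widehat U^0,A_W]-[\widehat W^0,A_U]-A_{[U,W]}=0$ for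 all vector fields $U,W$ on $\Sigma$. An *open book* of a closed manifold $N$ is a pair $(K,\varphi)$ such that some smooth $\phi\colon N\to\mathbb R^2$ transverse to $0$ *defines* it, i.e. $K=\phi^{-1}(0)$ (possibly empty) and $\varphi=\phi/\|\phi\|$ on $N\setminus K$, and such that $\varphi\colon N\setminus K\to\mathbb S^1$ is a smooth fibration. It is *adapted to* (supports) a contact structure $\xi$ on $N$ if $K$ is a positive contact submanifold and there is a contact form $\beta$ defining $\xi$ (an *adapted form*) with $d\beta$ positively symplectic on the fibres of $\varphi$. Two adapted open books $(K_0,\varphi_0)$, $(K_1,\varphi_1)$ of $(N,\xi)$ are *isotopic* if there is a smooth isotopy $(f_t)_{t\in[0,1]}$ of $N$ with $f_0=\mathrm{Id}$, $K_1=f_1(K_0)$, $\varphi_1=\varphi_0\circ f_1^{-1}$ and $(f_t(K_0),\varphi_0\circ f_t^{-1})$ adapted to $\xi$ for all $t$. **Statement.** *(A)* Let $\eta=\ker\alpha$ be a Bourgeois contact structure on a flat contact bundle $(\pi\colon V\to\Sigma,\eta_0)$. For $b\in\Sigma$ and a positive frame $(u,v)$ of $T_b\Sigma$ let $\Psi_\eta(u,v)$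 be the pair $(K,\varphi)$ on $M_b$ defined by the function $\phi_{(u,v)}=(\alpha(A_u),-\alpha(A_v))\colon M_b\to\mathbb R^2$, i.e. $K=\phi_{(u,v)}^{-1}(0)$ and $\varphi=\phi_{(u,v)}/\|\phi_{(u,v)}\|$ (this does not depend on the choice of $\alpha$). Then: 1. $\Psi_\eta(u,v)$ is an open book of $M_b$ adapted to $\xi_b$, for every $b\in\Sigma$ and every positive frame $(u,v)$ of $T_b\Sigma$. 2. For every smooth path $\gamma=(u_t,v_t)_{t\in[0,1]}$ of positive frames over a path $c$ in $\Sigma$, the open books $\Psi_\eta(u_t,v_t)$ form a smooth family of adapted open books: there is a smooth function $\Phi$ on $\{(t,p)\in[0,1]\times V : \pi(p)=c(t)\}$ such that $\Phi(t,\cdot)$ defines $\Psi_\eta(u_t,v_t)$ for every $t$. 3. For every $b\in\Sigma$ there are positive frames of $T_b\Sigma$, and the isotopy class $\psi_\eta(b)$ of $\Psi_\eta(u,v)$ among open books of $M_b$ adapted to $\xi_b$ does not depend on the positive frame $(u,v)$ of $T_b\Sigma$. 4. If $\pi$ is smoothly trivialized over an open set $U\subset\Sigma$, $\pi^{-1}(U)\cong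 U\times M$, and $c\colon(-\epsilon,\epsilon)\to U$ is a smooth path, there is a smooth family of adapted open books $(B_t,\varphi_t)$ of the fibres $M_{c(t)}$, in the sense of 2., with $(B_t,\varphi_t)\in\psi_\eta(c(t))$, whose image under $\pi^{-1}(U)\cong U\times M\to M$ is an isotopy of open books of $M$: there is a smooth family $(f_t)_{t\in(-\epsilon,\epsilon)}$ of diffeomorphisms of $M$ with $f_0=\mathrm{Id}$ such that $f_t$ carries the image of $(B_0,\varphi_0)$ to the image of $(B_t,\varphi_t)$. *(B)* Let $(M^{2n-1},\xi)$ be a closed contact manifold, $(B,\varphi)$ an open book of $M$ adapted to $\xi$, $\phi=(\phi_1,\phi_2)\colon M\to\mathbb R^2$ a smooth map defining $(B,\varphi)$ and, if $n\ge2$, satisfying $\beta\wedge d\beta^{n-2}\wedge d\phi_1\wedge d\phi_2\ge 0$, where $\beta$ is a contact form defining $\xi$ and adapted to $(B,\varphi)$. Then $\eta=\ker(\beta+\phi_1\,d\theta_1-\phi_2\,d\theta_2)$ is a Bourgeois contact structure on the flat contact bundle $(M\times\mathbb T^2\to\mathbb T^2,\ \xi\oplus T\mathbb T^2)$, where $\mathbb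 T^2$ has the angular coordinates $(\theta_1,\theta_2)$ and the orientation $d\theta_1\wedge d\theta_2$. For every $b\in\mathbb T^2$, under the identification $M_b=M\times\{b\}\cong M$, the class $\psi_\eta(b)$ is the isotopy class of $(B,\varphi)$ among open books of $M$ adapted to $\xi$. -/

import Mathlib

open Set
open scoped Manifold ContDiff

noncomputable section

namespace ContactBundle

/-! ### One-forms, exterior derivative and cooriented hyperplane fields -/

section Forms

variable {E : Type*} [NormedAddCommGroup E] [NormedSpace ℝ E]
  {H : Type*} [TopologicalSpace H] (I : ModelWithCorners ℝ E H)
  (N : Type*) [TopologicalSpace N] [ChartedSpace H N] [IsManifold I ∞ N]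

/-- A (not necessarily smooth) field of covectors on `N`. -/
abbrev OneForm := ∀ p : N, TangentSpace I p →L[ℝ] ℝ

/-- A cooriented hyperplane field `η`, recorded by its positive open half-spaces: `v ∈ η p` means
that `v` is positively transverse to the hyperplane at `p`. (The hyperplane at `p` is then
`{v | v ∉ η p ∧ -v ∉ η p}`.) Only fields with a defining form, see `Defines`, are meaningful. -/
abbrev HyperplaneField := ∀ p : N, Set (TangentSpace I p)

variable {I N}

/-- Smoothness of a one-form, as a fibrewise linear function on the tangent bundle. -/
def SmoothForm (α : OneForm I N) : Prop :=
  ContMDiff I.tangent 𝓘(ℝ, ℝ) ∞ (fun v : TangentBundle I N => α v.proj v.snd)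

/-- The kernel of `α`, cooriented by `α`. -/
def cokernel (α : OneForm I N) : HyperplaneField I N := fun p => {v | 0 < α p v}

/-- `α` is a smooth nowhere vanishing one-form with `η = ker α` as cooriented hyperplane fields. -/
def Defines (α : OneForm I N) (η : HyperplaneField I N) : Prop :=
  SmoothForm α ∧ (∀ p, α p ≠ 0) ∧ η = cokernel α

/-- The pullback `j^* α`. -/
def pullbackForm {E' : Type*} [NormedAddCommGroup E'] [NormedSpace ℝ E']
    {H' : Type*} [TopologicalSpace H'] (I' : ModelWithCorners ℝ E' H')
    {N' : Type*} [TopologicalSpace N'] [ChartedSpace H' N'] [IsManifold I' ∞ N']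
    (j : N' → N) (α : OneForm I N) : OneForm I' N' :=
  fun m => (α (j m)).comp (mfderiv I' I j m)

/-- The pullback `j^* η = {v | dj(v) ∈ η}`, cooriented by `η`. -/
def pullbackField {E' : Type*} [NormedAddCommGroup E'] [NormedSpace ℝ E']
    {H' : Type*} [TopologicalSpace H'] (I' : ModelWithCorners ℝ E' H')
    {N' : Type*} [TopologicalSpace N'] [ChartedSpace H' N'] [IsManifold I' ∞ N']
    (j : N' → N) (η : HyperplaneField I N) : HyperplaneField I' N' :=
  fun m => {v | mfderiv I' I j m v ∈ η (j m)}

/-- The one-form `α` read in the chart at `p` (for boundaryless manifolds). -/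
def formInChart (α : OneForm I N) (p : N) (y : E) : E →L[ℝ] ℝ :=
  (α ((extChartAt I p).symm y)).comp (mfderiv 𝓘(ℝ, E) I (extChartAt I p).symm y)

/-- The exterior derivative `(dα)_p (v, w)`, computed in the chart at `p`, with the convention
`dα(X, Y) = X (α Y) - Y (α X) - α [X, Y]`. -/
def extD (α : OneForm I N) (p : N) (v w : TangentSpace I p) : ℝ :=
  fderiv ℝ (formInChart α p) (extChartAt I p p)
      (mfderiv I 𝓘(ℝ, E) (extChartAt I p) p v) (mfderiv I 𝓘(ℝ, E) (extChartAt I p) p w)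
    - fderiv ℝ (formInChart α p) (extChartAt I p p)
      (mfderiv I 𝓘(ℝ, E) (extChartAt I p) p w) (mfderiv I 𝓘(ℝ, E) (extChartAt I p) p v)

/-- For a map `f` to the unit circle, the one-form `f^* dθ`; on a velocity `v` this is
`Im (conj (f p) * df(v))`. -/
def angularForm (I : ModelWithCorners ℝ E H) (f : N → Circle) : OneForm I N := fun p =>
  Complex.imCLM.comp ((ContinuousLinearMap.mul ℝ ℂ (starRingEnd ℂ (f p : ℂ))).comp
    (mfderiv I 𝓘(ℝ, ℂ) (fun q => (f q : ℂ)) p))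

/-- `2 ^ k` times the value of `a ∧ Ω ∧ ⋯ ∧ Ω` (with `k` factors `Ω`) on `2 k + 1` vectors, for a
covector `a` and an alternating bilinear form `Ω`. -/
def topForm (k : ℕ) {T : Type*} (a : T → ℝ) (Ω : T → T → ℝ) (v : Fin (2 * k + 1) → T) : ℝ :=
  ∑ σ : Equiv.Perm (Fin (2 * k + 1)), ((Equiv.Perm.sign σ : ℤ) : ℝ) *
    (a (v (σ 0)) * ∏ i : Fin k,
      Ω (v (σ ⟨2 * i + 1, by have := i.2; lia⟩)) (v (σ ⟨2 * i + 2, by have := i.2; lia⟩)))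

/-- The tuple `(z₁, z₂, w₀, …, w_{2m})`. -/
def cons₂ {T : Type*} {m : ℕ} (z₁ z₂ : T) (w : Fin (2 * m + 1) → T) :
    Fin (2 * (m + 1) + 1) → T :=
  Matrix.vecCons z₁ (Matrix.vecCons z₂ w)

/-- `ξ` is a (cooriented) contact structure on the `(2k+1)`-dimensional manifold `N`:
`γ ∧ (dγ)^k` vanishes nowhere, for a defining form `γ`. As usual `N` is then oriented by the
volume form `γ ∧ (dγ)^k`, which does not depend on `γ` up to positive factors. -/
def IsContact (k : ℕ) (ξ : HyperplaneField I N) : Prop :=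
  ∃ γ : OneForm I N, Defines γ ξ ∧ ∀ p, ∀ v : Fin (2 * k + 1) → TangentSpace I p,
    LinearIndependent ℝ v → topForm k (γ p) (extD γ p) v ≠ 0

/-- A smooth vector field. -/
def SmoothField (X : ∀ p : N, TangentSpace I p) : Prop :=
  ContMDiff I I.tangent ∞ (fun p => (⟨p, X p⟩ : TangentBundle I N))

/-- `o x u v` ("the frame `(u, v)` is positive") is an orientation of the surface `N`: it is
given by an area form. -/
def IsOrientation (o : ∀ x : N, TangentSpace I x → TangentSpace I x → Prop) : Prop :=
  ∃ μ : ∀ x : N, TangentSpace I x →L[ℝ] TangentSpace I x →L[ℝ] ℝ,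
    (∀ U W : ∀ x : N, TangentSpace I x, SmoothField U → SmoothField W →
      ContMDiff I 𝓘(ℝ, ℝ) ∞ (fun x => μ x (U x) (W x))) ∧
    (∀ x u, μ x u u = 0) ∧ (∀ x, μ x ≠ 0) ∧ ∀ x u v, o x u v ↔ 0 < μ x u v

end Forms

/-! ### Open books -/

/-- The data `(K, φ)` of an open book on `X`. The values of `φ` on `K` are irrelevant. -/
structure OpenBook (X : Type*) where
  /-- The binding `K`. -/
  binding : Set X
  /-- The map `φ : X ∖ K → 𝕊¹`. -/
  map : X → Circle

namespace OpenBook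

variable {X Y : Type*}

/-- The page `φ⁻¹(θ)`. -/
def page (B : OpenBook X) (θ : Circle) : Set X := {p | p ∉ B.binding ∧ B.map p = θ}

/-- The open book on `Y` corresponding to `B` under an identification `j : Y → X`. -/
def pullback (B : OpenBook X) (j : Y → X) : OpenBook Y := ⟨j ⁻¹' B.binding, B.map ∘ j⟩

/-- The image `(f(K), φ ∘ f⁻¹)`. -/
def image (B : OpenBook X) (f : X ≃ X) : OpenBook X := ⟨f '' B.binding, B.map ∘ f.symm⟩

/-- Equality of open books: same binding, and same map off the binding. -/
def Same (B B' : OpenBook X) : Prop :=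
  B.binding = B'.binding ∧ ∀ p, p ∉ B.binding → B.map p = B'.map p

end OpenBook

section OpenBooks

variable {E : Type*} [NormedAddCommGroup E] [NormedSpace ℝ E]
  {H : Type*} [TopologicalSpace H] (I : ModelWithCorners ℝ E H)
  {N : Type*} [TopologicalSpace N] [ChartedSpace H N] [IsManifold I ∞ N]

/-- `Φ : N → ℝ² = ℂ` defines the pair `(K, φ)`: it is smooth and transverse to `0`,
`K = Φ⁻¹(0)`, and `φ = Φ / ‖Φ‖` off `K`. -/
def IsDefinedBy (B : OpenBook N) (Φ : N → ℂ) : Prop :=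
  ContMDiff I 𝓘(ℝ, ℂ) ∞ Φ ∧
  (∀ p, Φ p = 0 → Function.Surjective (mfderiv I 𝓘(ℝ, ℂ) Φ p)) ∧
  B.binding = {p | Φ p = 0} ∧
  ∀ p, p ∉ B.binding → Φ p = ‖Φ p‖ * (B.map p : ℂ)

/-- `φ : N ∖ K → 𝕊¹` is a smooth (locally trivial) fibration: over a neighbourhood `U` of any
`θ` there is a diffeomorphism `τ : U × φ⁻¹(θ) → φ⁻¹(U)` over `U`, with inverse `y ↦ (φ y, r y)`. -/
def IsFibration (B : OpenBook N) : Prop :=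
  ContMDiffOn I (𝓡 1) ∞ B.map B.bindingᶜ ∧
  ∀ θ : Circle, ∃ U : Set Circle, IsOpen U ∧ θ ∈ U ∧ ∃ (τ : Circle × N → N) (r : N → N),
    ContMDiffOn ((𝓡 1).prod I) I ∞ τ (U ×ˢ B.page θ) ∧
    ContMDiffOn I I ∞ r (B.bindingᶜ ∩ B.map ⁻¹' U) ∧
    (∀ z ∈ U, ∀ x ∈ B.page θ, τ (z, x) ∈ B.page z ∧ r (τ (z, x)) = x) ∧
    ∀ y, y ∉ B.binding → B.map y ∈ U → r y ∈ B.page θ ∧ τ (B.map y, r y) = y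

/-- `(K, φ)` is an open book decomposition of `N` (possibly with empty binding). -/
def IsOpenBook (B : OpenBook N) : Prop := (∃ Φ, IsDefinedBy I B Φ) ∧ IsFibration I B

variable {I}

/-- The value at `(z₁, z₂, w)` of `dφ₁ ∧ dφ₂ ∧ γ ∧ (dγ)^m`, where `Φ = (φ₁, φ₂)`, `w` is a basis of
`ker dΦ` at `p` and `(dΦ z₁, dΦ z₂)` is a positive basis of `ℝ²`, measured (up to positive factors)
with respect to the orientation given by `γ ∧ (dγ)^(m+1)`. -/
def normalSign (m : ℕ) (γ : OneForm I N) (p : N) (z₁ z₂ : TangentSpace I p)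
    (w : Fin (2 * m + 1) → TangentSpace I p) : ℝ :=
  topForm m (γ p) (extD γ p) w * topForm (m + 1) (γ p) (extD γ p) (cons₂ z₁ z₂ w)

/-- `w` is a linearly independent family in `ker dΦ` and `(dΦ z₁, dΦ z₂)` is a positive basis of
`ℝ²`. -/
def IsAdaptedBasis {m : ℕ} (Φ : N → ℂ) (p : N) (z₁ z₂ : TangentSpace I p)
    (w : Fin (2 * m + 1) → TangentSpace I p) : Prop :=
  LinearIndependent ℝ w ∧ (∀ i, mfderiv I 𝓘(ℝ, ℂ) Φ p (w i) = 0) ∧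
  0 < (let L : TangentSpace I p →L[ℝ] ℂ := mfderiv I 𝓘(ℝ, ℂ) Φ p
    starRingEnd ℂ (L z₁) * L z₂).im

/-- The zero set of `Φ` is a positive contact submanifold of the contact manifold `(N, ker γ)` of
dimension `2k+1`; it is oriented as the preimage of `0`, equivalently as the boundary of the
pages. For `k = 0` the zero set is empty and there is no condition. -/
def BindingPositive (k : ℕ) (Φ : N → ℂ) (γ : OneForm I N) : Prop :=
  ∀ p, Φ p = 0 → ∀ m, m + 1 = k → ∀ z₁ z₂ (w : Fin (2 * m + 1) → TangentSpace I p),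
    IsAdaptedBasis Φ p z₁ z₂ w → 0 < normalSign m γ p z₁ z₂ w

/-- `γ ∧ (dγ)^(k-1) ∧ dφ₁ ∧ dφ₂ ≥ 0` on `N`, where `Φ = (φ₁, φ₂)` (no condition for `k = 0`). -/
def WedgeNonneg (k : ℕ) (Φ : N → ℂ) (γ : OneForm I N) : Prop :=
  ∀ p, ∀ m, m + 1 = k → ∀ z₁ z₂ (w : Fin (2 * m + 1) → TangentSpace I p),
    IsAdaptedBasis Φ p z₁ z₂ w → 0 ≤ normalSign m γ p z₁ z₂ w

/-- `dγ` is positively symplectic on the pages, i.e. `dφ ∧ (dγ)^k > 0` off the binding, for the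
orientation given by `γ ∧ (dγ)^k`. -/
def PagesPositive (k : ℕ) (B : OpenBook N) (γ : OneForm I N) : Prop :=
  ∀ p, p ∉ B.binding → ∀ v : Fin (2 * k + 1) → TangentSpace I p, LinearIndependent ℝ v →
    0 < topForm k (angularForm I B.map p) (extD γ p) v * topForm k (γ p) (extD γ p) v

/-- The contact form `β` defining `ξ` is adapted to the open book `B`. -/
def IsAdaptedForm (k : ℕ) (ξ : HyperplaneField I N) (B : OpenBook N) (β : OneForm I N) : Prop :=
  Defines β ξ ∧ PagesPositive k B β

/-- `B` is an open book decomposition adapted to (supporting) the contact structure `ξ`. -/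
def IsAdapted (k : ℕ) (ξ : HyperplaneField I N) (B : OpenBook N) : Prop :=
  IsOpenBook I B ∧
  (∀ Φ γ, IsDefinedBy I B Φ → Defines γ ξ → BindingPositive k Φ γ) ∧
  ∃ β, IsAdaptedForm k ξ B β

/-- `f_t`, `t ∈ J`, is a smooth family of diffeomorphisms of `N` with `f_0 = id`. -/
def IsIsotopyOn (J : Set ℝ) (f : ℝ → N ≃ₘ^∞⟮I, I⟯ N) : Prop :=
  ContMDiffOn (𝓘(ℝ, ℝ).prod I) I ∞ (fun x : ℝ × N => f x.1 x.2) (J ×ˢ univ) ∧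
  ∀ p, f 0 p = p

/-- `B₀` and `B₁` are adapted to `ξ` and isotopic among open books adapted to `ξ`. -/
def IsIsotopic (k : ℕ) (ξ : HyperplaneField I N) (B₀ B₁ : OpenBook N) : Prop :=
  IsAdapted k ξ B₀ ∧ IsAdapted k ξ B₁ ∧
  ∃ f : ℝ → N ≃ₘ^∞⟮I, I⟯ N, IsIsotopyOn (Icc 0 1) f ∧
    (∀ t ∈ Icc (0 : ℝ) 1, IsAdapted k ξ (B₀.image (f t).toEquiv)) ∧
    (B₀.image (f 1).toEquiv).Same B₁

end OpenBooks

/-! ### Contact fibre bundles over a surface -/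

section Bundles

variable {EV : Type*} [NormedAddCommGroup EV] [NormedSpace ℝ EV]
  {HV : Type*} [TopologicalSpace HV] (IV : ModelWithCorners ℝ EV HV)
  {V : Type*} [TopologicalSpace V] [ChartedSpace HV V] [IsManifold IV ∞ V]
  {ES : Type*} [NormedAddCommGroup ES] [NormedSpace ℝ ES]
  {HS : Type*} [TopologicalSpace HS] (IS : ModelWithCorners ℝ ES HS)
  {S : Type*} [TopologicalSpace S] [ChartedSpace HS S] [IsManifold IS ∞ S]
  {EM : Type*} [NormedAddCommGroup EM] [NormedSpace ℝ EM]
  {HM : Type*} [TopologicalSpace HM] (IM : ModelWithCorners ℝ EM HM)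
  {M : Type*} [TopologicalSpace M] [ChartedSpace HM M] [IsManifold IM ∞ M]
  (k : ℕ) (π : V → S)

/-- A local trivialization `π⁻¹(U) ≃ U × M` that is a diffeomorphism. -/
def IsSmoothTrivialization {π : V → S} (e : Bundle.Trivialization M π) : Prop :=
  ContMDiffOn IV (IS.prod IM) ∞ e e.source ∧
  ContMDiffOn (IS.prod IM) IV ∞ e.toOpenPartialHomeomorph.symm e.target

/-- `π : V → S` is a smooth fibre bundle with fibre `M`. -/
def IsSmoothFibreBundle (M : Type*) [TopologicalSpace M] [ChartedSpace HM M] [IsManifold IM ∞ M] (π : V → S) : Prop :=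
  ∀ b, ∃ e : Bundle.Trivialization M π, b ∈ e.baseSet ∧ IsSmoothTrivialization IV IS IM e

/-- The fibre `M_b = π⁻¹(b)`. -/
abbrev Fibre (π : V → S) (b : S) := ↥(π ⁻¹' {b})

/-- `v` is vertical, i.e. tangent to the fibre. -/
def IsVertical (p : V) (v : TangentSpace IV p) : Prop := mfderiv IV IS π p v = 0

/-- `η` is a contact fibre bundle: a cooriented hyperplane field inducing a contact structure on
each fibre, that is, for a defining form `α` the restriction of `α ∧ (dα)^k` to each (vertical)
tangent space of a fibre is nonzero. -/
def IsContactFibreBundle (η : HyperplaneField IV V) : Prop :=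
  ∃ α : OneForm IV V, Defines α η ∧ ∀ p, ∀ w : Fin (2 * k + 1) → TangentSpace IV p,
    LinearIndependent ℝ w → (∀ i, IsVertical IV IS π p (w i)) →
    topForm k (α p) (extD α p) w ≠ 0

/-- `w` lies in the contact connection of `η`: the `dα`-orthogonal in `η` of the fibre contact
planes (which does not depend on the defining form `α`). -/
def IsHorizontal (η : HyperplaneField IV V) (p : V) (w : TangentSpace IV p) : Prop :=
  ∀ α : OneForm IV V, Defines α η → α p w = 0 ∧
    ∀ z, IsVertical IV IS π p z → α p z = 0 → extD α p w z = 0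

/-- The horizontal lift at `p` of a tangent vector `u` of `S` based at `π p`. -/
def horizontalLift (η : HyperplaneField IV V) (p : V) (u : TangentBundle IS S) :
    TangentSpace IV p :=
  Classical.epsilon fun w => IsHorizontal IV IS π η p w ∧
    tangentMap IV IS π (⟨p, w⟩ : TangentBundle IV V) = u

/-- The horizontal lift of a vector field on `S`. -/
def liftField (η : HyperplaneField IV V) (U : ∀ x : S, TangentSpace IS x) :
    ∀ p : V, TangentSpace IV p :=
  fun p => horizontalLift IV IS π η p ⟨π p, U (π p)⟩

/-- The horizontal part of a vector field on `V`. -/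
def horizontalPart (η : HyperplaneField IV V) (X : ∀ p : V, TangentSpace IV p) :
    ∀ p : V, TangentSpace IV p :=
  fun p => horizontalLift IV IS π η p (tangentMap IV IS π (⟨p, X p⟩ : TangentBundle IV V))

/-- The curvature `R(X, Z) = ω([X_h, Z_h])`, where `ω` is the projection to the vertical part. -/
def curvature (η : HyperplaneField IV V) (X Z : ∀ p : V, TangentSpace IV p) :
    ∀ p : V, TangentSpace IV p :=
  let Y := VectorField.mlieBracket IV (horizontalPart IV IS π η X) (horizontalPart IV IS π η Z)
  fun p => Y p - horizontalPart IV IS π η Y p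

/-- The potential `A_u` of `η` with respect to `η₀`: difference of the horizontal lifts. -/
def potential (η₀ η : HyperplaneField IV V) (p : V) (u : TangentBundle IS S) :
    TangentSpace IV p :=
  horizontalLift IV IS π η p u - horizontalLift IV IS π η₀ p u

/-- The vertical vector field `A_U` on `V`, for a vector field `U` on `S`. -/
def potentialField (η₀ η : HyperplaneField IV V) (U : ∀ x : S, TangentSpace IS x) :
    ∀ p : V, TangentSpace IV p :=
  fun p => potential IV IS π η₀ η p ⟨π p, U (π p)⟩

/-- `d_∇ A (U, W) = ∇_U A_W - ∇_W A_U - A_{[U, W]}`, where `∇_U σ = [Û⁰, σ]` and `Û⁰` is the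
`η₀`-horizontal lift of `U`. -/
def covariantD (η₀ η : HyperplaneField IV V) (U W : ∀ x : S, TangentSpace IS x) :
    ∀ p : V, TangentSpace IV p :=
  fun p =>
    VectorField.mlieBracket IV (liftField IV IS π η₀ U) (potentialField IV IS π η₀ η W) p
    - VectorField.mlieBracket IV (liftField IV IS π η₀ W) (potentialField IV IS π η₀ η U) p
    - potentialField IV IS π η₀ η (VectorField.mlieBracket IS U W) p

/-- `η` is a positive contact structure on the `(2k+3)`-dimensional total space `V`. Here the fibres
are oriented by the contact structures that `η` induces on them, and `V` by the orientation of the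
fibres followed by the orientation `o` of `S`. -/
def IsPositiveContact (o : ∀ x : S, TangentSpace IS x → TangentSpace IS x → Prop)
    (η : HyperplaneField IV V) : Prop :=
  ∃ α : OneForm IV V, Defines α η ∧
    ∀ p, ∀ (z₁ z₂ : TangentSpace IV p) (w : Fin (2 * k + 1) → TangentSpace IV p),
      LinearIndependent ℝ w → (∀ i, IsVertical IV IS π p (w i)) →
      o (π p) (mfderiv IV IS π p z₁) (mfderiv IV IS π p z₂) →
      0 < topForm k (α p) (extD α p) w * topForm (k + 1) (α p) (extD α p) (cons₂ z₁ z₂ w)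

/-- `(π, η₀)` is a flat contact bundle with fibre `M` of dimension `2k+1`. -/
structure IsFlatContactBundle (M : Type*) [TopologicalSpace M] [ChartedSpace HM M] [IsManifold IM ∞ M]
    (η₀ : HyperplaneField IV V) : Prop where
  bundle : IsSmoothFibreBundle IV IS IM M π
  contact : IsContactFibreBundle IV IS k π η₀
  flat : ∀ X Z, SmoothField X → SmoothField Z → ∀ p, curvature IV IS π η₀ X Z p = 0

/-- `η` is a Bourgeois contact structure on the flat contact bundle `(π, η₀)` over the surface `S`
oriented by `o`: a contact fibre bundle with the same fibre contact structures as `η₀`, which is a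
contact structure on `V`, and whose potential satisfies `d_∇ A = 0`. -/
structure IsBourgeois (M : Type*) [TopologicalSpace M] [ChartedSpace HM M] [IsManifold IM ∞ M]
    (o : ∀ x : S, TangentSpace IS x → TangentSpace IS x → Prop)
    (η₀ η : HyperplaneField IV V) : Prop where
  orientation : IsOrientation o
  flat_bundle : IsFlatContactBundle IV IS IM k π M η₀
  contact_bundle : IsContactFibreBundle IV IS k π η
  same_fibres : ∀ p v, IsVertical IV IS π p v → (v ∈ η p ↔ v ∈ η₀ p)
  contact : IsPositiveContact IV IS k π o η
  closed : ∀ U W, SmoothField U → SmoothField W → ∀ p, covariantD IV IS π η₀ η U W p = 0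

/-- `j` is a diffeomorphism from `M` onto the fibre `M_b`. -/
def IsFibreDiffeo {π : V → S} {b : S} (j : M ≃ Fibre π b) : Prop :=
  ContMDiff IM IV ∞ (fun m => (j m : V)) ∧
  ∀ m, Function.Injective (mfderiv IM IV (fun m => (j m : V)) m)

/-- The open book `B` on the fibre `M_b` is adapted to the contact structure `ξ_b` induced by
`η`. Fibres are identified with the model fibre `M`; the choice of identification is irrelevant. -/
def IsFibreAdapted (M : Type*) [TopologicalSpace M] [ChartedSpace HM M] [IsManifold IM ∞ M] {π : V → S}
    (η : HyperplaneField IV V) {b : S} (B : OpenBook (Fibre π b)) : Prop :=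
  ∀ j : M ≃ Fibre π b, IsFibreDiffeo IV IM j →
    IsAdapted k (pullbackField IM (fun m => (j m : V)) η) (B.pullback j)

/-- The relation `∼` on open books of the fibre `(M_b, ξ_b)`: both are adapted, and they are
isotopic through adapted open books. -/
def IsFibreIsotopic (M : Type*) [TopologicalSpace M] [ChartedSpace HM M] [IsManifold IM ∞ M] {π : V → S}
    (η : HyperplaneField IV V) {b : S} (B₀ B₁ : OpenBook (Fibre π b)) : Prop :=
  ∀ j : M ≃ Fibre π b, IsFibreDiffeo IV IM j →
    IsIsotopic k (pullbackField IM (fun m => (j m : V)) η) (B₀.pullback j) (B₁.pullback j)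

/-- `B t`, `t ∈ J`, is a smooth family of adapted open books on the fibres `M_{c(t)}`: there is a
smooth function `Φ` on `{(t, p) ∈ J × V | π p = c t}` such that `Φ(t, ·)` defines `B t`. -/
def IsSmoothFamily (M : Type*) [TopologicalSpace M] [ChartedSpace HM M] [IsManifold IM ∞ M] {π : V → S}
    (η : HyperplaneField IV V) (J : Set ℝ) (c : ℝ → S) (B : ∀ t, OpenBook (Fibre π (c t))) :
    Prop :=
  ∃ Φ : ℝ × V → ℂ,
    ContMDiffOn (𝓘(ℝ, ℝ).prod IV) 𝓘(ℝ, ℂ) ∞ Φ {x | x.1 ∈ J ∧ π x.2 = c x.1} ∧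
    ∀ t ∈ J, IsFibreAdapted IV IM k M η (B t) ∧
      ∀ j : M ≃ Fibre π (c t), IsFibreDiffeo IV IM j →
        IsDefinedBy IM ((B t).pullback j) (fun m => Φ (t, (j m : V)))

/-- Some form defining `η`; what is built from it below does not depend on the choice. -/
def definingForm (η : HyperplaneField IV V) : OneForm IV V :=
  Classical.epsilon fun α => Defines α η

/-- The function `(α(A_u), -α(A_v))` on the fibre `M_b`, for a frame `(u, v)` of `T_b S`. -/
def frameFunction (η₀ η : HyperplaneField IV V) (b : S) (u v : TangentSpace IS b)
    (x : Fibre π b) : ℂ :=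
  ⟨definingForm IV η x (potential IV IS π η₀ η x ⟨b, u⟩),
    -definingForm IV η x (potential IV IS π η₀ η x ⟨b, v⟩)⟩

/-- The open book `Ψ_η(u, v)` on `M_b`: its binding consists of the points where `A_u` and `A_v` are
both tangent to `ξ_b`, and its map is `f / ‖f‖` for `f = (α(A_u), -α(A_v))`. -/
def frameOpenBook (η₀ η : HyperplaneField IV V) (b : S) (u v : TangentSpace IS b) :
    OpenBook (Fibre π b) where
  binding := {x | frameFunction IV IS π η₀ η b u v x = 0}
  map x := Circle.exp (Complex.arg (frameFunction IV IS π η₀ η b u v x))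

/-- `ψ_η(b)`: the open books of `M_b` isotopic to `Ψ_η(u, v)` for some positive frame. -/
def isotopyClass (M : Type*) [TopologicalSpace M] [ChartedSpace HM M] [IsManifold IM ∞ M]
    (o : ∀ x : S, TangentSpace IS x → TangentSpace IS x → Prop)
    (η₀ η : HyperplaneField IV V) (b : S) : Set (OpenBook (Fibre π b)) :=
  {B | ∃ u v, o b u v ∧ IsFibreIsotopic IV IM k M η (frameOpenBook IV IS π η₀ η b u v) B}

end Bundles

/-! ### The original construction on `M × 𝕋²` -/

section Torus

/-- The torus `𝕋² = 𝕊¹ × 𝕊¹`. -/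
abbrev Torus := Circle × Circle

/-- The model of `𝕋²`. -/
abbrev torusModel := (𝓡 1).prod (𝓡 1)

/-- The standard orientation of `𝕋²`: `(u, v)` is positive when `(dθ₁ ∧ dθ₂)(u, v) > 0`. -/
def torusOrientation (x : Torus) (u v : TangentSpace torusModel x) : Prop :=
  0 < angularForm torusModel (fun y : Torus => y.1) x u *
        angularForm torusModel (fun y : Torus => y.2) x v
      - angularForm torusModel (fun y : Torus => y.1) x v *
        angularForm torusModel (fun y : Torus => y.2) x u

variable {EM : Type*} [NormedAddCommGroup EM] [NormedSpace ℝ EM]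
  {HM : Type*} [TopologicalSpace HM] (IM : ModelWithCorners ℝ EM HM)
  {M : Type*} [TopologicalSpace M] [ChartedSpace HM M] [IsManifold IM ∞ M]

/-- The hyperplane field `ξ ⊕ T𝕋²` on `M × 𝕋²`. -/
def productField (ξ : HyperplaneField IM M) : HyperplaneField (IM.prod torusModel) (M × Torus) :=
  pullbackField (IM.prod torusModel) Prod.fst ξ

/-- The one-form `β + φ₁ dθ₁ - φ₂ dθ₂` on `M × 𝕋²`, where `Φ = (φ₁, φ₂)`. -/
def bourgeoisForm (β : OneForm IM M) (Φ : M → ℂ) : OneForm (IM.prod torusModel) (M × Torus) :=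
  fun x => pullbackForm (IM.prod torusModel) Prod.fst β x
    + (Φ x.1).re • angularForm (IM.prod torusModel) (fun y : M × Torus => y.2.1) x
    - (Φ x.1).im • angularForm (IM.prod torusModel) (fun y : M × Torus => y.2.2) x

/-- The identification `m ↦ (m, b)` of `M` with the fibre over `b ∈ 𝕋²`. -/
def slice (b : Torus) : M ≃ Fibre (Prod.snd : M × Torus → Torus) b where
  toFun m := ⟨(m, b), rfl⟩
  invFun x := x.1.1
  left_inv _ := rfl
  right_inv x := Subtype.ext (Prod.ext rfl x.2.symm)

end Torus

end ContactBundle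

end

open ContactBundle

noncomputable section

namespace ContactBundle

open Equiv (Perm swap)
open Module (finrank)
open Submodule (span)
open VectorField (mlieBracket)
open scoped ComplexConjugate

set_option linter.unusedSectionVars false

section TopFormSum

variable {T : Type*}

/-- The odd and even positions in the index set of `topForm`. -/
abbrev oddPos {k : ℕ} (i : Fin k) : Fin (2 * k + 1) := ⟨2 * i + 1, by have := i.2; lia⟩
/-- See `oddPos`. -/
abbrev evenPos {k : ℕ} (i : Fin k) : Fin (2 * k + 1) := ⟨2 * i + 2, by have := i.2; lia⟩

lemma oddPos_ne_zero {k : ℕ} (i : Fin k) : oddPos i ≠ 0 := fun h => by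
  simpa using congrArg Fin.val h

lemma evenPos_ne_zero {k : ℕ} (i : Fin k) : evenPos i ≠ 0 := fun h => by
  simpa using congrArg Fin.val h

lemma oddPos_injective {k : ℕ} : Function.Injective (oddPos : Fin k → Fin (2 * k + 1)) :=
  fun i j h => by have := congrArg Fin.val h; simp at this; exact Fin.ext this

lemma evenPos_injective {k : ℕ} : Function.Injective (evenPos : Fin k → Fin (2 * k + 1)) :=
  fun i j h => by have := congrArg Fin.val h; simp at this; exact Fin.ext this

lemma oddPos_ne_evenPos {k : ℕ} (i j : Fin k) : oddPos i ≠ evenPos j := fun h => by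
  have := congrArg Fin.val h; simp at this; lia

/-- A summand of `topForm`. -/
def topTerm (k : ℕ) (a : T → ℝ) (Ω : T → T → ℝ) (v : Fin (2 * k + 1) → T)
    (σ : Perm (Fin (2 * k + 1))) : ℝ :=
  ((Perm.sign σ : ℤ) : ℝ) *
    (a (v (σ 0)) * ∏ i : Fin k, Ω (v (σ (oddPos i))) (v (σ (evenPos i))))

lemma topForm_eq_sum_topTerm (k : ℕ) (a : T → ℝ) (Ω : T → T → ℝ) (v : Fin (2 * k + 1) → T) :
    topForm k a Ω v = ∑ σ, topTerm k a Ω v σ := rfl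

lemma topForm_congr_of_first {k : ℕ} {a a' : T → ℝ} {Ω Ω' : T → T → ℝ}
    {v v' : Fin (2 * k + 1) → T} (ha : ∀ i, i ≠ 0 → a (v i) = 0) (ha' : ∀ i, i ≠ 0 → a' (v' i) = 0)
    (h0 : a (v 0) = a' (v' 0)) (hΩ : ∀ i j, i ≠ 0 → j ≠ 0 → Ω (v i) (v j) = Ω' (v' i) (v' j)) :
    topForm k a Ω v = topForm k a' Ω' v' := by
  refine Finset.sum_congr rfl fun σ _ => ?_
  by_cases h : σ 0 = 0
  · rw [h, h0]
    congr 2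
    refine Finset.prod_congr rfl fun i _ => hΩ _ _ ?_ ?_
    · rw [← h]; exact fun hh => by simpa using congrArg Fin.val (σ.injective hh)
    · rw [← h]; exact fun hh => by simpa using congrArg Fin.val (σ.injective hh)
  · simp [ha _ h, ha' _ h]

lemma topForm_eq_zero_of_first {k : ℕ} {a : T → ℝ} {Ω : T → T → ℝ}
    {v : Fin (2 * k + 1) → T} (ha : ∀ i, a (v i) = 0) : topForm k a Ω v = 0 := by
  refine Finset.sum_eq_zero fun σ _ => ?_
  simp [ha]

/-- If `v i₀`, `i₀ ≠ 0`, pairs to zero with all `v j`, `j ≠ 0`, and `a` vanishes on `v j`, `j ≠ 0`,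
then the top form vanishes. -/
lemma topForm_eq_zero_of_degenerate {k : ℕ} {a : T → ℝ} {Ω : T → T → ℝ}
    {v : Fin (2 * k + 1) → T} (ha : ∀ i, i ≠ 0 → a (v i) = 0) {i₀ : Fin (2 * k + 1)} (hi₀ : i₀ ≠ 0)
    (hl : ∀ j, j ≠ 0 → Ω (v i₀) (v j) = 0) (hr : ∀ j, j ≠ 0 → Ω (v j) (v i₀) = 0) :
    topForm k a Ω v = 0 := by
  refine Finset.sum_eq_zero fun σ _ => ?_
  by_cases h : σ 0 = 0
  · have key : ∀ j, j ≠ 0 → σ j ≠ 0 := fun j hj hh => hj (σ.injective (hh.trans h.symm))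
    have hpos : (σ.symm i₀) ≠ 0 := fun hh => hi₀ (by rw [← h, ← hh]; simp)
    obtain ⟨i, hi⟩ : ∃ i : Fin k, σ.symm i₀ = oddPos i ∨ σ.symm i₀ = evenPos i := by
      have h1 : (σ.symm i₀).val ≠ 0 := fun hh => hpos (Fin.ext hh)
      have h2 := (σ.symm i₀).2
      refine ⟨⟨((σ.symm i₀).val - 1) / 2, by lia⟩, ?_⟩
      simp only [oddPos, evenPos, Fin.ext_iff]
      lia
    have : ∏ i : Fin k, Ω (v (σ (oddPos i))) (v (σ (evenPos i))) = 0 := by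
      refine Finset.prod_eq_zero (Finset.mem_univ i) ?_
      rcases hi with hi | hi
      · rw [← hi, Equiv.apply_symm_apply]
        exact hl _ (key _ (by simp [Fin.ext_iff]))
      · rw [← hi, Equiv.apply_symm_apply]
        exact hr _ (key _ (by simp [Fin.ext_iff]))
    erw [this]; simp
  · simp [ha _ h]

lemma topTerm_mul_pairSwap {k : ℕ} (a : T → ℝ) (Ω : T → T → ℝ) (v : Fin (2 * k + 1) → T)
    (σ : Perm (Fin (2 * k + 1))) (i j : Fin k) :
    topTerm k a Ω v (σ * (swap (oddPos i) (oddPos j) * swap (evenPos i) (evenPos j)))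
      = topTerm k a Ω v σ := by
  set ρ : Perm (Fin (2 * k + 1)) :=
    swap (oddPos i) (oddPos j) * swap (evenPos i) (evenPos j) with hρ
  have hs : Perm.sign ρ = 1 := by
    rw [hρ, map_mul, Perm.sign_swap', Perm.sign_swap']
    by_cases hij : i = j
    · simp [hij]
    · have h1 : oddPos i ≠ oddPos j := fun h => hij (by simp [Fin.ext_iff] at h ⊢; lia)
      have h2 : evenPos i ≠ evenPos j := fun h => hij (by simp [Fin.ext_iff] at h ⊢; lia)
      simp [h1, h2]
  have h0 : ρ 0 = 0 := by
    rw [hρ, Perm.mul_apply, Equiv.swap_apply_of_ne_of_ne (evenPos_ne_zero i).symm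
      (evenPos_ne_zero j).symm, Equiv.swap_apply_of_ne_of_ne (oddPos_ne_zero i).symm
      (oddPos_ne_zero j).symm]
  have ho : ∀ l, ρ (oddPos l) = oddPos (swap i j l) := by
    intro l
    have h1 : swap (evenPos i) (evenPos j) (oddPos l) = oddPos l := by
      apply Equiv.swap_apply_of_ne_of_ne <;> simp [Fin.ext_iff] <;> lia
    rw [hρ, Perm.mul_apply, h1]
    simp only [Equiv.swap_apply_def]
    simp only [Fin.ext_iff]
    split_ifs <;> simp <;> lia
  have he : ∀ l, ρ (evenPos l) = evenPos (swap i j l) := by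
    intro l
    rw [hρ, Perm.mul_apply]
    simp only [Equiv.swap_apply_def]
    simp only [Fin.ext_iff]
    split_ifs <;> simp <;> lia
  unfold topTerm
  rw [map_mul, hs, mul_one, Perm.mul_apply, h0]
  congr 2
  rw [← Equiv.prod_comp (swap i j) (fun l => Ω (v ((σ * ρ) (oddPos l))) (v ((σ * ρ) (evenPos l))))]
  refine Finset.prod_congr rfl fun l _ => ?_
  change Ω (v (σ (ρ _))) (v (σ (ρ _))) = _
  rw [ho, he]
  simp

lemma topTerm_mul_flip {k : ℕ} (a : T → ℝ) (Ω : T → T → ℝ) (hΩ : ∀ x y, Ω x y = - Ω y x)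
    (v : Fin (2 * k + 1) → T) (σ : Perm (Fin (2 * k + 1))) (i : Fin k) :
    topTerm k a Ω v (σ * swap (oddPos i) (evenPos i)) = topTerm k a Ω v σ := by
  set ρ : Perm (Fin (2 * k + 1)) := swap (oddPos i) (evenPos i) with hρ
  have hs : Perm.sign ρ = -1 := by
    rw [hρ, Perm.sign_swap]; simp [Fin.ext_iff]
  have h0 : ρ 0 = 0 := by
    rw [hρ, Equiv.swap_apply_of_ne_of_ne] <;> simp [Fin.ext_iff]
  unfold topTerm
  rw [map_mul, hs, Perm.mul_apply, h0]
  rw [← Finset.mul_prod_erase _ _ (Finset.mem_univ i), ← Finset.mul_prod_erase _ _ (Finset.mem_univ i)]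
  have h1 : ∏ l ∈ Finset.univ.erase i, Ω (v ((σ * ρ) (oddPos l))) (v ((σ * ρ) (evenPos l))) =
      ∏ l ∈ Finset.univ.erase i, Ω (v (σ (oddPos l))) (v (σ (evenPos l))) := by
    refine Finset.prod_congr rfl fun l hl => ?_
    have hne : l ≠ i := Finset.ne_of_mem_erase hl
    have hne' : (l : ℕ) ≠ i := fun h => hne (Fin.ext h)
    have e1 : ρ (oddPos l) = oddPos l := by
      rw [hρ]; apply Equiv.swap_apply_of_ne_of_ne <;> simp [Fin.ext_iff] <;> lia
    have e2 : ρ (evenPos l) = evenPos l := by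
      rw [hρ]; apply Equiv.swap_apply_of_ne_of_ne <;> simp [Fin.ext_iff] <;> lia
    rw [Perm.mul_apply, Perm.mul_apply, e1, e2]
  have h2 : Ω (v ((σ * ρ) (oddPos i))) (v ((σ * ρ) (evenPos i))) =
      - Ω (v (σ (oddPos i))) (v (σ (evenPos i))) := by
    rw [Perm.mul_apply, Perm.mul_apply, hρ, Equiv.swap_apply_left,
      Equiv.swap_apply_right, hΩ]
  erw [h1, h2]
  push_cast
  ring

lemma sum_perm_fix_zero {n : ℕ} (F : Perm (Fin (n + 1)) → ℝ) :
    ∑ σ : Perm (Fin (n + 1)), (if σ 0 = 0 then F σ else 0) =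
      ∑ e : Perm (Fin n), F (Perm.decomposeFin.symm (0, e)) := by
  rw [← Equiv.sum_comp Perm.decomposeFin.symm, Fintype.sum_prod_type]
  rw [Finset.sum_eq_single 0]
  · simp
  · intro p _ hp
    refine Finset.sum_eq_zero fun e _ => ?_
    simp [hp]
  · simp

/-- The permutation `0, 1, 2 ↦ 1, 2, 0`. -/
def rotThree (k : ℕ) : Perm (Fin (2 * (k + 1) + 1)) :=
  swap 0 (oddPos 0) * swap (oddPos 0) (evenPos 0)

theorem topForm_cons₂ {k : ℕ} {a : T → ℝ} {Ω : T → T → ℝ} (hΩ : ∀ x y, Ω x y = - Ω y x)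
    {z₁ z₂ : T} {w : Fin (2 * k + 1) → T} (ha₁ : a z₁ = 0) (ha₂ : a z₂ = 0)
    (haw : ∀ i, i ≠ 0 → a (w i) = 0) (h₁ : ∀ i, i ≠ 0 → Ω z₁ (w i) = 0) :
    topForm (k + 1) a Ω (cons₂ z₁ z₂ w) = 2 * (k + 1) * (Ω z₁ z₂ * topForm k a Ω w) := by
  set x : Fin (2 * (k + 1) + 1) → T := cons₂ z₁ z₂ w
  have x0 : x 0 = z₁ := rfl
  have x1 : x 1 = z₂ := rfl
  have xs : ∀ j : Fin (2 * k + 1), x j.succ.succ = w j := fun j => rfl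
  have hcase : ∀ j : Fin (2 * (k + 1) + 1), j = 0 ∨ j = 1 ∨ ∃ l : Fin (2 * k + 1), j = l.succ.succ := by
    intro j
    rcases Fin.eq_zero_or_eq_succ j with h | ⟨l, rfl⟩
    · exact Or.inl h
    · rcases Fin.eq_zero_or_eq_succ l with h | ⟨l, rfl⟩
      · right; left; rw [h]; rfl
      · exact Or.inr (Or.inr ⟨l, rfl⟩)
  have hΩ0 : ∀ y, Ω y y = 0 := fun y => by linarith [hΩ y y]
  set o0 : Fin (2 * (k + 1) + 1) := oddPos (0 : Fin (k + 1))
  set e0 : Fin (2 * (k + 1) + 1) := evenPos (0 : Fin (k + 1))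
  have hterm : ∀ σ, topTerm (k + 1) a Ω x σ =
      (∑ i : Fin (k + 1), if σ (oddPos i) = 0 ∧ σ (evenPos i) = 1 then topTerm (k + 1) a Ω x σ else 0)
      + ∑ i : Fin (k + 1),
        if σ (evenPos i) = 0 ∧ σ (oddPos i) = 1 then topTerm (k + 1) a Ω x σ else 0 := by
    intro σ
    by_cases ht : topTerm (k + 1) a Ω x σ = 0
    · simp [ht]
    have hσ0 : σ 0 = (0 : Fin (2 * k + 1)).succ.succ := by
      by_contra hne
      apply ht
      have : a (x (σ 0)) = 0 := by
        rcases hcase (σ 0) with h | h | ⟨l, h⟩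
        · rw [h, x0, ha₁]
        · rw [h, x1, ha₂]
        · rw [h, xs]; exact haw _ fun hl => hne (by rw [h, hl])
      simp [topTerm, this]
    have hfac : ∀ i : Fin (k + 1), Ω (x (σ (oddPos i))) (x (σ (evenPos i))) ≠ 0 := by
      intro i hi
      apply ht
      unfold topTerm
      erw [Finset.prod_eq_zero (Finset.mem_univ i) hi]
      simp
    have hne2 : ∀ j, j ≠ 0 → σ j ≠ (0 : Fin (2 * k + 1)).succ.succ := fun j hj h =>
      hj (σ.injective (h.trans hσ0.symm))
    have hpos : σ.symm 0 ≠ 0 := fun h => by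
      have : σ 0 = 0 := (σ.symm_apply_eq.mp h).symm
      exact Fin.succ_ne_zero _ (hσ0.symm.trans this)
    obtain ⟨i, hi⟩ : ∃ i : Fin (k + 1), σ.symm 0 = oddPos i ∨ σ.symm 0 = evenPos i := by
      have h1 : (σ.symm 0).val ≠ 0 := fun hh => hpos (Fin.ext hh)
      have h2 := (σ.symm 0).2
      refine ⟨⟨((σ.symm 0).val - 1) / 2, by lia⟩, ?_⟩
      simp only [oddPos, evenPos, Fin.ext_iff]
      lia
    have hone : ∀ j, j ≠ 0 → Ω z₁ (x (σ j)) ≠ 0 → σ j = 1 := by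
      intro j hj hj'
      rcases hcase (σ j) with h | h | ⟨l, h⟩
      · rw [h, x0] at hj'; exact absurd (hΩ0 _) hj'
      · exact h
      · rw [h, xs] at hj'
        exact absurd (h₁ l fun hl => hne2 j hj (by rw [h, hl])) hj'
    rcases hi with hi | hi
    · have hi' : σ (oddPos i) = 0 := by rw [← hi]; simp
      have h3 : σ (evenPos i) = 1 := by
        refine hone _ (evenPos_ne_zero i) ?_
        have := hfac i
        rwa [hi', x0] at this
      rw [Finset.sum_eq_single i, Finset.sum_eq_zero, if_pos ⟨hi', h3⟩, add_zero]
      · intro j _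
        rw [if_neg]
        rintro ⟨h, -⟩
        exact oddPos_ne_evenPos i j (σ.injective (hi'.trans h.symm))
      · intro j _ hj
        rw [if_neg]
        rintro ⟨h, -⟩
        exact hj (oddPos_injective (σ.injective (h.trans hi'.symm)))
      · simp
    · have hi' : σ (evenPos i) = 0 := by rw [← hi]; simp
      have h3 : σ (oddPos i) = 1 := by
        refine hone _ (oddPos_ne_zero i) ?_
        have := hfac i
        rw [hi', x0, hΩ] at this
        exact fun h => this (by rw [h, neg_zero])
      rw [Finset.sum_eq_zero, zero_add, Finset.sum_eq_single i, if_pos ⟨hi', h3⟩]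
      · intro j _ hj
        rw [if_neg]
        rintro ⟨h, -⟩
        exact hj (evenPos_injective (σ.injective (h.trans hi'.symm)))
      · simp
      · intro j _
        rw [if_neg]
        rintro ⟨h, -⟩
        exact oddPos_ne_evenPos j i (σ.injective (h.trans hi'.symm))
  set S : ℝ := ∑ σ : Perm (Fin (2 * (k + 1) + 1)),
    if σ o0 = 0 ∧ σ e0 = 1 then topTerm (k + 1) a Ω x σ else 0 with hS
  have hfirst : ∀ i : Fin (k + 1), ∑ σ : Perm (Fin (2 * (k + 1) + 1)),
      (if σ (oddPos i) = 0 ∧ σ (evenPos i) = 1 then topTerm (k + 1) a Ω x σ else 0) = S := by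
    intro i
    rw [← Equiv.sum_comp (Equiv.mulRight
      (swap (oddPos 0) (oddPos i) * swap (evenPos 0) (evenPos i)))]
    refine Finset.sum_congr rfl fun σ _ => ?_
    simp only [Equiv.coe_mulRight]
    rw [topTerm_mul_pairSwap]
    have e1 : (σ * (swap (oddPos 0) (oddPos i) * swap (evenPos 0) (evenPos i)))
        (oddPos i) = σ o0 := by
      rw [Perm.mul_apply, Perm.mul_apply, Equiv.swap_apply_of_ne_of_ne
        (oddPos_ne_evenPos _ _) (oddPos_ne_evenPos _ _), Equiv.swap_apply_right]
    have e2 : (σ * (swap (oddPos 0) (oddPos i) * swap (evenPos 0) (evenPos i)))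
        (evenPos i) = σ e0 := by
      rw [Perm.mul_apply, Perm.mul_apply, Equiv.swap_apply_right,
        Equiv.swap_apply_of_ne_of_ne (oddPos_ne_evenPos _ _).symm (oddPos_ne_evenPos _ _).symm]
    exact if_congr (by rw [e1, e2]) rfl rfl
  have hsecond : ∀ i : Fin (k + 1), ∑ σ : Perm (Fin (2 * (k + 1) + 1)),
      (if σ (evenPos i) = 0 ∧ σ (oddPos i) = 1 then topTerm (k + 1) a Ω x σ else 0) = S := by
    intro i
    rw [← hfirst i, ← Equiv.sum_comp (Equiv.mulRight (swap (oddPos i) (evenPos i)))]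
    refine Finset.sum_congr rfl fun σ _ => ?_
    simp only [Equiv.coe_mulRight]
    rw [topTerm_mul_flip _ _ hΩ]
    exact if_congr (by rw [Perm.mul_apply, Perm.mul_apply, Equiv.swap_apply_left,
      Equiv.swap_apply_right]) rfl rfl
  have hSval : S = Ω z₁ z₂ * topForm k a Ω w := by
    have c0 : rotThree k o0 = e0 := by
      rw [rotThree, Perm.mul_apply, Equiv.swap_apply_left, Equiv.swap_apply_of_ne_of_ne
        (evenPos_ne_zero _) (oddPos_ne_evenPos _ _).symm]
    have c1 : rotThree k e0 = 0 := by
      rw [rotThree, Perm.mul_apply, Equiv.swap_apply_right, Equiv.swap_apply_right]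
    have c2 : rotThree k 0 = o0 := by
      rw [rotThree, Perm.mul_apply, Equiv.swap_apply_of_ne_of_ne (oddPos_ne_zero _).symm
        (evenPos_ne_zero _).symm, Equiv.swap_apply_left]
    have c3 : ∀ j : Fin (2 * (k + 1) + 1), 3 ≤ j.val → rotThree k j = j := by
      intro j hj
      have n0 : j ≠ 0 := fun h => by rw [h] at hj; simp at hj
      have n1 : j ≠ oddPos 0 := fun h => by rw [h] at hj; simp at hj
      have n2 : j ≠ evenPos 0 := fun h => by rw [h] at hj; simp at hj
      rw [rotThree, Perm.mul_apply, Equiv.swap_apply_of_ne_of_ne n1 n2,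
        Equiv.swap_apply_of_ne_of_ne n0 n1]
    have hsgn : Perm.sign (rotThree k) = 1 := by
      rw [rotThree, map_mul, Perm.sign_swap (oddPos_ne_zero _).symm,
        Perm.sign_swap (oddPos_ne_evenPos _ _)]
      rfl
    have hsgn' : Perm.sign (rotThree k)⁻¹ = 1 := by rw [map_inv, hsgn]; rfl
    have d0 : (rotThree k)⁻¹ o0 = 0 := by rw [← c2]; simp
    have d1 : (rotThree k)⁻¹ e0 = o0 := by rw [← c0]; simp
    have d2 : (rotThree k)⁻¹ 0 = e0 := by rw [← c1]; simp
    have d3 : ∀ j : Fin (2 * (k + 1) + 1), 3 ≤ j.val → (rotThree k)⁻¹ j = j := by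
      intro j hj; nth_rewrite 1 [← c3 j hj]; simp
    rw [hS, ← Equiv.sum_comp (Equiv.mulRight (rotThree k)⁻¹)]
    simp only [Equiv.coe_mulRight, Perm.mul_apply, d0, d1]
    simp only [ite_and]
    erw [sum_perm_fix_zero]
    have ho0s : o0 = Fin.succ (0 : Fin (2 * k + 2)) := rfl
    have honeS : (1 : Fin (2 * (k + 1) + 1)) = Fin.succ (0 : Fin (2 * k + 2)) := rfl
    have hcond : ∀ e : Perm (Fin (2 * k + 2)),
        Perm.decomposeFin.symm ((0 : Fin (2 * k + 3)), e) o0 = 1 ↔ e 0 = 0 := by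
      intro e
      rw [ho0s]
      erw [Perm.decomposeFin_symm_apply_succ]
      rw [Equiv.swap_self, Equiv.refl_apply]
      exact ⟨fun h => Fin.succ_injective _ (h.trans honeS), fun h => by rw [h]; rfl⟩
    have hcond' : ∀ (e : Perm (Fin (2 * k + 2))) (c : ℝ),
        (if Perm.decomposeFin.symm ((0 : Fin (2 * k + 3)), e) o0 = 1 then c else 0) =
          if e 0 = 0 then c else 0 := fun e c => if_congr (hcond e) rfl rfl
    erw [Finset.sum_congr rfl fun e _ => hcond' e _]
    erw [sum_perm_fix_zero (n := 2 * k + 1)]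
    rw [topForm_eq_sum_topTerm, Finset.mul_sum]
    refine Finset.sum_congr rfl fun e _ => ?_
    set τ : Perm (Fin (2 * (k + 1) + 1)) :=
      Perm.decomposeFin.symm ((0 : Fin (2 * k + 3)), Perm.decomposeFin.symm ((0 : Fin (2 * k + 2)), e)) with hτ
    have t0 : τ 0 = 0 := by rw [hτ]; erw [Perm.decomposeFin_symm_apply_zero]
    have t1 : τ o0 = 1 := by
      rw [hτ, ho0s, honeS]
      erw [Perm.decomposeFin_symm_apply_succ, Perm.decomposeFin_symm_apply_zero]
      simp
    have ts : ∀ j : Fin (2 * k + 1), τ j.succ.succ = (e j).succ.succ := by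
      intro j
      rw [hτ]
      erw [Perm.decomposeFin_symm_apply_succ, Perm.decomposeFin_symm_apply_succ]
      simp
    have tsgn : Perm.sign τ = Perm.sign e := by
      rw [hτ]
      erw [Perm.decomposeFin.symm_sign, Perm.decomposeFin.symm_sign]
      simp
    unfold topTerm
    rw [map_mul, hsgn', mul_one, tsgn, Fin.prod_univ_succ]
    have f0 : (τ * (rotThree k)⁻¹) 0 = (e 0).succ.succ := by
      rw [Perm.mul_apply, d2, ← ts]; congr 1
    have f1 : (τ * (rotThree k)⁻¹) o0 = 0 := by rw [Perm.mul_apply, d0, t0]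
    have f2 : (τ * (rotThree k)⁻¹) e0 = 1 := by rw [Perm.mul_apply, d1, t1]
    have fo : ∀ i : Fin k, (τ * (rotThree k)⁻¹) (oddPos i.succ) = (e (oddPos i)).succ.succ := by
      intro i
      rw [Perm.mul_apply, d3 _ (by simp), ← ts]; congr 1
    have fe : ∀ i : Fin k, (τ * (rotThree k)⁻¹) (evenPos i.succ) = (e (evenPos i)).succ.succ := by
      intro i
      rw [Perm.mul_apply, d3 _ (by simp; lia), ← ts]; congr 1
    have hprod : ∏ i : Fin k, Ω (x ((τ * (rotThree k)⁻¹) (oddPos i.succ)))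
        (x ((τ * (rotThree k)⁻¹) (evenPos i.succ))) = ∏ i : Fin k, Ω (w (e (oddPos i))) (w (e (evenPos i))) :=
      Finset.prod_congr rfl fun i _ => by rw [fo, fe, xs, xs]
    erw [f1, f2, hprod, f0, xs, x0, x1]
    ring
  have hA : ∑ σ : Perm (Fin (2 * (k + 1) + 1)), ∑ i : Fin (k + 1),
      (if σ (oddPos i) = 0 ∧ σ (evenPos i) = 1 then topTerm (k + 1) a Ω x σ else 0) = (k + 1) * S := by
    rw [Finset.sum_comm, Finset.sum_congr rfl fun i _ => hfirst i]
    simp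
  have hB : ∑ σ : Perm (Fin (2 * (k + 1) + 1)), ∑ i : Fin (k + 1),
      (if σ (evenPos i) = 0 ∧ σ (oddPos i) = 1 then topTerm (k + 1) a Ω x σ else 0) = (k + 1) * S := by
    rw [Finset.sum_comm, Finset.sum_congr rfl fun i _ => hsecond i]
    simp
  rw [topForm_eq_sum_topTerm, Finset.sum_congr rfl fun σ _ => hterm σ, Finset.sum_add_distrib,
    hA, hB, hSval]
  ring

end TopFormSum

section TopFormAlternating

lemma topForm_smul {T : Type*} {k : ℕ} (c : ℝ) (a : T → ℝ) (Ω : T → T → ℝ) (v : Fin (2 * k + 1) → T) :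
    topForm k (fun x => c * a x) (fun x y => c * Ω x y) v = c ^ (k + 1) * topForm k a Ω v := by
  rw [topForm_eq_sum_topTerm, topForm_eq_sum_topTerm, Finset.mul_sum]
  refine Finset.sum_congr rfl fun σ _ => ?_
  unfold topTerm
  rw [Finset.prod_mul_distrib]
  simp only [Finset.prod_const, Finset.card_univ, Fintype.card_fin]
  ring

variable {T : Type*} [AddCommGroup T] [Module ℝ T]

/-- The multilinear map whose alternatization is `topForm`. -/
def topMulti (k : ℕ) (a : T →ₗ[ℝ] ℝ) (Ω : T →ₗ[ℝ] T →ₗ[ℝ] ℝ) :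
    MultilinearMap ℝ (fun _ : Fin (2 * k + 1) => T) ℝ :=
  have key : ∀ (v : Fin (2 * k + 1) → T) (j : Fin (2 * k + 1)), ∃ L : T →ₗ[ℝ] ℝ,
      ∀ [DecidableEq (Fin (2 * k + 1))] (x : T), a (Function.update v j x 0) *
        ∏ i : Fin k, Ω (Function.update v j x (oddPos i)) (Function.update v j x (evenPos i))
        = L x := by
    intro v j
    by_cases hj : j = 0
    · subst hj
      refine ⟨(∏ i : Fin k, Ω (v (oddPos i)) (v (evenPos i))) • a, fun x => ?_⟩
      rw [Function.update_self, LinearMap.smul_apply, smul_eq_mul, mul_comm]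
      congr 1
      exact Finset.prod_congr rfl fun i _ => by
        rw [Function.update_of_ne (oddPos_ne_zero i), Function.update_of_ne (evenPos_ne_zero i)]
    · obtain ⟨i, hi⟩ : ∃ i : Fin k, j = oddPos i ∨ j = evenPos i := by
        have h1 : j.val ≠ 0 := fun hh => hj (Fin.ext hh)
        have h2 := j.2
        refine ⟨⟨(j.val - 1) / 2, by lia⟩, ?_⟩
        simp only [oddPos, evenPos, Fin.ext_iff]
        lia
      rcases hi with rfl | rfl
      · refine ⟨(a (v 0) * ∏ l ∈ Finset.univ.erase i, Ω (v (oddPos l)) (v (evenPos l))) •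
          (Ω.flip (v (evenPos i))), fun x => ?_⟩
        rw [Function.update_of_ne (Ne.symm hj), ← Finset.mul_prod_erase _ _ (Finset.mem_univ i),
          Function.update_self, Function.update_of_ne (oddPos_ne_evenPos i i).symm]
        rw [LinearMap.smul_apply, smul_eq_mul, LinearMap.flip_apply]
        have : ∏ l ∈ Finset.univ.erase i, Ω (Function.update v (oddPos i) x (oddPos l))
            (Function.update v (oddPos i) x (evenPos l)) =
            ∏ l ∈ Finset.univ.erase i, Ω (v (oddPos l)) (v (evenPos l)) :=
          Finset.prod_congr rfl fun l hl => by
            rw [Function.update_of_ne fun h => Finset.ne_of_mem_erase hl (oddPos_injective h),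
              Function.update_of_ne (oddPos_ne_evenPos i l).symm]
        rw [this]; ring
      · refine ⟨(a (v 0) * ∏ l ∈ Finset.univ.erase i, Ω (v (oddPos l)) (v (evenPos l))) •
          (Ω (v (oddPos i))), fun x => ?_⟩
        rw [Function.update_of_ne (Ne.symm hj), ← Finset.mul_prod_erase _ _ (Finset.mem_univ i),
          Function.update_self, Function.update_of_ne (oddPos_ne_evenPos i i)]
        rw [LinearMap.smul_apply, smul_eq_mul]
        have : ∏ l ∈ Finset.univ.erase i, Ω (Function.update v (evenPos i) x (oddPos l))
            (Function.update v (evenPos i) x (evenPos l)) =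
            ∏ l ∈ Finset.univ.erase i, Ω (v (oddPos l)) (v (evenPos l)) :=
          Finset.prod_congr rfl fun l hl => by
            rw [Function.update_of_ne (oddPos_ne_evenPos l i),
              Function.update_of_ne fun h => Finset.ne_of_mem_erase hl (evenPos_injective h)]
        rw [this]; ring
  { toFun := fun v => a (v 0) * ∏ i : Fin k, Ω (v (oddPos i)) (v (evenPos i))
    map_update_add' := by
      intro _ v j x y
      obtain ⟨L, hL⟩ := key v j
      rw [hL, hL, hL, map_add]
    map_update_smul' := by
      intro _ v j c x
      obtain ⟨L, hL⟩ := key v j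
      rw [hL, hL, map_smul] }

/-- `topForm` as an alternating map. -/
def topAlt (k : ℕ) (a : T →ₗ[ℝ] ℝ) (Ω : T →ₗ[ℝ] T →ₗ[ℝ] ℝ) : T [⋀^Fin (2 * k + 1)]→ₗ[ℝ] ℝ :=
  MultilinearMap.alternatization (topMulti k a Ω)

lemma topAlt_apply (k : ℕ) (a : T →ₗ[ℝ] ℝ) (Ω : T →ₗ[ℝ] T →ₗ[ℝ] ℝ) (v : Fin (2 * k + 1) → T) :
    topAlt k a Ω v = topForm k a (fun x y => Ω x y) v := by
  rw [topAlt, MultilinearMap.alternatization_apply, topForm_eq_sum_topTerm]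
  refine Finset.sum_congr rfl fun σ _ => ?_
  rw [Units.smul_def, zsmul_eq_mul]
  rfl

/-- Alternating maps see a family spanning the same space through a common factor. -/
lemma exists_factor_of_span_le {n : ℕ} {w w' : Fin n → T} (hw : LinearIndependent ℝ w)
    (hw' : LinearIndependent ℝ w') (hs : ∀ i, w' i ∈ span ℝ (range w)) :
    ∃ c : ℝ, c ≠ 0 ∧ ∀ f : T [⋀^Fin n]→ₗ[ℝ] ℝ, f w' = c * f w := by
  set W := span ℝ (range w) with hW
  let b : Module.Basis (Fin n) ℝ W := Module.Basis.span hw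
  let u : Fin n → W := fun i => ⟨w' i, hs i⟩
  have hu : LinearIndependent ℝ u := LinearIndependent.of_comp W.subtype (by exact hw')
  have : Nonempty (Fin n) ∨ n = 0 := by
    rcases Nat.eq_zero_or_pos n with h | h
    · exact Or.inr h
    · exact Or.inl ⟨⟨0, h⟩⟩
  have hdet : b.det u ≠ 0 := by
    have : FiniteDimensional ℝ W := Module.Basis.finiteDimensional_of_finite b
    have hcard : Fintype.card (Fin n) = finrank ℝ W := by
      rw [Module.finrank_eq_card_basis b]
    have hspan : ⊤ ≤ span ℝ (range u) := by
      rw [LinearIndependent.span_eq_top_of_card_eq_finrank' hu hcard]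
    have : IsUnit (b.det u) := (Module.Basis.is_basis_iff_det b).1 ⟨hu, top_le_iff.1 hspan⟩
    exact this.ne_zero
  refine ⟨b.det u, hdet, fun f => ?_⟩
  have h1 := AlternatingMap.eq_smul_basis_det b (f.compLinearMap W.subtype)
  have h2 := congrArg (fun g => g u) h1
  simp only [AlternatingMap.smul_apply, smul_eq_mul] at h2
  have hb : ∀ i, ((b i : W) : T) = w i := fun i =>
    congrArg Subtype.val (Module.Basis.span_apply hw i)
  have e1 : (f.compLinearMap W.subtype) u = f w' := rfl
  have e2 : (f.compLinearMap W.subtype) b = f w := by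
    rw [AlternatingMap.compLinearMap_apply]; congr 1; funext i; exact hb i
  rw [e1, e2] at h2
  rw [h2, mul_comm]

lemma cons₂_apply_succ {m : ℕ} (z₁ z₂ : T) (w : Fin (2 * m + 1) → T) (f : T [⋀^Fin (2 * (m + 1) + 1)]→ₗ[ℝ] ℝ) :
    f (cons₂ z₁ z₂ w) = (AlternatingMap.curryLeft (AlternatingMap.curryLeft (n := 2 * m + 2) f z₁) z₂) w := rfl

/-- An adapted basis of the span of `w`. -/
lemma exists_adapted_family {n : ℕ} {w : Fin (n + 1) → T} (hw : LinearIndependent ℝ w)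
    (a : T →ₗ[ℝ] ℝ) {r : T} (hr : r ∈ span ℝ (range w)) (har : a r ≠ 0) :
    ∃ w' : Fin (n + 1) → T, LinearIndependent ℝ w' ∧
      (∀ i, w' i ∈ span ℝ (range w)) ∧ w' 0 = r ∧ ∀ i, i ≠ 0 → a (w' i) = 0 := by
  set W := span ℝ (range w) with hW
  let b : Module.Basis (Fin (n + 1)) ℝ W := Module.Basis.span hw
  have : FiniteDimensional ℝ W := Module.Basis.finiteDimensional_of_finite b
  have hfin : finrank ℝ W = n + 1 := by rw [Module.finrank_eq_card_basis b]; simp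
  let aW : W →ₗ[ℝ] ℝ := a.comp W.subtype
  have haW : aW ≠ 0 := fun h => har (LinearMap.congr_fun h (⟨r, hr⟩ : W))
  have hker : finrank ℝ (LinearMap.ker aW) = n := by
    have := LinearMap.finrank_range_add_finrank_ker aW
    rw [LinearMap.range_eq_top.2 (LinearMap.surjective haW), finrank_top, Module.finrank_self, hfin] at this
    lia
  let e := Module.finBasisOfFinrankEq ℝ (LinearMap.ker aW) hker
  let u : Fin n → T := fun i => ((e i : W) : T)
  have hu : LinearIndependent ℝ u := by
    have := e.linearIndependent.map' (W.subtype.comp (LinearMap.ker aW).subtype)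
      (by rw [LinearMap.ker_eq_bot]; exact W.injective_subtype.comp (LinearMap.ker aW).injective_subtype)
    exact this
  have hau : ∀ i, a (u i) = 0 := fun i => (e i).2
  refine ⟨Fin.cons r u, ?_, ?_, rfl, ?_⟩
  · rw [linearIndependent_finCons]
    refine ⟨hu, fun hmem => har ?_⟩
    have : span ℝ (range u) ≤ LinearMap.ker a := by
      rw [Submodule.span_le]; rintro _ ⟨i, rfl⟩; exact hau i
    exact this hmem
  · intro i
    refine Fin.cases ?_ (fun j => ?_) i
    · exact hr
    · exact (e j : W).2
  · intro i hi
    obtain ⟨j, rfl⟩ := Fin.exists_succ_eq.2 hi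
    exact hau j

lemma exists_linearIndependent_first {K : Type*} [AddCommGroup K] [Module ℝ K]
    [FiniteDimensional ℝ K] {d : ℕ} (hK : finrank ℝ K = d + 1) {x : K} (hx : x ≠ 0) :
    ∃ u : Fin (d + 1) → K, LinearIndependent ℝ u ∧ u 0 = x := by
  obtain ⟨ℓ, hℓ⟩ : ∃ ℓ : K →ₗ[ℝ] ℝ, ℓ x ≠ 0 := by
    by_contra! h
    exact hx ((Module.forall_dual_apply_eq_zero_iff ℝ x).1 h)
  let b := Module.finBasisOfFinrankEq ℝ K hK
  obtain ⟨u, hu, -, hu0, -⟩ := exists_adapted_family b.linearIndependent ℓ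
    (by rw [b.span_eq]; exact Submodule.mem_top) hℓ
  exact ⟨u, hu, hu0⟩

/-- A family of vectors adapted to a degenerate direction `x`. -/
lemma exists_adapted_family₂ {n : ℕ} {w : Fin (n + 2) → T} (hw : LinearIndependent ℝ w)
    (a : T →ₗ[ℝ] ℝ) {r x : T} (hr : r ∈ span ℝ (range w)) (har : a r ≠ 0)
    (hx : x ∈ span ℝ (range w)) (hx0 : x ≠ 0) (hax : a x = 0) :
    ∃ w' : Fin (n + 2) → T, LinearIndependent ℝ w' ∧
      (∀ i, w' i ∈ span ℝ (range w)) ∧ w' 1 = x ∧ ∀ i, i ≠ 0 → a (w' i) = 0 := by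
  obtain ⟨v, hv, hvs, hv0, hva⟩ := exists_adapted_family hw a hr har
  have hfr : finrank ℝ (span ℝ (range (Fin.tail v))) = n + 1 := by
    have : LinearIndependent ℝ (Fin.tail v) := hv.comp _ (Fin.succ_injective _)
    rw [finrank_span_eq_card this]; simp
  have hspan : span ℝ (range v) = span ℝ (range w) := by
    have hf : FiniteDimensional ℝ (span ℝ (range w)) :=
      FiniteDimensional.span_of_finite ℝ (finite_range w)
    refine Submodule.eq_of_le_of_finrank_eq (Submodule.span_le.2 ?_) ?_
    · rintro _ ⟨i, rfl⟩; exact hvs i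
    · rw [finrank_span_eq_card hv, finrank_span_eq_card hw]
  have hxt : x ∈ span ℝ (range (Fin.tail v)) := by
    rw [← hspan, ← Fin.cons_self_tail v, Fin.range_cons, Submodule.mem_span_insert] at hx
    obtain ⟨c, z, hz, rfl⟩ := hx
    have haz : a z = 0 := by
      have : span ℝ (range (Fin.tail v)) ≤ LinearMap.ker a := by
        rw [Submodule.span_le]; rintro _ ⟨i, rfl⟩; exact hva _ (Fin.succ_ne_zero i)
      exact this hz
    rw [map_add, map_smul, haz, add_zero, hv0, smul_eq_mul, mul_eq_zero] at hax
    rw [hax.resolve_right har, zero_smul, zero_add]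
    exact hz
  have hf : FiniteDimensional ℝ (span ℝ (range (Fin.tail v))) :=
    FiniteDimensional.span_of_finite ℝ (finite_range _)
  obtain ⟨u, hu, hu0⟩ := exists_linearIndependent_first hfr
    (x := ⟨x, hxt⟩) (fun h => hx0 (congrArg Subtype.val h))
  have hua : ∀ i, a (u i) = 0 := fun i => by
    have : span ℝ (range (Fin.tail v)) ≤ LinearMap.ker a := by
      rw [Submodule.span_le]; rintro _ ⟨i, rfl⟩; exact hva _ (Fin.succ_ne_zero i)
    exact this (u i).2
  have hu' : LinearIndependent ℝ (fun i => (u i : T)) :=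
    hu.map' (Submodule.subtype _) (Submodule.ker_subtype _)
  refine ⟨Fin.cons r fun i => (u i : T), ?_, ?_, ?_, ?_⟩
  · rw [linearIndependent_finCons]
    refine ⟨hu', fun hmem => har ?_⟩
    have : span ℝ (range fun i => (u i : T)) ≤ LinearMap.ker a := by
      rw [Submodule.span_le]; rintro _ ⟨i, rfl⟩; exact hua i
    exact this hmem
  · intro i
    refine Fin.cases hr (fun j => ?_) i
    rw [Fin.cons_succ, ← hspan]
    exact Submodule.span_mono (by rintro _ ⟨l, rfl⟩; exact ⟨l.succ, rfl⟩) (u j).2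
  · exact congrArg Subtype.val hu0
  · intro i hi
    obtain ⟨j, rfl⟩ := Fin.exists_succ_eq.2 hi
    exact hua j

variable {k : ℕ} {a : T →ₗ[ℝ] ℝ} {Ω : T →ₗ[ℝ] T →ₗ[ℝ] ℝ}

lemma topForm_eq_zero_of_not_linearIndependent {v : Fin (2 * k + 1) → T}
    (hv : ¬ LinearIndependent ℝ v) : topForm k a (fun x y => Ω x y) v = 0 := by
  rw [← topAlt_apply]; exact AlternatingMap.map_linearDependent _ _ hv

lemma linearIndependent_of_topForm_ne_zero {v : Fin (2 * k + 1) → T}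
    (h : topForm k a (fun x y => Ω x y) v ≠ 0) : LinearIndependent ℝ v := by
  by_contra hv
  exact h (topForm_eq_zero_of_not_linearIndependent hv)

lemma exists_mem_span_ne_zero_of_topForm_ne_zero {v : Fin (2 * k + 1) → T}
    (h : topForm k a (fun x y => Ω x y) v ≠ 0) : ∃ i, a (v i) ≠ 0 := by
  by_contra! hv
  exact h (topForm_eq_zero_of_first hv)

theorem topForm_cons₂_span (hΩ : ∀ x y, Ω x y = - Ω y x)
    {z₁ z₂ : T} {w : Fin (2 * k + 1) → T} (hw : LinearIndependent ℝ w)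
    (ha₁ : a z₁ = 0) (ha₂ : a z₂ = 0)
    (h₁ : ∀ y ∈ span ℝ (range w), a y = 0 → Ω z₁ y = 0) :
    topForm (k + 1) a (fun x y => Ω x y) (cons₂ z₁ z₂ w) =
      2 * (k + 1) * (Ω z₁ z₂ * topForm k a (fun x y => Ω x y) w) := by
  by_cases haw : ∃ i, a (w i) ≠ 0
  · obtain ⟨i, hi⟩ := haw
    obtain ⟨w', hw', hs, -, hw0⟩ := exists_adapted_family hw a (Submodule.subset_span ⟨i, rfl⟩) hi
    obtain ⟨c, hc, hcf⟩ := exists_factor_of_span_le hw hw' hs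
    have key := topForm_cons₂ (a := a) (Ω := fun x y => Ω x y) hΩ ha₁ ha₂ hw0
      (fun i hi => h₁ _ (hs i) (hw0 i hi))
    rw [← topAlt_apply, ← topAlt_apply, cons₂_apply_succ, hcf, hcf (topAlt k a Ω)] at key
    rw [← topAlt_apply, ← topAlt_apply, cons₂_apply_succ]
    apply mul_left_cancel₀ hc
    rw [key]; ring
  · push Not at haw
    rw [topForm_eq_zero_of_first (a := a) haw, topForm_eq_zero_of_first]
    · ring
    · intro i
      refine Fin.cases ha₁ (fun j => Fin.cases ha₂ (fun l => haw l) j) i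

theorem topForm_eq_zero_of_mem_span (hΩ : ∀ x y, Ω x y = - Ω y x) {w : Fin (2 * k + 1) → T}
    (hw : LinearIndependent ℝ w) {x : T} (hx : x ∈ span ℝ (range w)) (hx0 : x ≠ 0)
    (hax : a x = 0) (h : ∀ y ∈ span ℝ (range w), a y = 0 → Ω x y = 0) :
    topForm k a (fun x y => Ω x y) w = 0 := by
  by_cases haw : ∃ i, a (w i) ≠ 0
  · obtain ⟨i, hi⟩ := haw
    rcases k with _ | m
    · exfalso
      have : span ℝ (range w) = span ℝ {w 0} := by
        congr 1; ext y; constructor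
        · rintro ⟨j, rfl⟩; rw [Subsingleton.elim (α := Fin 1) j 0]; rfl
        · rintro rfl; exact ⟨0, rfl⟩
      rw [this, Submodule.mem_span_singleton] at hx
      obtain ⟨c, rfl⟩ := hx
      have hi0 : i = 0 := Subsingleton.elim (α := Fin 1) _ _
      rw [map_smul, smul_eq_mul, mul_eq_zero] at hax
      rcases hax with hc | hc
      · exact hx0 (by rw [hc, zero_smul])
      · exact hi (by rw [hi0]; exact hc)
    · obtain ⟨w', hw', hs, hw1, hw0⟩ := exists_adapted_family₂ hw a (Submodule.subset_span ⟨i, rfl⟩) hi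
        hx hx0 hax
      obtain ⟨c, hc, hcf⟩ := exists_factor_of_span_le hw hw' hs
      have key : topForm (m + 1) a (fun x y => Ω x y) w' = 0 := by
        refine topForm_eq_zero_of_degenerate hw0 (i₀ := 1) (by simp) (fun j hj => ?_) (fun j hj => ?_)
        · rw [hw1]; exact h _ (hs j) (hw0 j hj)
        · rw [hΩ, hw1, h _ (hs j) (hw0 j hj), neg_zero]
      rw [← topAlt_apply, hcf] at key
      rw [← topAlt_apply]
      exact (mul_eq_zero.1 key).resolve_left hc
  · push Not at haw
    exact topForm_eq_zero_of_first haw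

/-- Nondegeneracy of a contact covector on the span of `w`. -/
lemma eq_zero_of_topForm_ne_zero (hΩ : ∀ x y, Ω x y = - Ω y x) {w : Fin (2 * k + 1) → T}
    (hw : topForm k a (fun x y => Ω x y) w ≠ 0) {x : T} (hx : x ∈ span ℝ (range w))
    (hax : a x = 0) (h : ∀ y ∈ span ℝ (range w), a y = 0 → Ω x y = 0) : x = 0 := by
  by_contra hx0
  exact hw (topForm_eq_zero_of_mem_span hΩ (linearIndependent_of_topForm_ne_zero hw) hx hx0 hax h)

/-- Reeb vector and vectors with prescribed pairing. -/
theorem exists_reeb_and_hamiltonian (hΩ : ∀ x y, Ω x y = - Ω y x) {w : Fin (2 * k + 1) → T}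
    (hw : topForm k a (fun x y => Ω x y) w ≠ 0) :
    (∃ r ∈ span ℝ (range w), a r = 1 ∧ ∀ y ∈ span ℝ (range w), Ω r y = 0) ∧
    ∀ (c : ℝ) (ℓ : T →ₗ[ℝ] ℝ), ∃ x ∈ span ℝ (range w), a x = c ∧
      ∀ y ∈ span ℝ (range w), a y = 0 → Ω x y = ℓ y := by
  have hΩ0 : ∀ x, Ω x x = 0 := fun x => by linarith [hΩ x x]
  set W := span ℝ (range w) with hW
  let b : Module.Basis (Fin (2 * k + 1)) ℝ W :=
    Module.Basis.span (linearIndependent_of_topForm_ne_zero hw)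
  have : FiniteDimensional ℝ W := Module.Basis.finiteDimensional_of_finite b
  let aW : W →ₗ[ℝ] ℝ := a.comp W.subtype
  let L : W →ₗ[ℝ] (W →ₗ[ℝ] ℝ) :=
    ((LinearMap.lcomp ℝ ℝ W.subtype).comp Ω).comp W.subtype + LinearMap.toSpanSingleton ℝ _ aW ∘ₗ aW
  have hL : ∀ x y : W, L x y = Ω x y + a x * a y := fun x y => rfl
  have hinj : Function.Injective L := by
    rw [← LinearMap.ker_eq_bot, LinearMap.ker_eq_bot']
    intro x hx
    have h0 : a x = 0 := by
      have := hL x x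
      rw [hx, hΩ0, zero_add, LinearMap.zero_apply] at this
      exact mul_self_eq_zero.1 this.symm
    refine Subtype.ext (eq_zero_of_topForm_ne_zero hΩ hw x.2 h0 fun y hy hay => ?_)
    have := hL x ⟨y, hy⟩
    rw [hx, h0, zero_mul, add_zero, LinearMap.zero_apply] at this
    exact this.symm
  have hsurj : Function.Surjective L :=
    (LinearMap.injective_iff_surjective_of_finrank_eq_finrank
      (Subspace.dual_finrank_eq (K := ℝ) (V := W)).symm).1 hinj
  obtain ⟨r, hr⟩ := hsurj aW
  have hr' : ∀ y : W, Ω r y + a r * a y = a y := fun y => by rw [← hL, hr]; rfl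
  have har : a r = 1 := by
    have h1 := hr' r
    rw [hΩ0, zero_add] at h1
    by_contra hne
    have h0 : a r = 0 := by
      have h2 : a r * (a r - 1) = 0 := by linarith
      exact (mul_eq_zero.1 h2).resolve_right (sub_ne_zero.2 hne)
    have : (r : T) = 0 := eq_zero_of_topForm_ne_zero hΩ hw r.2 h0 fun y hy hay => by
      have := hr' ⟨y, hy⟩
      simpa [h0, hay] using this
    obtain ⟨i, hi⟩ := exists_mem_span_ne_zero_of_topForm_ne_zero hw
    have h2 := hr' ⟨w i, Submodule.subset_span ⟨i, rfl⟩⟩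
    simp [this] at h2
    exact hi h2.symm
  have hrΩ : ∀ y ∈ W, Ω r y = 0 := fun y hy => by
    have := hr' ⟨y, hy⟩
    rw [har, one_mul] at this
    linarith
  refine ⟨⟨r, r.2, har, hrΩ⟩, fun c ℓ => ?_⟩
  obtain ⟨x, hx⟩ := hsurj (ℓ.comp W.subtype + (c - ℓ r) • aW)
  have hx' : ∀ y : W, Ω x y + a x * a y = ℓ y + (c - ℓ r) * a y := fun y => by
    rw [← hL, hx]; rfl
  have hax : a x = c := by
    have := hx' r
    rw [hΩ x r, hrΩ x x.2, har] at this
    linarith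
  refine ⟨x, x.2, hax, fun y hy hay => ?_⟩
  have := hx' ⟨y, hy⟩
  simpa [hay] using this

/-- Conformal change: `(ca) ∧ (cΩ + b ∧ a)^k = c^(k+1) a ∧ Ω^k`. -/
theorem topForm_conformal {a' : T →ₗ[ℝ] ℝ} {Ω' : T →ₗ[ℝ] T →ₗ[ℝ] ℝ} {c : ℝ}
    (ha : ∀ x, a' x = c * a x) (hΩ : ∀ x y, a x = 0 → a y = 0 → Ω' x y = c * Ω x y)
    (v : Fin (2 * k + 1) → T) :
    topForm k a' (fun x y => Ω' x y) v = c ^ (k + 1) * topForm k a (fun x y => Ω x y) v := by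
  by_cases hv : LinearIndependent ℝ v
  · by_cases hav : ∃ i, a (v i) ≠ 0
    · obtain ⟨i, hi⟩ := hav
      obtain ⟨w', hw', hs, -, hw0⟩ := exists_adapted_family hv a (Submodule.subset_span ⟨i, rfl⟩) hi
      obtain ⟨d, hd, hdf⟩ := exists_factor_of_span_le hv hw' hs
      have key : topForm k a' (fun x y => Ω' x y) w' = c ^ (k + 1) * topForm k a (fun x y => Ω x y) w' := by
        rw [← topForm_smul]
        refine topForm_congr_of_first (fun i hi => by rw [ha, hw0 i hi, mul_zero])
          (fun i hi => by rw [hw0 i hi, mul_zero]) (ha _) (fun i j hi hj => hΩ _ _ (hw0 i hi) (hw0 j hj))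
      rw [← topAlt_apply, ← topAlt_apply, hdf, hdf (topAlt k a Ω)] at key
      rw [← topAlt_apply, ← topAlt_apply]
      apply mul_left_cancel₀ hd
      rw [key]; ring
    · push Not at hav
      rw [topForm_eq_zero_of_first (a := a) hav, topForm_eq_zero_of_first (fun i => by rw [ha, hav, mul_zero]),
        mul_zero]
  · rw [topForm_eq_zero_of_not_linearIndependent hv, topForm_eq_zero_of_not_linearIndependent hv, mul_zero]

/-- If `r` is a Reeb vector, then `b ∧ Ω^k = b(r) a ∧ Ω^k`. -/
theorem topForm_eq_reeb_mul (hΩ : ∀ x y, Ω x y = - Ω y x) {v : Fin (2 * k + 1) → T}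
    (hv : LinearIndependent ℝ v) {r : T} (hr : r ∈ span ℝ (range v)) (har : a r = 1)
    (hrΩ : ∀ y ∈ span ℝ (range v), Ω r y = 0) (b : T →ₗ[ℝ] ℝ) :
    topForm k b (fun x y => Ω x y) v = b r * topForm k a (fun x y => Ω x y) v := by
  obtain ⟨w', hw', hs, hw0, -⟩ := exists_adapted_family hv a hr (by rw [har]; exact one_ne_zero)
  obtain ⟨d, hd, hdf⟩ := exists_factor_of_span_le hv hw' hs
  have key : topForm k b (fun x y => Ω x y) w' = b r * topForm k a (fun x y => Ω x y) w' := by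
    rw [topForm_eq_sum_topTerm, topForm_eq_sum_topTerm, Finset.mul_sum]
    refine Finset.sum_congr rfl fun σ _ => ?_
    unfold topTerm
    by_cases h : σ 0 = 0
    · rw [h, hw0, har]; ring
    · have hpos : σ.symm 0 ≠ 0 := fun hh => h (σ.symm_apply_eq.mp hh).symm
      obtain ⟨i, hi⟩ : ∃ i : Fin k, σ.symm 0 = oddPos i ∨ σ.symm 0 = evenPos i := by
        have h1 : (σ.symm 0).val ≠ 0 := fun hh => hpos (Fin.ext hh)
        have h2 := (σ.symm 0).2
        refine ⟨⟨((σ.symm 0).val - 1) / 2, by lia⟩, ?_⟩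
        simp only [oddPos, evenPos, Fin.ext_iff]
        lia
      have : ∏ i : Fin k, Ω (w' (σ (oddPos i))) (w' (σ (evenPos i))) = 0 := by
        refine Finset.prod_eq_zero (Finset.mem_univ i) ?_
        rcases hi with hi | hi
        · rw [← hi, Equiv.apply_symm_apply, hw0]
          exact hrΩ _ (hs _)
        · rw [← hi, Equiv.apply_symm_apply, hw0, hΩ, hrΩ _ (hs _), neg_zero]
      rw [this]; ring
  rw [← topAlt_apply, ← topAlt_apply, hdf, hdf (topAlt k a Ω)] at key
  rw [← topAlt_apply, ← topAlt_apply]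
  apply mul_left_cancel₀ hd
  rw [key]; ring

lemma alternating_vecCons_mem_span {n : ℕ} (f : T [⋀^Fin (n + 1)]→ₗ[ℝ] ℝ) {v : Fin n → T} {s : T}
    (hs : s ∈ span ℝ (range v)) : f (Matrix.vecCons s v) = 0 := by
  refine AlternatingMap.map_linearDependent f _ fun h => ?_
  exact ((linearIndependent_finCons (K := ℝ) (x := s) (v := v)).1 h).2 hs

/-- The `2 × 2` determinant rule for the first two entries. -/
theorem alternating_cons₂_change {m : ℕ} (f : T [⋀^Fin (2 * (m + 1) + 1)]→ₗ[ℝ] ℝ)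
    {x y z₁ z₂ s₁ s₂ : T} {w : Fin (2 * m + 1) → T} {p q r t : ℝ}
    (hs₁ : s₁ ∈ span ℝ (range w)) (hs₂ : s₂ ∈ span ℝ (range w))
    (hz₁ : z₁ = p • x + q • y + s₁) (hz₂ : z₂ = r • x + t • y + s₂) :
    f (cons₂ z₁ z₂ w) = (p * t - q * r) * f (cons₂ x y w) := by
  have hadd : ∀ u u' z, f (cons₂ (u + u') z w) = f (cons₂ u z w) + f (cons₂ u' z w) := fun u u' z =>
    AlternatingMap.map_vecCons_add (n := 2 * m + 2) f (Matrix.vecCons z w) u u'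
  have hsmul : ∀ (c : ℝ) u z, f (cons₂ (c • u) z w) = c * f (cons₂ u z w) := fun c u z =>
    AlternatingMap.map_vecCons_smul (n := 2 * m + 2) f (Matrix.vecCons z w) c u
  have hswap : ∀ u z, f (cons₂ u z w) = - f (cons₂ z u w) := by
    intro u z
    have := AlternatingMap.map_swap f (cons₂ z u w) (i := 0) (j := 1) (by simp)
    rw [← this]
    congr 1
    funext i
    refine Fin.cases ?_ (fun j => Fin.cases ?_ (fun l => ?_) j) i
    · simp [cons₂]
    · change _ = cons₂ z u w (swap 0 1 1)
      simp [cons₂]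
    · change w l = cons₂ z u w (swap 0 1 l.succ.succ)
      have : swap (0 : Fin (2 * (m + 1) + 1)) 1 l.succ.succ = l.succ.succ :=
        Equiv.swap_apply_of_ne_of_ne (Fin.succ_ne_zero _)
          (fun h => Fin.succ_ne_zero l (Fin.succ_injective _ h))
      exact (congrArg (cons₂ z u w) this).symm
  have hself : ∀ u, f (cons₂ u u w) = 0 := fun u => by linarith [hswap u u]
  have hspan : ∀ s ∈ span ℝ (range w), ∀ z, f (cons₂ s z w) = 0 := by
    intro s hs z
    refine alternating_vecCons_mem_span (n := 2 * m + 2) f (Submodule.span_mono ?_ hs)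
    rintro _ ⟨i, rfl⟩
    exact ⟨i.succ, rfl⟩
  have hexp : ∀ u, f (cons₂ u z₂ w) = r * f (cons₂ u x w) + t * f (cons₂ u y w) := by
    intro u
    rw [hswap, hz₂, hadd, hadd, hsmul, hsmul, hspan _ hs₂, hswap x u, hswap y u]
    ring
  rw [hz₁, hadd, hadd, hsmul, hsmul, hspan _ hs₁, hexp, hexp, hself, hself, hswap y x]
  ring

end TopFormAlternating

/-- The derivative of a vector-valued function on a manifold. -/
def vderiv {E : Type*} [NormedAddCommGroup E] [NormedSpace ℝ E]
    {H : Type*} [TopologicalSpace H] (I : ModelWithCorners ℝ E H)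
    {N : Type*} [TopologicalSpace N] [ChartedSpace H N]
    {F : Type*} [NormedAddCommGroup F] [NormedSpace ℝ F] (f : N → F) (p : N) :
    TangentSpace I p →L[ℝ] F := mfderiv I 𝓘(ℝ, F) f p

lemma two_le_infty : (2 : WithTop ℕ∞) ≤ ∞ := by
  have : ((2 : ℕ∞) : WithTop ℕ∞) ≤ ((⊤ : ℕ∞) : WithTop ℕ∞) := WithTop.coe_le_coe.2 le_top
  exact this

section ChartForms

variable {E : Type*} [NormedAddCommGroup E] [NormedSpace ℝ E]
  {H : Type*} [TopologicalSpace H] {I : ModelWithCorners ℝ E H} [I.Boundaryless]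
  {N : Type*} [TopologicalSpace N] [ChartedSpace H N] [IsManifold I ∞ N]

lemma contMDiffAt_extChartAt_symm_of_mem {q : N} {y : E} (hy : y ∈ (extChartAt I q).target) :
    ContMDiffAt 𝓘(ℝ, E) I ∞ (extChartAt I q).symm y :=
  (contMDiffOn_extChartAt_symm q).contMDiffAt ((isOpen_extChartAt_target q).mem_nhds hy)

lemma contMDiffAt_extChartAt_of_mem {q p : N} (hp : p ∈ (extChartAt I q).source) :
    ContMDiffAt I 𝓘(ℝ, E) ∞ (extChartAt I q) p :=
  contMDiffAt_extChartAt' (by simpa [extChartAt_source] using hp)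

/-- The derivative of a chart, as a linear equivalence. -/
lemma mfderiv_symm_comp_mfderiv_extChartAt {q p : N} (hp : p ∈ (extChartAt I q).source)
    (v : TangentSpace I p) :
    mfderiv 𝓘(ℝ, E) I (extChartAt I q).symm (extChartAt I q p)
      (mfderiv I 𝓘(ℝ, E) (extChartAt I q) p v) = v := by
  have h := mfderivWithin_extChartAt_symm_comp_mfderiv_extChartAt' hp
  rw [ModelWithCorners.range_eq_univ, mfderivWithin_univ] at h
  exact congrArg (fun L : TangentSpace I p →L[ℝ] TangentSpace I p => L v) h

lemma mfderiv_comp_mfderiv_symm_extChartAt {q : N} {y : E} (hy : y ∈ (extChartAt I q).target)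
    (v : E) :
    mfderiv I 𝓘(ℝ, E) (extChartAt I q) ((extChartAt I q).symm y)
      (mfderiv 𝓘(ℝ, E) I (extChartAt I q).symm y v) = v := by
  have h := mfderiv_extChartAt_comp_mfderivWithin_extChartAt_symm hy
  rw [ModelWithCorners.range_eq_univ, mfderivWithin_univ] at h
  exact congrArg (fun L : E →L[ℝ] E => L v) h

lemma formInChart_apply_mfderiv (α : OneForm I N) {q p : N} (hp : p ∈ (extChartAt I q).source)
    (v : TangentSpace I p) :
    formInChart α q (extChartAt I q p) (vderiv I (extChartAt I q) p v) = α p v := by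
  have h := mfderiv_symm_comp_mfderiv_extChartAt hp v
  have key : ∀ p' : N, p' = p → ∀ u : TangentSpace I p', HEq u v → α p' u = α p v := by
    rintro p' rfl u hu; rw [eq_of_heq hu]
  exact key _ ((extChartAt I q).left_inv hp) _ (heq_of_eq h)

/-- Smoothness of a covector field at a point, in a chart. -/
lemma SmoothForm.contDiffAt_formInChart [FiniteDimensional ℝ E] {α : OneForm I N}
    (hα : SmoothForm α) {q : N} {y : E} (hy : y ∈ (extChartAt I q).target) :
    ContDiffAt ℝ ∞ (formInChart α q) y := by
  have : ContDiffOn ℝ ∞ (formInChart α q) (extChartAt I q).target := by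
    rw [contDiffOn_clm_apply]
    intro v
    have ho := isOpen_extChartAt_target (I := I) q
    have h1 : ContMDiffOn 𝓘(ℝ, E) 𝓘(ℝ, E).tangent ∞
        (fun z : E => (⟨z, v⟩ : TangentBundle 𝓘(ℝ, E) E)) (extChartAt I q).target := by
      intro z _
      exact (contMDiffAt_vectorSpace_iff_contDiffAt.2 contDiffAt_const).contMDiffWithinAt
    have h2 := (contMDiffOn_extChartAt_symm (I := I) (n := ∞) q).contMDiffOn_tangentMapWithin
      (m := ∞) (by simp) ho.uniqueMDiffOn
    have h3 := (hα.comp_contMDiffOn h2).comp h1 (fun z hz => hz)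
    rw [contMDiffOn_iff_contDiffOn] at h3
    refine h3.congr fun z hz => ?_
    simp only [Function.comp_apply, tangentMapWithin, formInChart]
    rw [mfderivWithin_of_isOpen ho hz]
    rfl
  exact this.contDiffAt ((isOpen_extChartAt_target q).mem_nhds hy)

variable {E' : Type*} [NormedAddCommGroup E'] [NormedSpace ℝ E']
  {H' : Type*} [TopologicalSpace H'] {I' : ModelWithCorners ℝ E' H'} [I'.Boundaryless]
  {N' : Type*} [TopologicalSpace N'] [ChartedSpace H' N'] [IsManifold I' ∞ N']

/-- Local expression of a map in charts. -/
def mapInChart (I : ModelWithCorners ℝ E H) (I' : ModelWithCorners ℝ E' H') (f : N' → N) (p : N')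
    (q : N) : E' → E :=
  extChartAt I q ∘ f ∘ (extChartAt I' p).symm

lemma contMDiffAt_comp_extChartAt_symm {F : Type*} [NormedAddCommGroup F] [NormedSpace ℝ F]
    {f : N' → F} {p : N'} (hf : ContMDiffAt I' 𝓘(ℝ, F) ∞ f p) :
    ContDiffAt ℝ ∞ (f ∘ (extChartAt I' p).symm) (extChartAt I' p p) := by
  rw [← contMDiffAt_iff_contDiffAt]
  refine ContMDiffAt.comp _ ?_ (contMDiffAt_extChartAt_symm_of_mem (mem_extChartAt_target p))
  rwa [extChartAt_to_inv]

lemma contDiffAt_mapInChart {f : N' → N} {p : N'} {q : N} (hf : ContMDiffAt I' I ∞ f p)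
    (hq : f p ∈ (extChartAt I q).source) :
    ContDiffAt ℝ ∞ (mapInChart I I' f p q) (extChartAt I' p p) :=
  contMDiffAt_comp_extChartAt_symm (f := extChartAt I q ∘ f)
    ((contMDiffAt_extChartAt_of_mem hq).comp p hf)

lemma eventually_source_of_contMDiffAt {f : N' → N} {p : N'} {q : N} (hf : ContMDiffAt I' I ∞ f p)
    (hq : f p ∈ (extChartAt I q).source) :
    ∀ᶠ y in nhds (extChartAt I' p p), y ∈ (extChartAt I' p).target ∧
      f ((extChartAt I' p).symm y) ∈ (extChartAt I q).source ∧
      MDifferentiableAt I' I f ((extChartAt I' p).symm y) := by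
  have h1 := (isOpen_extChartAt_target (I := I') p).mem_nhds (mem_extChartAt_target p)
  have hc : ContinuousAt (extChartAt I' p).symm (extChartAt I' p p) :=
    continuousAt_extChartAt_symm p
  have hf1 : ∀ᶠ x in nhds p, ContMDiffAt I' I 1 f x :=
    contMDiffAt_iff_contMDiffAt_nhds (by simp) |>.1 (hf.of_le (by simp))
  have hf2 : ∀ᶠ x in nhds p, f x ∈ (extChartAt I q).source :=
    hf.continuousAt.eventually ((isOpen_extChartAt_source q).mem_nhds hq)
  have hc' : Filter.Tendsto (extChartAt I' p).symm (nhds (extChartAt I' p p)) (nhds p) := by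
    simpa [ContinuousAt] using hc
  filter_upwards [h1, hc'.eventually hf1, hc'.eventually hf2] with y h1 h2 h3
  exact ⟨h1, h3, h2.mdifferentiableAt (by simp)⟩

lemma formInChart_pullbackForm (α : OneForm I N) {f : N' → N} {p : N'} {q : N}
    (hf : ContMDiffAt I' I ∞ f p) (hq : f p ∈ (extChartAt I q).source) :
    formInChart (pullbackForm I' f α) p =ᶠ[nhds (extChartAt I' p p)]
      fun y => (formInChart α q (mapInChart I I' f p q y)).comp
        (fderiv ℝ (mapInChart I I' f p q) y) := by
  filter_upwards [eventually_source_of_contMDiffAt hf hq] with y ⟨hy, hs, hd⟩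
  ext v
  have hφ := (contMDiffAt_extChartAt_of_mem hs).mdifferentiableAt (n := ∞) (by simp)
  have hψ := (contMDiffAt_extChartAt_symm_of_mem hy).mdifferentiableAt (n := ∞) (by simp)
  have hD : fderiv ℝ (mapInChart I I' f p q) y v =
      mfderiv I 𝓘(ℝ, E) (extChartAt I q) (f ((extChartAt I' p).symm y))
        (mfderiv I' I f ((extChartAt I' p).symm y)
          (mfderiv 𝓘(ℝ, E') I' (extChartAt I' p).symm y v)) := by
    rw [← mfderiv_eq_fderiv, mapInChart, mfderiv_comp y hφ (hd.comp y hψ), mfderiv_comp y hd hψ]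
    rfl
  rw [ContinuousLinearMap.comp_apply, hD]
  exact (formInChart_apply_mfderiv α hs _).symm

/-- The antisymmetrization of a bilinear form, pulled back by a linear map. -/
def alternatedPullback {T : Type*} [AddCommGroup T] [Module ℝ T] (B : E →L[ℝ] E →L[ℝ] ℝ)
    (L : T →ₗ[ℝ] E) : T →ₗ[ℝ] T →ₗ[ℝ] ℝ :=
  LinearMap.mk₂ ℝ (fun v w => B (L v) (L w) - B (L w) (L v))
    (fun _ _ _ => by simp only [map_add, add_apply]; ring)
    (fun _ _ _ => by simp only [map_smul, smul_apply, smul_eq_mul]; ring)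
    (fun _ _ _ => by simp only [map_add, add_apply]; ring)
    (fun _ _ _ => by simp only [map_smul, smul_apply, smul_eq_mul]; ring)

/-- The exterior derivative as a bilinear map. -/
def extDL (α : OneForm I N) (p : N) : TangentSpace I p →ₗ[ℝ] TangentSpace I p →ₗ[ℝ] ℝ :=
  alternatedPullback (fderiv ℝ (formInChart α p) (extChartAt I p p))
    (vderiv I (extChartAt I p) p : TangentSpace I p →ₗ[ℝ] E)

lemma extDL_apply (α : OneForm I N) (p : N) (v w : TangentSpace I p) :
    extDL α p v w = extD α p v w := rfl

lemma extD_apply (α : OneForm I N) (p : N) (v w : TangentSpace I p) :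
    extD α p v w = fderiv ℝ (formInChart α p) (extChartAt I p p)
        (vderiv I (extChartAt I p) p v) (vderiv I (extChartAt I p) p w)
      - fderiv ℝ (formInChart α p) (extChartAt I p p)
        (vderiv I (extChartAt I p) p w) (vderiv I (extChartAt I p) p v) := rfl

lemma extD_swap (α : OneForm I N) (p : N) (v w : TangentSpace I p) :
    extD α p v w = - extD α p w v := by
  simp only [extD]; ring

/-- Exterior derivative of a pullback, in arbitrary charts. -/
lemma extD_pullbackForm_chart {α : OneForm I N} {f : N' → N} {p : N'} {q : N}
    (hf : ContMDiffAt I' I ∞ f p) (hq : f p ∈ (extChartAt I q).source)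
    (hα : DifferentiableAt ℝ (formInChart α q) (extChartAt I q (f p))) (v w : TangentSpace I' p) :
    extD (pullbackForm I' f α) p v w =
      fderiv ℝ (formInChart α q) (extChartAt I q (f p))
        (vderiv I (extChartAt I q) (f p) (mfderiv I' I f p v))
        (vderiv I (extChartAt I q) (f p) (mfderiv I' I f p w))
      - fderiv ℝ (formInChart α q) (extChartAt I q (f p))
        (vderiv I (extChartAt I q) (f p) (mfderiv I' I f p w))
        (vderiv I (extChartAt I q) (f p) (mfderiv I' I f p v)) := by
  set y₀ := extChartAt I' p p with hy₀
  set g := mapInChart I I' f p q with hg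
  have hg0 : g y₀ = extChartAt I q (f p) := by simp [hg, hy₀, mapInChart]
  have hgs : ContDiffAt ℝ ∞ g y₀ := contDiffAt_mapInChart hf hq
  have hφ := (contMDiffAt_extChartAt_of_mem hq).mdifferentiableAt (n := ∞) (by simp)
  have hD : ∀ v : TangentSpace I' p, fderiv ℝ g y₀ (vderiv I' (extChartAt I' p) p v) =
      vderiv I (extChartAt I q) (f p) (mfderiv I' I f p v) := by
    intro v
    have hd1 := hgs.differentiableAt (by simp)
    have hd2 : MDifferentiableAt I' 𝓘(ℝ, E') (extChartAt I' p) p :=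
      (contMDiffAt_extChartAt (n := ∞)).mdifferentiableAt (by simp)
    have h1 : vderiv I' (g ∘ extChartAt I' p) p v =
        fderiv ℝ g y₀ (vderiv I' (extChartAt I' p) p v) := by
      rw [vderiv, mfderiv_comp p hd1.mdifferentiableAt hd2, mfderiv_eq_fderiv]; rfl
    have h2 : g ∘ extChartAt I' p =ᶠ[nhds p] extChartAt I q ∘ f := by
      filter_upwards [extChartAt_source_mem_nhds (I := I') p] with x hx
      simp only [hg, mapInChart, Function.comp_apply, (extChartAt I' p).left_inv hx]
    rw [← h1, vderiv, h2.mfderiv_eq, mfderiv_comp p hφ (hf.mdifferentiableAt (by simp))]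
    rfl
  have hFD : HasFDerivAt (formInChart (pullbackForm I' f α) p)
      (((ContinuousLinearMap.compL ℝ E' E ℝ) (formInChart α q (g y₀))).comp
          (fderiv ℝ (fderiv ℝ g) y₀) +
        ((ContinuousLinearMap.compL ℝ E' E ℝ).flip (fderiv ℝ g y₀)).comp
          ((fderiv ℝ (formInChart α q) (g y₀)).comp (fderiv ℝ g y₀))) y₀ := by
    have h1 : HasFDerivAt (fun y => formInChart α q (g y))
        ((fderiv ℝ (formInChart α q) (g y₀)).comp (fderiv ℝ g y₀)) y₀ := by
      have h0 : HasFDerivAt (formInChart α q) (fderiv ℝ (formInChart α q) (g y₀)) (g y₀) := by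
        rw [hg0]; exact hα.hasFDerivAt
      exact h0.comp y₀ (hgs.differentiableAt (by simp)).hasFDerivAt
    have h2 : HasFDerivAt (fderiv ℝ g) (fderiv ℝ (fderiv ℝ g) y₀) y₀ :=
      ((hgs.fderiv_right (m := 1) two_le_infty).differentiableAt (by simp)).hasFDerivAt
    exact (h1.clm_comp h2).congr_of_eventuallyEq (formInChart_pullbackForm α hf hq)
  have hsymm : IsSymmSndFDerivAt ℝ g y₀ := hgs.isSymmSndFDerivAt (by simpa using two_le_infty)
  rw [extD_apply, hFD.fderiv]
  simp only [add_apply, ContinuousLinearMap.comp_apply,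
    ContinuousLinearMap.compL_apply, ContinuousLinearMap.flip_apply]
  rw [hD v, hD w, hg0, hsymm.eq (vderiv I' (extChartAt I' p) p v)]
  ring

lemma extD_pullbackForm_of_differentiableAt {α : OneForm I N} {f : N' → N} {p : N'}
    (hf : ContMDiffAt I' I ∞ f p)
    (hα : DifferentiableAt ℝ (formInChart α (f p)) (extChartAt I (f p) (f p)))
    (v w : TangentSpace I' p) :
    extD (pullbackForm I' f α) p v w = extD α (f p) (mfderiv I' I f p v) (mfderiv I' I f p w) :=
  extD_pullbackForm_chart hf (mem_extChartAt_source _) hα v w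

/-- Naturality of the exterior derivative. -/
theorem extD_pullbackForm [FiniteDimensional ℝ E] {α : OneForm I N} (hα : SmoothForm α)
    {f : N' → N} {p : N'} (hf : ContMDiffAt I' I ∞ f p) (v w : TangentSpace I' p) :
    extD (pullbackForm I' f α) p v w = extD α (f p) (mfderiv I' I f p v) (mfderiv I' I f p w) :=
  extD_pullbackForm_of_differentiableAt hf
    ((hα.contDiffAt_formInChart (mem_extChartAt_target _)).differentiableAt (by simp)) v w

end ChartForms

lemma contMDiffAt_clm_apply {E : Type*} [NormedAddCommGroup E] [NormedSpace ℝ E]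
    {H : Type*} [TopologicalSpace H] {I : ModelWithCorners ℝ E H}
    {N : Type*} [TopologicalSpace N] [ChartedSpace H N]
    {F : Type*} [NormedAddCommGroup F] [NormedSpace ℝ F]
    {G : Type*} [NormedAddCommGroup G] [NormedSpace ℝ G]
    [FiniteDimensional ℝ F] {f : N → F →L[ℝ] G} {p : N}
    (h : ∀ y, ContMDiffAt I 𝓘(ℝ, G) ∞ (fun x => f x y) p) :
    ContMDiffAt I 𝓘(ℝ, F →L[ℝ] G) ∞ f p := by
  let d := finrank ℝ F
  have hd : d = finrank ℝ (Fin d → ℝ) := (Module.finrank_fin_fun ℝ).symm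
  let e₁ := ContinuousLinearEquiv.ofFinrankEq hd
  let e₂ := (e₁.arrowCongr (1 : G ≃L[ℝ] G)).trans (ContinuousLinearEquiv.piRing (Fin d))
  have h1 : ContMDiffAt I 𝓘(ℝ, Fin d → G) ∞ (fun x => e₂ (f x)) p :=
    contMDiffAt_pi_space.2 fun i => h _
  have h2 := (e₂.symm.contDiff (n := ∞)).contMDiff.contMDiffAt.comp p h1
  refine h2.congr_of_eventuallyEq (.of_forall fun x => ?_)
  simp

section Fields

variable {E : Type*} [NormedAddCommGroup E] [NormedSpace ℝ E]
  {H : Type*} [TopologicalSpace H] {I : ModelWithCorners ℝ E H}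
  {N : Type*} [TopologicalSpace N] [ChartedSpace H N] [IsManifold I ∞ N]
  {F : Type*} [NormedAddCommGroup F] [NormedSpace ℝ F]

/-- Smoothness of a vector field at a point. -/
def SmoothFieldAt (X : ∀ p : N, TangentSpace I p) (p : N) : Prop :=
  ContMDiffAt I I.tangent ∞ (fun p => (⟨p, X p⟩ : TangentBundle I N)) p

lemma SmoothField.smoothFieldAt {X : ∀ p : N, TangentSpace I p} (hX : SmoothField X) (p : N) :
    SmoothFieldAt X p := hX p

lemma SmoothFieldAt.mdifferentiableAt {X : ∀ p : N, TangentSpace I p} {p : N}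
    (hX : SmoothFieldAt X p) :
    MDifferentiableAt I I.tangent (fun p => (⟨p, X p⟩ : TangentBundle I N)) p :=
  ContMDiffAt.mdifferentiableAt hX (by simp)

lemma SmoothFieldAt.congr {X Y : ∀ p : N, TangentSpace I p} {p : N}
    (hX : SmoothFieldAt X p) (h : ∀ᶠ q in nhds p, Y q = X q) : SmoothFieldAt Y p :=
  ContMDiffAt.congr_of_eventuallyEq hX (h.mono fun q hq => by simp [hq])

lemma SmoothFieldAt.sub {X Y : ∀ p : N, TangentSpace I p} {p : N}
    (hX : SmoothFieldAt X p) (hY : SmoothFieldAt Y p) :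
    SmoothFieldAt (fun q => X q - Y q) p :=
  ContMDiffAt.sub_section hX hY

lemma SmoothFieldAt.smul {X : ∀ p : N, TangentSpace I p} {p : N} {f : N → ℝ}
    (hf : ContMDiffAt I 𝓘(ℝ, ℝ) ∞ f p) (hX : SmoothFieldAt X p) :
    SmoothFieldAt (fun q => f q • X q) p :=
  ContMDiffAt.smul_section hf hX

lemma SmoothFieldAt.mlieBracket [CompleteSpace E] {X Y : ∀ p : N, TangentSpace I p} {p : N}
    (hX : SmoothFieldAt X p) (hY : SmoothFieldAt Y p) :
    SmoothFieldAt (mlieBracket I X Y) p := by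
  have : IsManifold I ((⊤ : ℕ∞) + 1) N := by
    simpa using (inferInstance : IsManifold I ∞ N)
  have : IsManifold I (minSmoothness ℝ 2) N := by
    rw [minSmoothness_of_isRCLikeNormedField]
    exact IsManifold.of_le (n := ∞) two_le_infty
  exact ContMDiffAt.mlieBracket_vectorField (m := ⊤) (n := ⊤) hX hY (by simp)

/-- A field of linear maps that maps smooth fields to smooth functions. -/
def SmoothMapAt (A : ∀ p : N, TangentSpace I p →L[ℝ] F) (p : N) : Prop :=
  ∀ X : ∀ p : N, TangentSpace I p, SmoothFieldAt X p →
    ContMDiffAt I 𝓘(ℝ, F) ∞ (fun q => A q (X q)) p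

lemma SmoothForm.smoothMapAt {α : OneForm I N} (hα : SmoothForm α) (p : N) :
    SmoothMapAt α p := fun _ hX =>
  ContMDiffAt.comp p (g := fun v : TangentBundle I N => α v.proj v.snd) (hα _) hX

lemma contMDiffAt_vderiv {f : N → F} {p : N} (hf : ContMDiffAt I 𝓘(ℝ, F) ∞ f p) :
    SmoothMapAt (vderiv I f) p := by
  intro X hX
  rw [contMDiffAt_infty]
  intro n
  have : IsManifold I ((n : WithTop ℕ∞) + 1) N := IsManifold.of_le (n := ∞) (by
    exact_mod_cast (le_top : ((n + 1 : ℕ) : ℕ∞) ≤ ⊤))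
  obtain ⟨u, hu, hfu⟩ := (contMDiffAt_iff_contMDiffOn_nhds (n := ((n + 1 : ℕ) : WithTop ℕ∞))
    (by exact_mod_cast (ENat.natCast_ne_top (n + 1)))).1 (hf.of_le (by
      exact_mod_cast (le_top : ((n + 1 : ℕ) : ℕ∞) ≤ ⊤)))
  obtain ⟨v, hvu, hvo, hpv⟩ := mem_nhds_iff.1 hu
  have h2 := (hfu.mono hvu).contMDiffOn_tangentMapWithin (m := n) (by norm_cast) hvo.uniqueMDiffOn
  have h3 := (contMDiff_snd_tangentBundle_modelSpace F 𝓘(ℝ, F) (n := n)).comp_contMDiffOn h2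
  have h4 : ContMDiffAt I 𝓘(ℝ, F) n (fun q => (tangentMapWithin I 𝓘(ℝ, F) f v ⟨q, X q⟩).2) p := by
    have hX' := (ContMDiffAt.of_le (m := n) hX (by exact_mod_cast le_top))
    refine ContMDiffWithinAt.contMDiffAt (s := v) ?_ (hvo.mem_nhds hpv)
    exact ContMDiffWithinAt.comp (t := Bundle.TotalSpace.proj ⁻¹' v) p (h3 _ hpv)
      hX'.contMDiffWithinAt (fun q hq => hq)
  refine h4.congr_of_eventuallyEq ?_
  filter_upwards [hvo.mem_nhds hpv] with q hq
  simp only [tangentMapWithin, vderiv]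
  rw [mfderivWithin_of_isOpen hvo hq]
  rfl

/-- The local vector field through a point with given coordinates in the trivialization at `q`. -/
def localField (q : N) (w : N → E) (p : N) : TangentSpace I p :=
  (trivializationAt E (TangentSpace I) q).symmL ℝ p (w p)

lemma mem_baseSet_trivializationAt_self (q : N) :
    q ∈ (trivializationAt E (TangentSpace I : N → Type _) q).baseSet :=
  FiberBundle.mem_baseSet_trivializationAt' q

lemma smoothFieldAt_localField {q p : N} {w : N → E}
    (hp : p ∈ (trivializationAt E (TangentSpace I : N → Type _) q).baseSet)
    (hw : ContMDiffAt I 𝓘(ℝ, E) ∞ w p) :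
    SmoothFieldAt (I := I) (localField q w) p := by
  refine (Bundle.Trivialization.contMDiffAt_section_iff
    (trivializationAt E (TangentSpace I : N → Type _) q) hp).2 ?_
  refine hw.congr_of_eventuallyEq ?_
  filter_upwards [(trivializationAt E (TangentSpace I : N → Type _) q).open_baseSet.mem_nhds hp]
    with x hx
  exact (congrArg (fun z => (trivializationAt E (TangentSpace I : N → Type _) q ⟨x, z⟩).2)
    (Bundle.Trivialization.symmL_apply (R := ℝ) _ hx (w x))).trans
    (congrArg Prod.snd (Bundle.Trivialization.apply_mk_symm _ hx (w x)))

lemma exists_localField_eq (q : N) (z : TangentSpace I q) :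
    ∃ v : E, localField (I := I) q (fun _ => v) q = z :=
  ⟨(trivializationAt E (TangentSpace I : N → Type _) q ⟨q, z⟩).2, 
    (Bundle.Trivialization.symmL_apply (R := ℝ) _ (mem_baseSet_trivializationAt_self q) _).trans
      (Bundle.Trivialization.symm_apply_apply_mk _ (mem_baseSet_trivializationAt_self q) z)⟩

/-- Local solution of a smooth family of surjective linear equations, by a smooth field with
prescribed value at a point. -/
theorem exists_local_solution [FiniteDimensional ℝ F] {U : Set N} (hU : IsOpen U)
    {A : ∀ p : N, TangentSpace I p →L[ℝ] F} (hA : ∀ p ∈ U, SmoothMapAt A p)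
    {p₀ : N} (hp₀ : p₀ ∈ U) (hsurj : Function.Surjective (A p₀))
    {y : N → F} (hy : ∀ p ∈ U, ContMDiffAt I 𝓘(ℝ, F) ∞ y p)
    (z : TangentSpace I p₀) (hz : A p₀ z = y p₀) :
    ∃ U' ⊆ U, IsOpen U' ∧ p₀ ∈ U' ∧ (∀ p ∈ U', Function.Surjective (A p)) ∧
      ∃ Z : ∀ p : N, TangentSpace I p, Z p₀ = z ∧ ∀ p ∈ U', SmoothFieldAt Z p ∧ A p (Z p) = y p := by
  set e := trivializationAt E (TangentSpace I : N → Type _) p₀ with he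
  obtain ⟨v₀, hv₀⟩ := exists_localField_eq (I := I) p₀ z
  let Ã : N → E →L[ℝ] F := fun p => (A p).comp (e.symmL ℝ p)
  have hÃ : Function.Surjective (Ã p₀) := by
    intro f
    obtain ⟨x, hx⟩ := hsurj f
    obtain ⟨v, hv⟩ := exists_localField_eq (I := I) p₀ x
    exact ⟨v, by rw [← hx, ← hv]; rfl⟩
  obtain ⟨Q₀, hQ₀⟩ := (Ã p₀ : E →ₗ[ℝ] F).exists_rightInverse_of_surjective
    (LinearMap.range_eq_top.2 hÃ)
  let Q : F →L[ℝ] E := Q₀.toContinuousLinearMap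
  let Nn : N → F →L[ℝ] F := fun p => (Ã p).comp Q
  have hN0 : Nn p₀ = ContinuousLinearMap.id ℝ F := by
    ext f
    exact congrArg (fun L : F →ₗ[ℝ] F => L f) hQ₀
  have hNs : ∀ p ∈ U ∩ e.baseSet, ContMDiffAt I 𝓘(ℝ, F →L[ℝ] F) ∞ Nn p := fun p hp =>
    contMDiffAt_clm_apply fun f =>
      hA p hp.1 _ (smoothFieldAt_localField (w := fun _ => Q f) hp.2 contMDiffAt_const)
  have hUo : IsOpen (U ∩ e.baseSet) := hU.inter e.open_baseSet
  have hNc : ContinuousOn Nn (U ∩ e.baseSet) := fun p hp =>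
    (hNs p hp).continuousAt.continuousWithinAt
  let U' := U ∩ e.baseSet ∩ Nn ⁻¹' (range ((↑) : (F ≃L[ℝ] F) → (F →L[ℝ] F)))
  have hU' : IsOpen U' := hNc.isOpen_inter_preimage hUo ContinuousLinearEquiv.isOpen
  have hinv : ∀ p ∈ U', (Nn p).IsInvertible := fun p hp => hp.2
  let c : N → F := fun p => (Nn p).inverse (y p - Ã p v₀)
  let w : N → E := fun p => v₀ + Q (c p)
  have hsol : ∀ p ∈ U', A p (localField p₀ w p) = y p := by
    intro p hp
    have h1 : A p (localField p₀ w p) = Ã p v₀ + Nn p (c p) := by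
      change A p (e.symmL ℝ p (v₀ + Q (c p))) = _
      rw [map_add, map_add]; rfl
    rw [h1, (hinv p hp).self_apply_inverse]
    abel
  refine ⟨U', fun p hp => hp.1.1, hU',
    ⟨⟨hp₀, mem_baseSet_trivializationAt_self p₀⟩, ⟨ContinuousLinearEquiv.refl ℝ F, hN0.symm⟩⟩, ?_,
    localField p₀ w, ?_, fun p hp => ⟨smoothFieldAt_localField hp.1.2 ?_, hsol p hp⟩⟩
  · intro p hp f
    exact ⟨e.symmL ℝ p (Q ((Nn p).inverse f)), (hinv p hp).self_apply_inverse f⟩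
  · have hc0 : c p₀ = 0 := by
      have : Ã p₀ v₀ = y p₀ := by rw [← hz, ← hv₀]; rfl
      simp only [c, this, sub_self, map_zero]
    rw [← hv₀]
    simp only [localField, w, hc0, map_zero, add_zero]
  · have h1 : ContMDiffAt I 𝓘(ℝ, F) ∞ (fun p => y p - Ã p v₀) p :=
      (hy p hp.1.1).sub
        (hA p hp.1.1 _ (smoothFieldAt_localField (w := fun _ => v₀) hp.1.2 contMDiffAt_const))
    have h2 : ContMDiffAt I 𝓘(ℝ, F →L[ℝ] F) ∞ (fun p => (Nn p).inverse) p :=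
      ((hinv p hp).contDiffAt_map_inverse (n := ∞)).contMDiffAt.comp p (hNs p hp.1)
    have h3 : ContMDiffAt I 𝓘(ℝ, F) ∞ c p := h2.clm_apply h1
    exact contMDiffAt_const.add (Q.contDiff.contMDiff.contMDiffAt.comp p h3)

instance (p : N) [FiniteDimensional ℝ E] : FiniteDimensional ℝ (TangentSpace I p) :=
  inferInstanceAs (FiniteDimensional ℝ E)

/-- The solution of a smooth family of bijective linear equations is smooth. -/
theorem smoothFieldAt_of_bijective [FiniteDimensional ℝ E] [FiniteDimensional ℝ F] {U : Set N}
    (hU : IsOpen U) {A : ∀ p : N, TangentSpace I p →L[ℝ] F} (hA : ∀ p ∈ U, SmoothMapAt A p)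
    {p₀ : N} (hp₀ : p₀ ∈ U) (hbij : Function.Bijective (A p₀))
    {W : ∀ p : N, TangentSpace I p} (hy : ∀ p ∈ U, ContMDiffAt I 𝓘(ℝ, F) ∞ (fun p => A p (W p)) p) :
    SmoothFieldAt W p₀ := by
  obtain ⟨U', hU'U, hU', hp', hs, Z, -, hZ⟩ :=
    exists_local_solution hU hA hp₀ hbij.2 hy (W p₀) rfl
  refine (hZ p₀ hp').1.congr ?_
  filter_upwards [hU'.mem_nhds hp'] with p hp
  have hfin : finrank ℝ (TangentSpace I p) = finrank ℝ F :=
    LinearEquiv.finrank_eq (LinearEquiv.ofBijective (A p₀ : TangentSpace I p₀ →ₗ[ℝ] F) hbij)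
  exact ((LinearMap.injective_iff_surjective_of_finrank_eq_finrank
    (f := (A p : TangentSpace I p →ₗ[ℝ] F)) hfin).2 (hs p hp)) (hZ p hp).2.symm

end Fields

section Cartan

variable {E : Type*} [NormedAddCommGroup E] [NormedSpace ℝ E]
  {H : Type*} [TopologicalSpace H] {I : ModelWithCorners ℝ E H} [I.Boundaryless]
  {N : Type*} [TopologicalSpace N] [ChartedSpace H N] [IsManifold I ∞ N]
  {F : Type*} [NormedAddCommGroup F] [NormedSpace ℝ F]

lemma vderiv_comp {G : Type*} [NormedAddCommGroup G] [NormedSpace ℝ G] {f : N → F} {g : F → G}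
    {p : N} (hg : DifferentiableAt ℝ g (f p)) (hf : MDifferentiableAt I 𝓘(ℝ, F) f p)
    (v : TangentSpace I p) :
    vderiv I (fun q => g (f q)) p v = fderiv ℝ g (f p) (vderiv I f p v) := by
  have := mfderiv_comp p hg.mdifferentiableAt hf
  rw [vderiv, show (fun q => g (f q)) = g ∘ f from rfl, this, mfderiv_eq_fderiv]
  rfl

lemma vderiv_add {f g : N → F} {p : N} (hf : MDifferentiableAt I 𝓘(ℝ, F) f p)
    (hg : MDifferentiableAt I 𝓘(ℝ, F) g p) (v : TangentSpace I p) :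
    vderiv I (fun q => f q + g q) p v = vderiv I f p v + vderiv I g p v :=
  congrArg (fun L : TangentSpace I p →L[ℝ] F => L v) (hf.hasMFDerivAt.add hg.hasMFDerivAt).mfderiv

lemma vderiv_sub {f g : N → F} {p : N} (hf : MDifferentiableAt I 𝓘(ℝ, F) f p)
    (hg : MDifferentiableAt I 𝓘(ℝ, F) g p) (v : TangentSpace I p) :
    vderiv I (fun q => f q - g q) p v = vderiv I f p v - vderiv I g p v :=
  congrArg (fun L : TangentSpace I p →L[ℝ] F => L v) (hf.hasMFDerivAt.sub hg.hasMFDerivAt).mfderiv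

lemma vderiv_mul {f g : N → ℝ} {p : N} (hf : MDifferentiableAt I 𝓘(ℝ, ℝ) f p)
    (hg : MDifferentiableAt I 𝓘(ℝ, ℝ) g p) (v : TangentSpace I p) :
    vderiv I (fun q => f q * g q) p v = f p * vderiv I g p v + g p * vderiv I f p v :=
  congrArg (fun L : TangentSpace I p →L[ℝ] ℝ => L v) (hf.hasMFDerivAt.mul hg.hasMFDerivAt).mfderiv

lemma vderiv_const (c : F) (p : N) (v : TangentSpace I p) : vderiv I (fun _ : N => c) p v = 0 :=
  congrArg (fun L : TangentSpace I p →L[ℝ] F => L v) (mfderiv_const (c := c))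

lemma vderiv_congr {f g : N → F} {p : N} (h : f =ᶠ[nhds p] g) : vderiv I f p = vderiv I g p :=
  h.mfderiv_eq

lemma vderiv_eq_fderiv_chart {f : N → F} {p : N}
    (hf : DifferentiableAt ℝ (f ∘ (extChartAt I p).symm) (extChartAt I p p))
    (v : TangentSpace I p) :
    vderiv I f p v = fderiv ℝ (f ∘ (extChartAt I p).symm) (extChartAt I p p)
      (vderiv I (extChartAt I p) p v) := by
  have hd : MDifferentiableAt I 𝓘(ℝ, E) (extChartAt I p) p :=
    (contMDiffAt_extChartAt (n := ∞)).mdifferentiableAt (by simp)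
  rw [← vderiv_comp hf hd]
  refine congrArg (fun L : TangentSpace I p →L[ℝ] F => L v) (vderiv_congr ?_)
  filter_upwards [extChartAt_source_mem_nhds (I := I) p] with x hx
  simp only [Function.comp_apply, (extChartAt I p).left_inv hx]

/-- A vector field in the chart at `p`. -/
def fieldInChart (X : ∀ p : N, TangentSpace I p) (p : N) : E → E :=
  VectorField.mpullbackWithin 𝓘(ℝ, E) I (extChartAt I p).symm X (range I)

lemma formInChart_fieldInChart (α : OneForm I N) (X : ∀ p : N, TangentSpace I p) {p : N} {y : E}
    (hy : y ∈ (extChartAt I p).target) :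
    formInChart α p y (fieldInChart X p y) =
      α ((extChartAt I p).symm y) (X ((extChartAt I p).symm y)) := by
  have h := (isInvertible_mfderivWithin_extChartAt_symm hy).self_apply_inverse
    (X ((extChartAt I p).symm y))
  simp only [formInChart, fieldInChart, VectorField.mpullbackWithin_apply]
  rw [← mfderivWithin_univ, ← I.range_eq_univ]
  exact congrArg (α ((extChartAt I p).symm y)) h

lemma fieldInChart_self (X : ∀ p : N, TangentSpace I p) (p : N) :
    fieldInChart X p (extChartAt I p p) = vderiv I (extChartAt I p) p (X p) := by
  have hy := mem_extChartAt_target (I := I) p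
  have h1 := (isInvertible_mfderivWithin_extChartAt_symm hy).self_apply_inverse
    (X ((extChartAt I p).symm (extChartAt I p p)))
  rw [I.range_eq_univ, mfderivWithin_univ] at h1
  have h2 := mfderiv_comp_mfderiv_symm_extChartAt hy (fieldInChart X p (extChartAt I p p))
  have key : ∀ p' : N, p' = p → vderiv I (extChartAt I p) p' (X p') =
      vderiv I (extChartAt I p) p (X p) := by rintro p' rfl; rfl
  rw [← key _ (extChartAt_to_inv (I := I) p), ← h2]
  refine congrArg (mfderiv I 𝓘(ℝ, E) (extChartAt I p)
    ((extChartAt I p).symm (extChartAt I p p))) ?_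
  rw [← h1]
  simp only [fieldInChart, VectorField.mpullbackWithin_apply, I.range_eq_univ, mfderivWithin_univ]

/-- Cartan's formula for the exterior derivative. -/
theorem extD_eq_lieBracket [CompleteSpace E] {α : OneForm I N} {p : N}
    (hα : DifferentiableAt ℝ (formInChart α p) (extChartAt I p p))
    {X Y : ∀ p : N, TangentSpace I p}
    (hX : MDifferentiableAt I I.tangent (fun p => (⟨p, X p⟩ : TangentBundle I N)) p)
    (hY : MDifferentiableAt I I.tangent (fun p => (⟨p, Y p⟩ : TangentBundle I N)) p) :
    extD α p (X p) (Y p) = vderiv I (fun q => α q (Y q)) p (X p)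
      - vderiv I (fun q => α q (X q)) p (Y p) - α p (mlieBracket I X Y p) := by
  have : IsManifold I 2 N := IsManifold.of_le (n := ∞) two_le_infty
  have hdiff : ∀ {Z : ∀ p : N, TangentSpace I p},
      MDifferentiableAt I I.tangent (fun p => (⟨p, Z p⟩ : TangentBundle I N)) p →
      DifferentiableAt ℝ (fieldInChart Z p) (extChartAt I p p) := by
    intro Z hZ
    have h : DifferentiableWithinAt ℝ (fieldInChart Z p)
        ((extChartAt I p).symm ⁻¹' univ ∩ range I) (extChartAt I p p) :=
      MDifferentiableWithinAt.differentiableWithinAt_mpullbackWithin_vectorField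
        hZ.mdifferentiableWithinAt
    rwa [preimage_univ, univ_inter, I.range_eq_univ, differentiableWithinAt_univ] at h
  have hφ : ∀ {Z : ∀ p : N, TangentSpace I p},
      (fun q => α q (Z q)) ∘ (extChartAt I p).symm =ᶠ[nhds (extChartAt I p p)]
        fun y => formInChart α p y (fieldInChart Z p y) := by
    intro Z
    filter_upwards [(isOpen_extChartAt_target (I := I) p).mem_nhds (mem_extChartAt_target p)]
      with y hy
    exact (formInChart_fieldInChart α Z hy).symm
  have hder : ∀ {Z : ∀ p : N, TangentSpace I p} (v : TangentSpace I p),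
      MDifferentiableAt I I.tangent (fun p => (⟨p, Z p⟩ : TangentBundle I N)) p →
      vderiv I (fun q => α q (Z q)) p v =
        formInChart α p (extChartAt I p p)
          (fderiv ℝ (fieldInChart Z p) (extChartAt I p p) (vderiv I (extChartAt I p) p v)) +
        fderiv ℝ (formInChart α p) (extChartAt I p p) (vderiv I (extChartAt I p) p v)
          (vderiv I (extChartAt I p) p (Z p)) := by
    intro Z v hZ
    have h1 := hα.hasFDerivAt.clm_apply (hdiff hZ).hasFDerivAt
    have h2 := h1.congr_of_eventuallyEq hφ
    rw [vderiv_eq_fderiv_chart h2.differentiableAt, h2.fderiv]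
    simp only [add_apply, ContinuousLinearMap.comp_apply, ContinuousLinearMap.flip_apply,
      fieldInChart_self]
  have hbr : α p (mlieBracket I X Y p) = formInChart α p (extChartAt I p p)
      (fderiv ℝ (fieldInChart Y p) (extChartAt I p p) (vderiv I (extChartAt I p) p (X p)) -
       fderiv ℝ (fieldInChart X p) (extChartAt I p p) (vderiv I (extChartAt I p) p (Y p))) := by
    rw [← formInChart_apply_mfderiv α (mem_extChartAt_source p), ← VectorField.mlieBracketWithin_univ,
      VectorField.mlieBracketWithin_apply]
    refine congrArg (formInChart α p (extChartAt I p p)) ?_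
    refine ((isInvertible_mfderiv_extChartAt (mem_extChartAt_source p)).self_apply_inverse _).trans ?_
    have hb : VectorField.lieBracketWithin ℝ (fieldInChart X p) (fieldInChart Y p)
        ((extChartAt I p).symm ⁻¹' univ ∩ range I) (extChartAt I p p) =
        fderiv ℝ (fieldInChart Y p) (extChartAt I p p) (vderiv I (extChartAt I p) p (X p)) -
        fderiv ℝ (fieldInChart X p) (extChartAt I p p) (vderiv I (extChartAt I p) p (Y p)) := by
      rw [preimage_univ, univ_inter, I.range_eq_univ, VectorField.lieBracketWithin_univ,
        VectorField.lieBracket, fieldInChart_self X, fieldInChart_self Y]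
    exact hb
  rw [hder _ hX, hder _ hY, hbr, extD_apply, map_sub]
  ring

theorem SmoothForm.extD_eq_lieBracket [FiniteDimensional ℝ E] {α : OneForm I N} (hα : SmoothForm α)
    {p : N} {X Y : ∀ p : N, TangentSpace I p} (hX : SmoothFieldAt X p) (hY : SmoothFieldAt Y p) :
    extD α p (X p) (Y p) = vderiv I (fun q => α q (Y q)) p (X p)
      - vderiv I (fun q => α q (X q)) p (Y p) - α p (mlieBracket I X Y p) :=
  have : CompleteSpace E := FiniteDimensional.complete ℝ E
  ContactBundle.extD_eq_lieBracket
    ((hα.contDiffAt_formInChart (mem_extChartAt_target _)).differentiableAt (by simp))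
    hX.mdifferentiableAt hY.mdifferentiableAt

lemma SmoothFieldAt.eventually_mdifferentiableAt {X : ∀ p : N, TangentSpace I p} {p : N}
    (hX : SmoothFieldAt X p) : ∀ᶠ q in nhds p,
      MDifferentiableAt I I.tangent (fun p => (⟨p, X p⟩ : TangentBundle I N)) q := by
  have : IsManifold I (1 + 1) N := IsManifold.of_le (n := ∞) two_le_infty
  have h := (contMDiffAt_iff_contMDiffAt_nhds (n := 1) (by simp)).1
    (ContMDiffAt.of_le (m := 1) hX (by simp))
  exact h.mono fun q hq => hq.mdifferentiableAt (by simp)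

/-- Contraction of the exterior derivative with a vector field. -/
def contractD (α : OneForm I N) (Z : ∀ p : N, TangentSpace I p) (p : N) :
    TangentSpace I p →L[ℝ] ℝ :=
  ((fderiv ℝ (formInChart α p) (extChartAt I p p)).flip (vderiv I (extChartAt I p) p (Z p))
    - fderiv ℝ (formInChart α p) (extChartAt I p p) (vderiv I (extChartAt I p) p (Z p))).comp
    (vderiv I (extChartAt I p) p)

lemma contractD_apply (α : OneForm I N) (Z : ∀ p : N, TangentSpace I p) (p : N)
    (v : TangentSpace I p) : contractD α Z p v = extD α p v (Z p) := rfl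

lemma SmoothForm.smoothMapAt_contractD [FiniteDimensional ℝ E] {α : OneForm I N}
    (hα : SmoothForm α) {p : N} {Z : ∀ p : N, TangentSpace I p} (hZ : SmoothFieldAt Z p) :
    SmoothMapAt (contractD α Z) p := by
  have : CompleteSpace E := FiniteDimensional.complete ℝ E
  intro X hX
  have h1 := contMDiffAt_vderiv (hα.smoothMapAt p Z hZ) X hX
  have h2 := contMDiffAt_vderiv (hα.smoothMapAt p X hX) Z hZ
  have h3 := hα.smoothMapAt p _ (hX.mlieBracket hZ)
  refine ((h1.sub h2).sub h3).congr_of_eventuallyEq ?_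
  filter_upwards [hX.eventually_mdifferentiableAt, hZ.eventually_mdifferentiableAt] with q hq hq'
  exact ContactBundle.extD_eq_lieBracket
    ((hα.contDiffAt_formInChart (mem_extChartAt_target _)).differentiableAt (by simp)) hq hq'

lemma SmoothForm.contMDiffAt_extD [FiniteDimensional ℝ E] {α : OneForm I N}
    (hα : SmoothForm α) {p : N} {X Z : ∀ p : N, TangentSpace I p} (hX : SmoothFieldAt X p)
    (hZ : SmoothFieldAt Z p) : ContMDiffAt I 𝓘(ℝ, ℝ) ∞ (fun q => extD α q (X q) (Z q)) p :=
  hα.smoothMapAt_contractD hZ X hX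

variable {E' : Type*} [NormedAddCommGroup E'] [NormedSpace ℝ E']
  {H' : Type*} [TopologicalSpace H'] {I' : ModelWithCorners ℝ E' H'} [I'.Boundaryless]
  {N' : Type*} [TopologicalSpace N'] [ChartedSpace H' N'] [IsManifold I' ∞ N']

/-- Brackets of related vector fields are related. -/
theorem mfderiv_mlieBracket_of_related [FiniteDimensional ℝ E] [FiniteDimensional ℝ E']
    {f : N' → N} {p : N'} (hf : ContMDiffAt I' I ∞ f p)
    {X Y : ∀ p : N', TangentSpace I' p} {X' Y' : ∀ p : N, TangentSpace I p}
    (hX : SmoothFieldAt X p) (hY : SmoothFieldAt Y p)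
    (hX' : SmoothFieldAt X' (f p)) (hY' : SmoothFieldAt Y' (f p))
    (hXX' : ∀ᶠ q in nhds p, mfderiv I' I f q (X q) = X' (f q))
    (hYY' : ∀ᶠ q in nhds p, mfderiv I' I f q (Y q) = Y' (f q)) :
    mfderiv I' I f p (mlieBracket I' X Y p) = mlieBracket I X' Y' (f p) := by
  have : CompleteSpace E := FiniteDimensional.complete ℝ E
  have : CompleteSpace E' := FiniteDimensional.complete ℝ E'
  set q := f p with hq
  have hinj : Function.Injective (vderiv I (extChartAt I q) q) := fun a b hab => by
    rw [← mfderiv_symm_comp_mfderiv_extChartAt (mem_extChartAt_source (I := I) q) a,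
      ← mfderiv_symm_comp_mfderiv_extChartAt (mem_extChartAt_source (I := I) q) b]
    exact congrArg _ hab
  refine hinj ((SeparatingDual.eq_iff_forall_dual_eq (R := ℝ) (V := E)).2 fun ℓ => ?_)
  let α : OneForm I N := fun x => ℓ.comp (vderiv I (extChartAt I q) x)
  have hchart : formInChart α q =ᶠ[nhds (extChartAt I q q)] fun _ => ℓ := by
    filter_upwards [(isOpen_extChartAt_target (I := I) q).mem_nhds (mem_extChartAt_target q)]
      with y hy
    ext v
    exact congrArg ℓ (mfderiv_comp_mfderiv_symm_extChartAt hy v)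
  have hα : DifferentiableAt ℝ (formInChart α q) (extChartAt I q q) :=
    (differentiableAt_const ℓ).congr_of_eventuallyEq hchart
  have hd : ∀ {Z : ∀ p : N, TangentSpace I p}, SmoothFieldAt Z q →
      MDifferentiableAt I 𝓘(ℝ, ℝ) (fun x => α x (Z x)) q := by
    intro Z hZ
    have h1 := contMDiffAt_vderiv (contMDiffAt_extChartAt (I := I) (n := ∞) (x := q)) Z hZ
    exact (ℓ.contDiff.contMDiff.contMDiffAt.comp q h1).mdifferentiableAt (n := ∞) (by simp)
  have hpd : DifferentiableAt ℝ (formInChart (pullbackForm I' f α) p) (extChartAt I' p p) := by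
    refine DifferentiableAt.congr_of_eventuallyEq ?_
      (formInChart_pullbackForm α hf (mem_extChartAt_source q))
    have hgs := contDiffAt_mapInChart (I := I) (I' := I') hf (mem_extChartAt_source q)
    have h0 : mapInChart I I' f p q (extChartAt I' p p) = extChartAt I q q := by
      simp [mapInChart, hq]
    have h1 : DifferentiableAt ℝ (formInChart α q) (mapInChart I I' f p q (extChartAt I' p p)) := by
      rw [h0]; exact hα
    exact DifferentiableAt.clm_comp (h1.comp _ (hgs.differentiableAt (by simp)))
      ((hgs.fderiv_right (m := 1) two_le_infty).differentiableAt (by simp))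
  have hrel : ∀ {Z : ∀ p : N', TangentSpace I' p} {Z' : ∀ p : N, TangentSpace I p},
      SmoothFieldAt Z' q → (∀ᶠ x in nhds p, mfderiv I' I f x (Z x) = Z' (f x)) →
      ∀ v, vderiv I' (fun x => pullbackForm I' f α x (Z x)) p v =
        vderiv I (fun x => α x (Z' x)) q (mfderiv I' I f p v) := by
    intro Z Z' hZ' hr v
    have h1 : (fun x => pullbackForm I' f α x (Z x)) =ᶠ[nhds p] (fun x => α x (Z' x)) ∘ f := by
      filter_upwards [hr] with x hx
      exact congrArg (α (f x)) hx
    rw [vderiv_congr h1, vderiv, mfderiv_comp p (hd hZ') (hf.mdifferentiableAt (by simp))]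
    rfl
  have h1 := extD_pullbackForm_of_differentiableAt hf hα (X p) (Y p)
  rw [ContactBundle.extD_eq_lieBracket hpd hX.mdifferentiableAt hY.mdifferentiableAt,
    hXX'.self_of_nhds, hYY'.self_of_nhds,
    ContactBundle.extD_eq_lieBracket hα hX'.mdifferentiableAt hY'.mdifferentiableAt,
    hrel hY' hYY', hrel hX' hXX', hXX'.self_of_nhds, hYY'.self_of_nhds] at h1
  exact sub_right_injective h1

end Cartan

section FormAlgebra

variable {E : Type*} [NormedAddCommGroup E] [NormedSpace ℝ E] [FiniteDimensional ℝ E]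
  {H : Type*} [TopologicalSpace H] {I : ModelWithCorners ℝ E H} [I.Boundaryless]
  {N : Type*} [TopologicalSpace N] [ChartedSpace H N] [IsManifold I ∞ N]
  {F : Type*} [NormedAddCommGroup F] [NormedSpace ℝ F]

lemma SmoothForm.differentiableAt_formInChart {α : OneForm I N} (hα : SmoothForm α) (p : N) :
    DifferentiableAt ℝ (formInChart α p) (extChartAt I p p) :=
  (hα.contDiffAt_formInChart (mem_extChartAt_target _)).differentiableAt (by simp)

lemma contMDiff_snd_tangentMap {f : N → F} (hf : ContMDiff I 𝓘(ℝ, F) ∞ f) :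
    ContMDiff I.tangent 𝓘(ℝ, F) ∞ (fun v : TangentBundle I N => vderiv I f v.proj v.snd) :=
  (contMDiff_snd_tangentBundle_modelSpace F 𝓘(ℝ, F)).comp
    (hf.contMDiff_tangentMap (m := ∞) (by simp))

lemma contMDiff_tangentBundle_proj :
    ContMDiff I.tangent I ∞ (fun v : TangentBundle I N => v.proj) :=
  Bundle.contMDiff_proj (TangentSpace I : N → Type _)

lemma SmoothForm.add {α β : OneForm I N} (hα : SmoothForm α) (hβ : SmoothForm β) :
    SmoothForm (fun p => α p + β p) :=
  ContMDiff.add hα hβ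

lemma SmoothForm.smul {α : OneForm I N} {f : N → ℝ} (hf : ContMDiff I 𝓘(ℝ, ℝ) ∞ f)
    (hα : SmoothForm α) : SmoothForm (fun p => f p • α p) :=
  ContMDiff.mul (hf.comp contMDiff_tangentBundle_proj) hα

lemma SmoothForm.pullbackForm {E' : Type*} [NormedAddCommGroup E'] [NormedSpace ℝ E']
    {H' : Type*} [TopologicalSpace H'] {I' : ModelWithCorners ℝ E' H'}
    {N' : Type*} [TopologicalSpace N'] [ChartedSpace H' N'] [IsManifold I' ∞ N']
    {α : OneForm I N} (hα : SmoothForm α) {f : N' → N} (hf : ContMDiff I' I ∞ f) :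
    SmoothForm (ContactBundle.pullbackForm I' f α) :=
  ContMDiff.comp (g := fun v : TangentBundle I N => α v.proj v.snd) hα
    (hf.contMDiff_tangentMap (m := ∞) (by simp))

lemma extD_add {α β : OneForm I N} (hα : SmoothForm α) (hβ : SmoothForm β) (p : N)
    (v w : TangentSpace I p) :
    extD (fun p => α p + β p) p v w = extD α p v w + extD β p v w := by
  have h : formInChart (fun p => α p + β p) p = formInChart α p + formInChart β p := by
    ext y u; rfl
  have h2 := ((hα.differentiableAt_formInChart p).hasFDerivAt.add
    (hβ.differentiableAt_formInChart p).hasFDerivAt).fderiv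
  rw [extD_apply, h, h2, extD_apply, extD_apply]
  simp only [add_apply]
  ring

lemma extD_smul {α : OneForm I N} {f : N → ℝ} {p : N} (hf : ContMDiffAt I 𝓘(ℝ, ℝ) ∞ f p)
    (hα : SmoothForm α) (v w : TangentSpace I p) :
    extD (fun p => f p • α p) p v w =
      f p * extD α p v w + vderiv I f p v * α p w - vderiv I f p w * α p v := by
  have h : formInChart (fun p => f p • α p) p =
      (f ∘ (extChartAt I p).symm) • formInChart α p := by
    ext y u; rfl
  have hf' : DifferentiableAt ℝ (f ∘ (extChartAt I p).symm) (extChartAt I p p) :=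
    (contMDiffAt_comp_extChartAt_symm hf).differentiableAt (by simp)
  have h2 := (hf'.hasFDerivAt.smul (hα.differentiableAt_formInChart p).hasFDerivAt).fderiv
  rw [extD_apply, h, h2, extD_apply, vderiv_eq_fderiv_chart hf', vderiv_eq_fderiv_chart hf',
    ← formInChart_apply_mfderiv α (mem_extChartAt_source p) v,
    ← formInChart_apply_mfderiv α (mem_extChartAt_source p) w]
  simp only [add_apply, smul_apply, ContinuousLinearMap.smulRight_apply, Function.comp_apply,
    extChartAt_to_inv, smul_eq_mul]
  ring

/-- Any tangent vector extends to a smooth vector field near the point. -/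
lemma exists_smoothFieldAt_nhds {p : N} (z : TangentSpace I p) :
    ∃ Z : ∀ p : N, TangentSpace I p, Z p = z ∧ ∀ᶠ q in nhds p, SmoothFieldAt Z q := by
  obtain ⟨v, hv⟩ := exists_localField_eq (I := I) p z
  refine ⟨localField p fun _ => v, hv, ?_⟩
  filter_upwards [(trivializationAt E (TangentSpace I : N → Type _) p).open_baseSet.mem_nhds
    (mem_baseSet_trivializationAt_self p)] with q hq
  exact smoothFieldAt_localField hq contMDiffAt_const

/-- The germ of a smooth vector field extends to a smooth vector field. -/
lemma exists_smoothField_eventuallyEq [T2Space N] [SigmaCompactSpace N] {p : N}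
    {Z : ∀ p : N, TangentSpace I p} (hs : ∀ᶠ q in nhds p, SmoothFieldAt Z q) :
    ∃ Z' : ∀ p : N, TangentSpace I p, SmoothField Z' ∧ ∀ᶠ q in nhds p, Z' q = Z q := by
  obtain ⟨V, hV, hVo, hp⟩ := mem_nhds_iff.1 hs
  obtain ⟨f, hf⟩ : ∃ f : C^∞⟮I, N; 𝓘(ℝ, ℝ), ℝ⟯, (∀ᶠ q in nhds p, f q = 1) ∧
      ∀ᶠ q in nhdsSet Vᶜ, f q = 0 := by
    have : LocallyCompactSpace N := Manifold.locallyCompact_of_finiteDimensional I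
    have : ParacompactSpace N := inferInstance
    have : NormalSpace N := inferInstance
    obtain ⟨f, h0, h1, -⟩ := exists_contMDiffMap_zero_one_nhds_of_isClosed I (n := ⊤)
      (s := Vᶜ) (t := {p}) hVo.isClosed_compl isClosed_singleton (by simpa using hp)
    exact ⟨f, by rwa [nhdsSet_singleton] at h1, h0⟩
  refine ⟨fun q => f q • Z q, fun q => ?_, hf.1.mono fun q hq => by simp [hq]⟩
  by_cases hq : q ∈ V
  · exact SmoothFieldAt.smul (f.contMDiff q) (hV hq)
  · have h0 : SmoothFieldAt (fun q => (0 : ℝ) • localField (I := I) p (fun _ => (0 : E)) q) q := by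
      have : SmoothFieldAt (fun q => (0 : TangentSpace I q)) q :=
        Bundle.contMDiff_zeroSection ℝ (TangentSpace I : N → Type _) q
      simpa using this
    refine h0.congr ?_
    filter_upwards [(Filter.eventually_of_mem (mem_nhdsSet_iff_forall.1 hf.2 q hq)
      fun _ h => h)] with x hx
    have hx' : f x = 0 := hx
    simp [hx']

/-- Any tangent vector extends to a smooth vector field. -/
lemma exists_smoothField_eq [T2Space N] [SigmaCompactSpace N] {p : N} (z : TangentSpace I p) :
    ∃ Z : ∀ p : N, TangentSpace I p, SmoothField Z ∧ Z p = z := by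
  obtain ⟨Z, hZ, hs⟩ := exists_smoothFieldAt_nhds z
  obtain ⟨Z', hZ', h⟩ := exists_smoothField_eventuallyEq hs
  exact ⟨Z', hZ', h.self_of_nhds.trans hZ⟩

end FormAlgebra

section Angular

variable {E : Type*} [NormedAddCommGroup E] [NormedSpace ℝ E] [FiniteDimensional ℝ E]
  {H : Type*} [TopologicalSpace H] {I : ModelWithCorners ℝ E H} [I.Boundaryless]
  {N : Type*} [TopologicalSpace N] [ChartedSpace H N] [IsManifold I ∞ N]

lemma angularForm_apply (f : N → Circle) (p : N) (v : TangentSpace I p) :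
    angularForm I f p v =
      (conj (f p : ℂ) * vderiv I (fun q => (f q : ℂ)) p v).im := rfl

lemma contMDiff_circle_coe : ContMDiff (𝓡 1) 𝓘(ℝ, ℂ) ∞ (fun z : Circle => (z : ℂ)) := by
  have : Fact (finrank ℝ ℂ = 1 + 1) := Complex.finrank_real_complex_fact
  exact contMDiff_coe_sphere

lemma smoothForm_angularForm {f : N → Circle} (hf : ContMDiff I 𝓘(ℝ, ℂ) ∞ (fun q => (f q : ℂ))) :
    SmoothForm (angularForm I f) := by
  have h1 := contMDiff_snd_tangentMap hf
  have h2 := hf.comp (contMDiff_tangentBundle_proj (I := I) (N := N))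
  have h3 : ContMDiff I.tangent 𝓘(ℝ, ℂ) ∞
      (fun v : TangentBundle I N => conj (f v.proj : ℂ)) :=
    Complex.conjCLE.contDiff.contMDiff.comp h2
  exact Complex.imCLM.contDiff.contMDiff.comp
    ((contDiff_fst.mul contDiff_snd).contMDiff.comp (h3.prodMk_space h1))

lemma extD_angularForm {f : N → Circle} (hf : ContMDiff I 𝓘(ℝ, ℂ) ∞ (fun q => (f q : ℂ))) (p : N)
    (v w : TangentSpace I p) : extD (angularForm I f) p v w = 0 := by
  let κ : OneForm 𝓘(ℝ, ℂ) ℂ := fun z =>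
    Complex.imCLM.comp (ContinuousLinearMap.mul ℝ ℂ (conj z))
  let B : ℂ →L[ℝ] ℂ →L[ℝ] ℝ := (ContinuousLinearMap.compL ℝ ℂ ℂ ℝ Complex.imCLM).comp
    ((ContinuousLinearMap.mul ℝ ℂ).comp (Complex.conjCLE : ℂ →L[ℝ] ℂ))
  have hκ : ∀ q, formInChart κ q = B := by
    intro q; ext z u
    simp only [formInChart]
    have : mfderiv 𝓘(ℝ, ℂ) 𝓘(ℝ, ℂ) (extChartAt 𝓘(ℝ, ℂ) q).symm z = ContinuousLinearMap.id ℝ ℂ := by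
      simp only [mfld_simps]; exact mfderiv_id
    rw [this]; rfl
  have h0 : angularForm I f = pullbackForm I (fun q => (f q : ℂ)) κ := rfl
  have hd : ∀ v : TangentSpace I p,
      (conj (f p : ℂ) * vderiv I (fun q => (f q : ℂ)) p v).re = 0 := by
    intro v
    have h1 : vderiv I (fun q => ‖(f q : ℂ)‖ ^ 2) p v = 0 := by
      simp only [Circle.norm_coe]; exact vderiv_const _ _ _
    have h2 := (hasStrictFDerivAt_norm_sq (f p : ℂ)).hasFDerivAt
    rw [vderiv_comp (f := fun q => (f q : ℂ)) (g := fun z => ‖z‖ ^ 2) h2.differentiableAt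
      ((hf p).mdifferentiableAt (by simp)), h2.fderiv] at h1
    simp only [smul_apply, innerSL_apply_apply, Complex.inner, nsmul_eq_mul] at h1
    rw [mul_comm]
    simpa using h1
  rw [h0, extD_pullbackForm_of_differentiableAt (hf p) (by rw [hκ]; exact B.differentiableAt)]
  rw [extD, hκ, B.fderiv]
  set a := vderiv I (fun q => (f q : ℂ)) p v with ha
  set b := vderiv I (fun q => (f q : ℂ)) p w with hb
  have e1 : ∀ (q : ℂ), mfderiv 𝓘(ℝ, ℂ) 𝓘(ℝ, ℂ) (extChartAt 𝓘(ℝ, ℂ) q) q =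
      ContinuousLinearMap.id ℝ ℂ := by
    intro q; simp only [mfld_simps]; exact mfderiv_id
  rw [e1]
  change (conj a * b).im - (conj b * a).im = 0
  have h1 := hd v
  have h2 := hd w
  rw [← ha] at h1
  rw [← hb] at h2
  have h3 : Complex.normSq (f p : ℂ) = 1 := Circle.normSq_coe _
  have key : (conj a * b).im = 0 := by
    have : (conj a * b) = conj (conj (f p : ℂ) * a) *
        (conj (f p : ℂ) * b) := by
      have h4 : (f p : ℂ) * conj (f p : ℂ) = 1 := by
        rw [Complex.mul_conj, h3]; simp
      rw [map_mul, Complex.conj_conj]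
      linear_combination (- conj a * b) * h4
    rw [this, Complex.mul_im, Complex.conj_re, Complex.conj_im, h1, h2]; ring
  have key2 : (conj b * a).im = -(conj a * b).im := by
    simp only [Complex.mul_im, Complex.conj_re, Complex.conj_im]; ring
  rw [key2, key]; ring

/-- The angular form of a smooth nonvanishing function. -/
lemma angularForm_of_polar {f : N → Circle} {Φ : N → ℂ} {p : N}
    (hΦ : ContMDiffAt I 𝓘(ℝ, ℂ) ∞ Φ p) (h0 : Φ p ≠ 0)
    (hf : ∀ᶠ q in nhds p, Φ q = ‖Φ q‖ * (f q : ℂ)) (v : TangentSpace I p) :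
    angularForm I f p v = (conj (Φ p) * vderiv I Φ p v).im / ‖Φ p‖ ^ 2 := by
  have hn : 0 < ‖Φ p‖ := norm_pos_iff.2 h0
  have hev : ∀ᶠ q in nhds p, (f q : ℂ) = ‖Φ q‖⁻¹ • Φ q := by
    filter_upwards [hf, hΦ.continuousAt.eventually_ne h0] with q hq hq0
    have : (‖Φ q‖ : ℂ) ≠ 0 := by exact_mod_cast (norm_pos_iff.2 hq0).ne'
    rw [Complex.real_smul, Complex.ofReal_inv, eq_inv_mul_iff_mul_eq₀ this]
    exact hq.symm
  have hg : DifferentiableAt ℝ (fun z : ℂ => ‖z‖⁻¹) (Φ p) :=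
    ((contDiffAt_norm ℝ h0 (n := 1)).differentiableAt (by simp)).inv hn.ne'
  have hd : HasFDerivAt (fun z : ℂ => ‖z‖⁻¹ • z)
      (‖Φ p‖⁻¹ • ContinuousLinearMap.id ℝ ℂ +
        (fderiv ℝ (fun z : ℂ => ‖z‖⁻¹) (Φ p)).smulRight (Φ p)) (Φ p) :=
    hg.hasFDerivAt.smul (hasFDerivAt_id _)
  rw [angularForm_apply, vderiv_congr hev,
    vderiv_comp hd.differentiableAt (hΦ.mdifferentiableAt (by simp)), hd.fderiv, hev.self_of_nhds]
  set a := vderiv I Φ p v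
  simp only [add_apply, smul_apply, ContinuousLinearMap.id_apply,
    ContinuousLinearMap.smulRight_apply]
  set c := fderiv ℝ (fun z : ℂ => ‖z‖⁻¹) (Φ p) a
  simp only [Complex.real_smul, map_mul, Complex.conj_ofReal, Complex.mul_im, Complex.mul_re,
    Complex.add_im, Complex.add_re, Complex.ofReal_re, Complex.ofReal_im, Complex.conj_re,
    Complex.conj_im]
  field_simp
  ring

end Angular

section Superposition

variable {K : Type*} [TopologicalSpace K] [CompactSpace K]
  {E : Type*} [NormedAddCommGroup E] [NormedSpace ℝ E]

/-- Pointwise application of a continuous family of linear maps. -/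
def pointwiseApply {G : Type*} [NormedAddCommGroup G] [NormedSpace ℝ G] :
    C(K, E →L[ℝ] G) →L[ℝ] C(K, E) →L[ℝ] C(K, G) :=
  LinearMap.mkContinuous₂
    (LinearMap.mk₂ ℝ (fun (A : C(K, E →L[ℝ] G)) (h : C(K, E)) =>
        (⟨fun s => A s (h s), A.continuous.clm_apply h.continuous⟩ : C(K, G)))
      (fun _ _ _ => by ext; simp) (fun _ _ _ => by ext; simp)
      (fun _ _ _ => by ext; simp) (fun _ _ _ => by ext; simp)) 1
    (fun A h => by
      rw [one_mul]
      refine (ContinuousMap.norm_le _ (by positivity)).2 fun s => ?_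
      exact (A s).le_of_opNorm_le_of_le (A.norm_coe_le_norm s) (h.norm_coe_le_norm s))

lemma hasFDerivAt_superposition {G : Type*} [NormedAddCommGroup G] [NormedSpace ℝ G] {g : C(E, G)}
    {g' : C(E, E →L[ℝ] G)} (hg : ∀ x, HasFDerivAt g (g' x) x) (γ : C(K, E)) :
    HasFDerivAt (fun γ : C(K, E) => g.comp γ) (pointwiseApply (g'.comp γ)) γ := by
  rw [hasFDerivAt_iff_isLittleO_nhds_zero, Asymptotics.isLittleO_iff]
  intro c hc
  have hcont : Continuous (fun γ' : C(K, E) => g'.comp γ') :=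
    ContinuousMap.continuous_postcomp (X := K) g'
  obtain ⟨δ, hδ, hb⟩ := (Metric.continuous_iff (α := C(K, E)) (β := C(K, E →L[ℝ] G))).1 hcont γ c hc
  filter_upwards [Metric.ball_mem_nhds (0 : C(K, E)) hδ] with h hh
  have hh' : ‖h‖ < δ := by simpa using hh
  refine (ContinuousMap.norm_le _ (by positivity)).2 fun s => ?_
  have hmv := (convex_segment (γ s) (γ s + h s)).norm_image_sub_le_of_norm_hasFDerivWithin_le'
    (f := g) (f' := g') (φ := g' (γ s)) (C := c) (fun x _ => (hg x).hasFDerivWithinAt) ?_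
    (left_mem_segment ℝ _ _) (right_mem_segment ℝ _ _)
  · have e1 : (g.comp (γ + h) - g.comp γ - pointwiseApply (g'.comp γ) h) s =
        g (γ s + h s) - g (γ s) - g' (γ s) (γ s + h s - γ s) := by
      rw [add_sub_cancel_left]; rfl
    rw [e1]
    refine hmv.trans ?_
    rw [add_sub_cancel_left]
    exact mul_le_mul_of_nonneg_left (h.norm_coe_le_norm s) hc.le
  · intro x hx
    rw [segment_eq_image', add_sub_cancel_left] at hx
    obtain ⟨θ, hθ, rfl⟩ := hx
    have hd : dist (γ + θ • h) γ < δ := by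
      rw [dist_eq_norm, add_sub_cancel_left, norm_smul, Real.norm_of_nonneg hθ.1]
      exact (mul_le_of_le_one_left (norm_nonneg _) hθ.2).trans_lt hh'
    have h2 := (hb _ hd).le
    rw [← dist_eq_norm]
    exact (ContinuousMap.dist_apply_le_dist (f := g'.comp (γ + θ • h)) (g := g'.comp γ) s).trans h2

/-- The superposition operator of a smooth map is smooth. -/
theorem contDiff_superposition.{u, v} {K : Type v} [TopologicalSpace K] [CompactSpace K]
    {E : Type u} [NormedAddCommGroup E] [NormedSpace ℝ E] (n : ℕ) :
    ∀ {G : Type u} [NormedAddCommGroup G] [NormedSpace ℝ G] (g : C(E, G)),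
      ContDiff ℝ ∞ g → ContDiff ℝ n (fun γ : C(K, E) => g.comp γ) := by
  induction n with
  | zero =>
    intro G _ _ g _
    exact contDiff_zero.2 (ContinuousMap.continuous_postcomp (X := K) g)
  | succ n ih =>
    intro G _ _ g hg
    have hg' : ContDiff ℝ ∞ (fderiv ℝ g) := hg.fderiv_right (by simp)
    let g' : C(E, E →L[ℝ] G) := ⟨fderiv ℝ g, hg'.continuous⟩
    have h := (pointwiseApply (K := K) (E := E) (G := G)).contDiff.comp (ih g' hg')
    have h1 : ContDiff ℝ ((n : WithTop ℕ∞) + 1) (fun γ : C(K, E) => g.comp γ) :=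
      contDiff_succ_iff_hasFDerivAt.2 ⟨_, h, fun γ =>
        hasFDerivAt_superposition (g' := g')
          (fun x => (hg.differentiable (by simp) x).hasFDerivAt) γ⟩
    exact_mod_cast h1

end Superposition

section LocalFlow

variable {E : Type*} [NormedAddCommGroup E] [NormedSpace ℝ E]

lemma neg_one_le_one' : (-1 : ℝ) ≤ 1 := by norm_num

/-- Extension of a path on `[-1, 1]` to the line. -/
def extendPath (γ : C(Icc (-1 : ℝ) 1, E)) (s : ℝ) : E := γ (projIcc (-1) 1 neg_one_le_one' s)

lemma continuous_extendPath (γ : C(Icc (-1 : ℝ) 1, E)) : Continuous (extendPath γ) :=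
  γ.continuous.comp continuous_projIcc

/-- Integration of paths on `[-1, 1]`, from `0`. -/
def integralOperator (E : Type*) [NormedAddCommGroup E] [NormedSpace ℝ E] :
    C(Icc (-1 : ℝ) 1, E) →L[ℝ] C(Icc (-1 : ℝ) 1, E) :=
  LinearMap.mkContinuous
    { toFun := fun γ => ⟨fun s => ∫ r in (0 : ℝ)..s, extendPath γ r,
        (intervalIntegral.continuous_primitive
          (fun a b => (continuous_extendPath γ).intervalIntegrable a b) 0).comp
          continuous_subtype_val⟩
      map_add' := fun γ γ' => by
        ext s
        exact intervalIntegral.integral_add ((continuous_extendPath γ).intervalIntegrable _ _)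
          ((continuous_extendPath γ').intervalIntegrable _ _)
      map_smul' := fun c γ => by
        ext s
        exact intervalIntegral.integral_smul c _ } 1
    (fun γ => by
      refine (ContinuousMap.norm_le _ (by positivity)).2 fun s => ?_
      have h := intervalIntegral.norm_integral_le_of_norm_le_const (a := (0 : ℝ)) (b := s)
        (f := extendPath γ) (C := ‖γ‖) (fun r _ => γ.norm_coe_le_norm _)
      refine h.trans ?_
      rw [one_mul, sub_zero]
      exact mul_le_of_le_one_right (norm_nonneg _) (abs_le.2 s.2))

/-- Smooth dependence on initial value and time scale of solutions of `γ' = ε g(γ)`. -/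
theorem exists_smooth_local_solution [CompleteSpace E] {g : E → E} (hg : ContDiff ℝ ∞ g) (x₀ : E) :
    ∃ Γ : E × ℝ → C(Icc (-1 : ℝ) 1, E), ContDiffAt ℝ ∞ Γ (x₀, 0) ∧
      Γ (x₀, 0) = ContinuousMap.const _ x₀ ∧
      ∀ᶠ q in nhds (x₀, (0 : ℝ)), extendPath (Γ q) 0 = q.1 ∧
        ∀ s ∈ Ioo (-1 : ℝ) 1,
          HasDerivAt (extendPath (Γ q)) (q.2 • g (extendPath (Γ q) s)) s := by
  let gc : C(E, E) := ⟨g, hg.continuous⟩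
  have hN : ContDiff ℝ ∞ (fun γ : C(Icc (-1 : ℝ) 1, E) => gc.comp γ) :=
    contDiff_infty.2 fun n => contDiff_superposition n gc hg
  let cst : E →L[ℝ] C(Icc (-1 : ℝ) 1, E) :=
    LinearMap.mkContinuous
      { toFun := fun x => ContinuousMap.const _ x
        map_add' := fun _ _ => rfl
        map_smul' := fun _ _ => rfl } 1
      (fun x => (ContinuousMap.norm_le _ (by positivity)).2 fun s => (one_mul ‖x‖).ge)
  let f : (E × ℝ) × C(Icc (-1 : ℝ) 1, E) → C(Icc (-1 : ℝ) 1, E) := fun z =>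
    z.2 - cst z.1.1 - z.1.2 • integralOperator E (gc.comp z.2)
  have hf : ContDiff ℝ ∞ f :=
    (contDiff_snd.sub (cst.contDiff.comp (contDiff_fst.comp contDiff_fst))).sub
      ((contDiff_snd.comp contDiff_fst).smul
        ((integralOperator E).contDiff.comp (hN.comp contDiff_snd)))
  set u : (E × ℝ) × C(Icc (-1 : ℝ) 1, E) := ((x₀, 0), cst x₀) with hu
  have hfu : f u = 0 := by simp [f, hu]
  have hpart : fderiv ℝ f u ∘L .inr ℝ (E × ℝ) C(Icc (-1 : ℝ) 1, E) =
      ContinuousLinearMap.id ℝ _ := by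
    have h1 : HasFDerivAt (f ∘ fun γ => ((x₀, (0 : ℝ)), γ))
        (fderiv ℝ f u ∘L .inr ℝ (E × ℝ) C(Icc (-1 : ℝ) 1, E)) (cst x₀) :=
      ((hf.differentiable (by simp) u).hasFDerivAt).comp (cst x₀) (hasFDerivAt_prodMk_right _ _)
    have h2 : HasFDerivAt (f ∘ fun γ => ((x₀, (0 : ℝ)), γ)) (ContinuousLinearMap.id ℝ _)
        (cst x₀) := by
      have : (f ∘ fun γ => ((x₀, (0 : ℝ)), γ)) = fun γ => γ - cst x₀ := by
        funext γ; simp [f]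
      rw [this]
      exact (hasFDerivAt_id _).sub_const _
    exact h1.unique h2
  have hinv : (fderiv ℝ f u ∘L .inr ℝ (E × ℝ) C(Icc (-1 : ℝ) 1, E)).IsInvertible := by
    rw [hpart]; exact ⟨ContinuousLinearEquiv.refl ℝ _, rfl⟩
  have hfa : ContDiffAt ℝ ∞ f u := hf.contDiffAt
  refine ⟨hfa.implicitFunction (by simp) hinv, hfa.contDiffAt_implicitFunction (by simp) hinv,
    hfa.implicitFunction_apply_self (by simp) hinv, ?_⟩
  filter_upwards [hfa.eventually_apply_implicitFunction (by simp) hinv] with q hq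
  set γ := hfa.implicitFunction (by simp) hinv q with hγ
  rw [hfu] at hq
  have hcont : Continuous (extendPath (gc.comp γ)) := continuous_extendPath _
  have hsol : ∀ s ∈ Icc (-1 : ℝ) 1,
      extendPath γ s = q.1 + q.2 • ∫ r in (0 : ℝ)..s, extendPath (gc.comp γ) r := by
    intro s hs
    have h1 : f (q, γ) ⟨s, hs⟩ = 0 := by rw [hq]; rfl
    have h2 : γ ⟨s, hs⟩ - q.1 - q.2 • ∫ r in (0 : ℝ)..s, extendPath (gc.comp γ) r = 0 := h1
    rw [extendPath, projIcc_of_mem _ hs]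
    rw [sub_sub, sub_eq_zero] at h2
    exact h2
  refine ⟨by rw [hsol 0 (by norm_num)]; simp, fun s hs => ?_⟩
  have h1 : HasDerivAt (fun s => q.1 + q.2 • ∫ r in (0 : ℝ)..s, extendPath (gc.comp γ) r)
      (q.2 • extendPath (gc.comp γ) s) s :=
    ((intervalIntegral.integral_hasDerivAt_right (hcont.intervalIntegrable _ _)
      (hcont.stronglyMeasurableAtFilter _ _) hcont.continuousAt).const_smul q.2).const_add q.1
  refine h1.congr_of_eventuallyEq ?_
  filter_upwards [Icc_mem_nhds hs.1 hs.2] with r hr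
  exact hsol r hr

end LocalFlow

section Flow

variable {E : Type*} [NormedAddCommGroup E] [NormedSpace ℝ E] [FiniteDimensional ℝ E]
  {H : Type*} [TopologicalSpace H] {I : ModelWithCorners ℝ E H} [I.Boundaryless]
  {N : Type*} [TopologicalSpace N] [ChartedSpace H N] [IsManifold I ∞ N]

lemma SmoothField.contMDiff_one {X : ∀ p : N, TangentSpace I p} (hX : SmoothField X) :
    ContMDiff I I.tangent 1 (fun p => (⟨p, X p⟩ : TangentBundle I N)) :=
  ContMDiff.of_le hX (by simp)

lemma SmoothField.const_smul {X : ∀ p : N, TangentSpace I p} (hX : SmoothField X) (c : ℝ) :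
    SmoothField (c • X) := fun p =>
  SmoothFieldAt.smul (f := fun _ => c) contMDiffAt_const (hX.smoothFieldAt p)

lemma mfderiv_symm_comp_vderiv {q p : N} (hp : p ∈ (extChartAt I q).source) {y : E}
    (hy : extChartAt I q p = y) (v : TangentSpace I p) :
    mfderiv 𝓘(ℝ, E) I (extChartAt I q).symm y (vderiv I (extChartAt I q) p v) = v := by
  subst hy; exact mfderiv_symm_comp_mfderiv_extChartAt hp v

/-- Local integral curves of a smooth field, with smooth dependence on the initial point and on
the time scale. -/
theorem exists_local_flow {X : ∀ p : N, TangentSpace I p} (hX : SmoothField X) (p₀ : N) :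
    ∃ Θ : ℝ × N → N, ContMDiffAt (𝓘(ℝ, ℝ).prod I) I ∞ Θ (0, p₀) ∧
      ∀ᶠ q in nhds ((0 : ℝ), p₀), ∃ c : ℝ → N, c 0 = q.2 ∧ c (1 / 2) = Θ q ∧
        IsMIntegralCurveOn c (q.1 • X) (Ioo (-1) 1) := by
  have : CompleteSpace E := FiniteDimensional.complete ℝ E
  set φ := extChartAt I p₀ with hφ
  set y₀ := φ p₀ with hy₀
  have ht : φ.target ∈ nhds y₀ := (isOpen_extChartAt_target p₀).mem_nhds (mem_extChartAt_target p₀)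
  obtain ⟨r, hr, hball⟩ := Metric.nhds_basis_closedBall.mem_iff.1 ht
  let b : ContDiffBump y₀ := ⟨r / 2, r, by positivity, by linarith⟩
  let X' : E → E := fun y => vderiv I φ (φ.symm y) (X (φ.symm y))
  have hX' : ∀ y ∈ φ.target, ContDiffAt ℝ ∞ X' y := by
    intro y hy
    rw [← contMDiffAt_iff_contDiffAt]
    have h1 := contMDiffAt_vderiv (contMDiffAt_extChartAt_of_mem (I := I) (φ.map_target hy)) X
      (hX.smoothFieldAt _)
    exact h1.comp y (contMDiffAt_extChartAt_symm_of_mem hy)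
  let g : E → E := fun y => b y • X' y
  have hg : ContDiff ℝ ∞ g := by
    rw [contDiff_iff_contDiffAt]
    intro y
    by_cases hy : y ∈ φ.target
    · exact (b.contDiff.contDiffAt).smul (hX' y hy)
    · have hev : g =ᶠ[nhds y] fun _ => 0 := by
        have hyo : y ∈ (Metric.closedBall y₀ r)ᶜ := fun h => hy (hball h)
        filter_upwards [Metric.isClosed_closedBall.isOpen_compl.mem_nhds hyo] with z hz
        have : b z = 0 := b.zero_of_le_dist (by
          simp only [mem_compl_iff, Metric.mem_closedBall, not_le] at hz; exact hz.le)
        simp [g, this]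
      exact contDiffAt_const.congr_of_eventuallyEq hev
  obtain ⟨Γ, hΓ, hΓ0, hsol⟩ := exists_smooth_local_solution hg y₀
  have hhalf : (1 / 2 : ℝ) ∈ Icc (-1 : ℝ) 1 := by norm_num
  let ev : C(Icc (-1 : ℝ) 1, E) →L[ℝ] E := ContinuousMap.evalCLM ℝ ⟨1 / 2, hhalf⟩
  have hev : ∀ γ, ev γ = extendPath γ (1 / 2) := fun γ => by
    rw [extendPath, projIcc_of_mem _ hhalf]; rfl
  have hswap : ContMDiffAt (𝓘(ℝ, ℝ).prod I) 𝓘(ℝ, E × ℝ) ∞ (fun q : ℝ × N => (φ q.2, q.1)) (0, p₀) :=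
    ((contMDiffAt_extChartAt (x := p₀)).comp _ contMDiffAt_snd).prodMk_space contMDiffAt_fst
  refine ⟨fun q => φ.symm (ev (Γ (φ q.2, q.1))), ?_, ?_⟩
  · have h1 : ContMDiffAt (𝓘(ℝ, ℝ).prod I) 𝓘(ℝ, E) ∞ (fun q : ℝ × N => ev (Γ (φ q.2, q.1)))
        (0, p₀) :=
      ContMDiffAt.comp (g := fun x => ev (Γ x)) ((0 : ℝ), p₀)
        (ev.contDiff.contDiffAt.comp (φ p₀, (0 : ℝ)) hΓ).contMDiffAt hswap
    refine ContMDiffAt.comp ((0 : ℝ), p₀) ?_ h1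
    have : ev (Γ (φ p₀, 0)) = y₀ := by
      rw [← hy₀, hΓ0]; rfl
    rw [this]
    exact contMDiffAt_extChartAt_symm_of_mem (mem_extChartAt_target p₀)
  · have hcl : ∀ᶠ x in nhds (y₀, (0 : ℝ)), dist (Γ x) (ContinuousMap.const _ y₀) < r / 2 := by
      have := Metric.continuousAt_iff'.1 hΓ.continuousAt (r / 2) (by positivity)
      rwa [hΓ0] at this
    have hsrc : ∀ᶠ q in nhds ((0 : ℝ), p₀), q.2 ∈ φ.source :=
      continuousAt_snd.eventually (extChartAt_source_mem_nhds (I := I) p₀)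
    filter_upwards [hswap.continuousAt.eventually (hsol.and hcl), hsrc] with q ⟨⟨h0, hd⟩, hc⟩ hs
    set γ := Γ (φ q.2, q.1) with hγ
    have hmem : ∀ s, extendPath γ s ∈ Metric.ball y₀ (r / 2) := fun s =>
      (ContinuousMap.dist_apply_le_dist (f := γ) (g := ContinuousMap.const _ y₀) _).trans_lt hc
    have htar : ∀ s, extendPath γ s ∈ φ.target := fun s =>
      hball (Metric.ball_subset_closedBall (Metric.ball_subset_ball (by linarith) (hmem s)))
    refine ⟨fun s => φ.symm (extendPath γ s), ?_, by simp only [hev], ?_⟩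
    · simp only [h0]; exact φ.left_inv hs
    · intro s hs
      have hy := htar s
      have h1 : HasMFDerivAt 𝓘(ℝ, ℝ) 𝓘(ℝ, E) (extendPath γ) s
          (ContinuousLinearMap.toSpanSingleton ℝ (q.1 • g (extendPath γ s))) :=
        (hd s hs).hasFDerivAt.hasMFDerivAt
      have h2 : HasMFDerivAt 𝓘(ℝ, E) I φ.symm (extendPath γ s)
          (mfderiv 𝓘(ℝ, E) I φ.symm (extendPath γ s)) :=
        ((contMDiffAt_extChartAt_symm_of_mem hy).mdifferentiableAt (n := ∞)
          (by simp)).hasMFDerivAt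
      have h3 := HasMFDerivAt.comp s h2 h1
      have hb1 : b (extendPath γ s) = 1 := b.one_of_mem_closedBall
        (Metric.ball_subset_closedBall (hmem s))
      have h4 := mfderiv_symm_comp_vderiv (I := I) (φ.map_target hy) (φ.right_inv hy)
        (X (φ.symm (extendPath γ s)))
      have h5 : mfderiv 𝓘(ℝ, E) I φ.symm (extendPath γ s) (q.1 • g (extendPath γ s)) =
          q.1 • X (φ.symm (extendPath γ s)) := by
        refine (map_smul (mfderiv 𝓘(ℝ, E) I φ.symm (extendPath γ s)) q.1 _).trans ?_
        congr 1
        simp only [g, hb1, one_smul]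
        exact h4
      refine (h3.congr_mfderiv (ContinuousLinearMap.ext fun (r : ℝ) => ?_)).hasMFDerivWithinAt
      exact (map_smul (mfderiv 𝓘(ℝ, E) I φ.symm (extendPath γ s)) r
        (q.1 • g (extendPath γ s))).trans (congrArg (fun w => r • w) h5)

/-- A field with compact support is complete. -/
theorem exists_integralCurve_of_compact_support [T2Space N] {X : ∀ p : N, TangentSpace I p}
    (hX : SmoothField X) {K : Set N} (hK : IsCompact K) (h0 : ∀ p ∉ K, X p = 0) (p : N) :
    ∃ γ : ℝ → N, γ 0 = p ∧ IsMIntegralCurve γ X := by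
  have hunif : ∃ ε > 0, ∀ p ∈ K, ∃ γ : ℝ → N, γ 0 = p ∧ IsMIntegralCurveOn γ X (Ioo (-ε) ε) := by
    refine hK.induction_on (p := fun s => ∃ ε > 0, ∀ p ∈ s, ∃ γ : ℝ → N, γ 0 = p ∧
      IsMIntegralCurveOn γ X (Ioo (-ε) ε)) ⟨1, one_pos, by simp⟩ ?_ ?_ ?_
    · rintro s t hst ⟨ε, hε, h⟩
      exact ⟨ε, hε, fun p hp => h p (hst hp)⟩
    · rintro s t ⟨ε, hε, h⟩ ⟨δ, hδ, h'⟩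
      refine ⟨min ε δ, lt_min hε hδ, ?_⟩
      rintro p (hp | hp)
      · obtain ⟨γ, hγ, hγ'⟩ := h p hp
        exact ⟨γ, hγ, hγ'.mono (Ioo_subset_Ioo (neg_le_neg (min_le_left _ _)) (min_le_left _ _))⟩
      · obtain ⟨γ, hγ, hγ'⟩ := h' p hp
        exact ⟨γ, hγ, hγ'.mono (Ioo_subset_Ioo (neg_le_neg (min_le_right _ _)) (min_le_right _ _))⟩
    · intro p₀ _
      obtain ⟨Θ, -, hΘ⟩ := exists_local_flow hX p₀
      rw [nhds_prod_eq] at hΘ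
      obtain ⟨P, hP, Q, hQ, hPQ⟩ := Filter.eventually_prod_iff.1 hΘ
      obtain ⟨δ, hδ, hball⟩ := Metric.eventually_nhds_iff.1 hP
      refine ⟨{p | Q p}, mem_nhdsWithin_of_mem_nhds hQ, δ / 2, by positivity, fun p hp => ?_⟩
      obtain ⟨c, hc0, -, hc⟩ := hPQ (x := δ / 2) (hball (by
        rw [Real.dist_eq, sub_zero, abs_of_pos (by positivity)]; linarith)) hp
      refine ⟨c ∘ (· * (δ / 2)⁻¹), by simpa using hc0, ?_⟩
      have h1 := hc.comp_mul (δ / 2)⁻¹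
      have h2 : (δ / 2)⁻¹ • ((δ / 2) • X) = X := by
        rw [smul_smul, inv_mul_cancel₀ (by positivity), one_smul]
      rw [h2] at h1
      refine h1.mono fun t ht => ?_
      have h3 : 0 < δ / 2 := by positivity
      simp only [mem_ofPred_eq, mem_Ioo] at ht ⊢
      rw [← div_eq_mul_inv, lt_div_iff₀ h3, div_lt_iff₀ h3]
      constructor <;> linarith
  obtain ⟨ε, hε, h⟩ := hunif
  refine exists_isMIntegralCurve_of_isMIntegralCurveOn hX.contMDiff_one hε (fun p => ?_) p
  by_cases hp : p ∈ K
  · exact h p hp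
  · exact ⟨fun _ => p, rfl, (isMIntegralCurve_const (h0 p hp)).isMIntegralCurveOn _⟩

section Complete

variable [T2Space N] {X : ∀ p : N, TangentSpace I p} {σ : N → ℝ → N}

lemma flow_add (hX : SmoothField X) (h0 : ∀ p, σ p 0 = p) (hσ : ∀ p, IsMIntegralCurve (σ p) X)
    (p : N) (s t : ℝ) : σ (σ p s) t = σ p (t + s) := by
  have h := isMIntegralCurve_Ioo_eq_of_contMDiff_boundaryless (t₀ := 0) hX.contMDiff_one
    (hσ (σ p s)) ((hσ p).comp_add s) (by simp [h0])
  exact congrFun h t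

lemma contMDiffAt_flow_zero (hX : SmoothField X) (h0 : ∀ p, σ p 0 = p)
    (hσ : ∀ p, IsMIntegralCurve (σ p) X) (p₀ : N) :
    ContMDiffAt (𝓘(ℝ, ℝ).prod I) I ∞ (fun z : ℝ × N => σ z.2 z.1) (0, p₀) := by
  obtain ⟨Θ, hΘ, hc⟩ := exists_local_flow hX p₀
  have hs : ContMDiff (𝓘(ℝ, ℝ).prod I) (𝓘(ℝ, ℝ).prod I) ∞ (fun z : ℝ × N => (2 * z.1, z.2)) :=
    (ContMDiff.mul contMDiff_const contMDiff_fst).prodMk contMDiff_snd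
  have hz : (2 * ((0 : ℝ), p₀).1, ((0 : ℝ), p₀).2) = ((0 : ℝ), p₀) := by simp
  have h1 : ContMDiffAt (𝓘(ℝ, ℝ).prod I) I ∞ (Θ ∘ fun z : ℝ × N => (2 * z.1, z.2)) (0, p₀) :=
    ContMDiffAt.comp _ (by rw [hz]; exact hΘ) hs.contMDiffAt
  refine h1.congr_of_eventuallyEq ?_
  have hcont : Filter.Tendsto (fun z : ℝ × N => (2 * z.1, z.2)) (nhds (0, p₀)) (nhds (0, p₀)) := by
    have := hs.continuous.tendsto ((0 : ℝ), p₀)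
    rwa [hz] at this
  filter_upwards [hcont.eventually hc] with z ⟨c, hc0, hc1, hci⟩
  simp only [Function.comp_apply, ← hc1]
  have h2 := isMIntegralCurveOn_Ioo_eqOn_of_contMDiff_boundaryless (t₀ := 0) (a := -1) (b := 1)
    (by norm_num) (hX.const_smul (2 * z.1)).contMDiff_one
    (((hσ z.2).comp_mul (2 * z.1)).isMIntegralCurveOn _) hci (by simp [hc0, h0])
  have h3 := h2 (show (1 / 2 : ℝ) ∈ Ioo (-1 : ℝ) 1 by norm_num)
  rw [← h3]
  simp only [Function.comp_apply]
  congr 1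
  ring

/-- The flow of a complete smooth field is smooth. -/
theorem contMDiff_flow (hX : SmoothField X) (h0 : ∀ p, σ p 0 = p)
    (hσ : ∀ p, IsMIntegralCurve (σ p) X) :
    ContMDiff (𝓘(ℝ, ℝ).prod I) I ∞ (fun z : ℝ × N => σ z.2 z.1) := by
  rw [contMDiff_infty]
  intro n
  have hn : (n : WithTop ℕ∞) ≠ ∞ := by exact_mod_cast ENat.natCast_ne_top n
  have hle : (n : WithTop ℕ∞) ≤ ∞ := by exact_mod_cast (le_top : (n : ℕ∞) ≤ ⊤)
  have : IsManifold I n N := IsManifold.of_le (n := ∞) hle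
  have : IsManifold (𝓘(ℝ, ℝ).prod I) n (ℝ × N) := IsManifold.of_le (n := ∞) hle
  have hloc : ∀ q : N, ∀ᶠ z in nhds ((0 : ℝ), q),
      ContMDiffAt (𝓘(ℝ, ℝ).prod I) I n (fun z : ℝ × N => σ z.2 z.1) z := fun q =>
    (contMDiffAt_iff_contMDiffAt_nhds hn).1 ((contMDiffAt_flow_zero hX h0 hσ q).of_le hle)
  rintro ⟨t₁, p₀⟩
  let S : Set ℝ := {t | ContMDiffAt (𝓘(ℝ, ℝ).prod I) I n (fun z : ℝ × N => σ z.2 z.1) (t, p₀)}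
  suffices hS : S = univ by
    have : t₁ ∈ S := hS ▸ mem_univ t₁
    exact this
  refine IsClopen.eq_univ ⟨?_, ?_⟩ ⟨0, (hloc p₀).self_of_nhds⟩
  · refine isClosed_of_closure_subset fun t ht => ?_
    have hc : Continuous (σ p₀) := (hσ p₀).continuous
    have hmap : Filter.Tendsto (fun s => (t - s, σ p₀ s)) (nhds t) (nhds (0, σ p₀ t)) := by
      have : Continuous (fun s => (t - s, σ p₀ s)) := by fun_prop
      simpa using this.tendsto t
    obtain ⟨s, hs, hsS⟩ := (mem_closure_iff_frequently.1 ht).and_eventually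
      (hmap.eventually (hloc (σ p₀ t))) |>.exists
    have h1 : ContMDiffAt I I n (fun p => σ p s) p₀ :=
      ContMDiffAt.comp p₀ (g := fun z : ℝ × N => σ z.2 z.1) (f := fun p => (s, p)) hs
        (contMDiffAt_const.prodMk contMDiffAt_id)
    have h2 : ContMDiffAt (𝓘(ℝ, ℝ).prod I) (𝓘(ℝ, ℝ).prod I) n
        (fun z : ℝ × N => (z.1 - s, σ z.2 s)) (t, p₀) :=
      (contMDiffAt_fst.sub contMDiffAt_const).prodMk
        (ContMDiffAt.comp ((t, p₀) : ℝ × N) (g := fun p => σ p s) h1 contMDiffAt_snd)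
    have h3 : ContMDiffAt (𝓘(ℝ, ℝ).prod I) I n
        ((fun z : ℝ × N => σ z.2 z.1) ∘ fun z : ℝ × N => (z.1 - s, σ z.2 s)) (t, p₀) :=
      ContMDiffAt.comp _ hsS h2
    refine h3.congr_of_eventuallyEq (.of_forall fun z => ?_)
    simp only [Function.comp_apply, flow_add hX h0 hσ, sub_add_cancel]
  · rw [isOpen_iff_mem_nhds]
    intro t ht
    have h1 := (contMDiffAt_iff_contMDiffAt_nhds hn).1 ht
    have hc : Continuous (fun s : ℝ => (s, p₀)) := by fun_prop
    exact hc.continuousAt.eventually h1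

end Complete

end Flow

section TimeFlow

variable {E : Type*} [NormedAddCommGroup E] [NormedSpace ℝ E]
  {H : Type*} [TopologicalSpace H] {I : ModelWithCorners ℝ E H}
  {N : Type*} [TopologicalSpace N] [ChartedSpace H N]

lemma hasDerivWithinAt_comp_integralCurve {F : Type*} [NormedAddCommGroup F] [NormedSpace ℝ F]
    {X : ∀ p : N, TangentSpace I p} {γ : ℝ → N} {s : Set ℝ} (hγ : IsMIntegralCurveOn γ X s)
    {h : N → F} {t : ℝ} (ht : t ∈ s) (hh : MDifferentiableAt I 𝓘(ℝ, F) h (γ t)) :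
    HasDerivWithinAt (fun r => h (γ r)) (vderiv I h (γ t) (X (γ t))) s t := by
  have h1 := HasMFDerivAt.comp_hasMFDerivWithinAt t hh.hasMFDerivAt (hγ t ht)
  have h2 : HasFDerivWithinAt (fun r => h (γ r))
      ((vderiv I h (γ t)).comp ((1 : ℝ →L[ℝ] ℝ).smulRight (X (γ t)))) s t := h1.hasFDerivWithinAt
  refine h2.hasDerivWithinAt.congr_deriv ?_
  exact congrArg (vderiv I h (γ t)) (one_smul ℝ (X (γ t)))

lemma hasDerivAt_comp_integralCurve {F : Type*} [NormedAddCommGroup F] [NormedSpace ℝ F]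
    {X : ∀ p : N, TangentSpace I p} {γ : ℝ → N} (hγ : IsMIntegralCurve γ X)
    {h : N → F} (t : ℝ) (hh : MDifferentiableAt I 𝓘(ℝ, F) h (γ t)) :
    HasDerivAt (fun r => h (γ r)) (vderiv I h (γ t) (X (γ t))) t := by
  have h1 := hasDerivWithinAt_comp_integralCurve (hγ.isMIntegralCurveOn univ) (mem_univ t) hh
  rwa [hasDerivWithinAt_univ] at h1

variable [FiniteDimensional ℝ E] [I.Boundaryless] [IsManifold I ∞ N] [T2Space N] [CompactSpace N]
  {Z : ∀ p : ℝ × N, TangentSpace (𝓘(ℝ, ℝ).prod I) p}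

/-- A field on `ℝ × N` with unit time component is complete. -/
lemma exists_integralCurve_of_unit_time (hZ : SmoothField Z)
    (h1 : ∀ p, vderiv (𝓘(ℝ, ℝ).prod I) (Prod.fst : ℝ × N → ℝ) p (Z p) = 1) (p : ℝ × N) :
    ∃ γ : ℝ → ℝ × N, γ 0 = p ∧ IsMIntegralCurve γ Z := by
  rw [exists_isMIntegralCurve_iff_exists_isMIntegralCurveOn_Ioo hZ.contMDiff_one]
  intro a
  set R := |p.1| + |a| + 1 with hR
  have hRpos : 0 < R := by positivity
  let χ : ContDiffBump (0 : ℝ) := ⟨R, R + 1, hRpos, by linarith⟩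
  let Y : ∀ p : ℝ × N, TangentSpace (𝓘(ℝ, ℝ).prod I) p := fun p => χ p.1 • Z p
  have hfst : ContMDiff (𝓘(ℝ, ℝ).prod I) 𝓘(ℝ, ℝ) ∞ (Prod.fst : ℝ × N → ℝ) := contMDiff_fst
  have hY : SmoothField Y := fun p =>
    SmoothFieldAt.smul ((χ.contDiff (n := ⊤)).contMDiff.comp hfst p) (hZ.smoothFieldAt p)
  have hK : IsCompact (Metric.closedBall (0 : ℝ) (R + 1) ×ˢ (univ : Set N)) :=
    (isCompact_closedBall _ _).prod isCompact_univ
  obtain ⟨γ, hγ0, hγ⟩ := exists_integralCurve_of_compact_support hY hK (fun q hq => by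
    have : χ q.1 = 0 := χ.zero_of_le_dist (by
      simp only [mem_prod, mem_univ, and_true, Metric.mem_closedBall, not_le] at hq
      exact hq.le)
    simp [Y, this]) p
  have hder : ∀ t, HasDerivAt (fun r => (γ r).1) (χ (γ t).1) t := fun t => by
    have h2 := hasDerivAt_comp_integralCurve hγ t ((hfst (γ t)).mdifferentiableAt (by simp))
    rwa [show vderiv (𝓘(ℝ, ℝ).prod I) Prod.fst (γ t) (Y (γ t)) = χ (γ t).1 by
      simp only [Y, map_smul, h1, smul_eq_mul, mul_one]] at h2
  have hbd : ∀ t, |(γ t).1 - p.1| ≤ |t| := fun t => by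
    have := Convex.norm_image_sub_le_of_norm_hasDerivWithin_le (f := fun r => (γ r).1)
      (f' := fun t => χ (γ t).1) (C := 1) (s := univ) (x := 0) (y := t)
      (fun t _ => (hder t).hasDerivWithinAt)
      (fun t _ => by rw [Real.norm_of_nonneg χ.nonneg]; exact χ.le_one) convex_univ
      (mem_univ _) (mem_univ _)
    simpa [hγ0] using this
  refine ⟨γ, hγ0, fun t ht => ?_⟩
  have hχ : χ (γ t).1 = 1 := χ.one_of_mem_closedBall (by
    rw [Metric.mem_closedBall, dist_zero_right, Real.norm_eq_abs]
    have h3 := hbd t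
    have h4 : |t| < |a| := lt_of_lt_of_le (abs_lt.2 ht) (le_abs_self a)
    have h5 : |(γ t).1| ≤ |(γ t).1 - p.1| + |p.1| := by
      simpa using abs_add_le ((γ t).1 - p.1) p.1
    linarith)
  have h6 : Y (γ t) = Z (γ t) := by simp [Y, hχ]
  have h7 := (hγ t).hasMFDerivWithinAt (s := Ioo (-a) a)
  rwa [h6] at h7

/-- The flow of a time-dependent vector field. -/
theorem exists_timeFlow (hZ : SmoothField Z)
    (h1 : ∀ p, vderiv (𝓘(ℝ, ℝ).prod I) (Prod.fst : ℝ × N → ℝ) p (Z p) = 1) :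
    ∃ F G : ℝ × N → N, ContMDiff (𝓘(ℝ, ℝ).prod I) I ∞ F ∧ ContMDiff (𝓘(ℝ, ℝ).prod I) I ∞ G ∧
      (∀ x, F (0, x) = x) ∧ (∀ t x, G (t, F (t, x)) = x) ∧ (∀ t x, F (t, G (t, x)) = x) ∧
      ∀ x, IsMIntegralCurve (fun t => (t, F (t, x))) Z := by
  choose σ h0 hσ using exists_integralCurve_of_unit_time hZ h1
  have hs := contMDiff_flow hZ h0 hσ
  have hfst : ContMDiff (𝓘(ℝ, ℝ).prod I) 𝓘(ℝ, ℝ) ∞ (Prod.fst : ℝ × N → ℝ) := contMDiff_fst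
  have htime : ∀ p t, (σ p t).1 = p.1 + t := by
    intro p t
    have hd : ∀ t, HasDerivAt (fun r => (σ p r).1 - r) 0 t := fun t => by
      have h2 := hasDerivAt_comp_integralCurve (hσ p) t ((hfst (σ p t)).mdifferentiableAt (by simp))
      rw [h1] at h2
      have h3 := h2.sub (hasDerivAt_id t)
      rw [sub_self] at h3
      exact h3
    have h3 := is_const_of_deriv_eq_zero (fun t => (hd t).differentiableAt)
      (fun t => (hd t).deriv) t 0
    simp only [h0, sub_zero] at h3
    linarith
  have hpair : ∀ x t, σ (0, x) t = (t, (σ (0, x) t).2) := fun x t =>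
    Prod.ext (by simp [htime]) rfl
  have hpair' : ∀ x t, σ (t, x) (-t) = (0, (σ (t, x) (-t)).2) := fun x t =>
    Prod.ext (by simp [htime]) rfl
  refine ⟨fun z => (σ (0, z.2) z.1).2, fun z => (σ z (-z.1)).2, ?_, ?_, fun x => by simp [h0],
    fun t x => ?_, fun t x => ?_, fun x => ?_⟩
  · have h2 : ContMDiff (𝓘(ℝ, ℝ).prod I) (𝓘(ℝ, ℝ).prod (𝓘(ℝ, ℝ).prod I)) ∞
        (fun z : ℝ × N => (z.1, ((0 : ℝ), z.2))) :=
      contMDiff_fst.prodMk (contMDiff_const.prodMk contMDiff_snd)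
    exact contMDiff_snd.comp (hs.comp h2)
  · have h2 : ContMDiff (𝓘(ℝ, ℝ).prod I) (𝓘(ℝ, ℝ).prod (𝓘(ℝ, ℝ).prod I)) ∞
        (fun z : ℝ × N => (-z.1, z)) :=
      (contDiff_neg.contMDiff.comp contMDiff_fst).prodMk contMDiff_id
    exact contMDiff_snd.comp (hs.comp h2)
  · change (σ (t, (σ (0, x) t).2) (-t)).2 = x
    rw [← hpair, flow_add hZ h0 hσ]
    simp [h0]
  · change (σ (0, (σ (t, x) (-t)).2) t).2 = x
    rw [← hpair', flow_add hZ h0 hσ]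
    simp [h0]
  · have : (fun t => (t, (σ (0, x) t).2)) = σ (0, x) := funext fun t => (hpair x t).symm
    simp only [this]
    exact hσ _

end TimeFlow

section BookMaps

variable {E : Type*} [NormedAddCommGroup E] [NormedSpace ℝ E]
  {H : Type*} [TopologicalSpace H] {I : ModelWithCorners ℝ E H}
  {N : Type*} [TopologicalSpace N] [ChartedSpace H N]
  {E' : Type*} [NormedAddCommGroup E'] [NormedSpace ℝ E']
  {H' : Type*} [TopologicalSpace H'] {I' : ModelWithCorners ℝ E' H'}
  {N' : Type*} [TopologicalSpace N'] [ChartedSpace H' N']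

lemma vderiv_comp_map {F : Type*} [NormedAddCommGroup F] [NormedSpace ℝ F] {h : N → F}
    {f : N' → N} {p : N'} (hh : MDifferentiableAt I 𝓘(ℝ, F) h (f p))
    (hf : MDifferentiableAt I' I f p) (v : TangentSpace I' p) :
    vderiv I' (fun q => h (f q)) p v = vderiv I h (f p) (mfderiv I' I f p v) :=
  congrArg (fun L : TangentSpace I' p →L[ℝ] F => L v) (mfderiv_comp p hh hf)

lemma vderiv_fst (p : ℝ × N) (v : TangentSpace (𝓘(ℝ, ℝ).prod I) p) :
    vderiv (𝓘(ℝ, ℝ).prod I) (Prod.fst : ℝ × N → ℝ) p v = v.1 :=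
  congrArg (fun L : TangentSpace (𝓘(ℝ, ℝ).prod I) p →L[ℝ] ℝ => L v)
    (mfderiv_fst (I := 𝓘(ℝ, ℝ)) (I' := I))

lemma vderiv_slice {F : Type*} [NormedAddCommGroup F] [NormedSpace ℝ F] {Φ : ℝ × N → F} {t : ℝ}
    {x : N} (hΦ : MDifferentiableAt (𝓘(ℝ, ℝ).prod I) 𝓘(ℝ, F) Φ (t, x)) (w : TangentSpace I x) :
    vderiv I (fun y => Φ (t, y)) x w =
      vderiv (𝓘(ℝ, ℝ).prod I) Φ (t, x) (((0 : ℝ), w) : ℝ × E) := by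
  have h1 : MDifferentiableAt I (𝓘(ℝ, ℝ).prod I) (fun y : N => (t, y)) x :=
    mdifferentiableAt_const.prodMk mdifferentiableAt_id
  refine (vderiv_comp_map hΦ h1 w).trans (congrArg (vderiv (𝓘(ℝ, ℝ).prod I) Φ (t, x)) ?_)
  exact congrArg (fun L : TangentSpace I x →L[ℝ] ℝ × E => L w)
    (mfderiv_prod_right (I := 𝓘(ℝ, ℝ)) (I' := I))

/-- The one-form `Im (conj Φ dΦ) = ‖Φ‖² d(arg Φ)`. -/
def argDeriv (I : ModelWithCorners ℝ E H) (Φ : N → ℂ) (p : N) : TangentSpace I p →L[ℝ] ℝ :=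
  Complex.imCLM.comp ((ContinuousLinearMap.mul ℝ ℂ (conj (Φ p))).comp (vderiv I Φ p))

lemma argDeriv_apply (Φ : N → ℂ) (p : N) (v : TangentSpace I p) :
    argDeriv I Φ p v = (conj (Φ p) * vderiv I Φ p v).im := rfl

/-- `Φ` is transverse to `0` and its argument is a submersion off the zero set. -/
structure IsBookMap (I : ModelWithCorners ℝ E H) (Φ : N → ℂ) : Prop where
  smooth : ContMDiff I 𝓘(ℝ, ℂ) ∞ Φ
  transverse : ∀ p, Φ p = 0 → Function.Surjective (vderiv I Φ p)
  submersive : ∀ p, Φ p ≠ 0 → argDeriv I Φ p ≠ 0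

variable [IsManifold I ∞ N]

lemma contMDiffAt_conj {Φ : N → ℂ} {p : N} (hΦ : ContMDiffAt I 𝓘(ℝ, ℂ) ∞ Φ p) :
    ContMDiffAt I 𝓘(ℝ, ℂ) ∞ (fun q => conj (Φ q)) p :=
  Complex.conjCLE.contDiff.contMDiff.contMDiffAt.comp p hΦ

lemma contMDiffAt_complex_mul {Φ Ψ : N → ℂ} {p : N} (hΦ : ContMDiffAt I 𝓘(ℝ, ℂ) ∞ Φ p)
    (hΨ : ContMDiffAt I 𝓘(ℝ, ℂ) ∞ Ψ p) : ContMDiffAt I 𝓘(ℝ, ℂ) ∞ (fun q => Φ q * Ψ q) p :=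
  (contDiff_mul (𝕜 := ℝ) (𝔸 := ℂ)).contMDiff.contMDiffAt.comp p (hΦ.prodMk_space hΨ)

lemma smoothMapAt_argDeriv {Φ : N → ℂ} {p : N} (hΦ : ContMDiffAt I 𝓘(ℝ, ℂ) ∞ Φ p) :
    SmoothMapAt (argDeriv I Φ) p := fun X hX => by
  have h1 := contMDiffAt_vderiv hΦ X hX
  have h2 : ContMDiffAt I 𝓘(ℝ, ℂ) ∞ (fun q => conj (Φ q) * vderiv I Φ q (X q)) p :=
    contMDiffAt_complex_mul (contMDiffAt_conj hΦ) h1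
  exact Complex.imCLM.contDiff.contMDiff.contMDiffAt.comp p h2

lemma SmoothMapAt.prod {F G : Type*} [NormedAddCommGroup F] [NormedSpace ℝ F]
    [NormedAddCommGroup G] [NormedSpace ℝ G] {A : ∀ p : N, TangentSpace I p →L[ℝ] F}
    {B : ∀ p : N, TangentSpace I p →L[ℝ] G} {p : N} (hA : SmoothMapAt A p)
    (hB : SmoothMapAt B p) : SmoothMapAt (fun q => (A q).prod (B q)) p :=
  fun X hX => (hA X hX).prodMk_space (hB X hX)

lemma nonvanishing_curve {h h' : ℝ → ℂ} (hd : ∀ t, HasDerivAt h (h' t) t)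
    (him : ∀ t, (conj (h t) * h' t).im = 0) (hne : ∀ t, h t ≠ 0) (t : ℝ) :
    ∃ c : ℝ, 0 < c ∧ h t = c * h 0 := by
  have hc : ∀ t, HasDerivAt (fun r => conj (h r)) (conj (h' t)) t := fun t =>
    (Complex.conjCLE.hasFDerivAt (x := h t)).comp_hasDerivAt t (hd t)
  have hcne : ∀ t, conj (h t) ≠ 0 := fun t => by simpa using hne t
  have hq : ∀ t, HasDerivAt (fun r => h r / conj (h r)) 0 t := fun t => by
    refine ((hd t).div (hc t) (hcne t)).congr_deriv ?_
    rw [div_eq_zero_iff]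
    left
    have h2 := him t
    apply Complex.ext <;> simp at h2 ⊢ <;> linarith
  have hq0 : ∀ t, h t * conj (h 0) = h 0 * conj (h t) := fun t => by
    have := is_const_of_deriv_eq_zero (fun t => (hq t).differentiableAt) (fun t => (hq t).deriv) t 0
    rwa [div_eq_div_iff (hcne t) (hcne 0)] at this
  have him0 : ∀ t, (h t * conj (h 0)).im = 0 := fun t => by
    have := congrArg Complex.im (hq0 t)
    simp at this ⊢; linarith
  have hre : ∀ t, (h t * conj (h 0)).re ≠ 0 := fun t hr =>
    mul_ne_zero (hne t) (hcne 0) (Complex.ext hr (him0 t))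
  have hcont : Continuous fun t => (h t * conj (h 0)).re :=
    Complex.continuous_re.comp
      ((continuous_iff_continuousAt.2 fun t => (hd t).continuousAt).mul continuous_const)
  have hpos0 : (0 : ℝ) < (h 0 * conj (h 0)).re := by
    rw [Complex.mul_conj, Complex.ofReal_re]; exact Complex.normSq_pos.2 (hne 0)
  have hpos : 0 < (h t * conj (h 0)).re := by
    by_contra hneg
    obtain ⟨s, hs⟩ := mem_range_of_exists_le_of_exists_ge hcont
      ⟨t, not_lt.1 hneg⟩ ⟨0, hpos0.le⟩
    exact hre s hs
  refine ⟨(h t * conj (h 0)).re / Complex.normSq (h 0),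
    div_pos hpos (Complex.normSq_pos.2 (hne 0)), ?_⟩
  have hn : (Complex.normSq (h 0) : ℂ) ≠ 0 := by
    exact_mod_cast (Complex.normSq_pos.2 (hne 0)).ne'
  have h3 : (((h t * conj (h 0)).re : ℝ) : ℂ) = h t * conj (h 0) :=
    Complex.ext (by simp) (by rw [him0]; simp)
  rw [Complex.ofReal_div, h3, div_mul_eq_mul_div, eq_div_iff hn, ← Complex.mul_conj]
  ring

end BookMaps

section ThomIsotopy

variable {E : Type*} [NormedAddCommGroup E] [NormedSpace ℝ E] [FiniteDimensional ℝ E]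
  {H : Type*} [TopologicalSpace H] {I : ModelWithCorners ℝ E H} [I.Boundaryless]
  {N : Type*} [TopologicalSpace N] [ChartedSpace H N] [IsManifold I ∞ N]

lemma exists_time_solution {F : Type*} [NormedAddCommGroup F] [NormedSpace ℝ F]
    {p : ℝ × N} (A : TangentSpace (𝓘(ℝ, ℝ).prod I) p →L[ℝ] F)
    (hA : ∀ y : F, ∃ w : E, A (((0 : ℝ), w) : ℝ × E) = y) :
    Function.Surjective ((vderiv (𝓘(ℝ, ℝ).prod I) (Prod.fst : ℝ × N → ℝ) p).prod A) := by
  rintro ⟨a, y⟩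
  obtain ⟨w, hw⟩ := hA (y - A ((a, (0 : E)) : ℝ × E))
  refine ⟨((a, w) : ℝ × E), Prod.ext ?_ ?_⟩
  · exact vderiv_fst p _
  · have h1 : A ((a, w) : ℝ × E) = A (((0 : ℝ), w) : ℝ × E) + A ((a, (0 : E)) : ℝ × E) := by
      refine Eq.trans (congrArg A ?_) (map_add A _ _)
      exact Prod.ext (zero_add a).symm (add_zero w).symm
    exact h1.trans (by rw [hw, sub_add_cancel])

variable [T2Space N] [CompactSpace N]

/-- A smooth family of book maps is trivial up to an isotopy and positive factors. -/
theorem exists_isotopy_of_bookMaps {Φ : ℝ × N → ℂ}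
    (hΦ : ContMDiff (𝓘(ℝ, ℝ).prod I) 𝓘(ℝ, ℂ) ∞ Φ)
    (hbook : ∀ t, IsBookMap I (fun x => Φ (t, x))) :
    ∃ F G : ℝ × N → N, ContMDiff (𝓘(ℝ, ℝ).prod I) I ∞ F ∧ ContMDiff (𝓘(ℝ, ℝ).prod I) I ∞ G ∧
      (∀ x, F (0, x) = x) ∧ (∀ t x, G (t, F (t, x)) = x) ∧ (∀ t x, F (t, G (t, x)) = x) ∧
      ∀ t x, ∃ c : ℝ, 0 < c ∧ Φ (t, F (t, x)) = c * Φ (0, x) := by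
  let J := 𝓘(ℝ, ℝ).prod I
  have : LocallyCompactSpace H := I.locallyCompactSpace
  have hfst : ContMDiff J 𝓘(ℝ, ℝ) ∞ (Prod.fst : ℝ × N → ℝ) := contMDiff_fst
  have hdiff : ∀ p, MDifferentiableAt J 𝓘(ℝ, ℂ) Φ p := fun p =>
    (hΦ p).mdifferentiableAt (by simp)
  let A : ∀ p : ℝ × N, TangentSpace J p →L[ℝ] ℝ × ℂ := fun p =>
    (vderiv J (Prod.fst : ℝ × N → ℝ) p).prod (vderiv J Φ p)
  let B : ∀ p : ℝ × N, TangentSpace J p →L[ℝ] ℝ × ℝ := fun p =>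
    (vderiv J (Prod.fst : ℝ × N → ℝ) p).prod (argDeriv J Φ p)
  have hA : ∀ p, SmoothMapAt A p := fun p =>
    (contMDiffAt_vderiv (hfst p)).prod (contMDiffAt_vderiv (hΦ p))
  have hB : ∀ p, SmoothMapAt B p := fun p =>
    (contMDiffAt_vderiv (hfst p)).prod (smoothMapAt_argDeriv (hΦ p))
  have hAsurj : ∀ p, Φ p = 0 → Function.Surjective (A p) := fun p hp =>
    exists_time_solution _ fun y => by
      obtain ⟨w, hw⟩ := (hbook p.1).transverse p.2 hp y
      exact ⟨w, (vderiv_slice (hdiff p) w).symm.trans hw⟩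
  have hBsurj : ∀ p, Φ p ≠ 0 → Function.Surjective (B p) := fun p hp =>
    exists_time_solution _ fun y => by
      have hne := (hbook p.1).submersive p.2 hp
      obtain ⟨w, hw⟩ : ∃ w, argDeriv I (fun x => Φ (p.1, x)) p.2 w ≠ 0 := by
        by_contra hcon
        push Not at hcon
        exact hne (ContinuousLinearMap.ext hcon)
      have hw' : argDeriv J Φ p (((0 : ℝ), w) : ℝ × E) =
          argDeriv I (fun x => Φ (p.1, x)) p.2 w :=
        congrArg (fun z => (conj (Φ p) * z).im) (vderiv_slice (hdiff p) w).symm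
      refine ⟨(y / argDeriv I (fun x => Φ (p.1, x)) p.2 w) • w, ?_⟩
      have h1 := map_smul (argDeriv J Φ p) (y / argDeriv I (fun x => Φ (p.1, x)) p.2 w)
        (((0 : ℝ), w) : ℝ × E)
      refine Eq.trans (congrArg (argDeriv J Φ p) ?_) (h1.trans
        ((congrArg _ hw').trans (by rw [smul_eq_mul, div_mul_cancel₀ _ hw])))
      exact Prod.ext (mul_zero _).symm rfl
  have hopen : IsOpen {p | Function.Surjective (A p)} := by
    rw [isOpen_iff_mem_nhds]
    intro p hp
    obtain ⟨v, hv⟩ := hp 0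
    obtain ⟨U, -, hU, hpU, hs, -⟩ := exists_local_solution isOpen_univ (fun p _ => hA p)
      (mem_univ p) hp (y := fun _ => 0) (fun _ _ => contMDiffAt_const) v hv
    exact Filter.mem_of_superset (hU.mem_nhds hpU) hs
  have hK : IsClosed {p | Φ p = 0} := isClosed_eq hΦ.continuous continuous_const
  obtain ⟨W, hW, hKW, hWA⟩ := normal_exists_closure_subset hK hopen hAsurj
  let T : ∀ p : ℝ × N, Set (TangentSpace J p) := fun p =>
    {v | vderiv J (Prod.fst : ℝ × N → ℝ) p v = 1 ∧ argDeriv J Φ p v = 0 ∧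
      (p ∈ closure W → vderiv J Φ p v = 0)}
  obtain ⟨Z, hZ⟩ := exists_contMDiffSection_forall_mem_convex_of_local (n := ⊤) J
    (fun p : ℝ × N => TangentSpace J p) T
    (by
      intro p v hv w hw a b ha hb hab
      refine ⟨?_, ?_, fun hp => ?_⟩
      · rw [map_add, map_smul, map_smul, hv.1, hw.1]; simpa using hab
      · rw [map_add, map_smul, map_smul, hv.2.1, hw.2.1]; simp
      · rw [map_add, map_smul, map_smul, hv.2.2 hp, hw.2.2 hp]; simp)
    (by
      intro p
      by_cases hp : Function.Surjective (A p)
      · obtain ⟨v, hv⟩ := hp (1, 0)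
        obtain ⟨U, -, hU, hpU, -, Z, -, hZ⟩ := exists_local_solution isOpen_univ (fun p _ => hA p)
          (mem_univ p) hp (y := fun _ => (1, 0)) (fun _ _ => contMDiffAt_const) v hv
        refine ⟨U, hU.mem_nhds hpU, Z, fun q hq => (hZ q hq).1.contMDiffWithinAt, fun q hq => ?_⟩
        have h1 : vderiv J (Prod.fst : ℝ × N → ℝ) q (Z q) = 1 := congrArg Prod.fst (hZ q hq).2
        have h2 : vderiv J Φ q (Z q) = 0 := congrArg Prod.snd (hZ q hq).2
        exact ⟨h1, by rw [argDeriv_apply, h2]; simp, fun _ => h2⟩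
      · have hp' : p ∈ (closure W)ᶜ := fun h => hp (hWA h)
        have hs : Function.Surjective (B p) := hBsurj p fun h => hp (hAsurj p h)
        obtain ⟨v, hv⟩ := hs (1, 0)
        obtain ⟨U, hUW, hU, hpU, -, Z, -, hZ⟩ := exists_local_solution
          (isClosed_closure.isOpen_compl) (fun p _ => hB p)
          hp' hs (y := fun _ => (1, 0)) (fun _ _ => contMDiffAt_const) v hv
        refine ⟨U, hU.mem_nhds hpU, Z, fun q hq => (hZ q hq).1.contMDiffWithinAt, fun q hq => ?_⟩
        exact ⟨congrArg Prod.fst (hZ q hq).2, congrArg Prod.snd (hZ q hq).2,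
          fun h => absurd h (hUW hq)⟩)
  obtain ⟨F, G, hF, hG, h0, hGF, hFG, hcurve⟩ :=
    exists_timeFlow (Z := Z) Z.contMDiff fun p => (hZ p).1
  refine ⟨F, G, hF, hG, h0, hGF, hFG, fun t x => ?_⟩
  have hd : ∀ t, HasDerivAt (fun r => Φ (r, F (r, x))) (vderiv J Φ (t, F (t, x)) (Z (t, F (t, x)))) t :=
    fun t => hasDerivAt_comp_integralCurve (hcurve x) t (hdiff _)
  by_cases hz : ∃ s, Φ (s, F (s, x)) = 0
  · have hcont : Continuous fun r => (r, F (r, x)) :=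
      continuous_id.prodMk (hF.continuous.comp (continuous_id.prodMk continuous_const))
    have hcl : IsClopen {s | Φ (s, F (s, x)) = 0} := by
      refine ⟨isClosed_eq (hΦ.continuous.comp hcont) continuous_const, ?_⟩
      rw [Metric.isOpen_iff]
      intro s hs
      obtain ⟨δ, hδ, hball⟩ := Metric.isOpen_iff.1 (hW.preimage hcont) s (hKW hs)
      refine ⟨δ, hδ, fun r hr => ?_⟩
      have := (convex_ball s δ).is_const_of_fderivWithin_eq_zero (𝕜 := ℝ)
        (f := fun r => Φ (r, F (r, x))) (fun r _ => (hd r).differentiableAt.differentiableWithinAt)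
        (fun r hr => by
          have h3 := (hZ (r, F (r, x))).2.2 (subset_closure (hball hr))
          have h4 := (hd r).hasFDerivAt.hasFDerivWithinAt (s := Metric.ball s δ)
          rw [h3] at h4
          rw [h4.fderivWithin (Metric.isOpen_ball.uniqueDiffWithinAt hr)]
          ext; simp) hr (Metric.mem_ball_self hδ)
      exact this.trans hs
    have huniv := hcl.eq_univ hz
    refine ⟨1, one_pos, ?_⟩
    have h5 : Φ (t, F (t, x)) = 0 := (huniv ▸ mem_univ t : t ∈ {s | Φ (s, F (s, x)) = 0})
    have h6 : Φ (0, F (0, x)) = 0 := (huniv ▸ mem_univ 0 : (0 : ℝ) ∈ {s | Φ (s, F (s, x)) = 0})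
    rw [h0] at h6
    rw [h5, h6, mul_zero]
  · push Not at hz
    obtain ⟨c, hc, h7⟩ := nonvanishing_curve hd (fun t => (hZ _).2.1) hz t
    rw [h0] at h7
    exact ⟨c, hc, h7⟩

end ThomIsotopy

section Fibrations

variable {E : Type*} [NormedAddCommGroup E] [NormedSpace ℝ E]
  {H : Type*} [TopologicalSpace H] {I : ModelWithCorners ℝ E H}
  {N : Type*} [TopologicalSpace N] [ChartedSpace H N]

lemma contDiffAt_arg {z : ℂ} (hz : z ∈ Complex.slitPlane) : ContDiffAt ℝ ∞ Complex.arg z := by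
  have h : Complex.arg = fun z => Complex.imCLM (Complex.log z) :=
    funext fun z => (Complex.log_im z).symm
  rw [h]
  exact Complex.imCLM.contDiff.contDiffAt.comp z ((Complex.contDiffAt_log hz).restrict_scalars ℝ)

lemma contMDiffAt_circle {f : N → Circle} {p : N}
    (hf : ContMDiffAt I 𝓘(ℝ, ℂ) ∞ (fun q => (f q : ℂ)) p) : ContMDiffAt I (𝓡 1) ∞ f p := by
  have h1 : ContDiffAt ℝ ∞ (fun z : ℂ => Complex.arg (z * conj (f p : ℂ))) (f p : ℂ) := by
    refine ContDiffAt.comp _ (contDiffAt_arg ?_) (contDiffAt_id.mul contDiffAt_const)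
    simp [Complex.mul_conj]
  have h2 : ContMDiffAt I 𝓘(ℝ, ℝ) ∞
      (fun q => Complex.arg ((f q : ℂ) * conj (f p : ℂ))) p :=
    h1.contMDiffAt.comp (f := fun q => (f q : ℂ)) p hf
  have h3 : ContMDiffAt I (𝓡 1) ∞
      (fun q => f p * Circle.exp (Complex.arg ((f q : ℂ) * conj (f p : ℂ)))) p :=
    contMDiffAt_const.mul (contMDiff_circleExp.contMDiffAt.comp p h2)
  refine h3.congr_of_eventuallyEq (.of_forall fun q => ?_)
  have h4 : (f q : ℂ) * conj (f p : ℂ) = ((f q * (f p)⁻¹ : Circle) : ℂ) := by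
    rw [Circle.coe_mul, Circle.coe_inv_eq_conj]
  change f q = f p * Circle.exp (Complex.arg ((f q : ℂ) * conj (f p : ℂ)))
  rw [h4, Circle.exp_arg]
  rw [mul_comm, mul_assoc, inv_mul_cancel, mul_one]

variable {B : OpenBook N} {Φ : N → ℂ}

lemma IsDefinedBy.isClosed_binding (h : IsDefinedBy I B Φ) : IsClosed B.binding := by
  rw [h.2.2.1]; exact isClosed_eq h.1.continuous continuous_const

lemma IsDefinedBy.mem_binding (h : IsDefinedBy I B Φ) {p : N} : p ∈ B.binding ↔ Φ p = 0 := by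
  rw [h.2.2.1]; rfl

lemma IsDefinedBy.map_eq (h : IsDefinedBy I B Φ) {p : N} {r : ℝ} (hr : 0 < r) {z : Circle}
    (hp : Φ p = r * z) : p ∉ B.binding ∧ B.map p = z := by
  have hne : Φ p ≠ 0 := by
    rw [hp]; exact mul_ne_zero (by exact_mod_cast hr.ne') (Circle.coe_ne_zero z)
  have hb : p ∉ B.binding := fun hc => hne (h.mem_binding.1 hc)
  refine ⟨hb, Circle.ext ?_⟩
  have h1 := h.2.2.2 p hb
  have h2 : ‖Φ p‖ = r := by rw [hp, norm_mul, Circle.norm_coe, mul_one, Complex.norm_real,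
    Real.norm_of_nonneg hr.le]
  rw [h2, hp] at h1
  exact (mul_left_cancel₀ (by exact_mod_cast hr.ne') h1).symm

lemma IsDefinedBy.contMDiffAt_coe_map (h : IsDefinedBy I B Φ) {p : N} (hp : p ∉ B.binding) :
    ContMDiffAt I 𝓘(ℝ, ℂ) ∞ (fun q => (B.map q : ℂ)) p := by
  have hne : Φ p ≠ 0 := fun hc => hp (h.mem_binding.2 hc)
  have h1 : ContDiffAt ℝ ∞ (fun z : ℂ => ((‖z‖⁻¹ : ℝ) • z)) (Φ p) :=
    ((contDiffAt_norm ℝ hne).inv (norm_ne_zero_iff.2 hne)).smul contDiffAt_id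
  refine (h1.contMDiffAt.comp p (h.1 p)).congr_of_eventuallyEq ?_
  filter_upwards [h.isClosed_binding.isOpen_compl.mem_nhds hp] with q hq
  have hq' : Φ q ≠ 0 := fun hc => hq (h.mem_binding.2 hc)
  have h2 := h.2.2.2 q hq
  have h3 : (‖Φ q‖ : ℂ) ≠ 0 := by exact_mod_cast norm_ne_zero_iff.2 hq'
  change (B.map q : ℂ) = (‖Φ q‖⁻¹ : ℝ) • Φ q
  rw [Complex.real_smul, Complex.ofReal_inv, eq_inv_mul_iff_mul_eq₀ h3]
  exact h2.symm

lemma IsDefinedBy.contMDiffAt_map (h : IsDefinedBy I B Φ) {p : N} (hp : p ∉ B.binding) :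
    ContMDiffAt I (𝓡 1) ∞ B.map p :=
  contMDiffAt_circle (h.contMDiffAt_coe_map hp)

/-- The open book defined by a function. -/
def bookOf (Φ : N → ℂ) : OpenBook N := ⟨{p | Φ p = 0}, fun p => Circle.exp (Complex.arg (Φ p))⟩

lemma IsBookMap.isDefinedBy_bookOf (h : IsBookMap I Φ) : IsDefinedBy I (bookOf Φ) Φ :=
  ⟨h.smooth, h.transverse, rfl, fun p _ => by
    change _ = _ * (Circle.exp (Complex.arg (Φ p)) : ℂ)
    rw [Circle.coe_exp]
    exact (Complex.norm_mul_exp_arg_mul_I (Φ p)).symm⟩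

variable [IsManifold I ∞ N] [FiniteDimensional ℝ E] [I.Boundaryless] [T2Space N] [CompactSpace N]

lemma vderiv_const_mul {Φ : N → ℂ} {p : N} (hΦ : MDifferentiableAt I 𝓘(ℝ, ℂ) Φ p) (a : ℂ)
    (v : TangentSpace I p) : vderiv I (fun q => a * Φ q) p v = a * vderiv I Φ p v := by
  rw [vderiv_comp (g := fun z => a * z) (by fun_prop) hΦ]
  have : HasFDerivAt (fun z : ℂ => a * z) (ContinuousLinearMap.mul ℝ ℂ a) (Φ p) :=
    (ContinuousLinearMap.mul ℝ ℂ a).hasFDerivAt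
  rw [this.fderiv]; rfl

lemma IsBookMap.const_mul (h : IsBookMap I Φ) {a : ℂ} (ha : a ≠ 0) :
    IsBookMap I (fun q => a * Φ q) := by
  have hd : ∀ p, MDifferentiableAt I 𝓘(ℝ, ℂ) Φ p := fun p => (h.smooth p).mdifferentiableAt (by simp)
  refine ⟨fun p => contMDiffAt_complex_mul contMDiffAt_const (h.smooth p), fun p hp y => ?_,
    fun p hp hc => ?_⟩
  · obtain ⟨v, hv⟩ := h.transverse p ((mul_eq_zero.1 hp).resolve_left ha) (a⁻¹ * y)
    exact ⟨v, by rw [vderiv_const_mul (hd p), hv, mul_inv_cancel_left₀ ha]⟩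
  · refine h.submersive p (fun hc => hp (by rw [hc, mul_zero])) (ContinuousLinearMap.ext fun v => ?_)
    have h1 := congrArg (fun L : TangentSpace I p →L[ℝ] ℝ => L v) hc
    simp only [argDeriv_apply, vderiv_const_mul (hd p), map_mul] at h1
    rw [show conj a * conj (Φ p) * (a * vderiv I Φ p v) =
      (Complex.normSq a : ℂ) * (conj (Φ p) * vderiv I Φ p v) by
        rw [← Complex.mul_conj]; ring, Complex.im_ofReal_mul] at h1
    exact (mul_eq_zero.1 h1).resolve_left (Complex.normSq_pos.2 ha).ne'

/-- The map of the open book defined by a book map is a fibration. -/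
theorem IsBookMap.isFibration (h : IsBookMap I Φ) (hB : IsDefinedBy I B Φ) :
    IsFibration I B := by
  refine ⟨fun p hp => (hB.contMDiffAt_map hp).contMDiffWithinAt, fun θ => ?_⟩
  have hΨ : ContMDiff (𝓘(ℝ, ℝ).prod I) 𝓘(ℝ, ℂ) ∞
      (fun z : ℝ × N => Complex.exp (-(z.1 * Complex.I)) * Φ z.2) := fun z =>
    contMDiffAt_complex_mul
      ((show ContDiff ℝ ∞ fun t : ℝ => Complex.exp (-(t * Complex.I)) by
        have := Complex.ofRealCLM.contDiff (n := ∞)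
        exact (((this.mul contDiff_const).neg).cexp)).contMDiff.comp contMDiff_fst z)
      (h.smooth.comp contMDiff_snd z)
  obtain ⟨F, G, hF, hG, -, hGF, hFG, hc⟩ := exists_isotopy_of_bookMaps hΨ
    fun t => h.const_mul (a := Complex.exp (-(t * Complex.I))) (Complex.exp_ne_zero _)
  have hrot : ∀ t x, ∃ c : ℝ, 0 < c ∧ Φ (F (t, x)) = c * (Circle.exp t * Φ x) := fun t x => by
    obtain ⟨c, hc0, hc1⟩ := hc t x
    refine ⟨c, hc0, ?_⟩
    simp only [Complex.ofReal_zero, zero_mul, neg_zero, Complex.exp_zero, one_mul] at hc1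
    rw [Circle.coe_exp, mul_left_comm, ← hc1, ← mul_assoc, ← Complex.exp_add]
    simp
  let a : Circle → ℝ := fun z => Complex.arg ((z * θ⁻¹ : Circle) : ℂ)
  have ha : ∀ z, Circle.exp (a z) = z * θ⁻¹ := fun z => Circle.exp_arg _
  let U : Set Circle := {z | ((z * θ⁻¹ : Circle) : ℂ) ∈ Complex.slitPlane}
  have hU : IsOpen U := Complex.isOpen_slitPlane.preimage
    (contMDiff_circle_coe.continuous.comp (continuous_id.mul continuous_const))
  have haU : ∀ z ∈ U, ContMDiffAt (𝓡 1) 𝓘(ℝ, ℝ) ∞ a z := fun z hz =>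
    ContMDiffAt.comp z (contDiffAt_arg hz).contMDiffAt
      (contMDiff_circle_coe.contMDiffAt.comp z (contMDiffAt_id.mul contMDiffAt_const))
  refine ⟨U, hU, by simp [U], fun x => F (a x.1, x.2), fun y => G (a (B.map y), y),
    fun x hx => ?_, fun y hy => ?_, fun z hz x hx => ?_, fun y hy hyU => ?_⟩
  · have h1 : ContMDiffAt ((𝓡 1).prod I) 𝓘(ℝ, ℝ) ∞ (fun x : Circle × N => a x.1) x :=
      ContMDiffAt.comp x (haU _ hx.1) contMDiffAt_fst
    exact (hF.contMDiffAt.comp x (h1.prodMk contMDiffAt_snd)).contMDiffWithinAt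
  · have h1 : ContMDiffAt I 𝓘(ℝ, ℝ) ∞ (fun y : N => a (B.map y)) y :=
      ContMDiffAt.comp y (haU _ hy.2) (hB.contMDiffAt_map hy.1)
    exact (hG.contMDiffAt.comp y (h1.prodMk contMDiffAt_id)).contMDiffWithinAt
  · obtain ⟨c, hc0, hc1⟩ := hrot (a z) x
    have hx0 : 0 < ‖Φ x‖ := norm_pos_iff.2 fun h0 => hx.1 (hB.mem_binding.2 h0)
    have h2 := hB.map_eq (z := z) (mul_pos hc0 hx0) (p := F (a z, x)) (by
      rw [hc1, hB.2.2.2 x hx.1, hx.2, ha]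
      simp only [norm_mul, Complex.norm_real, norm_norm, Circle.norm_coe, mul_one]
      push_cast
      have := Circle.coe_ne_zero θ
      field_simp)
    refine ⟨h2, ?_⟩
    change G (a (B.map (F (a z, x))), F (a z, x)) = x
    rw [h2.2, hGF]
  · obtain ⟨c, hc0, hc1⟩ := hrot (a (B.map y)) (G (a (B.map y), y))
    have hy0 : 0 < ‖Φ y‖ := norm_pos_iff.2 fun h0 => hy (hB.mem_binding.2 h0)
    refine ⟨hB.map_eq (r := c⁻¹ * ‖Φ y‖) (by positivity) ?_, hFG _ _⟩
    rw [hFG, ha] at hc1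
    have h3 := hB.2.2.2 y hy
    have h4 := Circle.coe_ne_zero θ
    have h5 := Circle.coe_ne_zero (B.map y)
    have h6 : (c : ℂ) ≠ 0 := by exact_mod_cast hc0.ne'
    rw [h3] at hc1
    push_cast at hc1 ⊢
    field_simp at hc1 ⊢
    exact hc1.symm

/-- The open books defined by a smooth family of book maps are isotopic. -/
theorem exists_diffeos_of_bookMaps {Φ : ℝ × N → ℂ}
    (hΦ : ContMDiff (𝓘(ℝ, ℝ).prod I) 𝓘(ℝ, ℂ) ∞ Φ)
    (hbook : ∀ t, IsBookMap I (fun x => Φ (t, x))) :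
    ∃ f : ℝ → N ≃ₘ^∞⟮I, I⟯ N, ContMDiff (𝓘(ℝ, ℝ).prod I) I ∞ (fun x : ℝ × N => f x.1 x.2) ∧
      (∀ p, f 0 p = p) ∧ ∀ t B₀ B, IsDefinedBy I B₀ (fun x => Φ (0, x)) →
        IsDefinedBy I B (fun x => Φ (t, x)) → (B₀.image (f t).toEquiv).Same B := by
  obtain ⟨F, G, hF, hG, h0, hGF, hFG, hc⟩ := exists_isotopy_of_bookMaps hΦ hbook
  have hslice : ∀ t : ℝ, ContMDiff I (𝓘(ℝ, ℝ).prod I) ∞ (fun x : N => (t, x)) := fun t =>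
    contMDiff_const.prodMk contMDiff_id
  refine ⟨fun t => ⟨⟨fun x => F (t, x), fun x => G (t, x), hGF t, hFG t⟩, hF.comp (hslice t),
    hG.comp (hslice t)⟩, hF, h0, fun t B₀ B hB₀ hB => ⟨?_, fun p hp => ?_⟩⟩
  · ext p
    constructor
    · rintro ⟨x, hx, rfl⟩
      obtain ⟨c, -, hc1⟩ := hc t x
      exact hB.mem_binding.2 (hc1.trans (by rw [hB₀.mem_binding.1 hx, mul_zero]))
    · intro hp
      obtain ⟨c, hc0, hc1⟩ := hc t (G (t, p))
      refine ⟨G (t, p), hB₀.mem_binding.2 ?_, hFG t p⟩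
      rw [hFG, hB.mem_binding.1 hp] at hc1
      exact (mul_eq_zero.1 hc1.symm).resolve_left (by exact_mod_cast hc0.ne')
  · obtain ⟨c, hc0, hc1⟩ := hc t (G (t, p))
    have hx : G (t, p) ∉ B₀.binding := fun hx => hp ⟨G (t, p), hx, hFG t p⟩
    have hx0 : 0 < ‖Φ (0, G (t, p))‖ := norm_pos_iff.2 fun h0 => hx (hB₀.mem_binding.2 h0)
    rw [hFG, show Φ (0, G (t, p)) = _ from hB₀.2.2.2 _ hx, ← mul_assoc] at hc1
    exact (hB.map_eq (r := c * ‖Φ (0, G (t, p))‖) (mul_pos hc0 hx0)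
      (by push_cast; exact hc1)).2.symm

end Fibrations

lemma exists_ker_frame {n : ℕ} {T F : Type*} [AddCommGroup T] [Module ℝ T]
    [FiniteDimensional ℝ T] [AddCommGroup F] [Module ℝ F] {L : T →ₗ[ℝ] F}
    (hT : finrank ℝ T = finrank ℝ F + n) (hL : Function.Surjective L) :
    ∃ w : Fin n → T, LinearIndependent ℝ w ∧ (∀ i, L (w i) = 0) ∧
      ∀ z, L z = 0 → z ∈ span ℝ (range w) := by
  have hrank := LinearMap.finrank_range_add_finrank_ker L
  rw [LinearMap.range_eq_top.2 hL, finrank_top, hT, Nat.add_left_cancel_iff] at hrank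
  let b := Module.finBasisOfFinrankEq ℝ (LinearMap.ker L) hrank
  refine ⟨fun i => b i, b.linearIndependent.map' (Submodule.subtype _) (Submodule.ker_subtype _),
    fun i => (b i).2, fun z hz => ?_⟩
  have h1 : (⟨z, hz⟩ : LinearMap.ker L) ∈ span ℝ (range b) := by
    rw [b.span_eq]; exact Submodule.mem_top
  have h2 := Submodule.mem_map_of_mem (f := Submodule.subtype _) h1
  rw [Submodule.map_span, ← range_comp] at h2
  exact h2

section ContactForms

variable {E : Type*} [NormedAddCommGroup E] [NormedSpace ℝ E] [FiniteDimensional ℝ E]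
  {H : Type*} [TopologicalSpace H] {I : ModelWithCorners ℝ E H} [I.Boundaryless]
  {N : Type*} [TopologicalSpace N] [ChartedSpace H N] [IsManifold I ∞ N]
  {k : ℕ}

/-- `β ∧ (dβ)^k` vanishes nowhere on the `(2k+1)`-dimensional manifold `N`. -/
structure IsContactForm (k : ℕ) (β : OneForm I N) : Prop where
  dim : finrank ℝ E = 2 * k + 1
  smooth : SmoothForm β
  nondeg : ∀ p, ∀ v : Fin (2 * k + 1) → TangentSpace I p,
    LinearIndependent ℝ v → topForm k (β p) (extD β p) v ≠ 0

variable {β : OneForm I N}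

instance (p : N) : T2Space (TangentSpace I p) := inferInstanceAs (T2Space E)

lemma extDL_swap (β : OneForm I N) (p : N) (x y : TangentSpace I p) :
    extDL β p x y = - extDL β p y x := extD_swap β p x y

lemma extD_self (β : OneForm I N) (p : N) (x : TangentSpace I p) : extD β p x x = 0 := by
  linarith [extD_swap β p x x]

lemma exists_frame (hE : finrank ℝ E = 2 * k + 1) (p : N) :
    ∃ v : Fin (2 * k + 1) → TangentSpace I p, LinearIndependent ℝ v ∧
      span ℝ (range v) = ⊤ :=
  let b : Module.Basis (Fin (2 * k + 1)) ℝ E := Module.finBasisOfFinrankEq ℝ E hE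
  ⟨b, b.linearIndependent, b.span_eq⟩

namespace IsContactForm

variable (h : IsContactForm k β)
include h

lemma eq_zero {p : N} {x : TangentSpace I p} (hx : β p x = 0)
    (hΩ : ∀ y, β p y = 0 → extD β p x y = 0) : x = 0 := by
  obtain ⟨v, hv, hs⟩ := exists_frame (I := I) h.dim p
  exact eq_zero_of_topForm_ne_zero (a := (β p : TangentSpace I p →ₗ[ℝ] ℝ)) (Ω := extDL β p)
    (extDL_swap β p) (h.nondeg p v hv) (hs ▸ Submodule.mem_top) hx fun y _ hy => hΩ y hy

lemma exists_reeb (p : N) : ∃ r, β p r = 1 ∧ ∀ y, extD β p r y = 0 := by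
  obtain ⟨v, hv, hs⟩ := exists_frame (I := I) h.dim p
  obtain ⟨⟨r, -, hr1, hr2⟩, -⟩ := exists_reeb_and_hamiltonian
    (a := (β p : TangentSpace I p →ₗ[ℝ] ℝ)) (Ω := extDL β p) (extDL_swap β p) (h.nondeg p v hv)
  exact ⟨r, hr1, fun y => hr2 y (hs ▸ Submodule.mem_top)⟩

lemma exists_hamiltonian (p : N) (c : ℝ) (ℓ : TangentSpace I p →ₗ[ℝ] ℝ) :
    ∃ x, β p x = c ∧ ∀ y, β p y = 0 → extD β p x y = ℓ y := by
  obtain ⟨v, hv, hs⟩ := exists_frame (I := I) h.dim p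
  obtain ⟨-, h2⟩ := exists_reeb_and_hamiltonian
    (a := (β p : TangentSpace I p →ₗ[ℝ] ℝ)) (Ω := extDL β p) (extDL_swap β p) (h.nondeg p v hv)
  obtain ⟨x, -, hx, hx2⟩ := h2 c ℓ
  exact ⟨x, hx, fun y hy => hx2 y (hs ▸ Submodule.mem_top) hy⟩

/-- The Reeb vector field. -/
def reeb (p : N) : TangentSpace I p := (h.exists_reeb p).choose

lemma apply_reeb (p : N) : β p (h.reeb p) = 1 := (h.exists_reeb p).choose_spec.1

lemma extD_reeb (p : N) (y : TangentSpace I p) : extD β p (h.reeb p) y = 0 :=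
  (h.exists_reeb p).choose_spec.2 y

/-- The contact Hamiltonian vector field of `u`. -/
def ham (u : N → ℝ) (p : N) : TangentSpace I p :=
  (h.exists_hamiltonian p (u p) (-vderiv I u p : TangentSpace I p →L[ℝ] ℝ)).choose

lemma apply_ham (u : N → ℝ) (p : N) : β p (h.ham u p) = u p :=
  (h.exists_hamiltonian p (u p) (-vderiv I u p : TangentSpace I p →L[ℝ] ℝ)).choose_spec.1

lemma extD_ham_of_mem (u : N → ℝ) (p : N) {y : TangentSpace I p} (hy : β p y = 0) :
    extD β p (h.ham u p) y = - vderiv I u p y :=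
  (h.exists_hamiltonian p (u p) (-vderiv I u p : TangentSpace I p →L[ℝ] ℝ)).choose_spec.2 y hy

lemma extD_of_mem {p : N} {x : TangentSpace I p} {ℓ : TangentSpace I p →L[ℝ] ℝ}
    (hx : ∀ y, β p y = 0 → extD β p x y = - ℓ y) (y : TangentSpace I p) :
    extD β p x y = ℓ (h.reeb p) * β p y - ℓ y := by
  have h1 : β p (y - β p y • h.reeb p) = 0 := by
    rw [map_sub, map_smul, h.apply_reeb, smul_eq_mul, mul_one, sub_self]
  have h2 := hx _ h1
  have h3 : extD β p x (h.reeb p) = 0 := by rw [extD_swap, h.extD_reeb, neg_zero]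
  rw [← extDL_apply] at h2 h3 ⊢
  rw [map_sub, map_smul, h3, smul_zero, sub_zero, map_sub, map_smul] at h2
  rw [h2, smul_eq_mul]; ring

lemma extD_ham (u : N → ℝ) (p : N) (y : TangentSpace I p) :
    extD β p (h.ham u p) y = vderiv I u p (h.reeb p) * β p y - vderiv I u p y :=
  h.extD_of_mem (ℓ := vderiv I u p) (fun _ => h.extD_ham_of_mem u p) y

lemma vderiv_ham_self (u : N → ℝ) (p : N) :
    vderiv I u p (h.ham u p) = u p * vderiv I u p (h.reeb p) := by
  have h1 := h.extD_ham u p (h.ham u p)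
  rw [extD_self, h.apply_ham] at h1
  linarith

lemma vderiv_ham_swap (u v : N → ℝ) (p : N) :
    vderiv I u p (h.ham v p) = v p * vderiv I u p (h.reeb p) + u p * vderiv I v p (h.reeb p)
      - vderiv I v p (h.ham u p) := by
  have h1 := h.extD_ham u p (h.ham v p)
  have h2 := h.extD_ham v p (h.ham u p)
  have h3 := extD_swap β p (h.ham u p) (h.ham v p)
  rw [h.apply_ham] at h1 h2
  linarith

lemma eq_ham {u : N → ℝ} {p : N} {x : TangentSpace I p} (hx : β p x = u p)
    (hΩ : ∀ y, β p y = 0 → extD β p x y = - vderiv I u p y) : x = h.ham u p := by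
  rw [← sub_eq_zero]
  refine h.eq_zero (by rw [map_sub, hx, h.apply_ham, sub_self]) fun y hy => ?_
  have h1 := hΩ y hy
  have h2 := h.extD_ham_of_mem u p hy
  rw [← extDL_apply] at h1 h2 ⊢
  rw [map_sub, LinearMap.sub_apply, h1, h2, sub_self]

/-- Smoothness of a vector field can be tested after the isomorphism `x ↦ dβ(x, ·) + β(x) β`. -/
lemma smoothFieldAt_of_dual {W : ∀ p : N, TangentSpace I p}
    (hW : ∀ p, ∀ Z : ∀ p : N, TangentSpace I p, SmoothFieldAt Z p →
      ContMDiffAt I 𝓘(ℝ, ℝ) ∞ (fun q => extD β q (W q) (Z q) + β q (W q) * β q (Z q)) p)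
    (p₀ : N) : SmoothFieldAt W p₀ := by
  let e := trivializationAt E (TangentSpace I : N → Type _) p₀
  let Bil : ∀ p : N, TangentSpace I p →ₗ[ℝ] TangentSpace I p →ₗ[ℝ] ℝ := fun p =>
    extDL β p + (β p : TangentSpace I p →ₗ[ℝ] ℝ).smulRight (β p : TangentSpace I p →ₗ[ℝ] ℝ)
  let A : ∀ p : N, TangentSpace I p →L[ℝ] (E →L[ℝ] ℝ) := fun p =>
    LinearMap.toContinuousLinearMap
      ((LinearMap.toContinuousLinearMap : (E →ₗ[ℝ] ℝ) ≃ₗ[ℝ] (E →L[ℝ] ℝ)).toLinearMap ∘ₗ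
        (LinearMap.lcomp ℝ ℝ (e.symmL ℝ p : E →ₗ[ℝ] TangentSpace I p)) ∘ₗ Bil p)
  have hA : ∀ p (x : TangentSpace I p) (v : E), A p x v =
      extD β p x (localField p₀ (fun _ => v) p) + β p x * β p (localField p₀ (fun _ => v) p) :=
    fun p x v => rfl
  have hsm : ∀ X : ∀ p : N, TangentSpace I p, ∀ p ∈ e.baseSet,
      (∀ Z : ∀ p : N, TangentSpace I p, SmoothFieldAt Z p → ContMDiffAt I 𝓘(ℝ, ℝ) ∞
        (fun q => extD β q (X q) (Z q) + β q (X q) * β q (Z q)) p) →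
      ContMDiffAt I 𝓘(ℝ, E →L[ℝ] ℝ) ∞ (fun q => A q (X q)) p := fun X p hp hX =>
    contMDiffAt_clm_apply fun v => by
      simp only [hA]
      exact hX _ (smoothFieldAt_localField hp contMDiffAt_const)
  refine smoothFieldAt_of_bijective e.open_baseSet (A := A) (fun p hp X hX => hsm X p hp
    fun Z hZ => (h.smooth.contMDiffAt_extD hX hZ).add
      ((h.smooth.smoothMapAt p X hX).mul (h.smooth.smoothMapAt p Z hZ)))
    (mem_baseSet_trivializationAt_self p₀) ?_ fun p hp => hsm W p hp (hW p)
  have hinj : Function.Injective (A p₀) := by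
    rw [injective_iff_map_eq_zero]
    intro x hx
    have h1 : ∀ z, extD β p₀ x z + β p₀ x * β p₀ z = 0 := fun z => by
      obtain ⟨v, hv⟩ := exists_localField_eq p₀ z
      have := congrArg (fun L : E →L[ℝ] ℝ => L v) hx
      rw [← hv]
      exact (hA p₀ x v).symm.trans this
    have h2 : β p₀ x = 0 := by
      have := h1 x
      rw [extD_self, zero_add] at this
      exact mul_self_eq_zero.1 this
    exact h.eq_zero h2 fun y _ => by simpa [h2] using h1 y
  have hdim : finrank ℝ (TangentSpace I p₀) = finrank ℝ (E →L[ℝ] ℝ) := by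
    have h1 : finrank ℝ (E →L[ℝ] ℝ) = finrank ℝ (E →ₗ[ℝ] ℝ) :=
      (LinearMap.toContinuousLinearMap : (E →ₗ[ℝ] ℝ) ≃ₗ[ℝ] (E →L[ℝ] ℝ)).finrank_eq.symm
    rw [h1]
    exact (Subspace.dual_finrank_eq (K := ℝ) (V := E)).symm
  exact ⟨hinj, (LinearMap.injective_iff_surjective_of_finrank_eq_finrank hdim
    (f := (A p₀ : TangentSpace I p₀ →ₗ[ℝ] (E →L[ℝ] ℝ)))).1 hinj⟩

lemma smooth_reeb : SmoothField h.reeb := h.smoothFieldAt_of_dual fun p Z hZ => by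
  simp only [h.extD_reeb, h.apply_reeb, zero_add, one_mul]
  exact h.smooth.smoothMapAt p Z hZ

lemma smooth_ham {u : N → ℝ} (hu : ContMDiff I 𝓘(ℝ, ℝ) ∞ u) : SmoothField (h.ham u) :=
  h.smoothFieldAt_of_dual fun p Z hZ => by
    simp only [h.extD_ham, h.apply_ham]
    have hβ := h.smooth.smoothMapAt p Z hZ
    exact (((contMDiffAt_vderiv (hu p) _ (h.smooth_reeb p)).mul hβ).sub
      (contMDiffAt_vderiv (hu p) Z hZ)).add ((hu p).mul hβ)

lemma contMDiff_vderiv {u : N → ℝ} (hu : ContMDiff I 𝓘(ℝ, ℝ) ∞ u)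
    {X : ∀ p : N, TangentSpace I p} (hX : SmoothField X) :
    ContMDiff I 𝓘(ℝ, ℝ) ∞ (fun p => vderiv I u p (X p)) := fun p =>
  contMDiffAt_vderiv (hu p) X (hX p)

end IsContactForm

/-- Two forms defining the same cooriented field are proportional. -/
lemma exists_factor_of_defines {α γ : OneForm I N} {η : HyperplaneField I N} (hα : Defines α η)
    (hγ : Defines γ η) :
    ∃ c : N → ℝ, ContMDiff I 𝓘(ℝ, ℝ) ∞ c ∧ (∀ p, 0 < c p) ∧ γ = fun p => c p • α p := by
  have hs : ∀ p x, 0 < γ p x ↔ 0 < α p x := fun p x =>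
    Set.ext_iff.1 (congrFun (hγ.2.2.symm.trans hα.2.2) p) x
  have hsurj : ∀ p, Function.Surjective (α p) := fun p y => by
    obtain ⟨x, hx⟩ : ∃ x, α p x ≠ 0 := by
      by_contra hcon
      push Not at hcon
      exact hα.2.1 p (ContinuousLinearMap.ext hcon)
    exact ⟨(y / α p x) • x, by rw [map_smul, smul_eq_mul, div_mul_cancel₀ _ hx]⟩
  choose Z hZ using fun p => hsurj p 1
  have hker : ∀ p y, α p y = 0 → γ p y = 0 := fun p y hy => by
    by_contra hne
    rcases lt_or_gt_of_ne hne with hlt | hgt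
    · have := (hs p (-y)).1 (by rw [map_neg]; linarith)
      rw [map_neg, hy] at this; linarith
    · have := (hs p y).1 hgt; linarith
  have heq : ∀ p x, γ p x = γ p (Z p) * α p x := fun p x => by
    have h1 := hker p (x - α p x • Z p) (by
      rw [map_sub, map_smul, hZ, smul_eq_mul, mul_one, sub_self])
    rw [map_sub, map_smul, smul_eq_mul] at h1
    linarith
  refine ⟨fun p => γ p (Z p), fun p => ?_, fun p => (hs p _).2 (by rw [hZ]; exact one_pos), ?_⟩
  · obtain ⟨U, -, hU, hpU, -, Y, -, hY⟩ := exists_local_solution isOpen_univ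
      (fun p _ => hα.1.smoothMapAt p) (mem_univ p) (hsurj p) (y := fun _ => 1)
      (fun _ _ => contMDiffAt_const) (Z p) (hZ p)
    refine (hγ.1.smoothMapAt p Y (hY p hpU).1).congr_of_eventuallyEq ?_
    filter_upwards [hU.mem_nhds hpU] with q hq
    rw [heq q (Y q), (hY q hq).2, mul_one]
  · funext p
    exact ContinuousLinearMap.ext (heq p)

lemma IsContactForm.defines (h : IsContactForm k β) : Defines β (cokernel β) :=
  ⟨h.smooth, fun p h0 => by
    have := h.apply_reeb p
    rw [h0] at this
    exact zero_ne_one this, rfl⟩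

/-- Rescaling a one-form. -/
lemma topForm_rescale (hβ : SmoothForm β) {c : N → ℝ} (hc : ContMDiff I 𝓘(ℝ, ℝ) ∞ c) (m : ℕ) (p : N)
    (v : Fin (2 * m + 1) → TangentSpace I p) :
    topForm m ((fun p => c p • β p : OneForm I N) p) (extD (fun p => c p • β p) p) v =
      c p ^ (m + 1) * topForm m (β p) (extD β p) v :=
  topForm_conformal (a := (β p : TangentSpace I p →ₗ[ℝ] ℝ)) (Ω := extDL β p)
    (a' := (c p • β p : TangentSpace I p →L[ℝ] ℝ)) (Ω' := extDL (fun p => c p • β p) p)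
    (fun x => rfl) (fun x y hx hy => by
      rw [extDL_apply, extD_smul (hc p) hβ]
      rw [show β p x = 0 from hx, show β p y = 0 from hy]
      simp [extDL_apply]) v

lemma IsContactForm.rescale (h : IsContactForm k β) {c : N → ℝ}
    (hc : ContMDiff I 𝓘(ℝ, ℝ) ∞ c) (hpos : ∀ p, 0 < c p) :
    IsContactForm k (fun p => c p • β p : OneForm I N) :=
  ⟨h.dim, h.smooth.smul hc, fun p v hv => by
    rw [topForm_rescale h.smooth hc]
    exact mul_ne_zero (pow_pos (hpos p) _).ne' (h.nondeg p v hv)⟩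

/-- The orientation of the zero set in terms of Hamiltonian vectors. -/
lemma IsContactForm.normalSign_eq {m : ℕ} (h : IsContactForm (m + 1) β) {p : N}
    (L : TangentSpace I p →L[ℝ] ℂ)
    {y₁ y₂ z₁ z₂ : TangentSpace I p} {w : Fin (2 * m + 1) → TangentSpace I p}
    (hy₁ : β p y₁ = 0) (hy₂ : β p y₂ = 0)
    (h₁ : ∀ y, β p y = 0 → extD β p y₁ y = - (L y).re)
    (h₂ : ∀ y, β p y = 0 → extD β p y₂ y = - (L y).im)
    (hκ : extD β p y₁ y₂ ≠ 0) (hw : LinearIndependent ℝ w) (hwL : ∀ i, L (w i) = 0)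
    (hz : 0 < (conj (L z₁) * L z₂).im) :
    ∃ c : ℝ, 0 < c ∧ normalSign m β p z₁ z₂ w = c * extD β p y₁ y₂ := by
  set κ := extD β p y₁ y₂ with hκdef
  have hLy₁ : L y₁ = ⟨0, κ⟩ := by
    apply Complex.ext
    · have := h₁ y₁ hy₁; rw [extD_self] at this; simpa using this
    · have := h₂ y₁ hy₁; rw [extD_swap] at this; simp only; linarith
  have hLy₂ : L y₂ = ⟨-κ, 0⟩ := by
    apply Complex.ext
    · have := h₁ y₂ hy₂; simp only; linarith
    · have := h₂ y₂ hy₂; rw [extD_self] at this; simpa using this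
  have hker : ∀ z, L z = 0 ↔ z ∈ span ℝ (range w) := by
    let K := LinearMap.ker (L : TangentSpace I p →ₗ[ℝ] ℂ)
    have hle : span ℝ (range w) ≤ K := Submodule.span_le.2 (by
      rintro _ ⟨i, rfl⟩; exact hwL i)
    have hsurj : Function.Surjective (L : TangentSpace I p →ₗ[ℝ] ℂ) := fun z =>
      ⟨(z.im / κ) • y₁ + (-z.re / κ) • y₂, by
        change L _ = z
        rw [map_add, map_smul, map_smul, hLy₁, hLy₂]
        apply Complex.ext <;> simp <;> field_simp⟩
    have hrank := LinearMap.finrank_range_add_finrank_ker (L : TangentSpace I p →ₗ[ℝ] ℂ)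
    rw [LinearMap.range_eq_top.2 hsurj, finrank_top, Complex.finrank_real_complex,
      show finrank ℝ (TangentSpace I p) = 2 * (m + 1) + 1 from h.dim] at hrank
    have hK : finrank ℝ K = 2 * m + 1 := by
      change 2 + finrank ℝ K = _ at hrank
      omega
    have heq : span ℝ (range w) = K := Submodule.eq_of_le_of_finrank_eq hle (by
      rw [finrank_span_eq_card hw, Fintype.card_fin]; exact hK.symm)
    intro z
    rw [heq]; rfl
  have hdecomp : ∀ z, ∃ s ∈ span ℝ (range w),
      z = ((L z).im / κ) • y₁ + (-(L z).re / κ) • y₂ + s := fun z => by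
    refine ⟨z - (((L z).im / κ) • y₁ + (-(L z).re / κ) • y₂), (hker _).1 ?_, by abel⟩
    rw [map_sub, map_add, map_smul, map_smul, hLy₁, hLy₂]
    apply Complex.ext <;> simp <;> field_simp <;> ring
  obtain ⟨s₁, hs₁, hz₁⟩ := hdecomp z₁
  obtain ⟨s₂, hs₂, hz₂⟩ := hdecomp z₂
  let Al := topAlt (m + 1) (β p : TangentSpace I p →ₗ[ℝ] ℝ) (extDL β p)
  have e1 : topForm (m + 1) (β p) (extD β p) (cons₂ z₁ z₂ w) = _ :=
    (topAlt_apply (m + 1) (β p : TangentSpace I p →ₗ[ℝ] ℝ) (extDL β p) _).symm.trans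
      (alternating_cons₂_change Al hs₁ hs₂ hz₁ hz₂)
  have e2 : Al (cons₂ y₁ y₂ w) = 2 * (m + 1) * (κ * topForm m (β p) (extD β p) w) :=
    (topAlt_apply (m + 1) (β p : TangentSpace I p →ₗ[ℝ] ℝ) (extDL β p) _).trans
      (topForm_cons₂_span (extDL_swap β p) hw hy₁ hy₂
        (fun y hy hβ => (h₁ y hβ).trans (by rw [(hker y).2 hy]; simp)))
  have hdet : (L z₁).im / κ * (-(L z₂).re / κ) - -(L z₁).re / κ * ((L z₂).im / κ) =
      (conj (L z₁) * L z₂).im / κ ^ 2 := by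
    simp; field_simp; ring
  have ht : topForm m (β p) (extD β p) w ≠ 0 := by
    intro h0
    rw [h0, mul_zero, mul_zero] at e2
    have hne : topForm (m + 1) (β p) (extD β p) (cons₂ z₁ z₂ w) ≠ 0 := by
      refine h.nondeg p _ ?_
      have hind : LinearIndependent ℝ (Matrix.vecCons z₂ w) :=
        linearIndependent_finCons.2 ⟨hw, fun hmem => by
          rw [(hker z₂).2 hmem, mul_zero, Complex.zero_im] at hz; exact lt_irrefl _ hz⟩
      refine linearIndependent_finCons.2 ⟨hind, fun hmem => ?_⟩
      rw [show range (Matrix.vecCons z₂ w) = insert z₂ (range w) from Matrix.range_cons _ _ |>.trans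
        (by rw [singleton_union]), Submodule.mem_span_insert] at hmem
      obtain ⟨a, s, hs, hz⟩ := hmem
      have h3 : L z₁ = a * L z₂ := by
        rw [hz, map_add, (hker s).2 hs, add_zero, map_smul, Complex.real_smul]
      rename_i hz'
      rw [h3] at hz'
      rw [map_mul, Complex.conj_ofReal, mul_assoc, Complex.im_ofReal_mul, ← Complex.normSq_eq_conj_mul_self,
        Complex.ofReal_im, mul_zero] at hz'
      exact lt_irrefl _ hz'
    rw [e1, e2, mul_zero] at hne
    exact hne rfl
  refine ⟨(conj (L z₁) * L z₂).im / κ ^ 2 * (2 * (m + 1)) *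
    (topForm m (β p) (extD β p) w) ^ 2, by positivity, ?_⟩
  rw [normalSign, e1, e2, hdet]
  ring

end ContactForms

section ComplexParts

variable {E : Type*} [NormedAddCommGroup E] [NormedSpace ℝ E]
  {H : Type*} [TopologicalSpace H] {I : ModelWithCorners ℝ E H}
  {N : Type*} [TopologicalSpace N] [ChartedSpace H N] [I.Boundaryless] [IsManifold I ∞ N]

lemma vderiv_re {Φ : N → ℂ} {p : N} (hΦ : MDifferentiableAt I 𝓘(ℝ, ℂ) Φ p)
    (v : TangentSpace I p) : vderiv I (fun q => (Φ q).re) p v = (vderiv I Φ p v).re :=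
  (vderiv_comp (g := fun z => Complex.reCLM z) (Complex.reCLM.differentiableAt) hΦ v).trans
    (by rw [Complex.reCLM.fderiv]; rfl)

lemma vderiv_im {Φ : N → ℂ} {p : N} (hΦ : MDifferentiableAt I 𝓘(ℝ, ℂ) Φ p)
    (v : TangentSpace I p) : vderiv I (fun q => (Φ q).im) p v = (vderiv I Φ p v).im :=
  (vderiv_comp (g := fun z => Complex.imCLM z) (Complex.imCLM.differentiableAt) hΦ v).trans
    (by rw [Complex.imCLM.fderiv]; rfl)

lemma contMDiff_re {Φ : N → ℂ} (hΦ : ContMDiff I 𝓘(ℝ, ℂ) ∞ Φ) :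
    ContMDiff I 𝓘(ℝ, ℝ) ∞ (fun q => (Φ q).re) := Complex.reCLM.contDiff.contMDiff.comp hΦ

lemma contMDiff_im {Φ : N → ℂ} (hΦ : ContMDiff I 𝓘(ℝ, ℂ) ∞ Φ) :
    ContMDiff I 𝓘(ℝ, ℝ) ∞ (fun q => (Φ q).im) := Complex.imCLM.contDiff.contMDiff.comp hΦ

/-- Two real-linear surjections to `ℂ` whose values always have the same direction. -/
lemma exists_pos_factor {T : Type*} [AddCommGroup T] [Module ℝ T] (L L' : T →ₗ[ℝ] ℂ)
    (hL : Function.Surjective L) (hL' : Function.Surjective L')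
    (h : ∀ v, 0 ≤ (L' v * conj (L v)).re ∧ (L' v * conj (L v)).im = 0) :
    ∃ c : ℝ, 0 < c ∧ ∀ v, L' v = c * L v := by
  have hker : ∀ v, L v = 0 → L' v = 0 := fun v hv => by
    obtain ⟨u, hu⟩ := hL 1
    have h1 : ∀ s : ℝ, 0 ≤ (L' u).re + s * (L' v).re ∧ (L' u).im + s * (L' v).im = 0 := fun s => by
      have := h (u + s • v)
      simpa [hu, hv] using this
    have hre : (L' v).re = 0 := by
      by_contra hne
      have := (h1 (-((L' u).re + 1) / (L' v).re)).1
      rw [div_mul_cancel₀ _ hne] at this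
      linarith
    have him : (L' v).im = 0 := by linarith [(h1 0).2, (h1 1).2]
    exact Complex.ext hre him
  obtain ⟨u₁, h₁⟩ := hL 1
  obtain ⟨u₂, h₂⟩ := hL Complex.I
  have hform : ∀ v, L' v = (L v).re • L' u₁ + (L v).im • L' u₂ := fun v => by
    have := hker (v - (L v).re • u₁ - (L v).im • u₂) (by
      rw [map_sub, map_sub, map_smul, map_smul, h₁, h₂]
      apply Complex.ext <;> simp)
    rw [map_sub, map_sub, map_smul, map_smul] at this
    rw [sub_sub, sub_eq_zero] at this
    exact this
  have e₁ := h u₁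
  have e₂ := h u₂
  have e₃ := h (u₁ + u₂)
  simp [h₁, h₂] at e₁ e₂ e₃
  have hc : ∀ v, L' v = ((L' u₁).re : ℂ) * L v := fun v => by
    rw [hform v]
    apply Complex.ext
    · simp; rw [e₂.2]; ring
    · simp; rw [e₁.2, show (L' u₂).im = (L' u₁).re by linarith [e₃.2, e₁.2, e₂.2]]; ring
  refine ⟨(L' u₁).re, lt_of_le_of_ne e₁.1 fun h0 => ?_, hc⟩
  obtain ⟨v, hv⟩ := hL' 1
  rw [hc, ← h0] at hv
  simp at hv

/-- Functions defining the same open book are positively proportional to first order on the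
binding. -/
lemma vderiv_eq_of_isDefinedBy {B : OpenBook N} {Φ Φ' : N → ℂ} (h : IsDefinedBy I B Φ)
    (h' : IsDefinedBy I B Φ') {p : N} (hp : Φ p = 0) :
    ∃ c : ℝ, 0 < c ∧ ∀ v, vderiv I Φ' p v = c * vderiv I Φ p v := by
  have hp' : Φ' p = 0 := h'.mem_binding.1 (h.mem_binding.2 hp)
  have hdir : ∀ q, 0 ≤ (Φ' q * conj (Φ q)).re ∧ (Φ' q * conj (Φ q)).im = 0 := by
    intro q
    by_cases hq : q ∈ B.binding
    · rw [h.mem_binding.1 hq]; simp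
    · rw [h.2.2.2 q hq, h'.2.2.2 q hq]
      have : (‖Φ' q‖ : ℂ) * (B.map q : ℂ) * conj ((‖Φ q‖ : ℂ) * (B.map q : ℂ)) =
          ((‖Φ' q‖ * ‖Φ q‖ : ℝ) : ℂ) := by
        rw [map_mul, Complex.conj_ofReal, mul_mul_mul_comm, Complex.mul_conj,
          Complex.normSq_eq_norm_sq, Circle.norm_coe]
        push_cast; ring
      rw [this, Complex.ofReal_re, Complex.ofReal_im]
      exact ⟨by positivity, rfl⟩
  refine exists_pos_factor (vderiv I Φ p : TangentSpace I p →ₗ[ℝ] ℂ)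
    (vderiv I Φ' p : TangentSpace I p →ₗ[ℝ] ℂ) (h.2.1 p hp) (h'.2.1 p hp') fun v => ?_
  have hline : ∀ {Ψ : N → ℂ}, ContMDiff I 𝓘(ℝ, ℂ) ∞ Ψ → Ψ p = 0 →
      Filter.Tendsto (fun t : ℝ => t⁻¹ • Ψ ((extChartAt I p).symm
        (extChartAt I p p + t • vderiv I (extChartAt I p) p v))) (nhdsWithin 0 {0}ᶜ)
        (nhds (vderiv I Ψ p v)) := fun {Ψ} hΨ h0 => by
    have hd : DifferentiableAt ℝ (Ψ ∘ (extChartAt I p).symm) (extChartAt I p p) :=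
      (contMDiffAt_comp_extChartAt_symm (hΨ p)).differentiableAt (by simp)
    rw [vderiv_eq_fderiv_chart hd]
    have := (hd.hasFDerivAt.hasLineDerivAt (vderiv I (extChartAt I p) p v)).tendsto_slope_zero
    simpa [h0] using this
  have hlim := (hline h'.1 hp').mul ((Complex.continuous_conj.tendsto _).comp (hline h.1 hp))
  have hcl : IsClosed {z : ℂ | 0 ≤ z.re ∧ z.im = 0} :=
    (isClosed_le continuous_const Complex.continuous_re).inter
      (isClosed_eq Complex.continuous_im continuous_const)
  refine hcl.mem_of_tendsto hlim (.of_forall fun t => ?_)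
  have h3 := hdir ((extChartAt I p).symm
        (extChartAt I p p + t • vderiv I (extChartAt I p) p v))
  simp only [Function.comp_apply, Complex.real_smul, map_mul, Complex.conj_ofReal, Set.mem_ofPred_eq]
  rw [mul_mul_mul_comm, ← Complex.ofReal_mul, Complex.re_ofReal_mul, Complex.im_ofReal_mul, h3.2]
  exact ⟨mul_nonneg (mul_self_nonneg _) h3.1, mul_zero _⟩

end ComplexParts

section AdaptedForms

variable {E : Type*} [NormedAddCommGroup E] [NormedSpace ℝ E] [FiniteDimensional ℝ E]
  {H : Type*} [TopologicalSpace H] {I : ModelWithCorners ℝ E H} [I.Boundaryless]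
  {N : Type*} [TopologicalSpace N] [ChartedSpace H N] [IsManifold I ∞ N]
  {k : ℕ} {β : OneForm I N}

/-- Positivity of the binding can be checked on one defining function and one contact form. -/
lemma IsContactForm.bindingPositive_congr (h : IsContactForm k β) {B : OpenBook N} {Φ Φ' : N → ℂ}
    (hΦ : IsDefinedBy I B Φ) (hΦ' : IsDefinedBy I B Φ') {γ : OneForm I N}
    (hγ : Defines γ (cokernel β)) (hpos : BindingPositive k Φ β) : BindingPositive k Φ' γ := by
  obtain ⟨c, hc, hcpos, rfl⟩ := exists_factor_of_defines h.defines hγ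
  intro p hp m hm z₁ z₂ w hw
  have hp0 : Φ p = 0 := hΦ.mem_binding.1 (hΦ'.mem_binding.2 hp)
  obtain ⟨r, hr, hrv⟩ := vderiv_eq_of_isDefinedBy hΦ hΦ' hp0
  have hr' : (r : ℂ) ≠ 0 := by exact_mod_cast hr.ne'
  have h1 := hpos p hp0 m hm z₁ z₂ w ⟨hw.1, fun i => ?_, ?_⟩
  · rw [normalSign, topForm_rescale h.smooth hc, topForm_rescale h.smooth hc]
    rw [normalSign] at h1
    have := mul_pos (mul_pos (pow_pos (hcpos p) (m + 1)) (pow_pos (hcpos p) (m + 1 + 1))) h1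
    linarith [this]
  · have h2 : vderiv I Φ' p (w i) = 0 := hw.2.1 i
    rw [hrv] at h2
    exact (mul_eq_zero.1 h2).resolve_left hr'
  · have h2 : 0 < (conj (vderiv I Φ' p z₁) * vderiv I Φ' p z₂).im := hw.2.2
    rw [hrv, hrv, map_mul, Complex.conj_ofReal, mul_mul_mul_comm, ← Complex.ofReal_mul,
      Complex.im_ofReal_mul] at h2
    exact (mul_pos_iff_of_pos_left (mul_pos hr hr)).1 h2

/-- If the Hamiltonian field of `u > 0` is positively transverse to the pages then `β / u` is
adapted. -/
lemma IsContactForm.isAdaptedForm_of_ham (h : IsContactForm k β) {u : N → ℝ}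
    (hu : ContMDiff I 𝓘(ℝ, ℝ) ∞ u) (hpos : ∀ p, 0 < u p) {B : OpenBook N} {Φ : N → ℂ}
    (hB : IsDefinedBy I B Φ) (harg : ∀ p, Φ p ≠ 0 → 0 < argDeriv I Φ p (h.ham u p)) :
    IsAdaptedForm k (cokernel β) B (fun p => (u p)⁻¹ • β p) := by
  have hc : ContMDiff I 𝓘(ℝ, ℝ) ∞ fun p => (u p)⁻¹ := fun p =>
    ((contDiffAt_inv ℝ (hpos p).ne').contMDiffAt).comp p (hu p)
  have hcpos : ∀ p, 0 < (u p)⁻¹ := fun p => inv_pos.2 (hpos p)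
  have h' := h.rescale hc hcpos
  refine ⟨⟨h'.smooth, h'.defines.2.1, ?_⟩, fun p hp v hv => ?_⟩
  · funext p
    ext x
    exact (mul_pos_iff_of_pos_left (hcpos p)).symm
  · have hspan : ∀ x, x ∈ span ℝ (range v) := fun x => by
      rw [hv.span_eq_top_of_card_eq_finrank' (by
        rw [Fintype.card_fin]; exact h.dim.symm)]
      exact Submodule.mem_top
    have hdu : MDifferentiableAt I 𝓘(ℝ, ℝ) u p := (hu p).mdifferentiableAt (by simp)
    have hdc : MDifferentiableAt I 𝓘(ℝ, ℝ) (fun p => (u p)⁻¹) p := (hc p).mdifferentiableAt (by simp)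
    have hprod : ∀ x, (u p)⁻¹ * vderiv I u p x + u p * vderiv I (fun p => (u p)⁻¹) p x = 0 := fun x => by
      rw [← vderiv_mul hdc hdu, vderiv_congr (g := fun _ => (1 : ℝ))
        (.of_forall fun q => inv_mul_cancel₀ (hpos q).ne'), vderiv_const]
    have hr1 : (u p)⁻¹ * β p (h.ham u p) = 1 := by
      rw [h.apply_ham, inv_mul_cancel₀ (hpos p).ne']
    have hrΩ : ∀ y, extD (fun p => (u p)⁻¹ • β p) p (h.ham u p) y = 0 := fun y => by
      rw [extD_smul (hc p) h.smooth, h.extD_ham, h.apply_ham]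
      have e1 := hprod (h.ham u p)
      have e2 := hprod y
      rw [h.vderiv_ham_self] at e1
      have hne := (hpos p).ne'
      have e3 : vderiv I (fun p => (u p)⁻¹) p (h.ham u p) =
          - ((u p)⁻¹ * vderiv I u p (h.reeb p)) :=
        mul_left_cancel₀ hne (by linarith)
      rw [e3]
      linarith
    have e := topForm_eq_reeb_mul (a := ((u p)⁻¹ • β p : TangentSpace I p →L[ℝ] ℝ))
      (Ω := extDL (fun p => (u p)⁻¹ • β p) p) (extDL_swap _ p) hv (hspan (h.ham u p)) hr1
      (fun y _ => hrΩ y) (angularForm I B.map p : TangentSpace I p →ₗ[ℝ] ℝ)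
    have h0 : Φ p ≠ 0 := fun h0 => hp (hB.mem_binding.2 h0)
    have hang : 0 < angularForm I B.map p (h.ham u p) := by
      rw [angularForm_of_polar (hB.1 p) h0 (by
        filter_upwards [hB.isClosed_binding.isOpen_compl.mem_nhds hp] with q hq
        exact hB.2.2.2 q hq)]
      exact div_pos (harg p h0) (by positivity)
    have hne := h'.nondeg p v hv
    refine lt_of_lt_of_eq (mul_pos hang (mul_self_pos.2 hne)) ?_
    refine Eq.trans (mul_assoc _ _ _).symm ?_
    exact congrArg (· * topForm k ((u p)⁻¹ • β p : TangentSpace I p →L[ℝ] ℝ)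
      (extD (fun p => (u p)⁻¹ • β p) p) v) e.symm

end AdaptedForms

section AdaptedCriterion

lemma exists_bound_of_continuous {X : Type*} [TopologicalSpace X] [CompactSpace X] {u : X → ℝ}
    (hu : Continuous u) : ∃ C : ℝ, 0 ≤ C ∧ ∀ x, |u x| ≤ C := by
  obtain ⟨C, hC⟩ := isCompact_univ.exists_bound_of_continuousOn hu.continuousOn
  exact ⟨max C 0, le_max_right _ _, fun x => (hC x (mem_univ x)).trans (le_max_left _ _)⟩

lemma smoothing_inequality {q w s D d R T C₁ C₃ W : ℝ} (hq : 0 < q) (hw : 0 < w) (hs : 0 < s)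
    (hws : w ^ 2 = q + s ^ 2) (hW : w ≤ W) (hd : d ≤ D) (hC₁ : 0 ≤ C₁)
    (hR : R ^ 2 ≤ C₁ ^ 2 * q) (hT : |T| ≤ C₃ * q) (hsmall : s * (C₁ + W * C₃) < d) :
    0 < q * D + s ^ 2 * R - s * w * R - s * w * T := by
  have hws' : s < w := by nlinarith
  have h1 : |R| ≤ C₁ * w := abs_le_of_sq_le_sq (by nlinarith [mul_nonneg (sq_nonneg C₁) (sq_nonneg s)])
    (by positivity)
  have h2 : (w - s) * |R| ≤ C₁ * q := by
    have h3 : (w - s) * |R| ≤ (w - s) * (C₁ * w) := mul_le_mul_of_nonneg_left h1 (by linarith)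
    have h4 : (w - s) * (C₁ * w) ≤ C₁ * ((w - s) * (w + s)) := by
      have : 0 ≤ C₁ * ((w - s) * s) := mul_nonneg hC₁ (mul_nonneg (by linarith) hs.le)
      linarith
    have h5 : (w - s) * (w + s) = q := by linear_combination hws
    rw [h5] at h4
    linarith
  have h6 : w * |T| ≤ W * (C₃ * q) := mul_le_mul hW hT (abs_nonneg _) (by linarith)
  have h7 : s * ((w - s) * R) ≤ s * (C₁ * q) := mul_le_mul_of_nonneg_left
    ((mul_le_mul_of_nonneg_left (le_abs_self R) (by linarith)).trans h2) hs.le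
  have h8 : s * (w * T) ≤ s * (W * (C₃ * q)) := mul_le_mul_of_nonneg_left
    ((mul_le_mul_of_nonneg_left (le_abs_self T) hw.le).trans h6) hs.le
  have h9 : q * d ≤ q * D := mul_le_mul_of_nonneg_left hd hq.le
  have h10 : q * (s * (C₁ + W * C₃)) < q * d := mul_lt_mul_of_pos_left hsmall hq
  linarith

lemma abs_quadratic_le {f g P Q S p q s : ℝ} (hP : |P| ≤ p) (hQ : |Q| ≤ q) (hS : |S| ≤ s) :
    |f ^ 2 * P + f * g * Q + g ^ 2 * S| ≤ (p + q + s) * (f ^ 2 + g ^ 2) := by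
  have h1 : |f ^ 2 * P| ≤ f ^ 2 * p := by
    rw [abs_mul, abs_of_nonneg (sq_nonneg f)]; exact mul_le_mul_of_nonneg_left hP (sq_nonneg f)
  have h2 : |g ^ 2 * S| ≤ g ^ 2 * s := by
    rw [abs_mul, abs_of_nonneg (sq_nonneg g)]; exact mul_le_mul_of_nonneg_left hS (sq_nonneg g)
  have hfg : |f * g| ≤ f ^ 2 + g ^ 2 := by
    rw [abs_le]; constructor <;> nlinarith [sq_nonneg (f + g), sq_nonneg (f - g)]
  have h3 : |f * g * Q| ≤ (f ^ 2 + g ^ 2) * q := by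
    rw [abs_mul]; exact mul_le_mul hfg hQ (abs_nonneg _) (by positivity)
  have h4 := abs_add_three (f ^ 2 * P) (f * g * Q) (g ^ 2 * S)
  have h5 := (abs_nonneg P).trans hP
  have h6 := (abs_nonneg S).trans hS
  nlinarith [mul_nonneg (sq_nonneg f) h6, mul_nonneg (sq_nonneg g) h5]

lemma quadratic_remainder {f g a b D i e af ag bf bg Df Dg ef eg : ℝ} (hi : i * D = 1)
    (he : e = (f * b - g * a) * i)
    (h₁ : e * Df + D * ef = (f * bf + b * (f * a)) - (g * af + a * (D + g * a)))
    (h₂ : e * Dg + D * eg = (f * bg + b * (f * b - D)) - (g * ag + a * (g * b))) :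
    f ^ 2 * (-bg * i + b * Dg * i * i) + f * g * ((ag + bf) * i - (b * Df + a * Dg) * i * i)
      + g ^ 2 * (-af * i + a * Df * i * i) =
      -f * eg + g * ef + e * (f * b - g * a) - (f * b - g * a) := by
  have x₁ : ef = i * ((f * bf + b * (f * a)) - (g * af + a * (D + g * a)) - e * Df) := by
    linear_combination i * h₁ - ef * hi
  have x₂ : eg = i * ((f * bg + b * (f * b - D)) - (g * ag + a * (g * b)) - e * Dg) := by
    linear_combination i * h₂ - eg * hi
  rw [x₁, x₂, he]
  linear_combination (-(f * b - g * a)) * hi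

variable {E : Type*} [NormedAddCommGroup E] [NormedSpace ℝ E] [FiniteDimensional ℝ E]
  {H : Type*} [TopologicalSpace H] {I : ModelWithCorners ℝ E H} [I.Boundaryless]
  {N : Type*} [TopologicalSpace N] [ChartedSpace H N] [IsManifold I ∞ N]
  [CompactSpace N] {k : ℕ} {β : OneForm I N}

/-- If the contact bracket of `f` and `g` is positive, some positive contact Hamiltonian rotates
`f + i g` positively off its zero set. -/
theorem IsContactForm.exists_rotating_hamiltonian (h : IsContactForm k β) {f g : N → ℝ}
    (hf : ContMDiff I 𝓘(ℝ, ℝ) ∞ f) (hg : ContMDiff I 𝓘(ℝ, ℝ) ∞ g)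
    (hD : ∀ p, 0 < vderiv I g p (h.ham f p) - g p * vderiv I f p (h.reeb p)) :
    ∃ u : N → ℝ, ContMDiff I 𝓘(ℝ, ℝ) ∞ u ∧ (∀ p, 0 < u p) ∧ ∀ p, 0 < f p ^ 2 + g p ^ 2 →
      0 < f p * vderiv I g p (h.ham u p) - g p * vderiv I f p (h.ham u p) := by
  set D : N → ℝ := fun p => vderiv I g p (h.ham f p) - g p * vderiv I f p (h.reeb p) with hDdef
  set a : N → ℝ := fun p => vderiv I f p (h.reeb p) with hadef
  set b : N → ℝ := fun p => vderiv I g p (h.reeb p) with hbdef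
  have ha : ContMDiff I 𝓘(ℝ, ℝ) ∞ a := h.contMDiff_vderiv hf h.smooth_reeb
  have hb : ContMDiff I 𝓘(ℝ, ℝ) ∞ b := h.contMDiff_vderiv hg h.smooth_reeb
  have hXf := h.smooth_ham hf
  have hXg := h.smooth_ham hg
  have hDs : ContMDiff I 𝓘(ℝ, ℝ) ∞ D := (h.contMDiff_vderiv hg hXf).sub (hg.mul ha)
  have hDinv : ContMDiff I 𝓘(ℝ, ℝ) ∞ fun p => (D p)⁻¹ := fun p =>
    ((contDiffAt_inv ℝ (hD p).ne').contMDiffAt).comp p (hDs p)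
  set e : N → ℝ := fun p => (f p * b p - g p * a p) * (D p)⁻¹ with hedef
  have he : ContMDiff I 𝓘(ℝ, ℝ) ∞ e := ((hf.mul hb).sub (hg.mul ha)).mul hDinv
  obtain ⟨d, hd0, hd⟩ := isCompact_univ.exists_forall_le' hDs.continuous.continuousOn
    (a := 0) (fun p _ => hD p)
  obtain ⟨C₁, hC₁0, hC₁⟩ := exists_bound_of_continuous
    (u := fun p => Real.sqrt (a p ^ 2 + b p ^ 2))
    (((ha.continuous.pow 2).add (hb.continuous.pow 2)).sqrt)
  obtain ⟨W, hW0, hW⟩ := exists_bound_of_continuous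
    (u := fun p => Real.sqrt (f p ^ 2 + g p ^ 2 + 1))
    ((((hf.continuous.pow 2).add (hg.continuous.pow 2)).add continuous_const).sqrt)
  have hDc := hDinv.continuous
  obtain ⟨P, hP0, hP⟩ := exists_bound_of_continuous
    (u := fun p => -vderiv I b p (h.ham g p) * (D p)⁻¹
      + b p * vderiv I D p (h.ham g p) * (D p)⁻¹ * (D p)⁻¹)
    ((((h.contMDiff_vderiv hb hXg).continuous.neg).mul hDc).add
      (((hb.continuous.mul (h.contMDiff_vderiv hDs hXg).continuous).mul hDc).mul hDc))
  obtain ⟨S, hS0, hS⟩ := exists_bound_of_continuous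
    (u := fun p => -vderiv I a p (h.ham f p) * (D p)⁻¹
      + a p * vderiv I D p (h.ham f p) * (D p)⁻¹ * (D p)⁻¹)
    ((((h.contMDiff_vderiv ha hXf).continuous.neg).mul hDc).add
      (((ha.continuous.mul (h.contMDiff_vderiv hDs hXf).continuous).mul hDc).mul hDc))
  obtain ⟨Q, hQ0, hQ⟩ := exists_bound_of_continuous
    (u := fun p => (vderiv I a p (h.ham g p) + vderiv I b p (h.ham f p)) * (D p)⁻¹
      - (b p * vderiv I D p (h.ham f p) + a p * vderiv I D p (h.ham g p)) * (D p)⁻¹ * (D p)⁻¹)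
    ((((h.contMDiff_vderiv ha hXg).continuous.add (h.contMDiff_vderiv hb hXf).continuous).mul
      hDc).sub ((((hb.continuous.mul (h.contMDiff_vderiv hDs hXf).continuous).add
        (ha.continuous.mul (h.contMDiff_vderiv hDs hXg).continuous)).mul hDc).mul hDc))
  set C₃ := P + Q + S with hC₃
  have hC₃0 : 0 ≤ C₃ := by positivity
  obtain ⟨s, hs0, hs1, hsmall⟩ : ∃ s : ℝ, 0 < s ∧ s ≤ 1 ∧ s * (C₁ + W * C₃) < d := by
    have hA : 0 ≤ C₁ + W * C₃ := by positivity
    refine ⟨min 1 (d / (C₁ + W * C₃ + 1)), lt_min one_pos (by positivity), min_le_left _ _, ?_⟩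
    calc min 1 (d / (C₁ + W * C₃ + 1)) * (C₁ + W * C₃)
        ≤ d / (C₁ + W * C₃ + 1) * (C₁ + W * C₃) :=
          mul_le_mul_of_nonneg_right (min_le_right _ _) hA
      _ < d := by rw [div_mul_eq_mul_div, div_lt_iff₀ (by positivity)]; nlinarith
  set w : N → ℝ := fun p => Real.sqrt (f p ^ 2 + g p ^ 2 + s ^ 2) with hwdef
  have hwpos : ∀ p, 0 < f p ^ 2 + g p ^ 2 + s ^ 2 := fun p => by positivity
  have hw0 : ∀ p, 0 < w p := fun p => Real.sqrt_pos.2 (hwpos p)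
  have hwsq : ∀ p, w p ^ 2 = f p ^ 2 + g p ^ 2 + s ^ 2 := fun p => Real.sq_sqrt (hwpos p).le
  have hws : ContMDiff I 𝓘(ℝ, ℝ) ∞ w := fun p =>
    ((Real.contDiffAt_sqrt (hwpos p).ne').contMDiffAt).comp p
      ((((hf.pow 2).add (hg.pow 2)).add contMDiff_const) p)
  have hwW : ∀ p, w p ≤ W := fun p => by
    have h1 : s ^ 2 ≤ 1 := pow_le_one₀ hs0.le hs1
    have h2 : w p ≤ Real.sqrt (f p ^ 2 + g p ^ 2 + 1) := Real.sqrt_le_sqrt (by linarith)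
    exact h2.trans ((le_abs_self _).trans (hW p))
  have hmd : ∀ {u : N → ℝ} (p : N), ContMDiff I 𝓘(ℝ, ℝ) ∞ u → MDifferentiableAt I 𝓘(ℝ, ℝ) u p :=
    fun p hu => (hu p).mdifferentiableAt (by simp)
  have hmm : ∀ {u v : N → ℝ} (p : N), ContMDiff I 𝓘(ℝ, ℝ) ∞ u → ContMDiff I 𝓘(ℝ, ℝ) ∞ v →
      MDifferentiableAt I 𝓘(ℝ, ℝ) (fun q => u q * v q) p := fun p hu hv => hmd p (hu.mul hv)
  have hR2 : ∀ p, (f p * b p - g p * a p) ^ 2 ≤ C₁ ^ 2 * (f p ^ 2 + g p ^ 2) := fun p => by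
    have h1 : a p ^ 2 + b p ^ 2 ≤ C₁ ^ 2 := by
      have := hC₁ p
      rw [abs_of_nonneg (Real.sqrt_nonneg _)] at this
      exact (Real.sqrt_le_left hC₁0).1 this
    nlinarith [sq_nonneg (f p * a p + g p * b p),
      mul_le_mul_of_nonneg_right h1 (by positivity : 0 ≤ f p ^ 2 + g p ^ 2)]
  refine ⟨fun p => w p - s * e p, hws.sub (contMDiff_const.mul he), fun p => ?_, fun p hq => ?_⟩
  · have hdD : d ≤ D p := hd p (mem_univ p)
    have h1 : |f p * b p - g p * a p| ≤ C₁ * w p := abs_le_of_sq_le_sq (by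
      rw [mul_pow, hwsq]
      exact (hR2 p).trans (mul_le_mul_of_nonneg_left (by nlinarith) (sq_nonneg _)))
      (mul_nonneg hC₁0 (hw0 p).le)
    have h2 : s * e p ≤ s * (C₁ * w p * (D p)⁻¹) := mul_le_mul_of_nonneg_left
      (mul_le_mul_of_nonneg_right ((le_abs_self _).trans h1) (inv_pos.2 (hD p)).le) hs0.le
    have h3 : s * (C₁ * w p * (D p)⁻¹) < w p := by
      rw [show s * (C₁ * w p * (D p)⁻¹) = (s * C₁ * w p) / D p by field_simp, div_lt_iff₀ (hD p)]
      have h4 : s * C₁ < D p := by nlinarith [mul_nonneg hs0.le (mul_nonneg hW0 hC₃0)]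
      nlinarith [hw0 p]
    linarith
  · set u : N → ℝ := fun p => w p - s * e p with hudef
    have hdiff : ∀ v, vderiv I u p v = vderiv I w p v - s * vderiv I e p v := fun v => by
      rw [hudef, vderiv_sub (hmd p hws) (hmm p contMDiff_const he),
        vderiv_mul (hmd p contMDiff_const) (hmd p he), vderiv_const]
      ring
    have hdw : ∀ v, w p * vderiv I w p v = f p * vderiv I f p v + g p * vderiv I g p v := fun v => by
      have h1 : vderiv I (fun q => w q * w q) p v =
          vderiv I (fun q => f q * f q + g q * g q + s ^ 2) p v := by
        congr 2; funext q; have := hwsq q; nlinarith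
      rw [vderiv_mul (hmd p hws) (hmd p hws),
        vderiv_add (f := fun q => f q * f q + g q * g q) ((hmm p hf hf).add (hmm p hg hg))
          mdifferentiableAt_const,
        vderiv_add (hmm p hf hf) (hmm p hg hg), vderiv_mul (hmd p hf) (hmd p hf),
        vderiv_mul (hmd p hg) (hmd p hg), vderiv_const] at h1
      linarith
    have hde : ∀ v, e p * vderiv I D p v + D p * vderiv I e p v =
        (f p * vderiv I b p v + b p * vderiv I f p v)
          - (g p * vderiv I a p v + a p * vderiv I g p v) := fun v => by
      have h1 : vderiv I (fun q => e q * D q) p v =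
          vderiv I (fun q => f q * b q - g q * a q) p v := by
        congr 2; funext q; exact inv_mul_cancel_right₀ (hD q).ne' _
      rw [vderiv_mul (hmd p he) (hmd p hDs), vderiv_sub (hmm p hf hb) (hmm p hg ha),
        vderiv_mul (hmd p hf) (hmd p hb), vderiv_mul (hmd p hg) (hmd p ha)] at h1
      exact h1
    have eff : vderiv I f p (h.ham f p) = f p * a p := h.vderiv_ham_self f p
    have egg : vderiv I g p (h.ham g p) = g p * b p := h.vderiv_ham_self g p
    have egf : vderiv I g p (h.ham f p) = D p + g p * a p := by simp [hDdef, hadef]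
    have efg : vderiv I f p (h.ham g p) = f p * b p - D p := by
      rw [h.vderiv_ham_swap f g p, egf]; simp only [hadef, hbdef]; ring
    have efu := h.vderiv_ham_swap f u p
    have egu := h.vderiv_ham_swap g u p
    rw [efu, egu]
    simp only [hdiff]
    have w1 := hdw (h.ham f p)
    have w2 := hdw (h.ham g p)
    have d1 := hde (h.ham f p)
    have d2 := hde (h.ham g p)
    have hP' := hP p
    have hQ' := hQ p
    have hS' := hS p
    rw [eff, egf] at w1 d1
    rw [efg, egg] at w2 d2
    set T := f p ^ 2 * (-vderiv I b p (h.ham g p) * (D p)⁻¹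
      + b p * vderiv I D p (h.ham g p) * (D p)⁻¹ * (D p)⁻¹) + f p * g p *
      ((vderiv I a p (h.ham g p) + vderiv I b p (h.ham f p)) * (D p)⁻¹
      - (b p * vderiv I D p (h.ham f p) + a p * vderiv I D p (h.ham g p)) * (D p)⁻¹ * (D p)⁻¹)
      + g p ^ 2 * (-vderiv I a p (h.ham f p) * (D p)⁻¹
      + a p * vderiv I D p (h.ham f p) * (D p)⁻¹ * (D p)⁻¹) with hTdef
    have hT : |T| ≤ C₃ * (f p ^ 2 + g p ^ 2) := abs_quadratic_le hP' hQ' hS'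
    have hTe : T = - f p * vderiv I e p (h.ham g p) + g p * vderiv I e p (h.ham f p)
        + e p * (f p * b p - g p * a p) - (f p * b p - g p * a p) := by
      have he' : e p = (f p * b p - g p * a p) * (D p)⁻¹ := rfl
      have hi : (D p)⁻¹ * D p = 1 := inv_mul_cancel₀ (hD p).ne'
      rw [hTdef]
      generalize D p = Dp at *
      exact quadratic_remainder hi he' d1 d2
    have key := smoothing_inequality hq (hw0 p) hs0 (hwsq p)
      (hwW p) (hd p (mem_univ p)) hC₁0 (hR2 p) hT hsmall
    refine (mul_pos_iff_of_pos_left (hw0 p)).1 (lt_of_lt_of_eq key ?_)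
    have hw2 := hwsq p
    have hup : u p = w p - s * e p := rfl
    have hap : vderiv I f p (h.reeb p) = a p := rfl
    have hbp : vderiv I g p (h.reeb p) = b p := rfl
    rw [hTe, hup, hap, hbp]
    linear_combination (-(f p * b p - g p * a p)) * hw2 + f p * w2 - g p * w1

variable [T2Space N]

/-- Functions with positive contact bracket define adapted open books. -/
theorem IsContactForm.isAdapted_of_bracket_pos (h : IsContactForm k β) {Φ : N → ℂ}
    (hΦ : ContMDiff I 𝓘(ℝ, ℂ) ∞ Φ)
    (hD : ∀ p, 0 < vderiv I (fun q => (Φ q).im) p (h.ham (fun q => (Φ q).re) p)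
      - (Φ p).im * vderiv I (fun q => (Φ q).re) p (h.reeb p)) :
    IsBookMap I Φ ∧ ∀ B, IsDefinedBy I B Φ → IsAdapted k (cokernel β) B := by
  have hd : ∀ p, MDifferentiableAt I 𝓘(ℝ, ℂ) Φ p := fun p => (hΦ p).mdifferentiableAt (by simp)
  obtain ⟨u, hu, hu0, hrot⟩ := h.exists_rotating_hamiltonian (contMDiff_re hΦ) (contMDiff_im hΦ) hD
  have harg : ∀ p, Φ p ≠ 0 → 0 < argDeriv I Φ p (h.ham u p) := fun p hp => by
    have h1 : 0 < (Φ p).re ^ 2 + (Φ p).im ^ 2 := by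
      have := Complex.normSq_pos.2 hp
      rw [Complex.normSq_apply] at this
      linarith
    have h2 := hrot p h1
    rw [vderiv_re (hd p), vderiv_im (hd p)] at h2
    rw [argDeriv_apply, Complex.mul_im, Complex.conj_re, Complex.conj_im]
    linarith
  have hzero : ∀ p, Φ p = 0 →
      vderiv I Φ p (h.ham (fun q => (Φ q).re) p) =
        ⟨0, extD β p (h.ham (fun q => (Φ q).re) p) (h.ham (fun q => (Φ q).im) p)⟩ ∧
      vderiv I Φ p (h.ham (fun q => (Φ q).im) p) =
        ⟨-extD β p (h.ham (fun q => (Φ q).re) p) (h.ham (fun q => (Φ q).im) p), 0⟩ ∧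
      0 < extD β p (h.ham (fun q => (Φ q).re) p) (h.ham (fun q => (Φ q).im) p) := fun p hp => by
    have e1 := h.vderiv_ham_self (fun q => (Φ q).re) p
    have e2 := h.vderiv_ham_self (fun q => (Φ q).im) p
    have e3 := h.extD_ham (fun q => (Φ q).re) p (h.ham (fun q => (Φ q).im) p)
    have e4 := h.vderiv_ham_swap (fun q => (Φ q).re) (fun q => (Φ q).im) p
    have e5 := hD p
    rw [h.apply_ham] at e3
    simp only [hp, Complex.zero_re, Complex.zero_im, zero_mul, mul_zero, zero_sub, sub_zero,
      zero_add] at e1 e2 e3 e4 e5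
    rw [vderiv_re (hd p)] at e1 e3 e4
    rw [vderiv_im (hd p)] at e2 e4 e5
    refine ⟨Complex.ext e1 ?_, Complex.ext ?_ e2, ?_⟩
    · change _ = extD β p _ _
      rw [e3, e4, neg_neg]
    · change _ = -extD β p _ _
      rw [e3, neg_neg]
    · rw [e3, e4, neg_neg]; exact e5
  have hbook : IsBookMap I Φ := by
    refine ⟨hΦ, fun p hp z => ?_, fun p hp hc => ?_⟩
    · obtain ⟨e1, e2, e3⟩ := hzero p hp
      set κ := extD β p (h.ham (fun q => (Φ q).re) p) (h.ham (fun q => (Φ q).im) p)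
      refine ⟨(z.im / κ) • h.ham (fun q => (Φ q).re) p
        + (-z.re / κ) • h.ham (fun q => (Φ q).im) p, ?_⟩
      rw [map_add, map_smul, map_smul, e1, e2]
      have hne := e3.ne'
      apply Complex.ext <;> simp <;> field_simp
    · have := harg p hp
      rw [hc] at this
      exact lt_irrefl _ this
  refine ⟨hbook, fun B hB => ⟨⟨⟨Φ, hB⟩, hbook.isFibration hB⟩, fun Φ' γ hΦ' hγ => ?_,
    _, h.isAdaptedForm_of_ham hu hu0 hB harg⟩⟩
  refine h.bindingPositive_congr hB hΦ' hγ fun p hp m hm z₁ z₂ w hw => ?_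
  subst hm
  obtain ⟨-, -, e3⟩ := hzero p hp
  obtain ⟨c, hc, hceq⟩ := h.normalSign_eq (vderiv I Φ p)
    (y₁ := h.ham (fun q => (Φ q).re) p) (y₂ := h.ham (fun q => (Φ q).im) p)
    (by rw [h.apply_ham, hp]; rfl) (by rw [h.apply_ham, hp]; rfl)
    (fun y hy => by rw [h.extD_ham_of_mem _ p hy, vderiv_re (hd p)])
    (fun y hy => by rw [h.extD_ham_of_mem _ p hy, vderiv_im (hd p)])
    e3.ne' hw.1 hw.2.1 hw.2.2
  rw [hceq]
  exact mul_pos hc e3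

end AdaptedCriterion

section Same

variable {X : Type*} {B B' B'' : OpenBook X}

lemma OpenBook.Same.refl (B : OpenBook X) : B.Same B := ⟨rfl, fun _ _ => rfl⟩

lemma OpenBook.Same.symm (h : B.Same B') : B'.Same B :=
  ⟨h.1.symm, fun p hp => (h.2 p (h.1 ▸ hp)).symm⟩

lemma OpenBook.Same.trans (h : B.Same B') (h' : B'.Same B'') : B.Same B'' :=
  ⟨h.1.trans h'.1, fun p hp => (h.2 p hp).trans (h'.2 p (h.1 ▸ hp))⟩

lemma OpenBook.Same.image (h : B.Same B') (f : X ≃ X) : (B.image f).Same (B'.image f) :=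
  ⟨congrArg (f '' ·) h.1, fun p hp => h.2 _ fun hc => hp ⟨f.symm p, hc, f.apply_symm_apply p⟩⟩

lemma OpenBook.Same.pullback {Y : Type*} (h : B.Same B') (j : Y → X) :
    (B.pullback j).Same (B'.pullback j) :=
  ⟨congrArg (j ⁻¹' ·) h.1, fun _ hp => h.2 _ hp⟩

lemma OpenBook.image_image (B : OpenBook X) (f g : X ≃ X) :
    (B.image f).image g = B.image (f.trans g) := by
  simp only [OpenBook.image, Set.image_image, Function.comp_assoc]
  rfl

lemma OpenBook.pullback_image {Y : Type*} (B : OpenBook X) (f : X ≃ X) (j : Y ≃ X) :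
    (B.pullback j).image ((j.trans f).trans j.symm) = (B.image f).pullback j := by
  simp only [OpenBook.image, OpenBook.pullback]
  congr 1
  · ext y
    simp only [mem_image, mem_preimage]
    constructor
    · rintro ⟨x, hx, rfl⟩
      exact ⟨j x, hx, by simp⟩
    · rintro ⟨x, hx, hxy⟩
      exact ⟨j.symm x, by simpa using hx, by simp [hxy]⟩
  · funext y
    simp

end Same

section Isotopies

variable {E : Type*} [NormedAddCommGroup E] [NormedSpace ℝ E] [FiniteDimensional ℝ E]
  {H : Type*} [TopologicalSpace H] {I : ModelWithCorners ℝ E H} [I.Boundaryless]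
  {N : Type*} [TopologicalSpace N] [ChartedSpace H N] [IsManifold I ∞ N]
  {k : ℕ} {ξ : HyperplaneField I N} {B B' B₀ B₁ B₂ : OpenBook N} {Φ : N → ℂ}

lemma IsDefinedBy.congr (h : IsDefinedBy I B Φ) (hs : B.Same B') : IsDefinedBy I B' Φ :=
  ⟨h.1, h.2.1, hs.1 ▸ h.2.2.1, fun p hp => by
    have hp' : p ∉ B.binding := fun hc => hp (hs.1 ▸ hc)
    rw [← hs.2 p hp']; exact h.2.2.2 p hp'⟩

lemma OpenBook.Same.page (hs : B.Same B') (θ : Circle) : B.page θ = B'.page θ := by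
  ext p
  constructor
  · rintro ⟨h1, h2⟩; exact ⟨hs.1 ▸ h1, (hs.2 p h1).symm.trans h2⟩
  · rintro ⟨h1, h2⟩; exact ⟨hs.1 ▸ h1, (hs.2 p (hs.1 ▸ h1)).trans h2⟩

lemma IsFibration.congr (h : IsFibration I B) (hs : B.Same B') : IsFibration I B' := by
  refine ⟨?_, fun θ => ?_⟩
  · rw [← hs.1]
    exact h.1.congr fun p hp => (hs.2 p hp).symm
  · obtain ⟨U, hU, hθ, τ, r, h1, h2, h3, h4⟩ := h.2 θ
    have e : B'.bindingᶜ ∩ B'.map ⁻¹' U = B.bindingᶜ ∩ B.map ⁻¹' U := by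
      ext p
      rw [← hs.1]
      constructor
      · rintro ⟨hp, hq⟩; exact ⟨hp, by rw [mem_preimage, hs.2 p hp]; exact hq⟩
      · rintro ⟨hp, hq⟩; exact ⟨hp, by rw [mem_preimage, ← hs.2 p hp]; exact hq⟩
    refine ⟨U, hU, hθ, τ, r, hs.page θ ▸ h1, e ▸ h2, fun z hz x hx => ?_, fun y hy hyU => ?_⟩
    · rw [← hs.page] at hx ⊢
      exact h3 z hz x hx
    · have hy' : y ∉ B.binding := fun hc => hy (hs.1 ▸ hc)
      rw [← hs.2 y hy'] at hyU ⊢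
      rw [← hs.page]
      exact h4 y hy' hyU

lemma angularForm_congr {f g : N → Circle} {p : N} (h : f =ᶠ[nhds p] g) :
    angularForm I f p = angularForm I g p := by
  have h1 : (fun q => (f q : ℂ)) =ᶠ[nhds p] fun q => (g q : ℂ) := h.mono fun q hq => by
    change (f q : ℂ) = g q
    rw [hq]
  have h2 : vderiv I (fun q => (f q : ℂ)) p = vderiv I (fun q => (g q : ℂ)) p := vderiv_congr h1
  ext v
  change (conj (f p : ℂ) * vderiv I (fun q => (f q : ℂ)) p v).im =
    (conj (g p : ℂ) * vderiv I (fun q => (g q : ℂ)) p v).im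
  rw [h2, h.self_of_nhds]

lemma IsAdapted.congr (h : IsAdapted k ξ B) (hs : B.Same B') : IsAdapted k ξ B' := by
  obtain ⟨⟨⟨Φ, hΦ⟩, hf⟩, hb, β, hβ, hp⟩ := h
  refine ⟨⟨⟨Φ, hΦ.congr hs⟩, hf.congr hs⟩, fun Φ' γ hΦ' hγ => hb Φ' γ (hΦ'.congr hs.symm) hγ,
    β, hβ, fun p hpb v hv => ?_⟩
  have hpb' : p ∉ B.binding := fun hc => hpb (hs.1 ▸ hc)
  rw [← angularForm_congr (f := B.map) (by
    filter_upwards [hΦ.isClosed_binding.isOpen_compl.mem_nhds hpb'] with q hq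
    exact hs.2 q hq)]
  exact hp p hpb' v hv

lemma IsIsotopic.congr_left (h : IsIsotopic k ξ B₀ B₁) (hs : B₀.Same B₂) :
    IsIsotopic k ξ B₂ B₁ := by
  obtain ⟨h0, h1, f, hf, hft, hf1⟩ := h
  exact ⟨h0.congr hs, h1, f, hf, fun t ht => (hft t ht).congr (hs.image _),
    (hs.symm.image _).trans hf1⟩

lemma IsIsotopic.trans (h : IsIsotopic k ξ B₀ B₁) (h' : IsIsotopic k ξ B₁ B₂) :
    IsIsotopic k ξ B₀ B₂ := by
  obtain ⟨h0, h1, f, ⟨hf, hf0⟩, hft, hf1⟩ := h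
  obtain ⟨-, h2, g, ⟨hg, hg0⟩, hgt, hg1⟩ := h'
  have hχ : ∀ t, Real.smoothTransition t ∈ Icc (0 : ℝ) 1 := fun t =>
    ⟨Real.smoothTransition.nonneg t, Real.smoothTransition.le_one t⟩
  have hlate : ∀ t : ℝ, 1 / 2 ≤ t → (B₀.image (((f (Real.smoothTransition (2 * t))).trans
      (g (Real.smoothTransition (2 * t - 1)))).toEquiv)).Same
      (B₁.image (g (Real.smoothTransition (2 * t - 1))).toEquiv) := fun t ht => by
    rw [Real.smoothTransition.one_of_one_le (x := 2 * t) (by linarith)]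
    have := hf1.image (g (Real.smoothTransition (2 * t - 1))).toEquiv
    rwa [OpenBook.image_image] at this
  refine ⟨h0, h2, fun t => (f (Real.smoothTransition (2 * t))).trans
    (g (Real.smoothTransition (2 * t - 1))), ⟨?_, fun p => ?_⟩, fun t ht => ?_, ?_⟩
  · have hs : ContDiff ℝ ∞ Real.smoothTransition := Real.smoothTransition.contDiff (n := ⊤)
    have e1 : ContMDiff (𝓘(ℝ, ℝ).prod I) (𝓘(ℝ, ℝ).prod I) ∞
        (fun x : ℝ × N => (Real.smoothTransition (2 * x.1), x.2)) :=
      ((hs.comp (contDiff_const.mul contDiff_id)).contMDiff.comp contMDiff_fst).prodMk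
        contMDiff_snd
    have e2 : ContMDiff (𝓘(ℝ, ℝ).prod I) 𝓘(ℝ, ℝ) ∞
        (fun x : ℝ × N => Real.smoothTransition (2 * x.1 - 1)) :=
      (hs.comp ((contDiff_const.mul contDiff_id).sub contDiff_const)).contMDiff.comp contMDiff_fst
    have e3 := hf.comp (s := Icc 0 1 ×ˢ univ) e1.contMDiffOn fun x _ => ⟨hχ _, mem_univ _⟩
    exact hg.comp (e2.contMDiffOn.prodMk e3) fun x _ => ⟨hχ _, mem_univ _⟩
  · change g (Real.smoothTransition (2 * 0 - 1)) (f (Real.smoothTransition (2 * 0)) p) = p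
    rw [Real.smoothTransition.zero_of_nonpos (by norm_num),
      Real.smoothTransition.zero_of_nonpos (by norm_num), hf0, hg0]
  · rcases le_total t (1 / 2) with h3 | h3
    · refine (hft _ (hχ (2 * t))).congr ?_
      have : ((f (Real.smoothTransition (2 * t))).trans
          (g (Real.smoothTransition (2 * t - 1)))).toEquiv =
          (f (Real.smoothTransition (2 * t))).toEquiv := by
        ext x
        change g (Real.smoothTransition (2 * t - 1)) (f (Real.smoothTransition (2 * t)) x) = _
        rw [Real.smoothTransition.zero_of_nonpos (x := 2 * t - 1) (by linarith), hg0]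
        rfl
      rw [this]
      exact OpenBook.Same.refl _
    · exact (hgt _ (hχ (2 * t - 1))).congr (hlate t h3).symm
  · refine (hlate 1 (by norm_num)).trans ?_
    rw [Real.smoothTransition.one_of_one_le (by norm_num)]
    exact hg1

/-- Adapted open books in a smooth family are isotopic. -/
theorem isIsotopic_of_family [T2Space N] [CompactSpace N] {Φ : ℝ × N → ℂ}
    (hΦ : ContMDiff (𝓘(ℝ, ℝ).prod I) 𝓘(ℝ, ℂ) ∞ Φ)
    (hbook : ∀ t, IsBookMap I (fun x => Φ (t, x)))
    (had : ∀ t B, IsDefinedBy I B (fun x => Φ (t, x)) → IsAdapted k ξ B)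
    (h₀ : IsDefinedBy I B₀ (fun x => Φ (0, x))) (h₁ : IsDefinedBy I B₁ (fun x => Φ (1, x))) :
    IsIsotopic k ξ B₀ B₁ := by
  obtain ⟨f, hf, hf0, hft⟩ := exists_diffeos_of_bookMaps hΦ hbook
  refine ⟨had 0 _ h₀, had 1 _ h₁, f, ⟨hf.contMDiffOn, hf0⟩, fun t _ => ?_, hft 1 _ _ h₀ h₁⟩
  exact (had t _ (hbook t).isDefinedBy_bookOf).congr
    (hft t _ _ h₀ (hbook t).isDefinedBy_bookOf).symm

end Isotopies

section Transport

variable {E : Type*} [NormedAddCommGroup E] [NormedSpace ℝ E] [FiniteDimensional ℝ E]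
  {H : Type*} [TopologicalSpace H] {I : ModelWithCorners ℝ E H} [I.Boundaryless]
  {N : Type*} [TopologicalSpace N] [ChartedSpace H N] [IsManifold I ∞ N]
  {E₁ : Type*} [NormedAddCommGroup E₁] [NormedSpace ℝ E₁]
  {H₁ : Type*} [TopologicalSpace H₁] {I₁ : ModelWithCorners ℝ E₁ H₁}
  {N₁ : Type*} [TopologicalSpace N₁] [ChartedSpace H₁ N₁] [IsManifold I₁ ∞ N₁]
  {k : ℕ} {ξ : HyperplaneField I N} {B B' : OpenBook N} {Φ : N → ℂ}

lemma pullbackField_comp (ξ : HyperplaneField I₁ N₁) {g : N → N₁} {f : N → N}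
    (hg : ContMDiff I I₁ ∞ g) (hf : ContMDiff I I ∞ f) :
    pullbackField I f (pullbackField I g ξ) = pullbackField I (g ∘ f) ξ := by
  funext m
  ext v
  have h := mfderiv_comp m ((hg (f m)).mdifferentiableAt (by simp))
    ((hf m).mdifferentiableAt (by simp))
  change mfderiv I I₁ g (f m) (mfderiv I I f m v) ∈ ξ (g (f m)) ↔
    mfderiv I I₁ (g ∘ f) m v ∈ ξ (g (f m))
  rw [h]
  rfl

lemma pullbackForm_comp (α : OneForm I₁ N₁) {g : N → N₁} {f : N → N}
    (hg : ContMDiff I I₁ ∞ g) (hf : ContMDiff I I ∞ f) :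
    pullbackForm I f (pullbackForm I g α) = pullbackForm I (g ∘ f) α := by
  funext m
  have h := mfderiv_comp m ((hg (f m)).mdifferentiableAt (by simp))
    ((hf m).mdifferentiableAt (by simp))
  ext v
  change α (g (f m)) (mfderiv I I₁ g (f m) (mfderiv I I f m v)) =
    α (g (f m)) (mfderiv I I₁ (g ∘ f) m v)
  rw [h]
  rfl

lemma pullbackField_id (ξ : HyperplaneField I N) {f : N → N} (hf : ∀ x, f x = x) :
    pullbackField I f ξ = ξ := by
  obtain rfl : f = id := funext hf
  funext m
  ext v
  change mfderiv I I id m v ∈ ξ m ↔ v ∈ ξ m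
  rw [mfderiv_id]; rfl

lemma pullbackForm_id (α : OneForm I N) {f : N → N} (hf : ∀ x, f x = x) :
    pullbackForm I f α = α := by
  obtain rfl : f = id := funext hf
  funext m
  ext v
  change α m (mfderiv I I id m v) = α m v
  rw [mfderiv_id]; rfl

variable (ψ : N ≃ₘ^∞⟮I, I⟯ N)

lemma bijective_mfderiv_diffeomorph (p : N) : Function.Bijective (mfderiv I I ψ p) :=
  (ψ.mfderivToContinuousLinearEquiv (by simp) p).bijective

lemma IsDefinedBy.pullback (h : IsDefinedBy I B Φ) :
    IsDefinedBy I (B.pullback ψ) (fun x => Φ (ψ x)) := by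
  refine ⟨h.1.comp ψ.contMDiff, fun p hp => ?_, ?_, fun p hp => h.2.2.2 (ψ p) hp⟩
  · have h1 : ∀ v, vderiv I (fun x => Φ (ψ x)) p v = vderiv I Φ (ψ p) (mfderiv I I ψ p v) :=
      vderiv_comp_map ((h.1 _).mdifferentiableAt (by simp))
        ((ψ.contMDiff p).mdifferentiableAt (by simp))
    intro z
    obtain ⟨v, hv⟩ := h.2.1 (ψ p) hp z
    obtain ⟨v', rfl⟩ := (bijective_mfderiv_diffeomorph ψ p).2 v
    exact ⟨v', (h1 v').trans hv⟩
  · ext p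
    exact h.mem_binding (p := ψ p)

lemma defines_pullback {γ : OneForm I N} (h : Defines γ ξ) :
    Defines (pullbackForm I ψ γ) (pullbackField I ψ ξ) := by
  refine ⟨h.1.pullbackForm ψ.contMDiff, fun p hp => h.2.1 (ψ p) ?_, ?_⟩
  · ext v
    obtain ⟨v', rfl⟩ := (bijective_mfderiv_diffeomorph ψ p).2 v
    exact congrArg (fun L : TangentSpace I p →L[ℝ] ℝ => L v') hp
  · funext p
    ext v
    have := congrFun h.2.2 (ψ p)
    exact Set.ext_iff.1 this (mfderiv I I ψ p v)

lemma topForm_pullback {γ : OneForm I N} (hγ : SmoothForm γ) (m : ℕ) (p : N)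
    (v : Fin (2 * m + 1) → TangentSpace I p) :
    topForm m (pullbackForm I ψ γ p) (extD (pullbackForm I ψ γ) p) v =
      topForm m (γ (ψ p)) (extD γ (ψ p)) (fun i => mfderiv I I ψ p (v i)) := by
  unfold topForm
  simp only [extD_pullbackForm hγ (ψ.contMDiff p)]
  rfl

lemma comp_cons₂ {T T' : Type*} {m : ℕ} (L : T → T') (z₁ z₂ : T) (w : Fin (2 * m + 1) → T) :
    (fun i => L (cons₂ z₁ z₂ w i)) = cons₂ (L z₁) (L z₂) (fun i => L (w i)) := by
  funext i
  refine Fin.cases rfl (fun i => ?_) i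
  refine Fin.cases rfl (fun i => rfl) i

lemma BindingPositive.pullback {γ : OneForm I N} (hγ : SmoothForm γ)
    (hΦ : ContMDiff I 𝓘(ℝ, ℂ) ∞ Φ) (h : BindingPositive k Φ γ) :
    BindingPositive k (fun x => Φ (ψ x)) (pullbackForm I ψ γ) := by
  intro p hp m hm z₁ z₂ w hw
  have h1 : ∀ v, vderiv I (fun x => Φ (ψ x)) p v = vderiv I Φ (ψ p) (mfderiv I I ψ p v) :=
    vderiv_comp_map ((hΦ _).mdifferentiableAt (by simp))
      ((ψ.contMDiff p).mdifferentiableAt (by simp))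
  have h2 := h (ψ p) hp m hm (mfderiv I I ψ p z₁) (mfderiv I I ψ p z₂)
    (fun i => mfderiv I I ψ p (w i)) ⟨?_, fun i => (h1 _).symm.trans (hw.2.1 i), ?_⟩
  · rw [normalSign] at h2 ⊢
    rwa [topForm_pullback ψ hγ, topForm_pullback ψ hγ, comp_cons₂]
  · exact hw.1.map' (mfderiv I I ψ p : TangentSpace I p →ₗ[ℝ] TangentSpace I (ψ p))
      (LinearMap.ker_eq_bot.2 (bijective_mfderiv_diffeomorph ψ p).1)
  · have h3 : 0 < (conj (vderiv I (fun x => Φ (ψ x)) p z₁) *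
      vderiv I (fun x => Φ (ψ x)) p z₂).im := hw.2.2
    rw [h1, h1] at h3
    exact h3

lemma IsFibration.pullback (h : IsFibration I B) : IsFibration I (B.pullback ψ) := by
  refine ⟨h.1.comp ψ.contMDiff.contMDiffOn fun p hp => hp, fun θ => ?_⟩
  obtain ⟨U, hU, hθ, τ, r, h1, h2, h3, h4⟩ := h.2 θ
  have hpage : ∀ z x, x ∈ (B.pullback ψ).page z ↔ ψ x ∈ B.page z := fun z x => Iff.rfl
  refine ⟨U, hU, hθ, fun x => ψ.symm (τ (x.1, ψ x.2)), fun y => ψ.symm (r (ψ y)), ?_, ?_,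
    fun z hz x hx => ?_, fun y hy hyU => ?_⟩
  · have e1 : ContMDiff ((𝓡 1).prod I) ((𝓡 1).prod I) ∞ (fun x : Circle × N => (x.1, ψ x.2)) :=
      contMDiff_fst.prodMk (ψ.contMDiff.comp contMDiff_snd)
    exact ψ.symm.contMDiff.comp_contMDiffOn
      (h1.comp e1.contMDiffOn fun x hx => ⟨hx.1, hx.2⟩)
  · exact ψ.symm.contMDiff.comp_contMDiffOn
      (h2.comp ψ.contMDiff.contMDiffOn fun y hy => hy)
  · have := h3 z hz (ψ x) hx
    rw [hpage]
    simp only [Diffeomorph.apply_symm_apply, this.2, Diffeomorph.symm_apply_apply, and_true]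
    exact this.1
  · have := h4 (ψ y) hy hyU
    rw [hpage]
    simp only [Diffeomorph.apply_symm_apply]
    refine ⟨this.1, ?_⟩
    change ψ.symm (τ (B.map (ψ y), r (ψ y))) = y
    rw [this.2, Diffeomorph.symm_apply_apply]

lemma IsAdapted.pullback (h : IsAdapted k ξ B) :
    IsAdapted k (pullbackField I ψ ξ) (B.pullback ψ) := by
  obtain ⟨⟨⟨Φ, hΦ⟩, hf⟩, hb, β, hβ, hp⟩ := h
  refine ⟨⟨⟨_, hΦ.pullback ψ⟩, hf.pullback ψ⟩, fun Φ' γ hΦ' hγ => ?_,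
    _, defines_pullback ψ hβ, fun p hpb v hv => ?_⟩
  · have e1 := hΦ'.pullback ψ.symm
    have e2 := defines_pullback ψ.symm hγ
    rw [pullbackField_comp _ ψ.contMDiff ψ.symm.contMDiff,
      pullbackField_id _ (f := ψ ∘ ψ.symm) (fun x => ψ.apply_symm_apply x)] at e2
    have e3 : (B.pullback ψ).pullback ψ.symm = B := by
      simp only [OpenBook.pullback]
      congr 1
      · ext x; simp
      · funext x; simp
    rw [e3] at e1
    have e4 := (hb _ _ e1 e2).pullback ψ e2.1 e1.1
    simp only [Diffeomorph.symm_apply_apply] at e4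
    rwa [pullbackForm_comp _ ψ.symm.contMDiff ψ.contMDiff,
      pullbackForm_id _ (f := ψ.symm ∘ ψ) (fun x => ψ.symm_apply_apply x)] at e4
  · have h1 : ∀ v, angularForm I (B.pullback ψ).map p v =
        angularForm I B.map (ψ p) (mfderiv I I ψ p v) := fun v => by
      have := vderiv_comp_map (h := fun q => (B.map q : ℂ)) (f := ψ) (p := p)
        ((hΦ.contMDiffAt_coe_map hpb).mdifferentiableAt (by simp))
        ((ψ.contMDiff p).mdifferentiableAt (by simp)) v
      exact congrArg (fun z => (conj (B.map (ψ p) : ℂ) * z).im) this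
    have h2 := hp (ψ p) hpb (fun i => mfderiv I I ψ p (v i))
      (hv.map' (mfderiv I I ψ p : TangentSpace I p →ₗ[ℝ] TangentSpace I (ψ p))
        (LinearMap.ker_eq_bot.2 (bijective_mfderiv_diffeomorph ψ p).1))
    rw [topForm_pullback ψ hβ.1]
    refine lt_of_lt_of_eq h2 ?_
    congr 1
    unfold topForm
    simp only [extD_pullbackForm hβ.1 (ψ.contMDiff p), h1]

lemma IsIsotopic.pullback (h : IsIsotopic k ξ B B') :
    IsIsotopic k (pullbackField I ψ ξ) (B.pullback ψ) (B'.pullback ψ) := by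
  obtain ⟨h0, h1, f, ⟨hf, hf0⟩, hft, hf1⟩ := h
  have key : ∀ t, (B.pullback ψ).image ((ψ.trans (f t)).trans ψ.symm).toEquiv =
      (B.image (f t).toEquiv).pullback ψ := fun t =>
    OpenBook.pullback_image B (f t).toEquiv ψ.toEquiv
  refine ⟨h0.pullback ψ, h1.pullback ψ, fun t => (ψ.trans (f t)).trans ψ.symm,
    ⟨?_, fun p => ?_⟩, fun t ht => ?_, ?_⟩
  · have e1 : ContMDiff (𝓘(ℝ, ℝ).prod I) (𝓘(ℝ, ℝ).prod I) ∞ (fun x : ℝ × N => (x.1, ψ x.2)) :=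
      contMDiff_fst.prodMk (ψ.contMDiff.comp contMDiff_snd)
    exact ψ.symm.contMDiff.comp_contMDiffOn
      (hf.comp e1.contMDiffOn fun x hx => ⟨hx.1, mem_univ _⟩)
  · change ψ.symm (f 0 (ψ p)) = p
    rw [hf0, Diffeomorph.symm_apply_apply]
  · rw [key]; exact (hft t ht).pullback ψ
  · rw [key]; exact hf1.pullback ψ

end Transport

section LinearFamilies

variable {ES : Type*} [NormedAddCommGroup ES] [NormedSpace ℝ ES] [FiniteDimensional ℝ ES]
  {HS : Type*} [TopologicalSpace HS] {IS : ModelWithCorners ℝ ES HS} [IS.Boundaryless]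
  {S : Type*} [TopologicalSpace S] [ChartedSpace HS S] [IsManifold IS ∞ S]
  {EV : Type*} [NormedAddCommGroup EV] [NormedSpace ℝ EV]
  {HV : Type*} [TopologicalSpace HV] {IV : ModelWithCorners ℝ EV HV}
  {V : Type*} [TopologicalSpace V] [ChartedSpace HV V]
  {EX : Type*} [NormedAddCommGroup EX] [NormedSpace ℝ EX]
  {HX : Type*} [TopologicalSpace HX] {IX : ModelWithCorners ℝ EX HX}
  {X : Type*} [TopologicalSpace X] [ChartedSpace HX X]

/-- Smoothness of the values of a family of linear forms on tangent spaces, from smoothness of the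
values on local fields. -/
theorem contMDiffWithinAt_linear {π : V → S} {Q : ∀ p : V, TangentSpace IS (π p) →ₗ[ℝ] ℝ}
    {g : X → V} {w : X → TangentBundle IS S} {s : Set X} {x₀ : X}
    (hQ : ∀ y : ES, ContMDiffAt IV 𝓘(ℝ, ℝ) ∞
      (fun p => Q p (localField (w x₀).proj (fun _ => y) (π p))) (g x₀))
    (hg : ContMDiffWithinAt IX IV ∞ g s x₀) (hw : ContMDiffWithinAt IX IS.tangent ∞ w s x₀)
    (hx₀ : x₀ ∈ s) (hgw : ∀ x ∈ s, π (g x) = (w x).proj)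
    {r : X → ℝ} (hr : ∀ x ∈ s, ∀ u : TangentSpace IS (π (g x)),
      (⟨π (g x), u⟩ : TangentBundle IS S) = w x → r x = Q (g x) u) :
    ContMDiffWithinAt IX 𝓘(ℝ, ℝ) ∞ r s x₀ := by
  obtain ⟨hw1, hw2⟩ := Bundle.contMDiffWithinAt_totalSpace.1 hw
  let T := trivializationAt ES (TangentSpace IS : S → Type _) (w x₀).proj
  let A : V → ES →L[ℝ] ℝ := fun p => LinearMap.toContinuousLinearMap
    (Q p ∘ₗ (T.symmL ℝ (π p) : ES →ₗ[ℝ] TangentSpace IS (π p)))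
  have hA : ContMDiffAt IV 𝓘(ℝ, ES →L[ℝ] ℝ) ∞ A (g x₀) := contMDiffAt_clm_apply hQ
  have h1 : ContMDiffWithinAt IX 𝓘(ℝ, ℝ) ∞ (fun x => A (g x) (T (w x)).2) s x₀ :=
    (hA.comp_contMDiffWithinAt x₀ hg).clm_apply hw2
  have hev : ∀ᶠ x in nhdsWithin x₀ s, (w x).proj ∈ T.baseSet :=
    hw1.continuousWithinAt (T.open_baseSet.mem_nhds (mem_baseSet_trivializationAt_self _))
  have key : ∀ x ∈ s, (w x).proj ∈ T.baseSet → r x = A (g x) (T (w x)).2 := fun x hx hb => by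
    rw [← hgw x hx] at hb
    have h2 : (⟨π (g x), T.symmL ℝ (π (g x)) (T (w x)).2⟩ : TangentBundle IS S) = w x := by
      have h3 := hgw x hx
      generalize hwx : w x = z at h3
      obtain ⟨b, u⟩ := z
      change π (g x) = b at h3
      subst h3
      exact congrArg (Bundle.TotalSpace.mk (π (g x)))
        ((Bundle.Trivialization.symmL_apply (R := ℝ) _ hb _).trans
          (Bundle.Trivialization.symm_apply_apply_mk _ hb u))
    exact hr x hx _ h2
  refine h1.congr_of_eventuallyEq ?_ (key x₀ hx₀ (mem_baseSet_trivializationAt_self _))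
  filter_upwards [hev, self_mem_nhdsWithin] with x hx hxs using key x hxs hx

lemma contMDiff_const_base (b : S) {u : X → ES}
    (hu : ContMDiff IX 𝓘(ℝ, ES) ∞ u) :
    ContMDiff IX IS.tangent ∞ (fun x => (⟨b, u x⟩ : TangentBundle IS S)) := fun x => by
  refine Bundle.contMDiffAt_totalSpace.2 ⟨contMDiffAt_const, ?_⟩
  let T := trivializationAt ES (TangentSpace IS : S → Type _) b
  let L : ES →L[ℝ] ES := T.continuousLinearMapAt ℝ b
  have h1 : ContMDiffAt IX 𝓘(ℝ, ES) ∞ (fun x => L (u x)) x :=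
    L.contDiff.contMDiff.contMDiffAt.comp x (hu x)
  refine h1.congr_of_eventuallyEq (.of_forall fun y => ?_)
  exact (Bundle.Trivialization.continuousLinearMapAt_apply_of_mem (R := ℝ) T
    (mem_baseSet_trivializationAt_self b) (u y)).symm

/-- The area form of an orientation is a smooth function of pairs of tangent vectors. -/
lemma continuous_areaForm [T2Space S] [SigmaCompactSpace S]
    {μ : ∀ x : S, TangentSpace IS x →L[ℝ] TangentSpace IS x →L[ℝ] ℝ}
    (hμ : ∀ U W : ∀ x : S, TangentSpace IS x, SmoothField U → SmoothField W →
      ContMDiff IS 𝓘(ℝ, ℝ) ∞ (fun x => μ x (U x) (W x)))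
    {u v : X → TangentBundle IS S} (hu : ContMDiff IX IS.tangent ∞ u)
    (hv : ContMDiff IX IS.tangent ∞ v) (huv : ∀ x, (u x).proj = (v x).proj)
    {r : X → ℝ} (hr : ∀ x, ∀ w : TangentSpace IS (u x).proj,
      (⟨(u x).proj, w⟩ : TangentBundle IS S) = v x → r x = μ (u x).proj (u x).2 w) :
    Continuous r := by
  have hloc : ∀ (b : S) (y y' : ES), ContMDiffAt IS 𝓘(ℝ, ℝ) ∞
      (fun x => μ x (localField b (fun _ => y) x) (localField b (fun _ => y') x)) b := by
    intro b y y'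
    have hs : ∀ y : ES, ∀ᶠ x in nhds b, SmoothFieldAt (I := IS) (localField b fun _ => y) x := by
      intro y
      filter_upwards [(trivializationAt ES (TangentSpace IS : S → Type _) b).open_baseSet.mem_nhds
        (mem_baseSet_trivializationAt_self b)] with x hx
      exact smoothFieldAt_localField hx contMDiffAt_const
    obtain ⟨U, hU, hU'⟩ := exists_smoothField_eventuallyEq (hs y)
    obtain ⟨W, hW, hW'⟩ := exists_smoothField_eventuallyEq (hs y')
    refine (hμ U W hU hW b).congr_of_eventuallyEq ?_
    filter_upwards [hU', hW'] with x h1 h2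
    rw [h1, h2]
  have h2 : ∀ (b : S) (y' : ES) (z : TangentBundle IS S), z.proj = b →
      ContMDiffAt IS.tangent 𝓘(ℝ, ℝ) ∞ (fun z' : TangentBundle IS S =>
        μ z'.proj z'.2 (localField b (fun _ => y') z'.proj)) z := by
    rintro _ y' z rfl
    have h3 := contMDiffWithinAt_linear (π := id) (s := univ) (x₀ := z)
      (Q := fun x =>
        { toFun := fun u => μ x u (localField z.proj (fun _ => y') x)
          map_add' := fun u v => by rw [map_add]; rfl
          map_smul' := fun a u => by rw [map_smul]; rfl })
      (g := fun z : TangentBundle IS S => z.proj) (w := id) (IX := IS.tangent)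
      (fun y => hloc z.proj y y') (contMDiff_tangentBundle_proj z).contMDiffWithinAt
      contMDiffWithinAt_id (mem_univ _) (fun _ _ => rfl)
      (r := fun z' => μ z'.proj z'.2 (localField z.proj (fun _ => y') z'.proj)) ?_
    · exact h3.contMDiffAt Filter.univ_mem
    · rintro ⟨b, u'⟩ - u hu
      have hu' : u = u' := eq_of_heq (Bundle.TotalSpace.mk.inj hu).2
      exact congrArg (fun u => μ b u (localField z.proj (fun _ => y') b)) hu'.symm
  refine ContMDiff.continuous (I := IX) (I' := 𝓘(ℝ, ℝ)) (n := ∞) fun x => ?_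
  exact (contMDiffWithinAt_linear (π := fun z : TangentBundle IS S => z.proj) (s := univ)
    (Q := fun z => (μ z.proj z.2 : TangentSpace IS z.proj →ₗ[ℝ] ℝ)) (g := u) (w := v)
    (fun y => h2 _ y _ (huv x)) (hu x).contMDiffWithinAt (hv x).contMDiffWithinAt (mem_univ _)
    (fun x _ => huv x) (fun x _ => hr x)).contMDiffAt Filter.univ_mem

end LinearFamilies

section BracketPositivity

variable {E : Type*} [NormedAddCommGroup E] [NormedSpace ℝ E] [FiniteDimensional ℝ E]
  {H : Type*} [TopologicalSpace H] {I : ModelWithCorners ℝ E H} [I.Boundaryless]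
  {N : Type*} [TopologicalSpace N] [ChartedSpace H N] [IsManifold I ∞ N]
  {k : ℕ} {β : OneForm I N}

namespace IsContactForm

variable (h : IsContactForm k β)
include h

/-- The projection of the contact Hamiltonian field of `u` to the contact planes. -/
def horizontalHam (u : N → ℝ) (p : N) : TangentSpace I p := h.ham u p - u p • h.reeb p

lemma apply_horizontalHam (u : N → ℝ) (p : N) : β p (h.horizontalHam u p) = 0 := by
  rw [horizontalHam, map_sub, map_smul, h.apply_ham, h.apply_reeb, smul_eq_mul, mul_one, sub_self]

lemma extD_horizontalHam (u : N → ℝ) (p : N) {y : TangentSpace I p} (hy : β p y = 0) :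
    extD β p (h.horizontalHam u p) y = - vderiv I u p y := by
  have h1 := h.extD_ham_of_mem u p hy
  have h2 := h.extD_reeb p y
  rw [← extDL_apply] at h1 h2 ⊢
  rw [horizontalHam, map_sub, LinearMap.sub_apply, h1, map_smul, LinearMap.smul_apply, h2,
    smul_zero, sub_zero]

lemma bracket_eq (f g : N → ℝ) (p : N) :
    vderiv I g p (h.ham f p) - g p * vderiv I f p (h.reeb p) =
      (f p * vderiv I g p (h.reeb p) - g p * vderiv I f p (h.reeb p)) +
        extD β p (h.horizontalHam f p) (h.horizontalHam g p) := by
  rw [extD_swap, h.extD_horizontalHam g p (h.apply_horizontalHam f p), horizontalHam, map_sub,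
    map_smul, smul_eq_mul]
  ring

lemma extD_horizontalHam_nonneg {Φ : N → ℂ} (hΦ : ContMDiff I 𝓘(ℝ, ℂ) ∞ Φ)
    (hw : WedgeNonneg k Φ β) (p : N) : 0 ≤ extD β p (h.horizontalHam (fun q => (Φ q).re) p)
      (h.horizontalHam (fun q => (Φ q).im) p) := by
  set y₁ := h.horizontalHam (fun q => (Φ q).re) p with hy₁
  set y₂ := h.horizontalHam (fun q => (Φ q).im) p with hy₂
  have hd : MDifferentiableAt I 𝓘(ℝ, ℂ) Φ p := (hΦ p).mdifferentiableAt (by simp)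
  have b₁ : β p y₁ = 0 := h.apply_horizontalHam _ p
  have b₂ : β p y₂ = 0 := h.apply_horizontalHam _ p
  have e₁ : ∀ y, β p y = 0 → extD β p y₁ y = - (vderiv I Φ p y).re := fun y hy => by
    rw [hy₁, h.extD_horizontalHam _ p hy, vderiv_re hd]
  have e₂ : ∀ y, β p y = 0 → extD β p y₂ y = - (vderiv I Φ p y).im := fun y hy => by
    rw [hy₂, h.extD_horizontalHam _ p hy, vderiv_im hd]
  by_contra hneg
  push Not at hneg
  rcases k with _ | m
  · have h1 : y₁ = 0 := by
      obtain ⟨v, -, hv⟩ := exists_frame (I := I) h.dim p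
      have : ∀ y : TangentSpace I p, β p y = 0 → y = 0 := fun y hy => by
        have h1 : finrank ℝ (TangentSpace I p) = 1 := h.dim
        have hr : h.reeb p ≠ 0 := fun h0 => by
          have := h.apply_reeb p
          rw [h0, map_zero] at this
          exact zero_ne_one this
        obtain ⟨a, rfl⟩ := (finrank_eq_one_iff_of_nonzero' _ hr).1 h1 y
        rw [map_smul, h.apply_reeb, smul_eq_mul, mul_one] at hy
        rw [hy, zero_smul]
      exact this y₁ b₁
    rw [← extDL_apply, h1, map_zero, LinearMap.zero_apply] at hneg
    exact lt_irrefl _ hneg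
  set κ := extD β p y₁ y₂ with hκ
  have l₁ : vderiv I Φ p y₁ = κ * Complex.I := by
    refine Complex.ext ?_ ?_
    · have := e₁ y₁ b₁
      rw [extD_self] at this
      simp only [Complex.mul_re, Complex.ofReal_re, Complex.I_re, Complex.ofReal_im, Complex.I_im]
      linarith
    · have := e₂ y₁ b₁
      rw [extD_swap] at this
      simp only [Complex.mul_im, Complex.ofReal_re, Complex.I_re, Complex.ofReal_im, Complex.I_im]
      linarith
  have l₂ : vderiv I Φ p y₂ = -κ := by
    refine Complex.ext ?_ ?_
    · have := e₁ y₂ b₂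
      rw [Complex.neg_re, Complex.ofReal_re]
      linarith
    · have := e₂ y₂ b₂
      rw [extD_self] at this
      rw [Complex.neg_im, Complex.ofReal_im]
      linarith
  have hsurj : Function.Surjective (vderiv I Φ p) := fun z => by
    refine ⟨(z.im / κ) • y₁ + (-(z.re / κ)) • y₂, ?_⟩
    rw [map_add, map_smul, map_smul, l₁, l₂]
    have hc : (κ : ℝ) ≠ 0 := hneg.ne
    refine Complex.ext ?_ ?_
    · simp [hc]
    · simp [hc]
  obtain ⟨w, hwl, hw0, -⟩ := exists_ker_frame
    (L := (vderiv I Φ p : TangentSpace I p →ₗ[ℝ] ℂ)) (by rw [Complex.finrank_real_complex, add_comm]; exact h.dim) hsurj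
  have hz : 0 < (conj (vderiv I Φ p y₁) * vderiv I Φ p y₂).im := by
    rw [l₁, l₂]
    have := mul_pos_of_neg_of_neg hneg hneg
    simpa using this
  obtain ⟨c, hc, hcs⟩ := h.normalSign_eq (vderiv I Φ p) b₁ b₂ e₁ e₂ hneg.ne hwl hw0 hz
  have := hw p m rfl y₁ y₂ w ⟨hwl, hw0, hz⟩
  rw [hcs] at this
  exact absurd this (not_le.2 (mul_neg_of_pos_of_neg hc hneg))

lemma extD_horizontalHam_ne_zero {Φ : N → ℂ} (hΦ : ContMDiff I 𝓘(ℝ, ℂ) ∞ Φ)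
    (hb : BindingPositive k Φ β) {p : N} (hp : Φ p = 0) (hs : Function.Surjective (vderiv I Φ p)) :
    extD β p (h.horizontalHam (fun q => (Φ q).re) p)
      (h.horizontalHam (fun q => (Φ q).im) p) ≠ 0 := by
  set y₁ := h.horizontalHam (fun q => (Φ q).re) p with hy₁
  set y₂ := h.horizontalHam (fun q => (Φ q).im) p with hy₂
  have hd : MDifferentiableAt I 𝓘(ℝ, ℂ) Φ p := (hΦ p).mdifferentiableAt (by simp)
  have b₁ : β p y₁ = 0 := h.apply_horizontalHam _ p
  have b₂ : β p y₂ = 0 := h.apply_horizontalHam _ p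
  have e₁ : ∀ y, β p y = 0 → extD β p y₁ y = - (vderiv I Φ p y).re := fun y hy => by
    rw [hy₁, h.extD_horizontalHam _ p hy, vderiv_re hd]
  have e₂ : ∀ y, β p y = 0 → extD β p y₂ y = - (vderiv I Φ p y).im := fun y hy => by
    rw [hy₂, h.extD_horizontalHam _ p hy, vderiv_im hd]
  intro hκ
  have l₁ : vderiv I Φ p y₁ = 0 := by
    have h1 := e₁ y₁ b₁
    have h2 := e₂ y₁ b₁
    rw [extD_self] at h1
    rw [extD_swap, hκ] at h2
    exact Complex.ext (by rw [Complex.zero_re]; linarith) (by rw [Complex.zero_im]; linarith)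
  have l₂ : vderiv I Φ p y₂ = 0 := by
    have h1 := e₁ y₂ b₂
    have h2 := e₂ y₂ b₂
    rw [extD_self] at h2
    rw [hκ] at h1
    exact Complex.ext (by rw [Complex.zero_re]; linarith) (by rw [Complex.zero_im]; linarith)
  have hker : ∀ y, β p y = 0 → vderiv I Φ p y = 0 := by
    rcases k with _ | m
    · intro y hy
      have h1 : finrank ℝ (TangentSpace I p) = 1 := h.dim
      have hr : h.reeb p ≠ 0 := fun h0 => by
        have := h.apply_reeb p
        rw [h0, map_zero] at this
        exact zero_ne_one this
      obtain ⟨a, rfl⟩ := (finrank_eq_one_iff_of_nonzero' _ hr).1 h1 y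
      rw [map_smul, h.apply_reeb, smul_eq_mul, mul_one] at hy
      rw [hy, zero_smul, map_zero]
    · obtain ⟨w, hwl, hw0, hws⟩ := exists_ker_frame (L := (vderiv I Φ p : TangentSpace I p →ₗ[ℝ] ℂ))
        (by rw [Complex.finrank_real_complex, add_comm]; exact h.dim) hs
      obtain ⟨z₁, hz₁⟩ := hs 1
      obtain ⟨z₂, hz₂⟩ := hs Complex.I
      have h1 := hb p hp m rfl z₁ z₂ w ⟨hwl, hw0, by
        change 0 < (conj (vderiv I Φ p z₁) * vderiv I Φ p z₂).im
        rw [hz₁, hz₂]; simp⟩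
      have h2 : topForm m (β p) (extD β p) w ≠ 0 := fun h0 => by
        change 0 < topForm m (β p) (extD β p) w * _ at h1
        rw [h0, zero_mul] at h1
        exact lt_irrefl _ h1
      have hspan : ∀ y ∈ span ℝ (range w), vderiv I Φ p y = 0 := fun y hy => by
        have : span ℝ (range w) ≤
            LinearMap.ker (vderiv I Φ p : TangentSpace I p →ₗ[ℝ] ℂ) :=
          Submodule.span_le.2 (by rintro _ ⟨i, rfl⟩; exact hw0 i)
        exact this hy
      have z1 : y₁ = 0 := eq_zero_of_topForm_ne_zero
        (a := (β p : TangentSpace I p →ₗ[ℝ] ℝ)) (Ω := extDL β p) (extDL_swap β p) h2 (hws _ l₁) b₁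
        fun y hy hy0 => (e₁ y hy0).trans (by rw [hspan y hy, Complex.zero_re, neg_zero])
      have z2 : y₂ = 0 := eq_zero_of_topForm_ne_zero
        (a := (β p : TangentSpace I p →ₗ[ℝ] ℝ)) (Ω := extDL β p) (extDL_swap β p) h2 (hws _ l₂) b₂
        fun y hy hy0 => (e₂ y hy0).trans (by rw [hspan y hy, Complex.zero_im, neg_zero])
      intro y hy
      have f1 := e₁ y hy
      have f2 := e₂ y hy
      rw [z1, ← extDL_apply, map_zero, LinearMap.zero_apply] at f1
      rw [z2, ← extDL_apply, map_zero, LinearMap.zero_apply] at f2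
      exact Complex.ext (by rw [Complex.zero_re]; linarith) (by rw [Complex.zero_im]; linarith)
  have hline : ∀ y, vderiv I Φ p y = (β p y : ℂ) * vderiv I Φ p (h.reeb p) := fun y => by
    have h1 := hker (y - β p y • h.reeb p) (by
      rw [map_sub, map_smul, h.apply_reeb, smul_eq_mul, mul_one, sub_self])
    rw [map_sub, map_smul, sub_eq_zero, Complex.real_smul] at h1
    exact h1
  obtain ⟨z₁, hz₁⟩ := hs 1
  obtain ⟨z₂, hz₂⟩ := hs Complex.I
  rw [hline] at hz₁ hz₂
  have h1 : ((β p z₂ : ℝ) : ℂ) = (β p z₁ : ℝ) * Complex.I := by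
    calc ((β p z₂ : ℝ) : ℂ) = β p z₂ * ((β p z₁ : ℝ) * vderiv I Φ p (h.reeb p)) := by
          rw [hz₁, mul_one]
      _ = (β p z₁ : ℝ) * ((β p z₂ : ℝ) * vderiv I Φ p (h.reeb p)) := by ring
      _ = (β p z₁ : ℝ) * Complex.I := by rw [hz₂]
  have h2 := congrArg Complex.im h1
  simp only [Complex.ofReal_im, Complex.mul_im, Complex.ofReal_re, Complex.I_im, mul_one,
    Complex.I_re, mul_zero, add_zero] at h2
  rw [← h2, Complex.ofReal_zero, zero_mul] at hz₁
  exact zero_ne_one hz₁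

/-- Positivity of the contact bracket for a map defining a supporting open book. -/
theorem bracket_pos {B : OpenBook N} {Φ : N → ℂ} (hΦ : IsDefinedBy I B Φ)
    (hp : PagesPositive k B β) (hb : BindingPositive k Φ β) (hw : WedgeNonneg k Φ β) (p : N) :
    0 < vderiv I (fun q => (Φ q).im) p (h.ham (fun q => (Φ q).re) p)
      - (Φ p).im * vderiv I (fun q => (Φ q).re) p (h.reeb p) := by
  have hd : MDifferentiableAt I 𝓘(ℝ, ℂ) Φ p := (hΦ.1 p).mdifferentiableAt (by simp)
  rw [h.bracket_eq (fun q => (Φ q).re) (fun q => (Φ q).im) p]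
  have hκ := h.extD_horizontalHam_nonneg hΦ.1 hw p
  by_cases h0 : Φ p = 0
  · have := h.extD_horizontalHam_ne_zero hΦ.1 hb h0 (hΦ.2.1 p h0)
    rw [h0, Complex.zero_re, Complex.zero_im, zero_mul, zero_mul, sub_zero, zero_add]
    exact lt_of_le_of_ne hκ this.symm
  · refine add_pos_of_pos_of_nonneg ?_ hκ
    have hpB : p ∉ B.binding := fun h' => h0 (hΦ.mem_binding.1 h')
    obtain ⟨v, hv, hvs⟩ := exists_frame (I := I) h.dim p
    have h1 := hp p hpB v hv
    have h2 := topForm_eq_reeb_mul (a := (β p : TangentSpace I p →ₗ[ℝ] ℝ)) (Ω := extDL β p)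
      (extDL_swap β p) hv (r := h.reeb p) (by rw [hvs]; exact Submodule.mem_top) (h.apply_reeb p)
      (fun y _ => h.extD_reeb p y) (angularForm I B.map p : TangentSpace I p →ₗ[ℝ] ℝ)
    have h3 : topForm k (angularForm I B.map p) (extD β p) v =
      angularForm I B.map p (h.reeb p) * topForm k (β p) (extD β p) v := h2
    rw [h3, mul_assoc] at h1
    have h4 : 0 < angularForm I B.map p (h.reeb p) :=
      (pos_iff_pos_of_mul_pos h1).2 (lt_of_le_of_ne (mul_self_nonneg _) fun h' => by
        rw [← h', mul_zero] at h1
        exact lt_irrefl _ h1)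
    rw [angularForm_of_polar (hΦ.1 p) h0 (by
      filter_upwards [hΦ.isClosed_binding.isOpen_compl.mem_nhds hpB] with q hq
      exact hΦ.2.2.2 q hq)] at h4
    have h5 := (div_pos_iff_of_pos_right (by positivity)).1 h4
    rw [vderiv_im hd, vderiv_re hd]
    rw [Complex.mul_im, Complex.conj_re, Complex.conj_im] at h5
    linarith

end IsContactForm

end BracketPositivity

section InverseFunction

variable {E : Type*} [NormedAddCommGroup E] [NormedSpace ℝ E] [FiniteDimensional ℝ E]
  {H : Type*} [TopologicalSpace H] {I : ModelWithCorners ℝ E H} [I.Boundaryless]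
  {N : Type*} [TopologicalSpace N] [ChartedSpace H N] [IsManifold I ∞ N]

/-- A homeomorphism which is a smooth immersion has a smooth inverse. -/
theorem contMDiff_symm_of_injective_mfderiv (ψ : N ≃ₜ N) (hψ : ContMDiff I I ∞ ψ)
    (hinj : ∀ p, Function.Injective (mfderiv I I ψ p)) : ContMDiff I I ∞ ψ.symm := by
  intro q
  obtain ⟨p, rfl⟩ := ψ.surjective q
  have : CompleteSpace E := FiniteDimensional.complete ℝ E
  set G := writtenInExtChartAt I I p ψ with hG
  set x₀ := extChartAt I p p with hx₀
  have hGx₀ : G x₀ = extChartAt I (ψ p) (ψ p) := by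
    rw [hG, writtenInExtChartAt, Function.comp_apply, Function.comp_apply, hx₀,
      extChartAt_to_inv]
  have hsm : ContDiffAt ℝ ∞ G x₀ := by
    have h1 := (contMDiffAt_iff.1 (hψ p)).2
    rw [I.range_eq_univ, contDiffWithinAt_univ] at h1
    exact h1
  have hder : fderiv ℝ G x₀ = mfderiv I I ψ p := by
    rw [((hψ p).mdifferentiableAt (by simp)).mfderiv, I.range_eq_univ, fderivWithin_univ]
  have hinj' : Function.Injective (fderiv ℝ G x₀ : E →ₗ[ℝ] E) := by
    intro a b hab
    rw [hder] at hab
    exact hinj p hab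
  let e : E ≃L[ℝ] E := (LinearEquiv.ofInjectiveEndo _ hinj').toContinuousLinearEquiv
  have he : HasFDerivAt G (e : E →L[ℝ] E) x₀ :=
    (hsm.differentiableAt (by simp)).hasFDerivAt.congr_fderiv (ContinuousLinearMap.ext fun _ => rfl)
  have hstrict : HasStrictFDerivAt G (e : E →L[ℝ] E) x₀ := hsm.hasStrictFDerivAt' he (by simp)
  have hinv := hsm.to_localInverse he (by simp)
  refine contMDiffAt_iff.2 ⟨ψ.symm.continuous.continuousAt, ?_⟩
  rw [I.range_eq_univ, contDiffWithinAt_univ, ψ.symm_apply_apply]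
  rw [hGx₀] at hinv
  refine hinv.congr_of_eventuallyEq ?_
  set G' : E → E := extChartAt I p ∘ ψ.symm ∘ (extChartAt I (ψ p)).symm with hG'
  have hc1 : ContinuousAt (ψ.symm ∘ (extChartAt I (ψ p)).symm) (extChartAt I (ψ p) (ψ p)) :=
    ψ.symm.continuous.continuousAt.comp (continuousAt_extChartAt_symm (ψ p))
  have hv : (ψ.symm ∘ (extChartAt I (ψ p)).symm) (extChartAt I (ψ p) (ψ p)) = p := by
    rw [Function.comp_apply, extChartAt_to_inv, ψ.symm_apply_apply]
  have hsrc : ∀ᶠ y in nhds (extChartAt I (ψ p) (ψ p)),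
      (ψ.symm ∘ (extChartAt I (ψ p)).symm) y ∈ (extChartAt I p).source := by
    refine hc1 ?_
    rw [hv]
    exact extChartAt_source_mem_nhds p
  have hc2 : ContinuousAt G' (extChartAt I (ψ p) (ψ p)) := by
    refine ContinuousAt.comp ?_ hc1
    rw [hv]
    exact continuousAt_extChartAt p
  have hG'0 : G' (extChartAt I (ψ p) (ψ p)) = x₀ := congrArg (extChartAt I p) hv
  have hleft : ∀ᶠ x in nhds (G' (extChartAt I (ψ p) (ψ p))),
      hstrict.localInverse G e x₀ (G x) = x := by
    rw [hG'0]
    exact hstrict.eventually_left_inverse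
  filter_upwards [hsrc, hc2 hleft,
    (isOpen_extChartAt_target (I := I) (ψ p)).mem_nhds (mem_extChartAt_target (ψ p))]
    with y hy1 hy2 hy3
  have h3 : G (G' y) = y := by
    change extChartAt I (ψ p) (ψ ((extChartAt I p).symm (extChartAt I p
      ((ψ.symm ∘ (extChartAt I (ψ p)).symm) y)))) = y
    rw [(extChartAt I p).left_inv hy1, Function.comp_apply, ψ.apply_symm_apply]
    exact (extChartAt I (ψ p)).right_inv hy3
  have h4 : hstrict.localInverse G e x₀ (G (G' y)) = G' y := hy2
  rw [h3] at h4
  exact h4.symm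

end InverseFunction

section FibreBundles

variable {EV : Type*} [NormedAddCommGroup EV] [NormedSpace ℝ EV] [FiniteDimensional ℝ EV]
  {HV : Type*} [TopologicalSpace HV] {IV : ModelWithCorners ℝ EV HV} [IV.Boundaryless]
  {V : Type*} [TopologicalSpace V] [ChartedSpace HV V] [IsManifold IV ∞ V]
  {ES : Type*} [NormedAddCommGroup ES] [NormedSpace ℝ ES] [FiniteDimensional ℝ ES]
  {HS : Type*} [TopologicalSpace HS] {IS : ModelWithCorners ℝ ES HS} [IS.Boundaryless]
  {S : Type*} [TopologicalSpace S] [ChartedSpace HS S] [IsManifold IS ∞ S]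
  {EM : Type*} [NormedAddCommGroup EM] [NormedSpace ℝ EM] [FiniteDimensional ℝ EM]
  {HM : Type*} [TopologicalSpace HM] {IM : ModelWithCorners ℝ EM HM} [IM.Boundaryless]
  {M : Type*} [TopologicalSpace M] [ChartedSpace HM M] [IsManifold IM ∞ M]
  {k : ℕ} {π : V → S} {η₀ η : HyperplaneField IV V} {α₀ α : OneForm IV V}

lemma IsSmoothTrivialization.contMDiffAt_proj {e : Bundle.Trivialization M π}
    (he : IsSmoothTrivialization IV IS IM e) {p : V} (hp : π p ∈ e.baseSet) :
    ContMDiffAt IV IS ∞ π p := by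
  have hp' : p ∈ e.source := e.mem_source.2 hp
  have h1 : ContMDiffAt IV IS ∞ (fun q => (e q).1) p :=
    contMDiffAt_fst.comp p ((he.1 p hp').contMDiffAt (e.open_source.mem_nhds hp'))
  refine h1.congr_of_eventuallyEq ?_
  filter_upwards [e.open_source.mem_nhds hp'] with q hq
  exact (e.coe_fst hq).symm

lemma IsSmoothTrivialization.surjective_mfderiv_proj {e : Bundle.Trivialization M π}
    (he : IsSmoothTrivialization IV IS IM e) {p : V} (hp : π p ∈ e.baseSet) :
    Function.Surjective (mfderiv IV IS π p) := by
  have hp' : p ∈ e.source := e.mem_source.2 hp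
  have ht : ∀ x ∈ e.baseSet, (x, (e p).2) ∈ e.target := fun x hx => e.mem_target.2 hx
  have hsm : ContMDiffAt IS IV ∞ (fun x => e.toOpenPartialHomeomorph.symm (x, (e p).2)) (π p) :=
    ContMDiffAt.comp (π p) ((he.2 _ (ht _ hp)).contMDiffAt (e.open_target.mem_nhds (ht _ hp)))
      (contMDiffAt_id.prodMk contMDiffAt_const)
  have hs0 : e.toOpenPartialHomeomorph.symm (π p, (e p).2) = p := by
    have : (π p, (e p).2) = e p := Prod.ext (e.coe_fst hp').symm rfl
    rw [this]; exact e.left_inv hp'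
  have key : ∀ q, q = p → ∀ D : TangentSpace IS (π p) →L[ℝ] TangentSpace IV q,
      (∀ u, HEq (mfderiv IV IS π q (D u)) u) → Function.Surjective (mfderiv IV IS π p) := by
    rintro q rfl D hD u
    exact ⟨D u, eq_of_heq (hD u)⟩
  refine key _ hs0 (mfderiv IS IV (fun x => e.toOpenPartialHomeomorph.symm (x, (e p).2)) (π p))
    fun u => ?_
  have h1 := mfderiv_comp (π p) (I'' := IS) (g := π)
    (f := fun x => e.toOpenPartialHomeomorph.symm (x, (e p).2)) (by
      refine (he.contMDiffAt_proj ?_).mdifferentiableAt (by simp)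
      rw [hs0]; exact hp) (hsm.mdifferentiableAt (by simp))
  have h2 : (π ∘ fun x => e.toOpenPartialHomeomorph.symm (x, (e p).2)) =ᶠ[nhds (π p)] id := by
    filter_upwards [e.open_baseSet.mem_nhds hp] with x hx
    exact e.proj_symm_apply (ht x hx)
  rw [h2.mfderiv_eq, mfderiv_id] at h1
  exact heq_of_eq (congrArg (fun L : ES →L[ℝ] ES => L u) h1).symm

variable (IV IS k π) in
/-- A one-form on the total space of a submersion to a surface, which is a contact form on
the fibres. -/
structure IsFibredContactForm (α : OneForm IV V) : Prop where
  dim_total : finrank ℝ EV = 2 * k + 3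
  dim_base : finrank ℝ ES = 2
  smooth : SmoothForm α
  proj : ContMDiff IV IS ∞ π
  submersive : ∀ p, Function.Surjective (mfderiv IV IS π p)
  nondeg : ∀ p, ∀ w : Fin (2 * k + 1) → TangentSpace IV p, LinearIndependent ℝ w →
    (∀ i, IsVertical IV IS π p (w i)) → topForm k (α p) (extD α p) w ≠ 0

/-- The horizontality condition for one form. -/
def IsHorizontalFor (IV : ModelWithCorners ℝ EV HV) (IS : ModelWithCorners ℝ ES HS) (π : V → S)
    (α : OneForm IV V) (p : V) (w : TangentSpace IV p) : Prop :=
  α p w = 0 ∧ ∀ z, IsVertical IV IS π p z → α p z = 0 → extD α p w z = 0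

lemma isHorizontal_iff {α : OneForm IV V} {η : HyperplaneField IV V} (hα : Defines α η) {p : V}
    {w : TangentSpace IV p} : IsHorizontal IV IS π η p w ↔ IsHorizontalFor IV IS π α p w := by
  refine ⟨fun h => h α hα, fun h γ hγ => ?_⟩
  obtain ⟨c, hc, -, rfl⟩ := exists_factor_of_defines hα hγ
  refine ⟨by change c p * α p w = 0; rw [h.1, mul_zero], fun z hz hαz => ?_⟩
  have hz0 : α p z = 0 := by
    obtain ⟨c', -, hc', h'⟩ := exists_factor_of_defines hγ hα
    rw [h']
    change c' p * (c p • α p) z = 0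
    rw [hαz, mul_zero]
  rw [extD_smul (hc p) hα.1, h.2 z hz hz0, h.1, hz0]
  ring

namespace IsFibredContactForm

variable {α : OneForm IV V} (h : IsFibredContactForm IV IS k π α)
include h

lemma exists_vertical_frame (p : V) : ∃ w : Fin (2 * k + 1) → TangentSpace IV p,
    LinearIndependent ℝ w ∧ (∀ i, IsVertical IV IS π p (w i)) ∧
    ∀ z, IsVertical IV IS π p z → z ∈ span ℝ (range w) := by
  exact exists_ker_frame (L := (mfderiv IV IS π p : TangentSpace IV p →ₗ[ℝ] TangentSpace IS (π p)))
    (by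
      rw [show finrank ℝ (TangentSpace IS (π p)) = 2 from h.dim_base, add_comm]
      exact h.dim_total) (h.submersive p)

lemma isVertical_of_mem_span {p : V} {w : Fin (2 * k + 1) → TangentSpace IV p}
    (hw : ∀ i, IsVertical IV IS π p (w i)) {z : TangentSpace IV p}
    (hz : z ∈ span ℝ (range w)) : IsVertical IV IS π p z := by
  let L : TangentSpace IV p →ₗ[ℝ] TangentSpace IS (π p) := mfderiv IV IS π p
  have : span ℝ (range w) ≤ LinearMap.ker L := Submodule.span_le.2 (by
    rintro _ ⟨i, rfl⟩; exact hw i)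
  exact this hz

lemma exists_reeb (p : V) : ∃ r, IsVertical IV IS π p r ∧ α p r = 1 := by
  obtain ⟨w, hw, hv, -⟩ := h.exists_vertical_frame p
  obtain ⟨⟨r, hr, hr1, -⟩, -⟩ := exists_reeb_and_hamiltonian
    (a := (α p : TangentSpace IV p →ₗ[ℝ] ℝ)) (Ω := extDL α p) (extDL_swap α p) (h.nondeg p w hw hv)
  exact ⟨r, h.isVertical_of_mem_span hv hr, hr1⟩

lemma defines : Defines α (cokernel α) := ⟨h.smooth, fun p h0 => by
  obtain ⟨r, -, hr⟩ := h.exists_reeb p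
  rw [h0] at hr
  exact zero_ne_one hr, rfl⟩

lemma eq_zero {p : V} {x : TangentSpace IV p} (hx : IsVertical IV IS π p x)
    (hh : IsHorizontalFor IV IS π α p x) : x = 0 := by
  obtain ⟨w, hw, hv, hs⟩ := h.exists_vertical_frame p
  exact eq_zero_of_topForm_ne_zero (a := (α p : TangentSpace IV p →ₗ[ℝ] ℝ)) (Ω := extDL α p)
    (extDL_swap α p) (h.nondeg p w hw hv) (hs x hx) hh.1
    fun y hy hy0 => hh.2 y (h.isVertical_of_mem_span hv hy) hy0

lemma exists_lift (p : V) (u : TangentSpace IS (π p)) :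
    ∃ w, mfderiv IV IS π p w = u ∧ IsHorizontalFor IV IS π α p w := by
  obtain ⟨w, hw, hv, hs⟩ := h.exists_vertical_frame p
  obtain ⟨x₀, hx₀⟩ := h.submersive p u
  obtain ⟨-, h2⟩ := exists_reeb_and_hamiltonian
    (a := (α p : TangentSpace IV p →ₗ[ℝ] ℝ)) (Ω := extDL α p) (extDL_swap α p) (h.nondeg p w hw hv)
  obtain ⟨x, hx, hx1, hx2⟩ := h2 (- α p x₀) (- extDL α p x₀)
  refine ⟨x₀ + x, ?_, ?_, fun z hz hαz => ?_⟩
  · have : mfderiv IV IS π p x = 0 := h.isVertical_of_mem_span hv hx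
    rw [map_add, hx₀, this, add_zero]
  · have : α p x = - α p x₀ := hx1
    rw [map_add, this, add_neg_cancel]
  · have := hx2 z (hs z hz) hαz
    rw [← extDL_apply, map_add, LinearMap.add_apply, this, LinearMap.neg_apply, add_neg_cancel]

lemma lift_unique {p : V} {w w' : TangentSpace IV p}
    (hw : IsHorizontalFor IV IS π α p w) (hw' : IsHorizontalFor IV IS π α p w')
    (hd : mfderiv IV IS π p w = mfderiv IV IS π p w') : w = w' := by
  rw [← sub_eq_zero]
  refine h.eq_zero (by rw [IsVertical, map_sub, hd, sub_self])
    ⟨by rw [map_sub, hw.1, hw'.1, sub_self], fun z hz hαz => ?_⟩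
  have h1 := hw.2 z hz hαz
  have h2 := hw'.2 z hz hαz
  rw [← extDL_apply] at h1 h2 ⊢
  rw [map_sub, LinearMap.sub_apply, h1, h2, sub_self]

lemma horizontalLift_spec {η : HyperplaneField IV V} (hη : Defines α η) (p : V)
    (u : TangentSpace IS (π p)) :
    mfderiv IV IS π p (horizontalLift IV IS π η p ⟨π p, u⟩) = u ∧
      IsHorizontalFor IV IS π α p (horizontalLift IV IS π η p ⟨π p, u⟩) := by
  obtain ⟨w, hw1, hw2⟩ := h.exists_lift p u
  have hex : ∃ w, IsHorizontal IV IS π η p w ∧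
      tangentMap IV IS π (⟨p, w⟩ : TangentBundle IV V) = ⟨π p, u⟩ :=
    ⟨w, (isHorizontal_iff hη).2 hw2, by rw [tangentMap]; congr⟩
  have hs := Classical.epsilon_spec hex
  refine ⟨?_, (isHorizontal_iff hη).1 hs.1⟩
  exact eq_of_heq (Bundle.TotalSpace.mk.inj hs.2).2

lemma horizontalLift_eq {η : HyperplaneField IV V} (hη : Defines α η) {p : V}
    {u : TangentSpace IS (π p)} {w : TangentSpace IV p} (hw : mfderiv IV IS π p w = u)
    (hh : IsHorizontalFor IV IS π α p w) : horizontalLift IV IS π η p ⟨π p, u⟩ = w :=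
  have hs := h.horizontalLift_spec hη p u
  h.lift_unique hs.2 hh (hs.1.trans hw.symm)

lemma exists_base_chart (p₀ : V) : ∃ (O₀ : Set V) (c : S → ES), IsOpen O₀ ∧ p₀ ∈ O₀ ∧
    (∀ q ∈ O₀, ContMDiffAt IS 𝓘(ℝ, ES) ∞ c (π q)) ∧
    (∀ q ∈ O₀, ∀ v, vderiv IV (fun q => c (π q)) q v = vderiv IS c (π q) (mfderiv IV IS π q v)) ∧
    (∀ q ∈ O₀, ∀ u, vderiv IS c (π q) u = 0 → u = 0) ∧
    Function.Surjective ((vderiv IV (fun q => c (π q)) p₀).prod (α p₀)) := by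
  let c : S → ES := extChartAt IS (π p₀)
  let O₀ : Set V := π ⁻¹' (extChartAt IS (π p₀)).source
  have hO₀ : IsOpen O₀ := (isOpen_extChartAt_source _).preimage h.proj.continuous
  have hp₀ : p₀ ∈ O₀ := mem_extChartAt_source (π p₀)
  have hc : ∀ q ∈ O₀, ContMDiffAt IS 𝓘(ℝ, ES) ∞ c (π q) := fun q hq =>
    contMDiffAt_extChartAt_of_mem hq
  have hder : ∀ q ∈ O₀, ∀ v, vderiv IV (fun q => c (π q)) q v =
      vderiv IS c (π q) (mfderiv IV IS π q v) := fun q hq v =>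
    vderiv_comp_map ((hc q hq).mdifferentiableAt (by simp))
      ((h.proj q).mdifferentiableAt (by simp)) v
  have hcinj : ∀ q ∈ O₀, ∀ u, vderiv IS c (π q) u = 0 → u = 0 := fun q hq u hu => by
    have h1 := mfderiv_symm_comp_mfderiv_extChartAt hq u
    have h2 : mfderiv IS 𝓘(ℝ, ES) (extChartAt IS (π p₀)) (π q) u = 0 := hu
    rw [h2] at h1
    exact h1.symm.trans (map_zero _)
  refine ⟨O₀, c, hO₀, hp₀, hc, hder, hcinj, ?_⟩
  rintro ⟨y, a⟩
  obtain ⟨r, hr, hr1⟩ := h.exists_reeb p₀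
  obtain ⟨u₀, hu₀⟩ : ∃ u₀, vderiv IS c (π p₀) u₀ = y :=
    have hd : finrank ℝ (TangentSpace IS (π p₀)) = finrank ℝ ES := rfl
    (LinearMap.injective_iff_surjective_of_finrank_eq_finrank hd
      (f := (vderiv IS c (π p₀) : TangentSpace IS (π p₀) →ₗ[ℝ] ES))).1
      ((injective_iff_map_eq_zero _).2 (hcinj p₀ hp₀)) y
  obtain ⟨x, hx⟩ := h.submersive p₀ u₀
  refine ⟨x + (a - α p₀ x) • r, Prod.ext ?_ ?_⟩
  · have e1 : vderiv IV (fun q => c (π q)) p₀ (x + (a - α p₀ x) • r) = y := by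
      rw [hder p₀ hp₀, map_add, map_smul, hx, show mfderiv IV IS π p₀ r = 0 from hr, smul_zero,
        add_zero, hu₀]
    exact e1
  · change α p₀ (x + (a - α p₀ x) • r) = a
    rw [map_add, map_smul, hr1, smul_eq_mul, mul_one, add_sub_cancel]

lemma exists_local_vertical {p₀ : V} {z : TangentSpace IV p₀} (hz : IsVertical IV IS π p₀ z)
    (hαz : α p₀ z = 0) : ∃ Z : ∀ p : V, TangentSpace IV p, Z p₀ = z ∧
      ∀ᶠ q in nhds p₀, SmoothFieldAt Z q ∧ IsVertical IV IS π q (Z q) ∧ α q (Z q) = 0 := by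
  obtain ⟨O₀, c, hO₀, hp₀, hc, hder, hcinj, hsurj⟩ := h.exists_base_chart p₀
  obtain ⟨O', hO'sub, hO', hpO', -, Z, hZ0, hZ⟩ := exists_local_solution hO₀
    (A := fun q => (vderiv IV (fun q => c (π q)) q).prod (α q))
    (fun q hq => (contMDiffAt_vderiv ((hc q hq).comp q (h.proj q))).prod (h.smooth.smoothMapAt q))
    hp₀ hsurj (y := fun _ => 0) (fun _ _ => contMDiffAt_const) z
    (Prod.ext ((hder p₀ hp₀ z).trans (by
      rw [show mfderiv IV IS π p₀ z = 0 from hz, map_zero]; rfl)) hαz)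
  refine ⟨Z, hZ0, ?_⟩
  filter_upwards [hO'.mem_nhds hpO'] with q hq
  obtain ⟨h1, h2⟩ := hZ q hq
  exact ⟨h1, hcinj q (hO'sub hq) _ ((hder q (hO'sub hq) _).symm.trans (congrArg Prod.fst h2)),
    congrArg Prod.snd h2⟩

/-- Horizontal lifts of smooth fields are smooth. -/
theorem smoothFieldAt_of_horizontal {W : ∀ p : V, TangentSpace IV p}
    {U : ∀ x : S, TangentSpace IS x} {p₀ : V} (hU : ∀ᶠ x in nhds (π p₀), SmoothFieldAt U x)
    (hW : ∀ p, mfderiv IV IS π p (W p) = U (π p))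
    (hh : ∀ p, IsHorizontalFor IV IS π α p (W p)) : SmoothFieldAt W p₀ := by
  obtain ⟨O₁, c, hO₁, hp₁, hc₁, hder₁, hcinj₁, hsurj⟩ := h.exists_base_chart p₀
  obtain ⟨O, hOU, hO, hO0⟩ := eventually_nhds_iff.1 hU
  let O₀ : Set V := π ⁻¹' O ∩ O₁
  have hO₀ : IsOpen O₀ := (hO.preimage h.proj.continuous).inter hO₁
  have hp₀ : p₀ ∈ O₀ := ⟨hO0, hp₁⟩
  have hc := fun q (hq : q ∈ O₀) => hc₁ q hq.2
  have hder := fun q (hq : q ∈ O₀) => hder₁ q hq.2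
  have hcinj := fun q (hq : q ∈ O₀) => hcinj₁ q hq.2
  let A₁ : ∀ q : V, TangentSpace IV q →L[ℝ] ES × ℝ := fun q =>
    (vderiv IV (fun q => c (π q)) q).prod (α q)
  have hA₁ : ∀ q ∈ O₀, SmoothMapAt A₁ q := fun q hq =>
    (contMDiffAt_vderiv ((hc q hq).comp q (h.proj q))).prod (h.smooth.smoothMapAt q)
  have hker : ∀ q ∈ O₀, ∀ v, A₁ q v = 0 → IsVertical IV IS π q v ∧ α q v = 0 := fun q hq v hv =>
    ⟨hcinj q hq _ ((hder q hq v).symm.trans (congrArg Prod.fst hv)), congrArg Prod.snd hv⟩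
  replace hsurj : Function.Surjective (A₁ p₀) := hsurj
  have hrank := LinearMap.finrank_range_add_finrank_ker
    (A₁ p₀ : TangentSpace IV p₀ →ₗ[ℝ] ES × ℝ)
  rw [LinearMap.range_eq_top.2 hsurj, finrank_top, Module.finrank_prod, h.dim_base,
    Module.finrank_self,
    show finrank ℝ (TangentSpace IV p₀) = 2 * k + 3 from h.dim_total] at hrank
  let b := Module.finBasisOfFinrankEq ℝ
    (LinearMap.ker (A₁ p₀ : TangentSpace IV p₀ →ₗ[ℝ] ES × ℝ)) (n := 2 * k) (by omega)
  have hsol := fun i => exists_local_solution hO₀ hA₁ hp₀ hsurj (y := fun _ => 0)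
    (fun _ _ => contMDiffAt_const) (b i : TangentSpace IV p₀) (b i).2
  choose O' hO'sub hO' hpO' _ Z hZ0 hZ using hsol
  let A : ∀ q : V, TangentSpace IV q →L[ℝ] (ES × ℝ) × (Fin (2 * k) → ℝ) := fun q =>
    (A₁ q).prod (ContinuousLinearMap.pi fun i => contractD α (Z i) q)
  have hopen : IsOpen (O₀ ∩ ⋂ i, O' i) := hO₀.inter (isOpen_iInter_of_finite hO')
  refine smoothFieldAt_of_bijective hopen (A := A) (fun q hq => ?_) ⟨hp₀, mem_iInter.2 hpO'⟩ ?_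
    fun q hq => ?_
  · refine (hA₁ q hq.1).prod fun X hX => ?_
    refine contMDiffAt_pi_space.2 fun i => ?_
    exact h.smooth.smoothMapAt_contractD (hZ i q (mem_iInter.1 hq.2 i)).1 X hX
  · have hinj : Function.Injective (A p₀) := by
      rw [injective_iff_map_eq_zero]
      intro v hv
      obtain ⟨h1, h2⟩ := hker p₀ hp₀ v (congrArg Prod.fst hv)
      refine h.eq_zero h1 ⟨h2, fun z hz hαz => ?_⟩
      have hz1 : A₁ p₀ z = 0 := Prod.ext
        ((hder p₀ hp₀ z).trans (by rw [show mfderiv IV IS π p₀ z = 0 from hz, map_zero]; rfl)) hαz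
      let z' : LinearMap.ker (A₁ p₀ : TangentSpace IV p₀ →ₗ[ℝ] ES × ℝ) := ⟨z, hz1⟩
      have hz2 : (extDL α p₀ v ∘ₗ Submodule.subtype _) z' = 0 := by
        have : extDL α p₀ v ∘ₗ Submodule.subtype _ = 0 := b.ext fun i => by
          have h3 := congrFun (congrArg Prod.snd hv) i
          have h4 : contractD α (Z i) p₀ v = 0 := h3
          rw [contractD_apply, hZ0] at h4
          exact h4
        rw [this]; rfl
      exact hz2
    have hdim : finrank ℝ (TangentSpace IV p₀) =
        finrank ℝ ((ES × ℝ) × (Fin (2 * k) → ℝ)) := by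
      rw [Module.finrank_prod, Module.finrank_prod, h.dim_base, Module.finrank_self,
        Module.finrank_fin_fun, show finrank ℝ (TangentSpace IV p₀) = _ from h.dim_total]
      omega
    exact ⟨hinj, (LinearMap.injective_iff_surjective_of_finrank_eq_finrank hdim
      (f := (A p₀ : TangentSpace IV p₀ →ₗ[ℝ] _))).1 hinj⟩
  · have h1 : ContMDiffAt IV 𝓘(ℝ, ES) ∞ (fun q => vderiv IS c (π q) (U (π q))) q :=
      ContMDiffAt.comp q (g := fun x => vderiv IS c x (U x))
        (contMDiffAt_vderiv (hc q hq.1) U (hOU _ hq.1.1)) (h.proj q)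
    have h2 : ContMDiffAt IV 𝓘(ℝ, (ES × ℝ) × (Fin (2 * k) → ℝ)) ∞
        (fun q => ((vderiv IS c (π q) (U (π q)), (0 : ℝ)), (0 : Fin (2 * k) → ℝ))) q :=
      (h1.prodMk_space contMDiffAt_const).prodMk_space contMDiffAt_const
    refine h2.congr_of_eventuallyEq ?_
    filter_upwards [hopen.mem_nhds hq] with r hr
    refine Prod.ext (Prod.ext ?_ (hh r).1) (funext fun i => ?_)
    · exact (hder r hr.1 _).trans (by rw [hW])
    · obtain ⟨h3, h4⟩ := hker r hr.1 _ (hZ i r (mem_iInter.1 hr.2 i)).2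
      exact (hh r).2 _ h3 h4

lemma smoothFieldAt_liftField {η : HyperplaneField IV V} (hη : Defines α η)
    {U : ∀ x : S, TangentSpace IS x} {p₀ : V} (hU : ∀ᶠ x in nhds (π p₀), SmoothFieldAt U x) :
    SmoothFieldAt (liftField IV IS π η U) p₀ :=
  h.smoothFieldAt_of_horizontal hU (fun p => (h.horizontalLift_spec hη p _).1)
    (fun p => (h.horizontalLift_spec hη p _).2)

end IsFibredContactForm

lemma smoothFieldAt_zero {E : Type*} [NormedAddCommGroup E] [NormedSpace ℝ E]
    {H : Type*} [TopologicalSpace H] {I : ModelWithCorners ℝ E H}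
    {N : Type*} [TopologicalSpace N] [ChartedSpace H N] [IsManifold I ∞ N] (p : N) :
    SmoothFieldAt (0 : ∀ p : N, TangentSpace I p) p :=
  (Bundle.contMDiff_zeroSection ℝ (TangentSpace I : N → Type _)) p

lemma definingForm_defines (h : ∃ α, Defines α η) : Defines (definingForm IV η) η :=
  Classical.epsilon_spec h

lemma IsContactFibreBundle.isFibredContactForm (h : IsContactFibreBundle IV IS k π η)
    (hV : finrank ℝ EV = 2 * k + 3) (hS : finrank ℝ ES = 2)
    (hb : IsSmoothFibreBundle IV IS IM M π) (hα : Defines α η) :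
    IsFibredContactForm IV IS k π α where
  dim_total := hV
  dim_base := hS
  smooth := hα.1
  proj p := by
    obtain ⟨e, he, hs⟩ := hb (π p)
    exact hs.contMDiffAt_proj he
  submersive p := by
    obtain ⟨e, he, hs⟩ := hb (π p)
    exact hs.surjective_mfderiv_proj he
  nondeg p w hw hv := by
    obtain ⟨γ, hγ, h'⟩ := h
    obtain ⟨c, hc, hpos, rfl⟩ := exists_factor_of_defines hγ hα
    rw [topForm_rescale hγ.1 hc]
    exact mul_ne_zero (pow_ne_zero _ (hpos p).ne') (h' p w hw hv)

namespace IsFibredContactForm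

variable (h : IsFibredContactForm IV IS k π α)
include h

lemma smoothField_liftField (hη : Defines α η) {U : ∀ x : S, TangentSpace IS x}
    (hU : SmoothField U) : SmoothField (liftField IV IS π η U) := fun _ =>
  h.smoothFieldAt_liftField hη (.of_forall hU.smoothFieldAt)

lemma mfderiv_liftField (hη : Defines α η) (U : ∀ x : S, TangentSpace IS x) (p : V) :
    mfderiv IV IS π p (liftField IV IS π η U p) = U (π p) := (h.horizontalLift_spec hη p _).1

lemma isHorizontalFor_liftField (hη : Defines α η) (U : ∀ x : S, TangentSpace IS x) (p : V) :
    IsHorizontalFor IV IS π α p (liftField IV IS π η U p) := (h.horizontalLift_spec hη p _).2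

lemma mfderiv_mlieBracket_liftField (hη : Defines α η) {U W : ∀ x : S, TangentSpace IS x}
    (hU : SmoothField U) (hW : SmoothField W) (p : V) :
    mfderiv IV IS π p
      (mlieBracket IV (liftField IV IS π η U) (liftField IV IS π η W) p) =
      mlieBracket IS U W (π p) :=
  mfderiv_mlieBracket_of_related (h.proj p) (h.smoothField_liftField hη hU p)
    (h.smoothField_liftField hη hW p) (hU _) (hW _)
    (.of_forall (h.mfderiv_liftField hη U))
    (.of_forall (h.mfderiv_liftField hη W))

/-- For a flat connection, horizontal lifting commutes with brackets. -/
lemma mlieBracket_liftField (hη : Defines α η)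
    (hflat : ∀ X Z, SmoothField X → SmoothField Z → ∀ p, curvature IV IS π η X Z p = 0)
    {U W : ∀ x : S, TangentSpace IS x} (hU : SmoothField U) (hW : SmoothField W) (p : V) :
    mlieBracket IV (liftField IV IS π η U) (liftField IV IS π η W) p =
      liftField IV IS π η (mlieBracket IS U W) p := by
  have hh : ∀ U : ∀ x : S, TangentSpace IS x,
      horizontalPart IV IS π η (liftField IV IS π η U) = liftField IV IS π η U := fun U => by
    funext q
    refine congrArg (horizontalLift IV IS π η q) ?_
    exact congrArg (Bundle.TotalSpace.mk (π q)) (h.mfderiv_liftField hη U q)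
  have h1 := hflat _ _ (h.smoothField_liftField hη hU) (h.smoothField_liftField hη hW) p
  simp only [curvature, hh, sub_eq_zero] at h1
  rw [h1]
  refine congrArg (horizontalLift IV IS π η p) ?_
  exact congrArg (Bundle.TotalSpace.mk (π p)) (h.mfderiv_mlieBracket_liftField hη hU hW p)

lemma extD_liftField_of_mlieBracket (hη : Defines α η) {U W : ∀ x : S, TangentSpace IS x}
    (hU : SmoothField U) (hW : SmoothField W) (p : V) :
    extD α p (liftField IV IS π η U p) (liftField IV IS π η W p) =
      - α p (mlieBracket IV (liftField IV IS π η U) (liftField IV IS π η W) p) := by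
  have h0 : ∀ U : ∀ x : S, TangentSpace IS x,
      (fun q => α q (liftField IV IS π η U q)) = fun _ => 0 := fun U =>
    funext fun q => (h.isHorizontalFor_liftField hη U q).1
  rw [h.smooth.extD_eq_lieBracket (h.smoothField_liftField hη hU p)
    (h.smoothField_liftField hη hW p), h0, h0, vderiv_const, vderiv_const, sub_zero, zero_sub]

lemma isVertical_mfderiv_fibre {b : S} {j : M ≃ Fibre π b}
    (hj : IsFibreDiffeo IV IM j) (m : M) (v : TangentSpace IM m) :
    IsVertical IV IS π (j m : V) (mfderiv IM IV (fun m => (j m : V)) m v) := by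
  have h2 := mfderiv_comp (I := IM) (I' := IV) (I'' := IS) (g := π) (f := fun m => (j m : V)) m
    ((h.proj (j m)).mdifferentiableAt (by simp)) ((hj.1 m).mdifferentiableAt (by simp))
  have h3 : (π ∘ fun m => (j m : V)) = fun _ => b := funext fun m => (j m).2
  have h4 : mfderiv IM IS (π ∘ fun m => (j m : V)) m = (0 : EM →L[ℝ] ES) := by
    rw [h3]; exact mfderiv_const
  exact (congrArg (fun L : EM →L[ℝ] ES => L v) h2).symm.trans
    (congrArg (fun L : EM →L[ℝ] ES => L v) h4)

/-- A contact form on the fibres of the bundle restricts to a contact form of each fibre. -/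
lemma isContactForm_pullback (hM : finrank ℝ EM = 2 * k + 1) {b : S} {j : M ≃ Fibre π b}
    (hj : IsFibreDiffeo IV IM j) : IsContactForm k (pullbackForm IM (fun m => (j m : V)) α) where
  dim := hM
  smooth := h.smooth.pullbackForm hj.1
  nondeg m v hv := by
    have h1 : topForm k (pullbackForm IM (fun m => (j m : V)) α m)
        (extD (pullbackForm IM (fun m => (j m : V)) α) m) v = topForm k (α (j m)) (extD α (j m))
          (fun i => mfderiv IM IV (fun m => (j m : V)) m (v i)) := by
      simp only [topForm, extD_pullbackForm h.smooth (hj.1 m)]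
      rfl
    rw [h1]
    let L : TangentSpace IM m →L[ℝ] TangentSpace IV (j m : V) :=
      mfderiv IM IV (fun m => (j m : V)) m
    have hL : LinearMap.ker (L : TangentSpace IM m →ₗ[ℝ] TangentSpace IV (j m : V)) = ⊥ :=
      LinearMap.ker_eq_bot.2 (hj.2 m)
    exact h.nondeg _ _ (hv.map' (L : TangentSpace IM m →ₗ[ℝ] TangentSpace IV (j m : V)) hL)
      fun i => h.isVertical_mfderiv_fibre hj m (v i)

lemma exists_mfderiv_eq_of_isVertical (hM : finrank ℝ EM = 2 * k + 1) {b : S}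
    {j : M ≃ Fibre π b} (hj : IsFibreDiffeo IV IM j) (m : M) {z : TangentSpace IV (j m : V)}
    (hz : IsVertical IV IS π (j m : V) z) :
    ∃ v, mfderiv IM IV (fun m => (j m : V)) m v = z := by
  obtain ⟨w, hw, hv, hs⟩ := h.exists_vertical_frame (j m : V)
  let L : TangentSpace IM m →ₗ[ℝ] TangentSpace IV (j m : V) :=
    (mfderiv IM IV (fun m => (j m : V)) m : TangentSpace IM m →L[ℝ] TangentSpace IV (j m : V))
  have hle : LinearMap.range L ≤ span ℝ (range w) := by
    rintro _ ⟨v, rfl⟩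
    exact hs _ (h.isVertical_mfderiv_fibre hj m v)
  have h1 : finrank ℝ (LinearMap.range L) = 2 * k + 1 :=
    (LinearMap.finrank_range_of_inj (f := L) (hj.2 m)).trans hM
  have h2 : finrank ℝ (span ℝ (range w)) = 2 * k + 1 :=
    (finrank_span_eq_card hw).trans (Fintype.card_fin _)
  have h3 := Submodule.eq_of_le_of_finrank_eq hle (h1.trans h2.symm)
  have h4 : z ∈ LinearMap.range L := h3 ▸ hs z hz
  exact h4

end IsFibredContactForm

lemma potential_apply_eq (b : S) (u : TangentSpace IS b) (p : V) (hp : π p = b)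
    {U : ∀ x : S, TangentSpace IS x} (hU : U b = u) :
    potential IV IS π η₀ η p ⟨b, u⟩ = potentialField IV IS π η₀ η U p := by
  subst hp hU
  rfl

variable (IV IS k π η₀ η α₀ α) in
/-- The forms `α₀`, `α` restrict to contact forms of the fibres, with the same kernels. -/
structure IsFibredPair : Prop where
  left : IsFibredContactForm IV IS k π α₀
  right : IsFibredContactForm IV IS k π α
  defines_left : Defines α₀ η₀
  defines_right : Defines α η
  same_ker : ∀ p v, IsVertical IV IS π p v → (α₀ p v = 0 ↔ α p v = 0)

namespace IsFibredPair

variable (h : IsFibredPair IV IS k π η₀ η α₀ α)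
include h

lemma isVertical_potentialField (U : ∀ x : S, TangentSpace IS x) (p : V) :
    IsVertical IV IS π p (potentialField IV IS π η₀ η U p) := by
  have h1 := h.right.mfderiv_liftField h.defines_right U p
  have h2 := h.left.mfderiv_liftField h.defines_left U p
  have h3 := map_sub (mfderiv IV IS π p) (liftField IV IS π η U p) (liftField IV IS π η₀ U p)
  rw [h1, h2, sub_self] at h3
  exact h3

lemma smoothField_potentialField {U : ∀ x : S, TangentSpace IS x} (hU : SmoothField U) :
    SmoothField (potentialField IV IS π η₀ η U) := fun p =>
  SmoothFieldAt.sub (h.right.smoothField_liftField h.defines_right hU p)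
    (h.left.smoothField_liftField h.defines_left hU p)

lemma apply_potentialField (U : ∀ x : S, TangentSpace IS x) (p : V) :
    α p (potentialField IV IS π η₀ η U p) = - α p (liftField IV IS π η₀ U p) := by
  have h1 : potentialField IV IS π η₀ η U p =
    liftField IV IS π η U p - liftField IV IS π η₀ U p := rfl
  rw [h1, map_sub, (h.right.isHorizontalFor_liftField h.defines_right U p).1, zero_sub]

/-- The potential restricts to contact vector fields of the fibres. -/
lemma extD_potentialField {U : ∀ x : S, TangentSpace IS x} (hU : SmoothField U) {p : V}
    {z : TangentSpace IV p} (hz : IsVertical IV IS π p z) (hαz : α p z = 0) :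
    extD α p (potentialField IV IS π η₀ η U p) z =
      - vderiv IV (fun q => α q (potentialField IV IS π η₀ η U q)) p z := by
  obtain ⟨Z, hZ0, hZ⟩ := h.right.exists_local_vertical hz hαz
  have hX := h.left.smoothField_liftField h.defines_left hU p
  have hZp := hZ.self_of_nhds
  have hvert : IsVertical IV IS π p
      (mlieBracket IV (liftField IV IS π η₀ U) Z p) := by
    have h1 := mfderiv_mlieBracket_of_related (h.left.proj p) hX hZp.1 (hU _)
      (smoothFieldAt_zero (π p)) (.of_forall
        (h.left.mfderiv_liftField h.defines_left U)) (hZ.mono fun q hq => hq.2.1)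
    rw [show (mlieBracket IS U 0 (π p)) = 0 by simp] at h1
    exact h1
  have hker : ∀ γ : OneForm IV V, SmoothForm γ → (∀ᶠ q in nhds p, γ q (Z q) = 0) →
      extD γ p (liftField IV IS π η₀ U p) z =
        - vderiv IV (fun q => γ q (liftField IV IS π η₀ U q)) p z
        - γ p (mlieBracket IV (liftField IV IS π η₀ U) Z p) := fun γ hγ h0 => by
    rw [← hZ0, hγ.extD_eq_lieBracket hX hZp.1,
      vderiv_congr (g := fun _ => (0 : ℝ)) h0, vderiv_const, zero_sub]
  have h₀ := hker α₀ h.left.smooth (hZ.mono fun q hq => (h.same_ker q _ hq.2.1).2 hq.2.2)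
  have hlift := h.left.isHorizontalFor_liftField h.defines_left U
  rw [(hlift p).2 z hz ((h.same_ker p z hz).2 hαz),
    show (fun q => α₀ q (liftField IV IS π η₀ U q)) = fun _ => 0 from funext fun q => (hlift q).1,
    vderiv_const, neg_zero, zero_sub, eq_comm, neg_eq_zero] at h₀
  have h₁ := hker α h.right.smooth (hZ.mono fun q hq => hq.2.2)
  rw [(h.same_ker p _ hvert).1 h₀, sub_zero] at h₁
  have h2 : extD α p (potentialField IV IS π η₀ η U p) z =
      extD α p (liftField IV IS π η U p) z - extD α p (liftField IV IS π η₀ U p) z := by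
    have h3 : potentialField IV IS π η₀ η U p =
      liftField IV IS π η U p - liftField IV IS π η₀ U p := rfl
    rw [← extDL_apply, h3, map_sub]
    rfl
  rw [h2, (h.right.isHorizontalFor_liftField h.defines_right U p).2 z hz hαz, h₁, zero_sub]
  have h4 : (fun q => α q (liftField IV IS π η₀ U q)) =
      fun q => 0 - α q (potentialField IV IS π η₀ η U q) := funext fun q => by
    rw [h.apply_potentialField, zero_sub, neg_neg]
  have h5 : MDifferentiableAt IV 𝓘(ℝ, ℝ) (fun q => α q (potentialField IV IS π η₀ η U q)) p :=
    (h.right.smooth.smoothMapAt p _ (h.smoothField_potentialField hU p)).mdifferentiableAt (by simp)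
  rw [h4, vderiv_sub (mdifferentiableAt_const) h5, vderiv_const, zero_sub, neg_neg]

/-- If the connection `η₀` is flat and the potential is closed, then the curvature of `η` is given
by the brackets of the potential. -/
lemma extD_liftField (hflat : ∀ X Z, SmoothField X → SmoothField Z → ∀ p,
      curvature IV IS π η₀ X Z p = 0)
    (hclosed : ∀ U W, SmoothField U → SmoothField W → ∀ p, covariantD IV IS π η₀ η U W p = 0)
    {U W : ∀ x : S, TangentSpace IS x} (hU : SmoothField U) (hW : SmoothField W) (p : V) :
    extD α p (liftField IV IS π η U p) (liftField IV IS π η W p) =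
      - α p (mlieBracket IV (potentialField IV IS π η₀ η U)
        (potentialField IV IS π η₀ η W) p) := by
  rw [h.right.extD_liftField_of_mlieBracket h.defines_right hU hW]
  have hdec : ∀ U : ∀ x : S, TangentSpace IS x, liftField IV IS π η U =
      liftField IV IS π η₀ U + potentialField IV IS π η₀ η U := fun U => by
    funext q
    exact (add_sub_cancel (liftField IV IS π η₀ U q) (liftField IV IS π η U q)).symm
  have hl := fun {U : ∀ x : S, TangentSpace IS x} (hU : SmoothField U) =>
    (h.left.smoothField_liftField h.defines_left hU).smoothFieldAt p |>.mdifferentiableAt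
  have hp := fun {U : ∀ x : S, TangentSpace IS x} (hU : SmoothField U) =>
    (h.smoothField_potentialField hU).smoothFieldAt p |>.mdifferentiableAt
  have h1 := hclosed U W hU hW p
  have h2 : mlieBracket IV (liftField IV IS π η U) (liftField IV IS π η W) p =
      liftField IV IS π η (mlieBracket IS U W) p +
        mlieBracket IV (potentialField IV IS π η₀ η U)
          (potentialField IV IS π η₀ η W) p := by
    rw [hdec U, hdec W, VectorField.mlieBracket_add_left (hl hU) (hp hU),
      VectorField.mlieBracket_add_right (hl hW) (hp hW),
      VectorField.mlieBracket_add_right (hl hW) (hp hW),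
      h.left.mlieBracket_liftField h.defines_left hflat hU hW, hdec,
      VectorField.mlieBracket_swap_apply (V := potentialField IV IS π η₀ η U)
        (W := liftField IV IS π η₀ W)]
    rw [covariantD, sub_sub, sub_eq_zero] at h1
    rw [h1, Pi.add_apply]
    abel
  rw [h2, map_add, (h.right.isHorizontalFor_liftField h.defines_right _ p).1, zero_add]

end IsFibredPair

lemma IsPositiveContact.extD_pos {o : ∀ x : S, TangentSpace IS x → TangentSpace IS x → Prop}
    (hpos : IsPositiveContact IV IS k π o η) (h : IsFibredContactForm IV IS k π α)
    (hα : Defines α η) {p : V} {y₁ y₂ : TangentSpace IV p} (hy₁ : IsHorizontalFor IV IS π α p y₁)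
    (hy₂ : IsHorizontalFor IV IS π α p y₂)
    (ho : o (π p) (mfderiv IV IS π p y₁) (mfderiv IV IS π p y₂)) : 0 < extD α p y₁ y₂ := by
  obtain ⟨γ, hγ, hp⟩ := hpos
  obtain ⟨w, hw, hv, hs⟩ := h.exists_vertical_frame p
  have h₁ := (isHorizontal_iff hγ).1 ((isHorizontal_iff hα).2 hy₁)
  have h₂ := (isHorizontal_iff hγ).1 ((isHorizontal_iff hα).2 hy₂)
  have hv' := fun y hy => h.isVertical_of_mem_span hv (z := y) hy
  obtain ⟨c, hc, hcpos, rfl⟩ := exists_factor_of_defines hγ hα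
  have h3 := hp p y₁ y₂ w hw hv ho
  have h4 := topForm_cons₂_span (a := (γ p : TangentSpace IV p →ₗ[ℝ] ℝ)) (Ω := extDL γ p)
    (extDL_swap γ p) hw h₁.1 h₂.1 (fun y hy hy0 => h₁.2 y (hv' y hy) hy0)
  have h5 : topForm (k + 1) (γ p) (extD γ p) (cons₂ y₁ y₂ w) =
      2 * (k + 1) * (extD γ p y₁ y₂ * topForm k (γ p) (extD γ p) w) := h4
  have h6 : 0 < extD γ p y₁ y₂ := by
    rw [h5] at h3
    by_contra hneg
    push Not at hneg
    have : 0 ≤ topForm k (γ p) (extD γ p) w ^ 2 * (2 * (k + 1)) := by positivity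
    nlinarith [mul_nonneg this (neg_nonneg.2 hneg)]
  rw [extD_smul (hc p) hγ.1, h₁.1, h₂.1, mul_zero, mul_zero, add_zero, sub_zero]
  exact mul_pos (hcpos p) h6

lemma contMDiff_complex_mk {f g : M → ℝ} (hf : ContMDiff IM 𝓘(ℝ, ℝ) ∞ f)
    (hg : ContMDiff IM 𝓘(ℝ, ℝ) ∞ g) : ContMDiff IM 𝓘(ℝ, ℂ) ∞ (fun m => (⟨f m, g m⟩ : ℂ)) := by
  have h1 : ContMDiff IM 𝓘(ℝ, ℂ) ∞ (fun m => Complex.equivRealProdCLM.symm (f m, g m)) :=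
    Complex.equivRealProdCLM.symm.contDiff.contMDiff.comp (hf.prodMk_space hg)
  exact h1

/-- Positive frames are sent to adapted open books. -/
theorem IsFibredPair.isAdapted_frame [T2Space M] [CompactSpace M]
    (h : IsFibredPair IV IS k π η₀ η α₀ α) (hM : finrank ℝ EM = 2 * k + 1)
    {o : ∀ x : S, TangentSpace IS x → TangentSpace IS x → Prop}
    (hpos : IsPositiveContact IV IS k π o η)
    (hflat : ∀ X Z, SmoothField X → SmoothField Z → ∀ p, curvature IV IS π η₀ X Z p = 0)
    (hclosed : ∀ U W, SmoothField U → SmoothField W → ∀ p, covariantD IV IS π η₀ η U W p = 0)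
    {b : S} {j : M ≃ Fibre π b} (hj : IsFibreDiffeo IV IM j) {U W : ∀ x : S, TangentSpace IS x}
    (hU : SmoothField U) (hW : SmoothField W) (ho : o b (U b) (W b)) {Φ : M → ℂ}
    (hΦ : ∀ m, Φ m = ⟨α (j m) (potentialField IV IS π η₀ η U (j m)),
      -α (j m) (potentialField IV IS π η₀ η W (j m))⟩) :
    IsBookMap IM Φ ∧
      ∀ B, IsDefinedBy IM B Φ → IsAdapted k (pullbackField IM (fun m => (j m : V)) η) B := by
  have hβ := h.right.isContactForm_pullback hM hj
  have hξ : pullbackField IM (fun m => (j m : V)) η =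
      cokernel (pullbackForm IM (fun m => (j m : V)) α) := by
    rw [h.defines_right.2.2]; rfl
  have hsm : ∀ {U : ∀ x : S, TangentSpace IS x}, SmoothField U → ContMDiff IV 𝓘(ℝ, ℝ) ∞
      (fun q => α q (potentialField IV IS π η₀ η U q)) := fun hU p =>
    h.right.smooth.smoothMapAt p _ (h.smoothField_potentialField hU p)
  let f : (∀ x : S, TangentSpace IS x) → M → ℝ := fun U m =>
    α (j m) (potentialField IV IS π η₀ η U (j m))
  have hf : ∀ {U : ∀ x : S, TangentSpace IS x}, SmoothField U → ContMDiff IM 𝓘(ℝ, ℝ) ∞ (f U) :=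
    fun hU => (hsm hU).comp hj.1
  have hder : ∀ {U : ∀ x : S, TangentSpace IS x}, SmoothField U → ∀ m v,
      vderiv IM (f U) m v = vderiv IV (fun q => α q (potentialField IV IS π η₀ η U q)) (j m)
        (mfderiv IM IV (fun m => (j m : V)) m v) := fun {U} hU m v =>
    vderiv_comp_map (h := fun q => α q (potentialField IV IS π η₀ η U q))
      (f := fun m => (j m : V)) ((hsm hU _).mdifferentiableAt (by simp))
      ((hj.1 m).mdifferentiableAt (by simp)) v
  have hham : ∀ {U : ∀ x : S, TangentSpace IS x}, SmoothField U → ∀ m,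
      mfderiv IM IV (fun m => (j m : V)) m (hβ.ham (f U) m) =
        potentialField IV IS π η₀ η U (j m) := fun {U} hU m => by
    obtain ⟨x, hx⟩ := h.right.exists_mfderiv_eq_of_isVertical hM hj m
      (h.isVertical_potentialField U (j m))
    have h1 : pullbackForm IM (fun m => (j m : V)) α m x = f U m := congrArg (α (j m)) hx
    rw [← hβ.eq_ham (u := f U) (x := x) h1 fun y hy => ?_, hx]
    rw [extD_pullbackForm h.right.smooth (hj.1 m), hx, hder hU]
    exact h.extD_potentialField hU (h.right.isVertical_mfderiv_fibre hj m y) hy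
  obtain rfl : Φ = fun m => ⟨f U m, - f W m⟩ := funext hΦ
  have hΦs := contMDiff_complex_mk (hf hU) (f := f U) (g := fun m => - f W m) (hf hW).neg
  rw [hξ]
  refine hβ.isAdapted_of_bracket_pos hΦs fun m => ?_
  have hjm : π (j m : V) = b := (j m).2
  have e1 : 0 < extD α (j m) (liftField IV IS π η U (j m)) (liftField IV IS π η W (j m)) := by
    refine hpos.extD_pos h.right h.defines_right
      (h.right.isHorizontalFor_liftField h.defines_right U _)
      (h.right.isHorizontalFor_liftField h.defines_right W _) ?_
    rw [h.right.mfderiv_liftField h.defines_right, h.right.mfderiv_liftField h.defines_right, hjm]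
    exact ho
  rw [h.extD_liftField hflat hclosed hU hW] at e1
  have e2 := h.right.smooth.extD_eq_lieBracket (h.smoothField_potentialField hU (j m))
    (h.smoothField_potentialField hW (j m))
  have e3 := hβ.extD_ham (f U) m (hβ.ham (f W) m)
  rw [extD_pullbackForm h.right.smooth (hj.1 m), hham hU, hham hW, hβ.apply_ham, hder hU _
    (hβ.ham (f W) m), hham hW] at e3
  have e4 : vderiv IM (fun m => - f W m) m (hβ.ham (f U) m) =
      - vderiv IV (fun q => α q (potentialField IV IS π η₀ η W q)) (j m)
        (potentialField IV IS π η₀ η U (j m)) := by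
    have e5 : (fun m => - f W m) = fun m => 0 - f W m := by simp
    rw [e5, vderiv_sub mdifferentiableAt_const ((hf hW m).mdifferentiableAt (by simp)),
      vderiv_const, zero_sub, hder hW, hham hU]
  change 0 < vderiv IM (fun m => - f W m) m (hβ.ham (f U) m)
    - (- f W m) * vderiv IM (f U) m (hβ.reeb m)
  rw [e4]
  linarith

namespace IsFibredContactForm

variable (h : IsFibredContactForm IV IS k π α)
include h

lemma horizontalLift_add (hη : Defines α η) (p : V) (u v : TangentSpace IS (π p)) :
    horizontalLift IV IS π η p ⟨π p, u + v⟩ =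
      horizontalLift IV IS π η p ⟨π p, u⟩ + horizontalLift IV IS π η p ⟨π p, v⟩ := by
  have hu := h.horizontalLift_spec hη p u
  have hv := h.horizontalLift_spec hη p v
  refine h.horizontalLift_eq hη (by rw [map_add, hu.1, hv.1])
    ⟨by rw [map_add, hu.2.1, hv.2.1, add_zero], fun z hz hαz => ?_⟩
  rw [← extDL_apply, map_add, LinearMap.add_apply, extDL_apply, extDL_apply, hu.2.2 z hz hαz,
    hv.2.2 z hz hαz, add_zero]

lemma horizontalLift_smul (hη : Defines α η) (p : V) (a : ℝ) (u : TangentSpace IS (π p)) :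
    horizontalLift IV IS π η p ⟨π p, a • u⟩ = a • horizontalLift IV IS π η p ⟨π p, u⟩ := by
  have hu := h.horizontalLift_spec hη p u
  refine h.horizontalLift_eq hη (by rw [map_smul, hu.1])
    ⟨by rw [map_smul, hu.2.1, smul_zero], fun z hz hαz => ?_⟩
  rw [← extDL_apply, map_smul, LinearMap.smul_apply, extDL_apply, hu.2.2 z hz hαz, smul_zero]

end IsFibredContactForm

namespace IsFibredPair

variable (h : IsFibredPair IV IS k π η₀ η α₀ α)
include h

/-- The linear form `u ↦ α (A_u)`. -/
def potentialForm (p : V) : TangentSpace IS (π p) →ₗ[ℝ] ℝ where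
  toFun u := α p (potential IV IS π η₀ η p ⟨π p, u⟩)
  map_add' u v := by
    rw [← map_add, potential, h.right.horizontalLift_add h.defines_right,
      h.left.horizontalLift_add h.defines_left, potential, potential, add_sub_add_comm]
  map_smul' a u := by
    rw [potential, h.right.horizontalLift_smul h.defines_right,
      h.left.horizontalLift_smul h.defines_left, ← smul_sub, map_smul]
    rfl

lemma contMDiffWithinAt_potential {EX : Type*} [NormedAddCommGroup EX] [NormedSpace ℝ EX]
    {HX : Type*} [TopologicalSpace HX] {IX : ModelWithCorners ℝ EX HX}
    {X : Type*} [TopologicalSpace X] [ChartedSpace HX X]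
    {g : X → V} {w : X → TangentBundle IS S} {s : Set X} {x₀ : X}
    (hg : ContMDiffWithinAt IX IV ∞ g s x₀) (hw : ContMDiffWithinAt IX IS.tangent ∞ w s x₀)
    (hx₀ : x₀ ∈ s) (hgw : ∀ x ∈ s, π (g x) = (w x).proj) :
    ContMDiffWithinAt IX 𝓘(ℝ, ℝ) ∞ (fun x => α (g x) (potential IV IS π η₀ η (g x) (w x))) s x₀ := by
  refine contMDiffWithinAt_linear (Q := h.potentialForm) (fun y => ?_) hg hw hx₀ hgw ?_
  · have hU : ∀ᶠ x in nhds (π (g x₀)),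
        SmoothFieldAt (I := IS) (localField (w x₀).proj fun _ => y) x := by
      rw [hgw x₀ hx₀]
      filter_upwards [(trivializationAt ES (TangentSpace IS : S → Type _)
        (w x₀).proj).open_baseSet.mem_nhds (mem_baseSet_trivializationAt_self _)] with x hx
      exact smoothFieldAt_localField hx contMDiffAt_const
    exact h.right.smooth.smoothMapAt _ _ (SmoothFieldAt.sub
      (h.right.smoothFieldAt_liftField h.defines_right hU)
      (h.left.smoothFieldAt_liftField h.defines_left hU))
  · intro x _ u hu
    rw [← hu]
    rfl

end IsFibredPair

namespace IsBourgeois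

variable {o : ∀ x : S, TangentSpace IS x → TangentSpace IS x → Prop}
  (h : IsBourgeois IV IS IM k π M o η₀ η)
include h

lemma isFibredPair (hEV : finrank ℝ EV = 2 * k + 3) (hES : finrank ℝ ES = 2) :
    IsFibredPair IV IS k π η₀ η (definingForm IV η₀) (definingForm IV η) := by
  have d₀ : Defines (definingForm IV η₀) η₀ :=
    definingForm_defines (h.flat_bundle.contact.imp fun _ hγ => hγ.1)
  have d : Defines (definingForm IV η) η :=
    definingForm_defines (h.contact_bundle.imp fun _ hγ => hγ.1)
  have hsub : ∀ p v, IsVertical IV IS π p v →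
      (0 < definingForm IV η p v ↔ 0 < definingForm IV η₀ p v) := fun p v hv => by
    have h1 : v ∈ η p ↔ 0 < definingForm IV η p v := by
      conv_lhs => rw [d.2.2]
      rfl
    have h2 : v ∈ η₀ p ↔ 0 < definingForm IV η₀ p v := by
      conv_lhs => rw [d₀.2.2]
      rfl
    rw [← h1, ← h2]
    exact h.same_fibres p v hv
  refine ⟨h.flat_bundle.contact.isFibredContactForm hEV hES h.flat_bundle.bundle d₀,
    h.contact_bundle.isFibredContactForm hEV hES h.flat_bundle.bundle d, d₀, d, fun p v hv => ?_⟩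
  have h1 := hsub p v hv
  have h2 := hsub p (-v) (by rw [IsVertical, map_neg, show mfderiv IV IS π p v = 0 from hv, neg_zero])
  rw [map_neg, map_neg, neg_pos, neg_pos] at h2
  constructor
  · intro h0
    rw [h0] at h1 h2
    exact le_antisymm (not_lt.1 fun h' => (lt_irrefl _ (h1.1 h')))
      (not_lt.1 fun h' => (lt_irrefl _ (h2.1 h')))
  · intro h0
    rw [h0] at h1 h2
    exact le_antisymm (not_lt.1 fun h' => (lt_irrefl _ (h1.2 h')))
      (not_lt.1 fun h' => (lt_irrefl _ (h2.2 h')))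

variable [T2Space S] [CompactSpace S] [T2Space M] [CompactSpace M]
  (hEM : finrank ℝ EM = 2 * k + 1) (hEV : finrank ℝ EV = 2 * k + 3)
  (hES : finrank ℝ ES = 2)
include hEM hEV hES

/-- Positive frames define adapted open books of the fibres. -/
theorem isAdapted_frameFunction {b : S} {u v : TangentSpace IS b} (ho : o b u v)
    {j : M ≃ Fibre π b} (hj : IsFibreDiffeo IV IM j) :
    IsBookMap IM (fun m => frameFunction IV IS π η₀ η b u v (j m)) ∧
      ∀ B, IsDefinedBy IM B (fun m => frameFunction IV IS π η₀ η b u v (j m)) →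
        IsAdapted k (pullbackField IM (fun m => (j m : V)) η) B := by
  obtain ⟨U, hU, hUb⟩ := exists_smoothField_eq u
  obtain ⟨W, hW, hWb⟩ := exists_smoothField_eq v
  refine (h.isFibredPair hEV hES).isAdapted_frame hEM h.contact h.flat_bundle.flat h.closed hj hU hW
    (by rwa [hUb, hWb]) fun m => ?_
  rw [frameFunction, potential_apply_eq b u _ (j m).2 hUb, potential_apply_eq b v _ (j m).2 hWb]

theorem isDefinedBy_frameOpenBook {b : S} {u v : TangentSpace IS b} (ho : o b u v)
    {j : M ≃ Fibre π b} (hj : IsFibreDiffeo IV IM j) :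
    IsDefinedBy IM ((frameOpenBook IV IS π η₀ η b u v).pullback j)
      (fun m => frameFunction IV IS π η₀ η b u v (j m)) :=
  (h.isAdapted_frameFunction hEM hEV hES ho hj).1.isDefinedBy_bookOf

theorem isFibreAdapted_frameOpenBook {b : S} {u v : TangentSpace IS b} (ho : o b u v) :
    IsFibreAdapted IV IM k M η (frameOpenBook IV IS π η₀ η b u v) := fun _ hj =>
  (h.isAdapted_frameFunction hEM hEV hES ho hj).2 _ (h.isDefinedBy_frameOpenBook hEM hEV hES ho hj)

/-- Smooth paths of positive frames are sent to smooth families of adapted open books. -/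
theorem isSmoothFamily_frameOpenBook {J : Set ℝ} {c : ℝ → S} {u v : ∀ t, TangentSpace IS (c t)}
    (hu : ContMDiffOn 𝓘(ℝ, ℝ) IS.tangent ∞ (fun t => (⟨c t, u t⟩ : TangentBundle IS S)) J)
    (hv : ContMDiffOn 𝓘(ℝ, ℝ) IS.tangent ∞ (fun t => (⟨c t, v t⟩ : TangentBundle IS S)) J)
    (ho : ∀ t ∈ J, o (c t) (u t) (v t)) :
    IsSmoothFamily IV IM k M η J c (fun t => frameOpenBook IV IS π η₀ η (c t) (u t) (v t)) := by
  let F : (∀ t, TangentSpace IS (c t)) → ℝ × V → ℝ := fun u x =>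
    definingForm IV η x.2 (potential IV IS π η₀ η x.2 ⟨c x.1, u x.1⟩)
  have hF : ∀ u : ∀ t, TangentSpace IS (c t),
      ContMDiffOn 𝓘(ℝ, ℝ) IS.tangent ∞ (fun t => (⟨c t, u t⟩ : TangentBundle IS S)) J →
      ContMDiffOn (𝓘(ℝ, ℝ).prod IV) 𝓘(ℝ, ℝ) ∞ (F u) {x | x.1 ∈ J ∧ π x.2 = c x.1} :=
    fun u hu x hx => (h.isFibredPair hEV hES).contMDiffWithinAt_potential (g := fun x => x.2)
      (w := fun x => ⟨c x.1, u x.1⟩) contMDiffWithinAt_snd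
      ((hu x.1 hx.1).comp x contMDiffWithinAt_fst fun y hy => hy.1) hx fun y hy => hy.2
  refine ⟨fun x => ⟨F u x, - F v x⟩, ?_, fun t ht => ⟨?_, fun j hj => ?_⟩⟩
  · exact Complex.equivRealProdCLM.symm.contDiff.contMDiff.comp_contMDiffOn
      ((hF u hu).prodMk_space (hF v hv).neg)
  · exact h.isFibreAdapted_frameOpenBook hEM hEV hES (ho t ht)
  · exact h.isDefinedBy_frameOpenBook hEM hEV hES (ho t ht) hj

end IsBourgeois

lemma IsFibreIsotopic.trans {b : S} {B₀ B₁ B₂ : OpenBook (Fibre π b)}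
    (h : IsFibreIsotopic IV IM k M η B₀ B₁) (h' : IsFibreIsotopic IV IM k M η B₁ B₂) :
    IsFibreIsotopic IV IM k M η B₀ B₂ :=
  fun j hj => (h j hj).trans (h' j hj)

/-- An alternating form on a plane which vanishes on a basis is zero. -/
lemma eq_zero_of_alternating_plane {T : Type*} [AddCommGroup T] [Module ℝ T]
    {B : T → T → ℝ} (hadd : ∀ x y z, B (x + y) z = B x z + B y z)
    (hsmul : ∀ (a : ℝ) x z, B (a • x) z = a * B x z) (hself : ∀ x, B x x = 0)
    (hadd' : ∀ x y z, B z (x + y) = B z x + B z y)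
    (hsmul' : ∀ (a : ℝ) x z, B z (a • x) = a * B z x) (hT : finrank ℝ T = 2) {u v : T}
    (huv : LinearIndependent ℝ ![u, v]) (h0 : B u v = 0) (x y : T) : B x y = 0 := by
  have : FiniteDimensional ℝ T := .of_finrank_pos (by omega)
  have hsp : ∀ x : T, ∃ a b : ℝ, x = a • u + b • v := fun x => by
    have h1 : x ∈ span ℝ (range ![u, v]) := by
      rw [huv.span_eq_top_of_card_eq_finrank (by simp [hT])]
      exact Submodule.mem_top
    rw [Matrix.range_cons, Matrix.range_cons, Matrix.range_empty, union_empty,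
      singleton_union, Submodule.mem_span_pair] at h1
    obtain ⟨a, b, hab⟩ := h1
    exact ⟨a, b, hab.symm⟩
  have h1 : B v u = 0 := by
    have := hself (u + v)
    rw [hadd, hadd', hadd', hself, hself, h0] at this
    linarith
  obtain ⟨a, b, rfl⟩ := hsp x
  obtain ⟨c, d, rfl⟩ := hsp y
  simp only [hadd, hadd', hsmul, hsmul', hself, h0, h1, mul_zero, add_zero]

lemma linearIndependent_pair_of_alternating {T : Type*} [AddCommGroup T] [Module ℝ T]
    {B : T → T → ℝ} (hsmul : ∀ (a : ℝ) x z, B (a • x) z = a * B x z) (hself : ∀ x, B x x = 0)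
    (hsmul' : ∀ (a : ℝ) x z, B z (a • x) = a * B z x) {u v : T} (h : B u v ≠ 0) :
    LinearIndependent ℝ ![u, v] := by
  rw [LinearIndependent.pair_iff' (by rintro rfl; exact h (by simpa using hsmul 0 0 v))]
  rintro a rfl
  exact h (by rw [hsmul', hself, mul_zero])

lemma IsOrientation.exists_frame {o : ∀ x : S, TangentSpace IS x → TangentSpace IS x → Prop}
    (ho : IsOrientation o) (b : S) : ∃ u v, o b u v := by
  obtain ⟨μ, -, hself, hne, hiff⟩ := ho
  obtain ⟨u, v, huv⟩ : ∃ u v, μ b u v ≠ 0 := by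
    by_contra! hc
    exact hne b (ContinuousLinearMap.ext fun u => ContinuousLinearMap.ext fun v => hc u v)
  rcases lt_or_gt_of_ne huv with hlt | hgt
  · refine ⟨-u, v, (hiff b _ _).2 ?_⟩
    rw [map_neg]
    exact neg_pos.2 hlt
  · exact ⟨u, v, (hiff b _ _).2 hgt⟩

namespace IsBourgeois

variable {o : ∀ x : S, TangentSpace IS x → TangentSpace IS x → Prop}
  (h : IsBourgeois IV IS IM k π M o η₀ η)
  [T2Space S] [CompactSpace S] [T2Space M] [CompactSpace M]
  (hEM : finrank ℝ EM = 2 * k + 1) (hEV : finrank ℝ EV = 2 * k + 3)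
  (hES : finrank ℝ ES = 2)
include h hEM hEV hES

lemma isFibreIsotopic_of_path {b : S} {u v : ℝ → ES} (hu : ContDiff ℝ ∞ u) (hv : ContDiff ℝ ∞ v)
    (ho : ∀ t, o b (u t) (v t)) :
    IsFibreIsotopic IV IM k M η (frameOpenBook IV IS π η₀ η b (u 0) (v 0))
      (frameOpenBook IV IS π η₀ η b (u 1) (v 1)) := fun j hj => by
  have hF : ∀ u : ℝ → ES, ContDiff ℝ ∞ u → ContMDiff (𝓘(ℝ, ℝ).prod IM) 𝓘(ℝ, ℝ) ∞
      (fun x : ℝ × M => definingForm IV η (j x.2) (potential IV IS π η₀ η (j x.2) ⟨b, u x.1⟩)) :=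
    fun u hu x => by
      have h1 := (h.isFibredPair hEV hES).contMDiffWithinAt_potential (s := univ) (x₀ := x)
        (IX := 𝓘(ℝ, ℝ).prod IM) (g := fun x : ℝ × M => (j x.2 : V)) (w := fun x => ⟨b, u x.1⟩)
        ((hj.1.comp contMDiff_snd) x).contMDiffWithinAt
        ((contMDiff_const_base b (hu.contMDiff.comp contMDiff_fst)) x).contMDiffWithinAt
        (mem_univ _) (fun y _ => (j y.2).2)
      exact h1.contMDiffAt Filter.univ_mem
  refine isIsotopic_of_family (Φ := fun x => frameFunction IV IS π η₀ η b (u x.1) (v x.1) (j x.2))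
    ?_ (fun t => (h.isAdapted_frameFunction hEM hEV hES (ho t) hj).1)
    (fun t => (h.isAdapted_frameFunction hEM hEV hES (ho t) hj).2)
    (h.isDefinedBy_frameOpenBook hEM hEV hES (ho 0) hj)
    (h.isDefinedBy_frameOpenBook hEM hEV hES (ho 1) hj)
  exact contMDiff_complex_mk (hF u hu) (hF v hv).neg

lemma isFibreIsotopic_of_segment {b : S} {u u' v v' : TangentSpace IS b} (ho : o b u v)
    (huv' : o b u v') (hu'v : o b u' v) (ho' : o b u' v') :
    IsFibreIsotopic IV IM k M η (frameOpenBook IV IS π η₀ η b u v)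
      (frameOpenBook IV IS π η₀ η b u' v') := by
  obtain ⟨μ, -, -, -, hiff⟩ := h.orientation
  let s := Real.smoothTransition
  let γ : TangentSpace IS b → TangentSpace IS b → ℝ → ES := fun x y t =>
    (1 - s t) • (x : ES) + s t • (y : ES)
  have hs : ContDiff ℝ ∞ s := Real.smoothTransition.contDiff (n := ⊤)
  have hγ : ∀ x y, ContDiff ℝ ∞ (γ x y) := fun x y =>
    ((contDiff_const.sub hs).smul contDiff_const).add (hs.smul contDiff_const)
  have hpos : ∀ {x y} t, 0 < x → 0 < y → 0 < (1 - s t) * x + s t * y := fun {x y} t hx hy => by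
    rcases eq_or_lt_of_le (Real.smoothTransition.nonneg t) with h0 | h0
    · rw [show s t = 0 from h0.symm]; linarith
    · have h5 : 0 < s t * y := mul_pos h0 hy
      have h6 : 0 ≤ (1 - s t) * x :=
        mul_nonneg (sub_nonneg.2 (Real.smoothTransition.le_one t)) hx.le
      linarith
  have e0 : ∀ x y, γ x y 0 = x := fun x y => by
    simp only [γ, show s 0 = 0 from Real.smoothTransition.zero, sub_zero, one_smul, zero_smul,
      add_zero]
    rfl
  have e1 : ∀ x y, γ x y 1 = y := fun x y => by
    simp only [γ, show s 1 = 1 from Real.smoothTransition.one, sub_self, one_smul, zero_smul,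
      zero_add]
    rfl
  have h1 := h.isFibreIsotopic_of_path hEM hEV hES (b := b) (hγ u u') (hγ v v') fun t => by
    rw [hiff] at ho huv' hu'v ho'
    have hr : ∀ x, μ b x (γ v v' t) = (1 - s t) * μ b x v + s t * μ b x v' := fun x => by
      have h3 := map_add (μ b x) ((1 - s t) • v) (s t • v')
      rw [map_smul, map_smul] at h3
      exact h3
    have hl : ∀ z, μ b (γ u u' t) z = (1 - s t) * μ b u z + s t * μ b u' z := fun z => by
      have h3 := map_add (μ b) ((1 - s t) • u) (s t • u')
      rw [map_smul, map_smul] at h3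
      exact congrArg (fun L : TangentSpace IS b →L[ℝ] ℝ => L z) h3
    refine (hiff _ _ _).2 ?_
    rw [hl, hr, hr]
    exact hpos t (hpos t ho huv') (hpos t hu'v ho')
  rwa [e0, e0, e1, e1] at h1

/-- The open books of positive frames at a point are isotopic. -/
theorem isFibreIsotopic_of_frames {b : S} {u v u' v' : TangentSpace IS b} (ho : o b u v)
    (ho' : o b u' v') : IsFibreIsotopic IV IM k M η (frameOpenBook IV IS π η₀ η b u v)
      (frameOpenBook IV IS π η₀ η b u' v') := by
  obtain ⟨μ, -, hself, -, hiff⟩ := h.orientation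
  have hadd : ∀ x y z, μ b (x + y) z = μ b x z + μ b y z := fun x y z => by rw [map_add]; rfl
  have hswap : ∀ x y, μ b x y = - μ b y x := fun x y => by
    have h1 := hself b (x + y)
    rw [hadd, map_add, map_add, hself, hself] at h1
    linarith
  have hdirect : ∀ {x y}, o b x y → o b x v' → IsFibreIsotopic IV IM k M η
      (frameOpenBook IV IS π η₀ η b x y) (frameOpenBook IV IS π η₀ η b u' v') := fun h1 h2 =>
    (h.isFibreIsotopic_of_segment hEM hEV hES h1 h2 h1 h2).trans
      (h.isFibreIsotopic_of_segment hEM hEV hES h2 h2 ho' ho')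
  have hrot : ∀ {x y}, o b x y → o b y (-x) ∧ IsFibreIsotopic IV IM k M η
      (frameOpenBook IV IS π η₀ η b x y) (frameOpenBook IV IS π η₀ η b y (-x)) := fun {x y} h1 => by
    have p1 := (hiff b x y).1 h1
    have e1 : μ b (x + y) y = μ b x y := by
      rw [hadd, hself, add_zero]
    have e2 : μ b (x + y) (-x) = μ b x y := by
      rw [map_neg, hadd, hself, zero_add, ← hswap]
    have e3 : μ b y (-x) = μ b x y := by rw [map_neg, ← hswap]
    have o1 : o b (x + y) y := (hiff _ _ _).2 (e1.symm ▸ p1)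
    have o2 : o b (x + y) (-x) := (hiff _ _ _).2 (e2.symm ▸ p1)
    have o3 : o b y (-x) := (hiff _ _ _).2 (e3.symm ▸ p1)
    exact ⟨o3, ((h.isFibreIsotopic_of_segment hEM hEV hES h1 h1 o1 o1).trans
      (h.isFibreIsotopic_of_segment hEM hEV hES o1 o2 o1 o2)).trans
      (h.isFibreIsotopic_of_segment hEM hEV hES o2 o2 o3 o3)⟩
  obtain ⟨o₁, h₁⟩ := hrot ho
  obtain ⟨o₂, h₂⟩ := hrot o₁
  obtain ⟨o₃, h₃⟩ := hrot o₂
  by_cases c0 : 0 < μ b u v'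
  · exact hdirect ho ((hiff _ _ _).2 c0)
  by_cases c1 : 0 < μ b v v'
  · exact h₁.trans (hdirect o₁ ((hiff _ _ _).2 c1))
  by_cases c2 : 0 < μ b (-u) v'
  · exact (h₁.trans h₂).trans (hdirect o₂ ((hiff _ _ _).2 c2))
  by_cases c3 : 0 < μ b (-v) v'
  · exact ((h₁.trans h₂).trans h₃).trans (hdirect o₃ ((hiff _ _ _).2 c3))
  exfalso
  have n2 : μ b (-u) v' = - μ b u v' := by rw [map_neg]; rfl
  have n3 : μ b (-v) v' = - μ b v v' := by rw [map_neg]; rfl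
  have z1 : μ b u v' = 0 := by rw [n2] at c2; linarith
  have z2 : μ b v v' = 0 := by rw [n3] at c3; linarith
  have hli : LinearIndependent ℝ ![u, v] :=
    linearIndependent_pair_of_alternating (B := fun x y => μ b x y)
      (fun a x z => by rw [map_smul]; rfl) (hself b) (fun a x z => by rw [map_smul]; rfl)
      ((hiff _ _ _).1 ho).ne'
  have : u' ∈ span ℝ (range ![u, v]) := by
    have : FiniteDimensional ℝ (TangentSpace IS b) := inferInstanceAs (FiniteDimensional ℝ ES)
    rw [hli.span_eq_top_of_card_eq_finrank (by
      rw [Fintype.card_fin]; exact hES.symm)]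
    exact Submodule.mem_top
  rw [Matrix.range_cons, Matrix.range_cons, Matrix.range_empty, union_empty,
    singleton_union, Submodule.mem_span_pair] at this
  obtain ⟨p, q, rfl⟩ := this
  have h0 := (hiff _ _ _).1 ho'
  have e : μ b (p • u + q • v) v' = p * μ b u v' + q * μ b v v' := by
    rw [map_add, map_smul, map_smul]; rfl
  rw [e, z1, z2, mul_zero, mul_zero, add_zero] at h0
  exact lt_irrefl _ h0

theorem mem_isotopyClass {b : S} {u v : TangentSpace IS b} (ho : o b u v)
    {B : OpenBook (Fibre π b)} : B ∈ isotopyClass IV IS IM k π M o η₀ η b ↔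
      IsFibreIsotopic IV IM k M η (frameOpenBook IV IS π η₀ η b u v) B :=
  ⟨fun ⟨_, _, ho', h'⟩ => (h.isFibreIsotopic_of_frames hEM hEV hES ho ho').trans h',
    fun h' => ⟨u, v, ho, h'⟩⟩

end IsBourgeois

section FramePaths

variable {E : Type*} [NormedAddCommGroup E] [NormedSpace ℝ E] [FiniteDimensional ℝ E]
  {H : Type*} [TopologicalSpace H] {I : ModelWithCorners ℝ E H} [I.Boundaryless]
  {N : Type*} [TopologicalSpace N] [ChartedSpace H N] [IsManifold I ∞ N]

lemma contMDiff_unit_time : ContMDiff 𝓘(ℝ, ℝ) 𝓘(ℝ, ℝ).tangent ∞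
    (fun t => (⟨t, (1 : ℝ)⟩ : TangentBundle 𝓘(ℝ, ℝ) ℝ)) :=
  (contMDiff_vectorSpace_iff_contDiff (V := fun _ => (1 : ℝ))).2 contDiff_const

lemma contMDiff_velocity {c : ℝ → N} (hc : ContMDiff 𝓘(ℝ, ℝ) I ∞ c) :
    ContMDiff 𝓘(ℝ, ℝ) I.tangent ∞
      (fun t => (⟨c t, mfderiv 𝓘(ℝ, ℝ) I c t (1 : ℝ)⟩ : TangentBundle I N)) :=
  (hc.contMDiff_tangentMap (m := ∞) (by simp)).comp contMDiff_unit_time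

lemma contMDiffAt_timeField {w : ℝ × N → TangentBundle I N} {x : ℝ × N}
    (hw : ContMDiffAt (𝓘(ℝ, ℝ).prod I) I.tangent ∞ w x)
    {Z : ∀ x : ℝ × N, TangentSpace (𝓘(ℝ, ℝ).prod I) x}
    (hZ : ∀ᶠ x in nhds x, (Z x).1 = (1 : ℝ) ∧ (⟨x.2, (Z x).2⟩ : TangentBundle I N) = w x) :
    SmoothFieldAt Z x := by
  have h1 : ContMDiffAt (𝓘(ℝ, ℝ).prod I) (𝓘(ℝ, ℝ).prod I).tangent ∞ (fun x : ℝ × N =>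
      (equivTangentBundleProd 𝓘(ℝ, ℝ) ℝ I N).symm (⟨x.1, (1 : ℝ)⟩, w x)) x :=
    (contMDiff_equivTangentBundleProd_symm _).comp x
      (((contMDiff_unit_time.comp contMDiff_fst) x).prodMk hw)
  refine h1.congr_of_eventuallyEq ?_
  filter_upwards [hZ] with y hy
  rw [← hy.2, ← hy.1]
  rfl

/-- A smooth path is an integral curve of a time-dependent vector field. -/
lemma exists_timeField_of_path [T2Space N] [SigmaCompactSpace N] {c : ℝ → N}
    (hc : ContMDiff 𝓘(ℝ, ℝ) I ∞ c) :
    ∃ Z : ∀ x : ℝ × N, TangentSpace (𝓘(ℝ, ℝ).prod I) x, SmoothField Z ∧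
      (∀ x, (Z x).1 = (1 : ℝ)) ∧ ∀ t, ((Z (t, c t)).2 : E) = mfderiv 𝓘(ℝ, ℝ) I c t (1 : ℝ) := by
  let P : ∀ x : ℝ × N, Set (TangentSpace (𝓘(ℝ, ℝ).prod I) x) := fun x =>
    {z | z.1 = (1 : ℝ) ∧ (x.2 = c x.1 → (z.2 : E) = mfderiv 𝓘(ℝ, ℝ) I c x.1 (1 : ℝ))}
  have hconv : ∀ x, Convex ℝ (P x) := by
    intro x y hy z hz a b ha hb hab
    refine ⟨?_, fun hx => ?_⟩
    · have h1 : (a • y + b • z).1 = a * (y.1 : ℝ) + b * (z.1 : ℝ) := rfl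
      rw [h1, hy.1, hz.1, mul_one, mul_one, hab]
    · have h1 : ((a • y + b • z).2 : E) = a • (y.2 : E) + b • (z.2 : E) := rfl
      rw [h1, hy.2 hx, hz.2 hx]
      exact (add_smul a b _).symm.trans ((congrArg (· • _) hab).trans (one_smul ℝ _))
  suffices hloc : ∀ x₀ : ℝ × N, ∃ U ∈ nhds x₀,
      ∃ s : ∀ x : ℝ × N, TangentSpace (𝓘(ℝ, ℝ).prod I) x,
      ContMDiffOn (𝓘(ℝ, ℝ).prod I) (𝓘(ℝ, ℝ).prod I).tangent ∞
        (fun x => (⟨x, s x⟩ : TangentBundle (𝓘(ℝ, ℝ).prod I) (ℝ × N))) U ∧ ∀ y ∈ U, s y ∈ P y by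
    obtain ⟨Z, hZ⟩ := exists_contMDiffSection_forall_mem_convex_of_local (𝓘(ℝ, ℝ).prod I) (n := ⊤)
      (F_fiber := ℝ × E) (TangentSpace (𝓘(ℝ, ℝ).prod I) : ℝ × N → Type _) P hconv hloc
    exact ⟨Z, Z.contMDiff, fun x => (hZ x).1, fun t => (hZ (t, c t)).2 rfl⟩
  rintro ⟨s₀, x₀⟩
  by_cases hx : x₀ = c s₀
  · let T := trivializationAt E (TangentSpace I : N → Type _) x₀
    let y : ℝ → E := fun t => (T ⟨c t, mfderiv 𝓘(ℝ, ℝ) I c t (1 : ℝ)⟩).2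
    let O : Set (ℝ × N) := {x | c x.1 ∈ T.baseSet ∧ x.2 ∈ T.baseSet}
    have hO : IsOpen O := (T.open_baseSet.preimage (hc.continuous.comp continuous_fst)).inter
      (T.open_baseSet.preimage continuous_snd)
    let s : ∀ x : ℝ × N, TangentSpace (𝓘(ℝ, ℝ).prod I) x := fun x =>
      ((1 : ℝ), (T.symmL ℝ x.2 (y x.1) : E))
    have hs : ∀ x ∈ O, SmoothFieldAt s x := fun x hx => by
      have h1 : ContMDiffAt I.tangent (I.prod 𝓘(ℝ, E)) ∞ T
          (⟨c x.1, mfderiv 𝓘(ℝ, ℝ) I c x.1 (1 : ℝ)⟩ : TangentBundle I N) :=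
        (Bundle.Trivialization.contMDiffOn T _ (T.mem_source.2 hx.1)).contMDiffAt
          (T.open_source.mem_nhds (T.mem_source.2 hx.1))
      have hy : ContMDiffAt 𝓘(ℝ, ℝ) 𝓘(ℝ, E) ∞ y x.1 :=
        contMDiffAt_snd.comp x.1 (h1.comp x.1 (contMDiff_velocity hc x.1))
      have h2 : ContMDiffAt (I.prod 𝓘(ℝ, E)) I.tangent ∞ T.toOpenPartialHomeomorph.symm
          (x.2, y x.1) :=
        (Bundle.Trivialization.contMDiffOn_symm T _ (T.mem_target.2 hx.2)).contMDiffAt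
          (T.open_target.mem_nhds (T.mem_target.2 hx.2))
      refine contMDiffAt_timeField (w := fun x => T.toOpenPartialHomeomorph.symm (x.2, y x.1))
        (h2.comp x (contMDiffAt_snd.prodMk (hy.comp x contMDiffAt_fst))) ?_
      filter_upwards [hO.mem_nhds hx] with z hz
      refine ⟨rfl, ?_⟩
      exact (congrArg (Bundle.TotalSpace.mk z.2)
        (Bundle.Trivialization.symmL_apply (R := ℝ) _ hz.2 (y z.1))).trans
        (Bundle.Trivialization.mk_symm T hz.2 (y z.1))
    refine ⟨O, hO.mem_nhds ⟨hx ▸ mem_baseSet_trivializationAt_self x₀,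
      mem_baseSet_trivializationAt_self x₀⟩, s, fun x hx => (hs x hx).contMDiffWithinAt,
      fun x hx => ⟨rfl, fun hxc => ?_⟩⟩
    obtain ⟨t, q⟩ := x
    obtain rfl : q = c t := hxc
    exact (Bundle.Trivialization.symmL_apply (R := ℝ) _ hx.1 _).trans
      (Bundle.Trivialization.symm_apply_apply_mk _ hx.1 _)
  · let O : Set (ℝ × N) := {x | x.2 ≠ c x.1}
    have hO : IsOpen O := (isClosed_eq continuous_snd (hc.continuous.comp continuous_fst)).isOpen_compl
    refine ⟨O, hO.mem_nhds hx, fun x => ((1 : ℝ), (0 : E)), fun x _ => ?_,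
      fun x hx => ⟨rfl, fun h' => absurd h' hx⟩⟩
    refine ContMDiffAt.contMDiffWithinAt (contMDiffAt_timeField
      (w := fun x => ⟨x.2, 0⟩) ?_ (.of_forall fun x => ⟨rfl, rfl⟩))
    exact ((Bundle.contMDiff_zeroSection ℝ (TangentSpace I : N → Type _)).comp contMDiff_snd) x

/-- Frames of a surface extend along paths. -/
theorem exists_positive_frame_path [T2Space N] [CompactSpace N] (hE : finrank ℝ E = 2)
    {o : ∀ x : N, TangentSpace I x → TangentSpace I x → Prop} (ho : IsOrientation o) {c : ℝ → N}
    (hc : ContMDiff 𝓘(ℝ, ℝ) I ∞ c) :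
    ∃ u v : ∀ t, TangentSpace I (c t),
      ContMDiff 𝓘(ℝ, ℝ) I.tangent ∞ (fun t => (⟨c t, u t⟩ : TangentBundle I N)) ∧
      ContMDiff 𝓘(ℝ, ℝ) I.tangent ∞ (fun t => (⟨c t, v t⟩ : TangentBundle I N)) ∧
      ∀ t, o (c t) (u t) (v t) := by
  obtain ⟨Z, hZ, hZ1, hZc⟩ := exists_timeField_of_path hc
  obtain ⟨F, G, hF, hG, hF0, hGF, hFG, hint⟩ := exists_timeFlow hZ
    fun x => (vderiv_fst x (Z x)).trans (hZ1 x)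
  have hFc : ∀ t, F (t, c 0) = c t := by
    have h1 : IsMIntegralCurve (fun t => (t, c t)) Z := fun t => by
      have h2 := (hasMFDerivAt_id (I := 𝓘(ℝ, ℝ)) t).prodMk
        ((hc t).mdifferentiableAt (by simp)).hasMFDerivAt
      refine h2.congr_mfderiv ?_
      refine ContinuousLinearMap.ext_ring ?_
      exact (Prod.ext (hZ1 (t, c t)).symm (hZc t).symm :
        (((1 : ℝ), mfderiv 𝓘(ℝ, ℝ) I c t (1 : ℝ)) : ℝ × E) = Z (t, c t)).trans
          (one_smul ℝ (Z (t, c t))).symm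
    have h3 := isMIntegralCurve_Ioo_eq_of_contMDiff_boundaryless (t₀ := 0) hZ.contMDiff_one
      (hint (c 0)) h1 (Prod.ext rfl (hF0 _))
    exact fun t => congrArg Prod.snd (congrFun h3 t)
  obtain ⟨μ, hμs, hself, hne, hiff⟩ := id ho
  obtain ⟨u₀, v₀, h₀⟩ := ho.exists_frame (c 0)
  let L : ∀ t, TangentSpace I (c 0) →L[ℝ] TangentSpace I (F (t, c 0)) := fun t =>
    (mfderiv (𝓘(ℝ, ℝ).prod I) I F (t, c 0)).comp (ContinuousLinearMap.inr ℝ ℝ E)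
  have hL : ∀ t, Function.Injective (L t) := fun t => by
    rw [injective_iff_map_eq_zero]
    intro z hz
    have h1 := ((contMDiff_fst (t, c 0)).mdifferentiableAt (n := ∞) (by simp)).hasMFDerivAt.prodMk
      ((hF (t, c 0)).mdifferentiableAt (by simp)).hasMFDerivAt
    have h2 := HasMFDerivAt.comp (t, c 0)
      ((hG (t, F (t, c 0))).mdifferentiableAt (by simp)).hasMFDerivAt h1
    have h3 : (G ∘ fun x : ℝ × N => (x.1, F x)) = Prod.snd := funext fun x => hGF x.1 x.2
    rw [h3] at h2
    have h4 := congrArg (fun A : ℝ × E →L[ℝ] E => A (0, z))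
      (hasMFDerivAt_unique h2 (hasMFDerivAt_snd (t, c 0)))
    have h5 : mfderiv (𝓘(ℝ, ℝ).prod I) 𝓘(ℝ, ℝ) (Prod.fst : ℝ × N → ℝ) (t, c 0)
        (((0 : ℝ), z) : ℝ × E) = 0 := vderiv_fst (t, c 0) (((0 : ℝ), z) : ℝ × E)
    have h6 : (mfderiv (𝓘(ℝ, ℝ).prod I) I F (t, c 0) (((0 : ℝ), z) : ℝ × E) : E) = 0 := hz
    refine Eq.trans h4.symm ?_
    refine (congrArg (mfderiv (𝓘(ℝ, ℝ).prod I) I G (t, F (t, c 0)))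
      (Prod.ext h5 h6 : _ = ((0 : ℝ × E)))).trans ?_
    exact map_zero _
  have hpath : ∀ z : TangentSpace I (c 0), ContMDiff 𝓘(ℝ, ℝ) I.tangent ∞
      (fun t => (⟨F (t, c 0), L t z⟩ : TangentBundle I N)) := fun z => by
    have h1 : ContMDiff 𝓘(ℝ, ℝ) (𝓘(ℝ, ℝ).prod I).tangent ∞ (fun t : ℝ =>
        (equivTangentBundleProd 𝓘(ℝ, ℝ) ℝ I N).symm (⟨t, (0 : ℝ)⟩, ⟨c 0, z⟩)) :=
      contMDiff_equivTangentBundleProd_symm.comp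
        ((Bundle.contMDiff_zeroSection ℝ (TangentSpace 𝓘(ℝ, ℝ) : ℝ → Type _)).prodMk
          contMDiff_const)
    exact (hF.contMDiff_tangentMap (m := ∞) (by simp)).comp h1
  have hex : ∀ (z : TangentSpace I (c 0)) t, ∃ w : TangentSpace I (c t),
      (⟨c t, w⟩ : TangentBundle I N) = ⟨F (t, c 0), L t z⟩ := fun z t => by
    have key : ∀ x, x = c t → ∀ a : TangentSpace I x,
        ∃ w : TangentSpace I (c t), (⟨c t, w⟩ : TangentBundle I N) = ⟨x, a⟩ := by
      rintro _ rfl a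
      exact ⟨a, rfl⟩
    exact key _ (hFc t) _
  choose w hw using hex
  have hsm : ∀ z, ContMDiff 𝓘(ℝ, ℝ) I.tangent ∞ (fun t => (⟨c t, w z t⟩ : TangentBundle I N)) :=
    fun z => by simpa only [hw] using hpath z
  have hne' : ∀ t, μ (c t) (w u₀ t) (w v₀ t) ≠ 0 := fun t => by
    have key : ∀ x, x = c t → ∀ a b : TangentSpace I x, μ x a b ≠ 0 →
        (⟨c t, w u₀ t⟩ : TangentBundle I N) = ⟨x, a⟩ →
        (⟨c t, w v₀ t⟩ : TangentBundle I N) = ⟨x, b⟩ → μ (c t) (w u₀ t) (w v₀ t) ≠ 0 := by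
      rintro _ rfl a b hab ha hb
      rw [show w u₀ t = a from eq_of_heq (Bundle.TotalSpace.mk.inj ha).2,
        show w v₀ t = b from eq_of_heq (Bundle.TotalSpace.mk.inj hb).2]
      exact hab
    refine key _ (hFc t) _ _ (fun h0 => ?_) (hw u₀ t) (hw v₀ t)
    have hli : LinearIndependent ℝ ![u₀, v₀] :=
      linearIndependent_pair_of_alternating (B := fun x y => μ (c 0) x y)
        (fun a x z => by rw [map_smul]; rfl) (hself _) (fun a x z => by rw [map_smul]; rfl)
        ((hiff _ _ _).1 h₀).ne'
    have hli' : LinearIndependent ℝ ![L t u₀, L t v₀] := by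
      have h1 := hli.map' (L t : TangentSpace I (c 0) →ₗ[ℝ] TangentSpace I (F (t, c 0)))
        (LinearMap.ker_eq_bot.2 (hL t))
      have h2 : ![L t u₀, L t v₀] = L t ∘ ![u₀, v₀] := funext fun i => by fin_cases i <;> rfl
      rw [h2]
      exact h1
    refine hne (F (t, c 0)) (ContinuousLinearMap.ext fun x => ContinuousLinearMap.ext fun y => ?_)
    exact eq_zero_of_alternating_plane (B := fun x y => μ (F (t, c 0)) x y)
      (fun x y z => by rw [map_add]; rfl) (fun a x z => by rw [map_smul]; rfl) (hself _)
      (fun x y z => by rw [map_add]) (fun a x z => by rw [map_smul]; rfl) hE hli' h0 x y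
  have hcont : Continuous fun t => μ (c t) (w u₀ t) (w v₀ t) :=
    continuous_areaForm hμs (hsm u₀) (hsm v₀) (fun _ => rfl) fun t z hz =>
      congrArg (μ (c t) (w u₀ t)) (eq_of_heq (Bundle.TotalSpace.mk.inj hz).2).symm
  have hsign : (∀ t, 0 < μ (c t) (w u₀ t) (w v₀ t)) ∨ ∀ t, μ (c t) (w u₀ t) (w v₀ t) < 0 := by
    by_contra! hcon
    obtain ⟨⟨a, ha⟩, b, hb⟩ := hcon
    obtain ⟨t, ht⟩ := mem_range_of_exists_le_of_exists_ge hcont ⟨a, ha⟩ ⟨b, hb⟩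
    exact hne' t ht
  rcases hsign with hpos | hneg
  · exact ⟨w u₀, w v₀, hsm u₀, hsm v₀, fun t => (hiff _ _ _).2 (hpos t)⟩
  · refine ⟨w v₀, w u₀, hsm v₀, hsm u₀, fun t => (hiff _ _ _).2 ?_⟩
    have h1 := hself (c t) (w u₀ t + w v₀ t)
    have h2 : μ (c t) (w u₀ t + w v₀ t) (w u₀ t + w v₀ t) =
        μ (c t) (w u₀ t) (w u₀ t + w v₀ t) + μ (c t) (w v₀ t) (w u₀ t + w v₀ t) := by
      rw [map_add (μ (c t))]; rfl
    rw [h2, map_add, map_add, hself, hself] at h1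
    linarith [hneg t]

end FramePaths

lemma isFibreDiffeo_trivialization {e : Bundle.Trivialization M π}
    (he : IsSmoothTrivialization IV IS IM e) {b : S} (hb : b ∈ e.baseSet) :
    IsFibreDiffeo IV IM (e.preimageSingletonHomeomorph hb).symm.toEquiv := by
  have hj : ∀ m, (((e.preimageSingletonHomeomorph hb).symm.toEquiv m : Fibre π b) : V) =
      e.toOpenPartialHomeomorph.symm (b, m) := fun m =>
    congrArg Subtype.val (e.preimageSingletonHomeomorph_symm_apply hb m)
  have ht : ∀ m, (b, m) ∈ e.target := fun m => e.mem_target.2 hb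
  have hsm : ContMDiff IM IV ∞
      (fun m => (((e.preimageSingletonHomeomorph hb).symm.toEquiv m : Fibre π b) : V)) := by
    simp only [hj]
    exact fun m => ContMDiffAt.comp m ((he.2 _ (ht m)).contMDiffAt (e.open_target.mem_nhds (ht m)))
      (contMDiffAt_const.prodMk contMDiffAt_id)
  refine ⟨hsm, fun m => ?_⟩
  set j : M → V := fun m => (((e.preimageSingletonHomeomorph hb).symm.toEquiv m : Fibre π b) : V)
  have hjs : j m ∈ e.source := by
    rw [show j m = _ from hj m]; exact e.map_target (ht m)
  have hr : ContMDiffAt IV IM ∞ (fun p => (e p).2) (j m) :=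
    contMDiffAt_snd.comp _ ((he.1 _ hjs).contMDiffAt (e.open_source.mem_nhds hjs))
  have h1 := HasMFDerivAt.comp m (hr.mdifferentiableAt (by simp)).hasMFDerivAt
    ((hsm m).mdifferentiableAt (by simp)).hasMFDerivAt
  have h2 : ((fun p => (e p).2) ∘ j) = id := funext fun m => by
    change (e (j m)).2 = m
    rw [show j m = _ from hj m]
    exact congrArg Prod.snd (e.right_inv (ht m))
  rw [h2] at h1
  have h3 := hasMFDerivAt_unique h1 (hasMFDerivAt_id m)
  rw [injective_iff_map_eq_zero]
  intro v hv
  have h4 := congrArg (fun A : EM →L[ℝ] EM => A v) h3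
  refine Eq.trans h4.symm ?_
  exact (congrArg (mfderiv IV IM (fun p => (e p).2) (j m)) hv).trans (map_zero _)

/-- A smooth reparametrization of `(-ε, ε)` by the line. -/
lemma exists_reparametrization {ε : ℝ} (hε : 0 < ε) : ∃ ρ σ : ℝ → ℝ, ContDiff ℝ ∞ ρ ∧
    ContDiffOn ℝ ∞ σ (Ioo (-ε) ε) ∧ (∀ s, ρ s ∈ Ioo (-ε) ε) ∧ σ 0 = 0 ∧
    ∀ t ∈ Ioo (-ε) ε, ρ (σ t) = t := by
  have hπ := Real.pi_pos
  have hmem : ∀ t ∈ Ioo (-ε) ε, Real.pi / (2 * ε) * t ∈ Ioo (-(Real.pi / 2)) (Real.pi / 2) := by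
    intro t ht
    have e1 : Real.pi / (2 * ε) * t = Real.pi / 2 * (t / ε) := by field_simp
    have h1 : -1 < t / ε := by rw [lt_div_iff₀ hε]; linarith [ht.1]
    have h2 : t / ε < 1 := by rw [div_lt_iff₀ hε]; linarith [ht.2]
    rw [e1]
    constructor <;> nlinarith
  refine ⟨fun s => 2 * ε / Real.pi * Real.arctan s, fun t => Real.tan (Real.pi / (2 * ε) * t),
    contDiff_const.mul Real.contDiff_arctan, fun t ht => ?_, fun s => ?_, by simp, fun t ht => ?_⟩
  · refine ContDiffAt.contDiffWithinAt ((Real.contDiffAt_tan.2 ?_).comp t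
      (contDiffAt_const.mul contDiffAt_id))
    exact (Real.cos_pos_of_mem_Ioo (hmem t ht)).ne'
  · have h1 := Real.neg_pi_div_two_lt_arctan s
    have h2 := Real.arctan_lt_pi_div_two s
    have e1 : 2 * ε / Real.pi * (Real.pi / 2) = ε := by field_simp
    have hp : 0 < 2 * ε / Real.pi := by positivity
    constructor <;> nlinarith
  · change 2 * ε / Real.pi * Real.arctan (Real.tan (Real.pi / (2 * ε) * t)) = t
    rw [Real.arctan_tan (hmem t ht).1 (hmem t ht).2]
    field_simp

namespace IsBourgeois

variable {o : ∀ x : S, TangentSpace IS x → TangentSpace IS x → Prop}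
  (h : IsBourgeois IV IS IM k π M o η₀ η)
  [T2Space S] [CompactSpace S] [T2Space M] [CompactSpace M]
  (hEM : finrank ℝ EM = 2 * k + 1) (hEV : finrank ℝ EV = 2 * k + 3)
  (hES : finrank ℝ ES = 2)
include h hEM hEV hES

/-- Over a trivialized set, the isotopy classes along a path come from an isotopy of open books. -/
theorem exists_isotopy_of_path {e : Bundle.Trivialization M π}
    (he : IsSmoothTrivialization IV IS IM e) {ε : ℝ} (hε : 0 < ε) {c : ℝ → S}
    (hcs : ContMDiffOn 𝓘(ℝ, ℝ) IS ∞ c (Ioo (-ε) ε)) (hc : ∀ t ∈ Ioo (-ε) ε, c t ∈ e.baseSet) :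
    ∃ B : ∀ t, OpenBook (Fibre π (c t)),
      (∀ t ∈ Ioo (-ε) ε, B t ∈ isotopyClass IV IS IM k π M o η₀ η (c t)) ∧
      IsSmoothFamily IV IM k M η (Ioo (-ε) ε) c B ∧
      ∃ f : ℝ → M ≃ₘ^∞⟮IM, IM⟯ M, IsIsotopyOn (Ioo (-ε) ε) f ∧
        ∀ (h0 : (0 : ℝ) ∈ Ioo (-ε) ε) (t : ℝ) (ht : t ∈ Ioo (-ε) ε),
          (((B 0).pullback (e.preimageSingletonHomeomorph (hc 0 h0)).symm).image
            (f t).toEquiv).Same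
          ((B t).pullback (e.preimageSingletonHomeomorph (hc t ht)).symm) := by
  obtain ⟨ρ, σ, hρ, hσ, hρmem, hσ0, hρσ⟩ := exists_reparametrization hε
  have hcρ : ContMDiff 𝓘(ℝ, ℝ) IS ∞ (fun s => c (ρ s)) := fun s =>
    ((hcs (ρ s) (hρmem s)).contMDiffAt (isOpen_Ioo.mem_nhds (hρmem s))).comp s (hρ.contMDiff s)
  obtain ⟨u, v, hu, hv, huv⟩ := exists_positive_frame_path hES h.orientation hcρ
  let α := definingForm IV η
  let g : ℝ × M → V := fun x => e.toOpenPartialHomeomorph.symm (c (ρ x.1), x.2)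
  have ht : ∀ x : ℝ × M, (c (ρ x.1), x.2) ∈ e.target := fun x => e.mem_target.2 (hc _ (hρmem _))
  have hg : ContMDiff (𝓘(ℝ, ℝ).prod IM) IV ∞ g := fun x =>
    ContMDiffAt.comp x ((he.2 _ (ht x)).contMDiffAt (e.open_target.mem_nhds (ht x)))
      (((hcρ.comp contMDiff_fst) x).prodMk contMDiffAt_snd)
  let F : (∀ s, TangentSpace IS (c (ρ s))) → ℝ × M → ℝ := fun u x =>
    α (g x) (potential IV IS π η₀ η (g x) ⟨c (ρ x.1), u x.1⟩)
  have hF : ∀ u : ∀ s, TangentSpace IS (c (ρ s)),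
      ContMDiff 𝓘(ℝ, ℝ) IS.tangent ∞ (fun s => (⟨c (ρ s), u s⟩ : TangentBundle IS S)) →
      ContMDiff (𝓘(ℝ, ℝ).prod IM) 𝓘(ℝ, ℝ) ∞ (F u) := fun u hu x =>
    ((h.isFibredPair hEV hES).contMDiffWithinAt_potential (s := univ) (g := g)
      (w := fun x => ⟨c (ρ x.1), u x.1⟩) (hg x).contMDiffWithinAt
      ((hu.comp contMDiff_fst) x).contMDiffWithinAt (mem_univ _)
      fun y _ => e.proj_symm_apply (ht y)).contMDiffAt Filter.univ_mem
  let Φ : ℝ × M → ℂ := fun x => ⟨F u x, - F v x⟩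
  have hΦ : ContMDiff (𝓘(ℝ, ℝ).prod IM) 𝓘(ℝ, ℂ) ∞ Φ := contMDiff_complex_mk (hF u hu) (hF v hv).neg
  have hΦj : ∀ s m, Φ (s, m) = frameFunction IV IS π η₀ η (c (ρ s)) (u s) (v s)
      ((e.preimageSingletonHomeomorph (hc _ (hρmem s))).symm m) := fun s m => by
    rw [e.preimageSingletonHomeomorph_symm_apply]; rfl
  obtain ⟨f, hf, hf0, hfS⟩ := exists_diffeos_of_bookMaps hΦ fun s => by
    simp only [hΦj]
    exact (h.isAdapted_frameFunction hEM hEV hES (huv s)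
      (isFibreDiffeo_trivialization he (hc _ (hρmem s)))).1
  have hex : ∀ u : ∀ s, TangentSpace IS (c (ρ s)), ∀ t, ∃ w : TangentSpace IS (c t),
      t ∈ Ioo (-ε) ε → (⟨c t, w⟩ : TangentBundle IS S) = ⟨c (ρ (σ t)), u (σ t)⟩ := fun u t => by
    by_cases ht : t ∈ Ioo (-ε) ε
    · have key : ∀ r, r = t → ∀ a : TangentSpace IS (c r),
          ∃ w : TangentSpace IS (c t), (⟨c t, w⟩ : TangentBundle IS S) = ⟨c r, a⟩ := by
        rintro _ rfl a
        exact ⟨a, rfl⟩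
      obtain ⟨w, hw⟩ := key _ (hρσ t ht) (u (σ t))
      exact ⟨w, fun _ => hw⟩
    · exact ⟨0, fun h' => absurd h' ht⟩
  choose w hw using hex
  have hws : ∀ u : ∀ s, TangentSpace IS (c (ρ s)),
      ContMDiff 𝓘(ℝ, ℝ) IS.tangent ∞ (fun s => (⟨c (ρ s), u s⟩ : TangentBundle IS S)) →
      ContMDiffOn 𝓘(ℝ, ℝ) IS.tangent ∞ (fun t => (⟨c t, w u t⟩ : TangentBundle IS S))
        (Ioo (-ε) ε) := fun u hu => by
    have h1 : ContMDiffOn 𝓘(ℝ, ℝ) 𝓘(ℝ, ℝ) ∞ σ (Ioo (-ε) ε) := hσ.contMDiffOn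
    exact (hu.comp_contMDiffOn h1).congr fun t ht => hw u t ht
  have hfun : ∀ t (ht : t ∈ Ioo (-ε) ε), o (c t) (w u t) (w v t) ∧
      ∀ m, Φ (σ t, m) = frameFunction IV IS π η₀ η (c t) (w u t) (w v t)
        ((e.preimageSingletonHomeomorph (hc t ht)).symm m) := fun t ht => by
    have key : ∀ r (hr : t = r) (hb : c r ∈ e.baseSet) (a a' : TangentSpace IS (c r)),
        (⟨c t, w u t⟩ : TangentBundle IS S) = ⟨c r, a⟩ →
        (⟨c t, w v t⟩ : TangentBundle IS S) = ⟨c r, a'⟩ → o (c r) a a' →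
        (∀ m, Φ (σ t, m) = frameFunction IV IS π η₀ η (c r) a a'
          ((e.preimageSingletonHomeomorph hb).symm m)) →
        o (c t) (w u t) (w v t) ∧ ∀ m, Φ (σ t, m) = frameFunction IV IS π η₀ η (c t) (w u t) (w v t)
        ((e.preimageSingletonHomeomorph (hc t ht)).symm m) := by
      rintro _ rfl hb a a' ha ha' h1 h2
      rw [show w u t = a from eq_of_heq (Bundle.TotalSpace.mk.inj ha).2,
        show w v t = a' from eq_of_heq (Bundle.TotalSpace.mk.inj ha').2]
      exact ⟨h1, h2⟩
    exact key _ (hρσ t ht).symm (hc _ (hρmem (σ t))) _ _ (hw u t ht) (hw v t ht) (huv _) (hΦj (σ t))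
  refine ⟨fun t => frameOpenBook IV IS π η₀ η (c t) (w u t) (w v t), fun t ht => ?_,
    h.isSmoothFamily_frameOpenBook hEM hEV hES (hws u hu) (hws v hv) fun t ht => (hfun t ht).1,
    fun t => f (σ t), ⟨?_, fun p => ?_⟩, fun h0 t ht => ?_⟩
  · exact (h.mem_isotopyClass hEM hEV hES (hfun t ht).1).2
      (h.isFibreIsotopic_of_frames hEM hEV hES (hfun t ht).1 (hfun t ht).1)
  · have h1 : ContMDiffOn 𝓘(ℝ, ℝ) 𝓘(ℝ, ℝ) ∞ σ (Ioo (-ε) ε) := hσ.contMDiffOn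
    exact hf.comp_contMDiffOn ((h1.comp contMDiffOn_fst fun x hx => hx.1).prodMk contMDiffOn_snd)
  · change f (σ 0) p = p
    rw [hσ0]; exact hf0 p
  · refine hfS (σ t) _ _ ?_ ?_
    · have h1 := h.isDefinedBy_frameOpenBook hEM hEV hES (hfun 0 h0).1
        (isFibreDiffeo_trivialization he (hc 0 h0))
      have h2 := fun m => (hfun 0 h0).2 m
      rw [hσ0] at h2
      rw [show (fun x => Φ (0, x)) = _ from funext h2]
      exact h1
    · have h1 := h.isDefinedBy_frameOpenBook hEM hEV hES (hfun t ht).1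
        (isFibreDiffeo_trivialization he (hc t ht))
      rw [show (fun x => Φ (σ t, x)) = _ from funext (hfun t ht).2]
      exact h1

end IsBourgeois

end FibreBundles

section Products

variable {ES : Type*} [NormedAddCommGroup ES] [NormedSpace ℝ ES] [FiniteDimensional ℝ ES]
  {HS : Type*} [TopologicalSpace HS] {IS : ModelWithCorners ℝ ES HS} [IS.Boundaryless]
  {S : Type*} [TopologicalSpace S] [ChartedSpace HS S] [IsManifold IS ∞ S]
  {EM : Type*} [NormedAddCommGroup EM] [NormedSpace ℝ EM] [FiniteDimensional ℝ EM]
  {HM : Type*} [TopologicalSpace HM] {IM : ModelWithCorners ℝ EM HM} [IM.Boundaryless]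
  {M : Type*} [TopologicalSpace M] [ChartedSpace HM M] [IsManifold IM ∞ M]
  {k : ℕ} {β : OneForm IM M} {f g : M → ℝ} {Θ₁ Θ₂ : OneForm IS S}

/-- The tangent vector `(v, u)` of a product. -/
def prodVec (x : M × S) (v : TangentSpace IM x.1) (u : TangentSpace IS x.2) :
    TangentSpace (IM.prod IS) x := ((v, u) : EM × ES)

lemma mfderiv_fst_prodVec (x : M × S) (v : TangentSpace IM x.1) (u : TangentSpace IS x.2) :
    mfderiv (IM.prod IS) IM Prod.fst x (prodVec x v u) = v :=
  congrArg (fun L : EM × ES →L[ℝ] EM => L (v, u)) (mfderiv_fst (I := IM) (I' := IS) (x := x))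

lemma mfderiv_snd_prodVec (x : M × S) (v : TangentSpace IM x.1) (u : TangentSpace IS x.2) :
    mfderiv (IM.prod IS) IS Prod.snd x (prodVec x v u) = u :=
  congrArg (fun L : EM × ES →L[ℝ] ES => L (v, u)) (mfderiv_snd (I := IM) (I' := IS) (x := x))

lemma exists_prodVec (x : M × S) (w : TangentSpace (IM.prod IS) x) :
    ∃ (v : TangentSpace IM x.1) (u : TangentSpace IS x.2), w = prodVec x v u :=
  ⟨(w : EM × ES).1, (w : EM × ES).2, rfl⟩

lemma prodVec_ext {x : M × S} {w w' : TangentSpace (IM.prod IS) x}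
    (h₁ : mfderiv (IM.prod IS) IM Prod.fst x w = mfderiv (IM.prod IS) IM Prod.fst x w')
    (h₂ : mfderiv (IM.prod IS) IS Prod.snd x w = mfderiv (IM.prod IS) IS Prod.snd x w') :
    w = w' := by
  obtain ⟨v, u, rfl⟩ := exists_prodVec x w
  obtain ⟨v', u', rfl⟩ := exists_prodVec x w'
  rw [mfderiv_fst_prodVec, mfderiv_fst_prodVec] at h₁
  rw [mfderiv_snd_prodVec, mfderiv_snd_prodVec] at h₂
  rw [h₁, h₂]

lemma isVertical_prodVec {x : M × S} {v : TangentSpace IM x.1} {u : TangentSpace IS x.2} :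
    IsVertical (IM.prod IS) IS Prod.snd x (prodVec x v u) ↔ u = 0 := by
  rw [IsVertical, mfderiv_snd_prodVec]

lemma smoothField_prodVec {X : ∀ m : M, TangentSpace IM m} {U : ∀ b : S, TangentSpace IS b}
    (hX : SmoothField X) (hU : SmoothField U) :
    SmoothField (fun x : M × S => prodVec x (X x.1) (U x.2)) := by
  have h1 : ContMDiff (IM.prod IS) (IM.tangent.prod IS.tangent) ∞
      (fun x : M × S => ((⟨x.1, X x.1⟩, ⟨x.2, U x.2⟩) : TangentBundle IM M × TangentBundle IS S)) :=
    (hX.comp contMDiff_fst).prodMk (hU.comp contMDiff_snd)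
  exact contMDiff_equivTangentBundleProd_symm.comp h1

lemma mlieBracket_prodVec {X X' : ∀ m : M, TangentSpace IM m} {U U' : ∀ b : S, TangentSpace IS b}
    (hX : SmoothField X) (hU : SmoothField U) (hX' : SmoothField X') (hU' : SmoothField U')
    (x : M × S) :
    mlieBracket (IM.prod IS) (fun x : M × S => prodVec x (X x.1) (U x.2))
        (fun x : M × S => prodVec x (X' x.1) (U' x.2)) x =
      prodVec x (mlieBracket IM X X' x.1) (mlieBracket IS U U' x.2) := by
  refine prodVec_ext ?_ ?_
  · rw [mfderiv_fst_prodVec]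
    exact mfderiv_mlieBracket_of_related contMDiffAt_fst (smoothField_prodVec hX hU x)
      (smoothField_prodVec hX' hU' x) (hX x.1) (hX' x.1)
      (.of_forall fun q => mfderiv_fst_prodVec q _ _)
      (.of_forall fun q => mfderiv_fst_prodVec q _ _)
  · rw [mfderiv_snd_prodVec]
    exact mfderiv_mlieBracket_of_related contMDiffAt_snd (smoothField_prodVec hX hU x)
      (smoothField_prodVec hX' hU' x) (hU x.2) (hU' x.2)
      (.of_forall fun q => mfderiv_snd_prodVec q _ _)
      (.of_forall fun q => mfderiv_snd_prodVec q _ _)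

/-- The form `β + f Θ₁ - g Θ₂` on `M × S`. -/
def productForm (β : OneForm IM M) (f g : M → ℝ) (Θ₁ Θ₂ : OneForm IS S) :
    OneForm (IM.prod IS) (M × S) := fun x =>
  pullbackForm (IM.prod IS) Prod.fst β x + (f x.1 • pullbackForm (IM.prod IS) Prod.snd Θ₁ x +
    (-g x.1) • pullbackForm (IM.prod IS) Prod.snd Θ₂ x)

lemma pullbackForm_fst_prodVec (x : M × S) (v : TangentSpace IM x.1) (u : TangentSpace IS x.2) :
    pullbackForm (IM.prod IS) Prod.fst β x (prodVec x v u) = β x.1 v :=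
  congrArg (β x.1) (mfderiv_fst_prodVec x v u)

lemma pullbackForm_snd_prodVec (x : M × S) (v : TangentSpace IM x.1) (u : TangentSpace IS x.2) :
    pullbackForm (IM.prod IS) Prod.snd Θ₁ x (prodVec x v u) = Θ₁ x.2 u :=
  congrArg (Θ₁ x.2) (mfderiv_snd_prodVec x v u)

lemma productForm_prodVec (x : M × S) (v : TangentSpace IM x.1) (u : TangentSpace IS x.2) :
    productForm β f g Θ₁ Θ₂ x (prodVec x v u) = β x.1 v + f x.1 * Θ₁ x.2 u - g x.1 * Θ₂ x.2 u := by
  change pullbackForm (IM.prod IS) Prod.fst β x (prodVec x v u) +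
    (f x.1 * pullbackForm (IM.prod IS) Prod.snd Θ₁ x (prodVec x v u) +
    (-g x.1) * pullbackForm (IM.prod IS) Prod.snd Θ₂ x (prodVec x v u)) = _
  rw [pullbackForm_fst_prodVec, pullbackForm_snd_prodVec, pullbackForm_snd_prodVec]
  ring

lemma smoothForm_productForm (hβ : SmoothForm β) (hf : ContMDiff IM 𝓘(ℝ, ℝ) ∞ f)
    (hg : ContMDiff IM 𝓘(ℝ, ℝ) ∞ g) (hΘ₁ : SmoothForm Θ₁) (hΘ₂ : SmoothForm Θ₂) :
    SmoothForm (productForm β f g Θ₁ Θ₂) :=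
  (hβ.pullbackForm contMDiff_fst).add
    (((hΘ₁.pullbackForm contMDiff_snd).smul (hf.comp contMDiff_fst)).add
      ((hΘ₂.pullbackForm contMDiff_snd).smul ((hg.neg).comp contMDiff_fst)))

lemma extD_productForm (hβ : SmoothForm β) (hf : ContMDiff IM 𝓘(ℝ, ℝ) ∞ f)
    (hg : ContMDiff IM 𝓘(ℝ, ℝ) ∞ g) (hΘ₁ : SmoothForm Θ₁) (hΘ₂ : SmoothForm Θ₂)
    (hd₁ : ∀ b u v, extD Θ₁ b u v = 0) (hd₂ : ∀ b u v, extD Θ₂ b u v = 0) (x : M × S)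
    (v v' : TangentSpace IM x.1) (u u' : TangentSpace IS x.2) :
    extD (productForm β f g Θ₁ Θ₂) x (prodVec x v u) (prodVec x v' u') =
      extD β x.1 v v' + vderiv IM f x.1 v * Θ₁ x.2 u' - vderiv IM f x.1 v' * Θ₁ x.2 u
        - vderiv IM g x.1 v * Θ₂ x.2 u' + vderiv IM g x.1 v' * Θ₂ x.2 u := by
  have hsf : ∀ {f : M → ℝ} {Θ : OneForm IS S}, ContMDiff IM 𝓘(ℝ, ℝ) ∞ f → SmoothForm Θ →
      SmoothForm (fun x : M × S => f x.1 • pullbackForm (IM.prod IS) Prod.snd Θ x) :=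
    fun hf hΘ => (hΘ.pullbackForm contMDiff_snd).smul (hf.comp contMDiff_fst)
  have hs : ∀ {f : M → ℝ} {Θ : OneForm IS S}, ContMDiff IM 𝓘(ℝ, ℝ) ∞ f → SmoothForm Θ →
      (∀ b u v, extD Θ b u v = 0) →
      extD (fun x : M × S => f x.1 • pullbackForm (IM.prod IS) Prod.snd Θ x) x (prodVec x v u)
        (prodVec x v' u') = vderiv IM f x.1 v * Θ x.2 u' - vderiv IM f x.1 v' * Θ x.2 u := by
    intro f Θ hf hΘ hd
    have hv : ∀ v u, vderiv (IM.prod IS) (fun x : M × S => f x.1) x (prodVec x v u) =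
        vderiv IM f x.1 v := fun v u =>
      (vderiv_comp_map ((hf x.1).mdifferentiableAt (by simp)) mdifferentiableAt_fst _).trans
        (congrArg (vderiv IM f x.1) (mfderiv_fst_prodVec x v u))
    have he : extD (pullbackForm (IM.prod IS) Prod.snd Θ) x (prodVec x v u) (prodVec x v' u') =
        0 := (extD_pullbackForm hΘ contMDiffAt_snd _ _).trans (hd _ _ _)
    rw [extD_smul (f := fun x : M × S => f x.1) ((hf.comp contMDiff_fst) x)
      (hΘ.pullbackForm contMDiff_snd), he, hv, hv, pullbackForm_snd_prodVec,
      pullbackForm_snd_prodVec]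
    ring
  have hneg : ∀ v, vderiv IM (fun m => - g m) x.1 v = - vderiv IM g x.1 v := fun v => by
    have hd : MDifferentiableAt IM 𝓘(ℝ, ℝ) g x.1 := (hg x.1).mdifferentiableAt (by simp)
    rw [show (fun m => - g m) = fun m => 0 - g m from funext fun m => (zero_sub _).symm,
      vderiv_sub mdifferentiableAt_const hd, vderiv_const, zero_sub]
  have h0 := extD_add (hβ.pullbackForm (contMDiff_fst (I := IM) (J := IS) (M := M) (N := S)))
    ((hsf hf hΘ₁).add (hsf hg.neg hΘ₂)) x (prodVec x v u) (prodVec x v' u')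
  have h1 := extD_add (hsf hf hΘ₁) (hsf hg.neg hΘ₂) x (prodVec x v u) (prodVec x v' u')
  have h2 : extD (pullbackForm (IM.prod IS) Prod.fst β) x (prodVec x v u) (prodVec x v' u') =
      extD β x.1 v v' := by
    rw [extD_pullbackForm hβ contMDiffAt_fst, mfderiv_fst_prodVec, mfderiv_fst_prodVec]
  rw [h1, h2, hs hf hΘ₁ hd₁, hs hg.neg hΘ₂ hd₂] at h0
  refine h0.trans ?_
  rw [hneg, hneg]
  ring

lemma isSmoothFibreBundle_snd :
    IsSmoothFibreBundle (IM.prod IS) IS IM M (Prod.snd : M × S → S) := fun b => by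
  let e : Bundle.Trivialization M (Prod.snd : M × S → S) :=
    { (Homeomorph.prodComm M S).toOpenPartialHomeomorph with
      baseSet := univ
      open_baseSet := isOpen_univ
      source_eq := rfl
      target_eq := by simp
      proj_toFun := fun _ _ => rfl }
  refine ⟨e, mem_univ b, ?_, ?_⟩
  · exact (contMDiff_snd.prodMk contMDiff_fst).contMDiffOn
  · exact (contMDiff_snd.prodMk contMDiff_fst).contMDiffOn

variable (f g Θ₁ Θ₂) in
/-- The fibre component of horizontal lifts for the kernel of `β + f Θ₁ - g Θ₂`. -/
def IsContactForm.liftComponent (h : IsContactForm k β) (x : M × S) (u : TangentSpace IS x.2) :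
    TangentSpace IM x.1 :=
  Θ₂ x.2 u • h.ham g x.1 - Θ₁ x.2 u • h.ham f x.1

variable (k β f g Θ₁ Θ₂) in
/-- The data of a contact form on `M`, two functions and two closed forms on `S`. -/
structure IsProductData : Prop where
  form : IsContactForm k β
  dim_base : finrank ℝ ES = 2
  smooth_fst : ContMDiff IM 𝓘(ℝ, ℝ) ∞ f
  smooth_snd : ContMDiff IM 𝓘(ℝ, ℝ) ∞ g
  smooth_left : SmoothForm Θ₁
  smooth_right : SmoothForm Θ₂
  closed_left : ∀ b u v, extD Θ₁ b u v = 0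
  closed_right : ∀ b u v, extD Θ₂ b u v = 0

namespace IsProductData

variable (h : IsProductData k β f g Θ₁ Θ₂)
include h

lemma zero : IsProductData k β 0 0 Θ₁ Θ₂ :=
  { h with smooth_fst := contMDiff_const, smooth_snd := contMDiff_const }

lemma extD_apply (x : M × S) (v v' : TangentSpace IM x.1) (u u' : TangentSpace IS x.2) :
    extD (productForm β f g Θ₁ Θ₂) x (prodVec x v u) (prodVec x v' u') =
      extD β x.1 v v' + vderiv IM f x.1 v * Θ₁ x.2 u' - vderiv IM f x.1 v' * Θ₁ x.2 u
        - vderiv IM g x.1 v * Θ₂ x.2 u' + vderiv IM g x.1 v' * Θ₂ x.2 u :=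
  extD_productForm h.form.smooth h.smooth_fst h.smooth_snd h.smooth_left h.smooth_right
    h.closed_left h.closed_right x v v' u u'

lemma topForm_vertical (x : M × S) (v : Fin (2 * k + 1) → TangentSpace IM x.1) :
    topForm k (productForm β f g Θ₁ Θ₂ x) (extD (productForm β f g Θ₁ Θ₂) x)
      (fun i => prodVec x (v i) 0) = topForm k (β x.1) (extD β x.1) v := by
  simp only [topForm, productForm_prodVec, h.extD_apply, map_zero, mul_zero, add_zero, sub_zero]

lemma isFibredContactForm :
    IsFibredContactForm (IM.prod IS) IS k Prod.snd (productForm β f g Θ₁ Θ₂) where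
  dim_total := by
    rw [Module.finrank_prod, h.form.dim, h.dim_base]
  dim_base := h.dim_base
  smooth := smoothForm_productForm h.form.smooth h.smooth_fst h.smooth_snd h.smooth_left
    h.smooth_right
  proj := contMDiff_snd
  submersive x u := ⟨prodVec x 0 u, mfderiv_snd_prodVec x 0 u⟩
  nondeg x w hw hv := by
    choose v u hvu using fun i => exists_prodVec x (w i)
    have hw' : w = fun i => prodVec x (v i) 0 := funext fun i => by
      have := hv i
      rw [hvu, isVertical_prodVec] at this
      rw [hvu, this]
    rw [hw', h.topForm_vertical]
    refine h.form.nondeg _ _ ?_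
    have h1 : LinearIndependent ℝ ((LinearMap.inl ℝ EM ES) ∘ (v : Fin (2 * k + 1) → EM)) := by
      have h2 : w = (LinearMap.inl ℝ EM ES) ∘ (v : Fin (2 * k + 1) → EM) := hw'
      exact h2 ▸ hw
    exact LinearIndependent.of_comp _ h1

lemma isHorizontalFor (x : M × S) (u : TangentSpace IS x.2) :
    IsHorizontalFor (IM.prod IS) IS Prod.snd (productForm β f g Θ₁ Θ₂) x
      (prodVec x (h.form.liftComponent f g Θ₁ Θ₂ x u) u) := by
  refine ⟨?_, fun z hz hαz => ?_⟩
  · rw [productForm_prodVec, IsContactForm.liftComponent, map_sub, map_smul, map_smul,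
      h.form.apply_ham, h.form.apply_ham, smul_eq_mul, smul_eq_mul]
    ring
  · obtain ⟨v, u', rfl⟩ := exists_prodVec x z
    obtain rfl := isVertical_prodVec.1 hz
    rw [productForm_prodVec, map_zero, map_zero, mul_zero, mul_zero, add_zero, sub_zero] at hαz
    rw [h.extD_apply, ← extDL_apply β, IsContactForm.liftComponent, map_sub, map_smul, map_smul,
      LinearMap.sub_apply, LinearMap.smul_apply, LinearMap.smul_apply, extDL_apply, extDL_apply,
      h.form.extD_ham_of_mem _ _ hαz, h.form.extD_ham_of_mem _ _ hαz, map_zero, map_zero,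
      smul_eq_mul, smul_eq_mul]
    ring

lemma horizontalLift_eq (x : M × S) (u : TangentSpace IS x.2) :
    horizontalLift (IM.prod IS) IS Prod.snd (cokernel (productForm β f g Θ₁ Θ₂)) x ⟨x.2, u⟩ =
      prodVec x (h.form.liftComponent f g Θ₁ Θ₂ x u) u :=
  h.isFibredContactForm.horizontalLift_eq h.isFibredContactForm.defines
    (mfderiv_snd_prodVec x _ u) (h.isHorizontalFor x u)

lemma horizontalLift_zero (x : M × S) (u : TangentSpace IS x.2) :
    horizontalLift (IM.prod IS) IS Prod.snd (cokernel (productForm β 0 0 Θ₁ Θ₂)) x ⟨x.2, u⟩ =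
      prodVec x 0 u := by
  have h0 : h.form.ham 0 x.1 = 0 := by
    refine (h.form.eq_ham (by rw [map_zero]; rfl) fun y _ => ?_).symm
    have h1 : vderiv IM (0 : M → ℝ) x.1 y = 0 := vderiv_const 0 x.1 y
    rw [h1, ← extDL_apply, map_zero, LinearMap.zero_apply, neg_zero]
  rw [h.zero.horizontalLift_eq, IsContactForm.liftComponent, h0, smul_zero, smul_zero, sub_zero]

lemma potential_eq (x : M × S) (u : TangentSpace IS x.2) :
    potential (IM.prod IS) IS Prod.snd (cokernel (productForm β 0 0 Θ₁ Θ₂))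
      (cokernel (productForm β f g Θ₁ Θ₂)) x ⟨x.2, u⟩ =
        prodVec x (h.form.liftComponent f g Θ₁ Θ₂ x u) 0 := by
  rw [potential, h.horizontalLift_eq, h.horizontalLift_zero]
  refine prodVec_ext ?_ ?_
  · rw [map_sub, mfderiv_fst_prodVec, mfderiv_fst_prodVec, mfderiv_fst_prodVec, sub_zero]
  · rw [map_sub, mfderiv_snd_prodVec, mfderiv_snd_prodVec, mfderiv_snd_prodVec, sub_self]

lemma productForm_potential (x : M × S) (u : TangentSpace IS x.2) :
    productForm β f g Θ₁ Θ₂ x (potential (IM.prod IS) IS Prod.snd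
      (cokernel (productForm β 0 0 Θ₁ Θ₂)) (cokernel (productForm β f g Θ₁ Θ₂)) x ⟨x.2, u⟩) =
        Θ₂ x.2 u * g x.1 - Θ₁ x.2 u * f x.1 := by
  rw [h.potential_eq, productForm_prodVec, IsContactForm.liftComponent, map_sub, map_smul,
    map_smul, h.form.apply_ham, h.form.apply_ham, map_zero, map_zero, smul_eq_mul, smul_eq_mul,
    mul_zero, mul_zero, add_zero, sub_zero]

/-- The connection of `β` on the product is flat. -/
lemma curvature_zero {X Z : ∀ x : M × S, TangentSpace (IM.prod IS) x} (hX : SmoothField X)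
    (hZ : SmoothField Z) (x : M × S) :
    curvature (IM.prod IS) IS Prod.snd (cokernel (productForm β 0 0 Θ₁ Θ₂)) X Z x = 0 := by
  have hpart : ∀ X : ∀ x : M × S, TangentSpace (IM.prod IS) x,
      horizontalPart (IM.prod IS) IS Prod.snd (cokernel (productForm β 0 0 Θ₁ Θ₂)) X =
        fun x => prodVec x 0 (mfderiv (IM.prod IS) IS Prod.snd x (X x)) := fun X =>
    funext fun x => h.horizontalLift_zero x _
  have hs : ∀ {X : ∀ x : M × S, TangentSpace (IM.prod IS) x}, SmoothField X →
      SmoothField (fun x => prodVec x 0 (mfderiv (IM.prod IS) IS Prod.snd x (X x))) :=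
    fun {X} hX => by
    have h1 : ContMDiff (IM.prod IS) (IM.tangent.prod IS.tangent) ∞ (fun x : M × S =>
        ((⟨x.1, 0⟩, tangentMap (IM.prod IS) IS Prod.snd ⟨x, X x⟩) :
          TangentBundle IM M × TangentBundle IS S)) :=
      ContMDiff.prodMk ((Bundle.contMDiff_zeroSection ℝ (TangentSpace IM : M → Type _)).comp
        contMDiff_fst) ((contMDiff_snd.contMDiff_tangentMap (n := ∞) (m := ∞) (by simp)).comp hX)
    exact contMDiff_equivTangentBundleProd_symm.comp h1
  change mlieBracket (IM.prod IS) (horizontalPart _ _ _ _ X)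
    (horizontalPart _ _ _ _ Z) x - horizontalPart _ _ _ _ (mlieBracket (IM.prod IS)
      (horizontalPart _ _ _ _ X) (horizontalPart _ _ _ _ Z)) x = 0
  rw [hpart X, hpart Z, hpart, sub_eq_zero]
  refine prodVec_ext ?_ (mfderiv_snd_prodVec x _ _).symm
  rw [mfderiv_fst_prodVec]
  have h2 := mfderiv_mlieBracket_of_related (I := IM) (f := (Prod.fst : M × S → M))
    (X' := 0) (Y' := 0) contMDiffAt_fst
    (hs hX x) (hs hZ x) (smoothFieldAt_zero x.1) (smoothFieldAt_zero x.1)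
    (.of_forall fun q => mfderiv_fst_prodVec q _ _)
    (.of_forall fun q => mfderiv_fst_prodVec q _ _)
  rw [h2]
  simp

omit h in
lemma mlieBracket_smul_vertical {X : ∀ m : M, TangentSpace IM m} {U : ∀ b : S, TangentSpace IS b}
    (hX : SmoothField X) (hU : SmoothField U) {c : S → ℝ} (hc : ContMDiff IS 𝓘(ℝ, ℝ) ∞ c)
    (x : M × S) :
    mlieBracket (IM.prod IS) (fun x : M × S => prodVec x 0 (U x.2))
      ((fun x : M × S => c x.2) • fun x : M × S => prodVec x (X x.1) 0) x =
        vderiv IS c x.2 (U x.2) • prodVec x (X x.1) 0 := by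
  have hzM : SmoothField (0 : ∀ m : M, TangentSpace IM m) := fun p => smoothFieldAt_zero p
  have hzS : SmoothField (0 : ∀ b : S, TangentSpace IS b) := fun p => smoothFieldAt_zero p
  have h1 := mlieBracket_prodVec hzM hU hX hzS x
  have h2 : mlieBracket (IM.prod IS) (fun x : M × S => prodVec x 0 (U x.2))
      (fun x : M × S => prodVec x (X x.1) 0) x = 0 := by
    refine h1.trans ?_
    simp only [VectorField.mlieBracket_zero_left, VectorField.mlieBracket_zero_right, Pi.zero_apply]
    rfl
  have h3 : vderiv (IM.prod IS) (fun x : M × S => c x.2) x (prodVec x 0 (U x.2)) =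
      vderiv IS c x.2 (U x.2) :=
    (vderiv_comp_map ((hc x.2).mdifferentiableAt (by simp)) mdifferentiableAt_snd _).trans
      (congrArg (vderiv IS c x.2) (mfderiv_snd_prodVec x _ _))
  refine (VectorField.mlieBracket_smul_right (f := fun x : M × S => c x.2)
    (W := fun x : M × S => prodVec x (X x.1) 0)
    (((hc.comp contMDiff_snd) x).mdifferentiableAt (by simp))
    ((smoothField_prodVec hX hzS).smoothFieldAt x).mdifferentiableAt).trans ?_
  rw [h2, smul_zero, add_zero, ← h3]
  rfl

lemma covariantD_eq_zero {U W : ∀ b : S, TangentSpace IS b} (hU : SmoothField U)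
    (hW : SmoothField W) (x : M × S) :
    covariantD (IM.prod IS) IS Prod.snd (cokernel (productForm β 0 0 Θ₁ Θ₂))
      (cokernel (productForm β f g Θ₁ Θ₂)) U W x = 0 := by
  have hlift : ∀ U : ∀ b : S, TangentSpace IS b, liftField (IM.prod IS) IS Prod.snd
      (cokernel (productForm β 0 0 Θ₁ Θ₂)) U = fun x : M × S => prodVec x 0 (U x.2) := fun U =>
    funext fun x => h.horizontalLift_zero x _
  let X₁ : ∀ m : M, TangentSpace IM m := fun m => (-1 : ℝ) • h.form.ham f m
  let X₂ : ∀ m : M, TangentSpace IM m := h.form.ham g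
  have hX₂ : SmoothField X₂ := h.form.smooth_ham h.smooth_snd
  have hX₁ : SmoothField X₁ := fun m =>
    SmoothFieldAt.smul contMDiffAt_const (h.form.smooth_ham h.smooth_fst m)
  have hpot : ∀ U : ∀ b : S, TangentSpace IS b, potentialField (IM.prod IS) IS Prod.snd
      (cokernel (productForm β 0 0 Θ₁ Θ₂)) (cokernel (productForm β f g Θ₁ Θ₂)) U =
        ((fun x : M × S => Θ₂ x.2 (U x.2)) • fun x : M × S => prodVec x (X₂ x.1) 0) +
        ((fun x : M × S => Θ₁ x.2 (U x.2)) • fun x : M × S => prodVec x (X₁ x.1) 0) :=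
    fun U => funext fun x => by
      refine (h.potential_eq x _).trans ?_
      change _ = Θ₂ x.2 (U x.2) • prodVec x (X₂ x.1) 0 + Θ₁ x.2 (U x.2) • prodVec x (X₁ x.1) 0
      refine prodVec_ext ?_ ?_
      · rw [map_add, map_smul, map_smul, mfderiv_fst_prodVec, mfderiv_fst_prodVec,
          mfderiv_fst_prodVec, IsContactForm.liftComponent, smul_comm, neg_one_smul, sub_eq_add_neg]
      · rw [map_add, map_smul, map_smul, mfderiv_snd_prodVec, mfderiv_snd_prodVec,
          mfderiv_snd_prodVec, smul_zero, smul_zero, add_zero]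
  have hc : ∀ {Θ : OneForm IS S} {U : ∀ b : S, TangentSpace IS b}, SmoothForm Θ → SmoothField U →
      ContMDiff IS 𝓘(ℝ, ℝ) ∞ (fun b => Θ b (U b)) := fun hΘ hU b => hΘ.smoothMapAt b _ (hU b)
  have hs : ∀ {Θ : OneForm IS S} {U : ∀ b : S, TangentSpace IS b} {X : ∀ m : M, TangentSpace IM m},
      SmoothForm Θ → SmoothField U → SmoothField X →
      SmoothFieldAt ((fun x : M × S => Θ x.2 (U x.2)) • fun x : M × S => prodVec x (X x.1) 0) x :=
    fun hΘ hU hX => SmoothFieldAt.smul (((hc hΘ hU).comp contMDiff_snd) x)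
      (smoothField_prodVec hX (fun p => smoothFieldAt_zero p) x)
  have hbr : ∀ {U W : ∀ b : S, TangentSpace IS b}, SmoothField U → SmoothField W →
      mlieBracket (IM.prod IS) (liftField (IM.prod IS) IS Prod.snd
        (cokernel (productForm β 0 0 Θ₁ Θ₂)) U) (potentialField (IM.prod IS) IS Prod.snd
        (cokernel (productForm β 0 0 Θ₁ Θ₂)) (cokernel (productForm β f g Θ₁ Θ₂)) W) x =
      vderiv IS (fun b => Θ₂ b (W b)) x.2 (U x.2) • prodVec x (X₂ x.1) 0 +
        vderiv IS (fun b => Θ₁ b (W b)) x.2 (U x.2) • prodVec x (X₁ x.1) 0 := fun {U W} hU hW => by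
    rw [hlift, hpot, VectorField.mlieBracket_add_right
      (hs h.smooth_right hW hX₂).mdifferentiableAt (hs h.smooth_left hW hX₁).mdifferentiableAt,
      mlieBracket_smul_vertical hX₂ hU (hc h.smooth_right hW),
      mlieBracket_smul_vertical hX₁ hU (hc h.smooth_left hW)]
  have e₁ := h.smooth_left.extD_eq_lieBracket (hU x.2) (hW x.2)
  have e₂ := h.smooth_right.extD_eq_lieBracket (hU x.2) (hW x.2)
  rw [h.closed_left] at e₁
  rw [h.closed_right] at e₂
  have e₃ : potentialField (IM.prod IS) IS Prod.snd (cokernel (productForm β 0 0 Θ₁ Θ₂))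
      (cokernel (productForm β f g Θ₁ Θ₂)) (mlieBracket IS U W) x =
        Θ₂ x.2 (mlieBracket IS U W x.2) • prodVec x (X₂ x.1) 0 +
        Θ₁ x.2 (mlieBracket IS U W x.2) • prodVec x (X₁ x.1) 0 := by
    rw [hpot]; rfl
  rw [covariantD, hbr hU hW, hbr hW hU, e₃, add_sub_add_comm, add_sub_add_comm, ← sub_smul,
    ← sub_smul, ← sub_smul, ← sub_smul, ← e₁, ← e₂, zero_smul, zero_smul, add_zero]

/-- The curvature of `β + f Θ₁ - g Θ₂` is a multiple of the contact bracket of `f` and `g`. -/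
lemma extD_horizontal (x : M × S) (u u' : TangentSpace IS x.2) :
    extD (productForm β f g Θ₁ Θ₂) x (prodVec x (h.form.liftComponent f g Θ₁ Θ₂ x u) u)
      (prodVec x (h.form.liftComponent f g Θ₁ Θ₂ x u') u') =
      (Θ₁ x.2 u * Θ₂ x.2 u' - Θ₁ x.2 u' * Θ₂ x.2 u) * (vderiv IM g x.1 (h.form.ham f x.1)
        - g x.1 * vderiv IM f x.1 (h.form.reeb x.1)) := by
  have h1 := h.form.extD_ham f x.1 (h.form.ham g x.1)
  have h2 := extD_swap β x.1 (h.form.ham g x.1) (h.form.ham f x.1)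
  rw [h.form.apply_ham] at h1
  rw [h.extD_apply, ← extDL_apply β]
  simp only [IsContactForm.liftComponent, map_sub, map_smul, LinearMap.sub_apply,
    LinearMap.smul_apply, smul_eq_mul, extDL_apply, extD_self, h1, h2]
  ring

/-- The kernel of `β + f Θ₁ - g Θ₂` is a positive contact structure if the contact bracket of `f`
and `g` is positive. -/
lemma isPositiveContact {o : ∀ b : S, TangentSpace IS b → TangentSpace IS b → Prop}
    (ho : ∀ b u v, o b u v → 0 < Θ₁ b u * Θ₂ b v - Θ₁ b v * Θ₂ b u)
    (hD : ∀ p, 0 < vderiv IM g p (h.form.ham f p) - g p * vderiv IM f p (h.form.reeb p)) :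
    IsPositiveContact (IM.prod IS) IS k Prod.snd o (cokernel (productForm β f g Θ₁ Θ₂)) := by
  have hF := h.isFibredContactForm
  refine ⟨productForm β f g Θ₁ Θ₂, hF.defines, fun x z₁ z₂ w hw hv hz => ?_⟩
  set α := productForm β f g Θ₁ Θ₂
  obtain ⟨v₁, u₁, rfl⟩ := exists_prodVec x z₁
  obtain ⟨v₂, u₂, rfl⟩ := exists_prodVec x z₂
  rw [mfderiv_snd_prodVec, mfderiv_snd_prodVec] at hz
  have hspan : ∀ z, IsVertical (IM.prod IS) IS Prod.snd x z → z ∈ span ℝ (range w) := by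
    obtain ⟨w', hw', hv', hs'⟩ := hF.exists_vertical_frame x
    have h1 : span ℝ (range w) = span ℝ (range w') := by
      have : FiniteDimensional ℝ (TangentSpace (IM.prod IS) x) :=
        inferInstanceAs (FiniteDimensional ℝ (EM × ES))
      refine Submodule.eq_of_le_of_finrank_eq (Submodule.span_le.2 ?_)
        ((finrank_span_eq_card hw).trans (finrank_span_eq_card hw').symm)
      rintro _ ⟨i, rfl⟩
      exact hs' _ (hv i)
    exact fun z hz => h1 ▸ hs' z hz
  have hdec : ∀ v u, prodVec x v u = prodVec x (h.form.liftComponent f g Θ₁ Θ₂ x u) u +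
      prodVec x (v - h.form.liftComponent f g Θ₁ Θ₂ x u) 0 := fun v u => by
    refine prodVec_ext ?_ ?_
    · rw [map_add, mfderiv_fst_prodVec, mfderiv_fst_prodVec, mfderiv_fst_prodVec, add_sub_cancel]
    · rw [map_add, mfderiv_snd_prodVec, mfderiv_snd_prodVec, mfderiv_snd_prodVec, add_zero]
  have hh₁ := h.isHorizontalFor x u₁
  have hh₂ := h.isHorizontalFor x u₂
  set y₁ := prodVec x (h.form.liftComponent f g Θ₁ Θ₂ x u₁) u₁
  set y₂ := prodVec x (h.form.liftComponent f g Θ₁ Θ₂ x u₂) u₂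
  have h1 := alternating_cons₂_change
    (topAlt (k + 1) (α x : TangentSpace (IM.prod IS) x →ₗ[ℝ] ℝ) (extDL α x)) (x := y₁) (y := y₂)
    (p := 1) (q := 0) (r := 0) (t := 1)
    (hspan _ (isVertical_prodVec (v := v₁ - h.form.liftComponent f g Θ₁ Θ₂ x u₁).2 rfl))
    (hspan _ (isVertical_prodVec (v := v₂ - h.form.liftComponent f g Θ₁ Θ₂ x u₂).2 rfl))
    ((hdec v₁ u₁).trans (by rw [one_smul, zero_smul, add_zero]))
    ((hdec v₂ u₂).trans (by rw [one_smul, zero_smul, zero_add]))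
  have h2 : topForm (k + 1) (α x) (extD α x) (cons₂ (prodVec x v₁ u₁) (prodVec x v₂ u₂) w) =
      topForm (k + 1) (α x) (extD α x) (cons₂ y₁ y₂ w) := by
    rw [topAlt_apply, topAlt_apply, mul_one, zero_mul, sub_zero, one_mul] at h1
    exact h1
  have hv' := fun y hy => hF.isVertical_of_mem_span hv (z := y) hy
  have h3 : topForm (k + 1) (α x) (extD α x) (cons₂ y₁ y₂ w) =
      2 * (k + 1) * (extD α x y₁ y₂ * topForm k (α x) (extD α x) w) :=
    topForm_cons₂_span (a := (α x : TangentSpace (IM.prod IS) x →ₗ[ℝ] ℝ)) (Ω := extDL α x)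
      (extDL_swap α x) hw hh₁.1 hh₂.1 (fun y hy hy0 => hh₁.2 y (hv' y hy) hy0)
  have h4 : 0 < extD α x y₁ y₂ := by
    rw [h.extD_horizontal]
    exact mul_pos (ho _ _ _ hz) (hD x.1)
  have h5 := pow_two_pos_of_ne_zero (hF.nondeg x w hw hv)
  rw [h2, h3, show topForm k (α x) (extD α x) w * (2 * (k + 1) * (extD α x y₁ y₂ *
    topForm k (α x) (extD α x) w)) = 2 * (k + 1) * (extD α x y₁ y₂ *
    topForm k (α x) (extD α x) w ^ 2) by ring]
  positivity

/-- Products of a contact manifold and a surface carry Bourgeois contact structures. -/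
theorem isBourgeois {o : ∀ b : S, TangentSpace IS b → TangentSpace IS b → Prop}
    (hor : IsOrientation o) (ho : ∀ b u v, o b u v → 0 < Θ₁ b u * Θ₂ b v - Θ₁ b v * Θ₂ b u)
    (hD : ∀ p, 0 < vderiv IM g p (h.form.ham f p) - g p * vderiv IM f p (h.form.reeb p)) :
    IsBourgeois (IM.prod IS) IS IM k Prod.snd M o (cokernel (productForm β 0 0 Θ₁ Θ₂))
      (cokernel (productForm β f g Θ₁ Θ₂)) where
  orientation := hor
  flat_bundle :=
    { bundle := isSmoothFibreBundle_snd
      contact := ⟨_, h.zero.isFibredContactForm.defines, h.zero.isFibredContactForm.nondeg⟩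
      flat := fun _ _ hX hZ x => h.curvature_zero hX hZ x }
  contact_bundle := ⟨_, h.isFibredContactForm.defines, h.isFibredContactForm.nondeg⟩
  same_fibres x w hw := by
    obtain ⟨v, u, rfl⟩ := exists_prodVec x w
    obtain rfl := isVertical_prodVec.1 hw
    simp only [cokernel, mem_ofPred_eq, productForm_prodVec, map_zero, mul_zero]
  contact := h.isPositiveContact ho hD
  closed _ _ hU hW x := h.covariantD_eq_zero hU hW x

end IsProductData

end Products

section Torus

variable {EM : Type*} [NormedAddCommGroup EM] [NormedSpace ℝ EM] [FiniteDimensional ℝ EM]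
  {HM : Type*} [TopologicalSpace HM] {IM : ModelWithCorners ℝ EM HM} [IM.Boundaryless]
  {M : Type*} [TopologicalSpace M] [ChartedSpace HM M] [IsManifold IM ∞ M]
  {k : ℕ} {β : OneForm IM M}

/-- The coordinate form of a map from the torus to the circle. -/
abbrev torusForm (f : Torus → Circle) : OneForm torusModel Torus := angularForm torusModel f

lemma contMDiff_coe_fst : ContMDiff torusModel 𝓘(ℝ, ℂ) ∞ (fun y : Torus => (y.1 : ℂ)) :=
  contMDiff_circle_coe.comp contMDiff_fst

lemma contMDiff_coe_snd : ContMDiff torusModel 𝓘(ℝ, ℂ) ∞ (fun y : Torus => (y.2 : ℂ)) :=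
  contMDiff_circle_coe.comp contMDiff_snd

lemma exists_circle_tangent (z : Circle) : ∃ w : TangentSpace (𝓡 1) z,
    (conj (z : ℂ) * vderiv (𝓡 1) (fun z : Circle => (z : ℂ)) z w).im = 1 := by
  obtain ⟨t, rfl⟩ : ∃ t, Circle.exp t = z := ⟨_, Circle.exp_arg z⟩
  have hsm : MDifferentiableAt 𝓘(ℝ, ℝ) (𝓡 1) Circle.exp t :=
    (contMDiff_circleExp t).mdifferentiableAt (n := ∞) (by simp)
  refine ⟨mfderiv 𝓘(ℝ, ℝ) (𝓡 1) Circle.exp t (1 : ℝ), ?_⟩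
  have h0 := vderiv_comp_map ((contMDiff_circle_coe (Circle.exp t)).mdifferentiableAt (by simp))
    hsm (1 : ℝ)
  have h1 : HasDerivAt (fun t : ℝ => ((Circle.exp t : Circle) : ℂ))
      (Complex.exp (t * Complex.I) * Complex.I) t := by
    have h2 : HasDerivAt (fun t : ℝ => (t : ℂ) * Complex.I) Complex.I t := by
      simpa using (Complex.ofRealCLM.hasDerivAt (x := t)).mul_const Complex.I
    simpa only [Circle.coe_exp] using h2.cexp
  have h3 : vderiv 𝓘(ℝ, ℝ) (fun t : ℝ => ((Circle.exp t : Circle) : ℂ)) t (1 : ℝ) =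
      Complex.exp (t * Complex.I) * Complex.I := by
    rw [vderiv, mfderiv_eq_fderiv, h1.hasFDerivAt.fderiv]
    exact one_smul ℝ _
  refine (congrArg (fun z : ℂ => (conj ((Circle.exp t : Circle) : ℂ) * z).im)
    (h0.symm.trans h3)).trans ?_
  rw [Circle.coe_exp, ← mul_assoc, ← Complex.normSq_eq_conj_mul_self,
    Complex.normSq_eq_norm_sq, Complex.norm_exp_ofReal_mul_I]
  simp

/-- The coordinate forms are a coframe of the torus. -/
lemma exists_torus_vector (b : Torus) (r s : ℝ) : ∃ u : TangentSpace torusModel b,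
    torusForm (fun y => y.1) b u = r ∧ torusForm (fun y => y.2) b u = s := by
  obtain ⟨w₁, hw₁⟩ := exists_circle_tangent b.1
  obtain ⟨w₂, hw₂⟩ := exists_circle_tangent b.2
  refine ⟨prodVec b (r • w₁) (s • w₂), ?_, ?_⟩
  · rw [angularForm_apply, vderiv_comp_map ((contMDiff_circle_coe _).mdifferentiableAt (by simp))
      (f := (Prod.fst : Torus → Circle)) mdifferentiableAt_fst, mfderiv_fst_prodVec, map_smul,
      mul_smul_comm, Complex.smul_im, hw₁, smul_eq_mul, mul_one]
  · rw [angularForm_apply, vderiv_comp_map ((contMDiff_circle_coe _).mdifferentiableAt (by simp))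
      (f := (Prod.snd : Torus → Circle)) mdifferentiableAt_snd, mfderiv_snd_prodVec, map_smul,
      mul_smul_comm, Complex.smul_im, hw₂, smul_eq_mul, mul_one]

lemma isOrientation_torus : IsOrientation torusOrientation := by
  let Θ₁ := torusForm fun y => y.1
  let Θ₂ := torusForm fun y => y.2
  have h₁ : SmoothForm Θ₁ := smoothForm_angularForm contMDiff_coe_fst
  have h₂ : SmoothForm Θ₂ := smoothForm_angularForm contMDiff_coe_snd
  have hμ : ∀ b u v, ((Θ₁ b).smulRight (Θ₂ b) - (Θ₂ b).smulRight (Θ₁ b)) u v =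
      Θ₁ b u * Θ₂ b v - Θ₁ b v * Θ₂ b u := fun b u v => by
    change Θ₁ b u * Θ₂ b v - Θ₂ b u * Θ₁ b v = _
    ring
  refine ⟨fun b => (Θ₁ b).smulRight (Θ₂ b) - (Θ₂ b).smulRight (Θ₁ b), fun U W hU hW => ?_,
    fun b u => ?_, fun b h0 => ?_, fun b u v => ?_⟩
  · simp only [hμ]
    have hs : ∀ {Θ : OneForm torusModel Torus} {U : ∀ b : Torus, TangentSpace torusModel b},
      SmoothForm Θ → SmoothField U → ContMDiff torusModel 𝓘(ℝ, ℝ) ∞ (fun b => Θ b (U b)) :=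
      fun hΘ hU b => hΘ.smoothMapAt b _ (hU b)
    exact ((hs h₁ hU).mul (hs h₂ hW)).sub ((hs h₁ hW).mul (hs h₂ hU))
  · rw [hμ, sub_self]
  · obtain ⟨u, (hu₁ : Θ₁ b u = 1), (hu₂ : Θ₂ b u = 0)⟩ := exists_torus_vector b 1 0
    obtain ⟨v, (hv₁ : Θ₁ b v = 0), (hv₂ : Θ₂ b v = 1)⟩ := exists_torus_vector b 0 1
    have h3 : Θ₁ b u * Θ₂ b v - Θ₁ b v * Θ₂ b u = 0 :=
      (hμ b u v).symm.trans (congrArg (fun L : TangentSpace torusModel b →L[ℝ] TangentSpace torusModel b →L[ℝ] ℝ => L u v) h0)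
    rw [hu₁, hu₂, hv₁, hv₂] at h3
    norm_num at h3
  · rw [hμ]; rfl

lemma isProductData_torus {f g : M → ℝ} (h : IsContactForm k β) (hf : ContMDiff IM 𝓘(ℝ, ℝ) ∞ f)
    (hg : ContMDiff IM 𝓘(ℝ, ℝ) ∞ g) :
    IsProductData k β f g (torusForm fun y => y.1) (torusForm fun y => y.2) where
  form := h
  dim_base := by simp
  smooth_fst := hf
  smooth_snd := hg
  smooth_left := smoothForm_angularForm contMDiff_coe_fst
  smooth_right := smoothForm_angularForm contMDiff_coe_snd
  closed_left := extD_angularForm contMDiff_coe_fst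
  closed_right := extD_angularForm contMDiff_coe_snd

lemma bourgeoisForm_eq (Φ : M → ℂ) : bourgeoisForm IM β Φ =
    productForm β (fun m => (Φ m).re) (fun m => (Φ m).im) (torusForm fun y => y.1)
      (torusForm fun y => y.2) := by
  have hp : ∀ {f : Torus → Circle}, ContMDiff torusModel 𝓘(ℝ, ℂ) ∞ (fun y => (f y : ℂ)) →
      ∀ (x : M × Torus) w, angularForm (IM.prod torusModel) (fun y : M × Torus => f y.2) x w =
        pullbackForm (IM.prod torusModel) Prod.snd (torusForm f) x w := fun {f} hf x w => by
    rw [angularForm_apply, vderiv_comp_map (h := fun y => (f y : ℂ))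
      ((hf _).mdifferentiableAt (by simp)) mdifferentiableAt_snd]
    rfl
  funext x
  refine ContinuousLinearMap.ext fun w => ?_
  change pullbackForm (IM.prod torusModel) Prod.fst β x w
    + (Φ x.1).re * angularForm (IM.prod torusModel) (fun y : M × Torus => y.2.1) x w
    - (Φ x.1).im * angularForm (IM.prod torusModel) (fun y : M × Torus => y.2.2) x w =
    pullbackForm (IM.prod torusModel) Prod.fst β x w +
    ((Φ x.1).re * pullbackForm (IM.prod torusModel) Prod.snd (torusForm fun y => y.1) x w +
    -(Φ x.1).im * pullbackForm (IM.prod torusModel) Prod.snd (torusForm fun y => y.2) x w)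
  rw [hp (f := fun y => y.1) contMDiff_coe_fst, hp (f := fun y => y.2) contMDiff_coe_snd]
  ring

lemma productField_eq : productField IM (cokernel β) =
    cokernel (productForm β 0 0 (torusForm fun y => y.1) (torusForm fun y => y.2)) := by
  funext x
  ext w
  obtain ⟨v, u, rfl⟩ := exists_prodVec x w
  simp only [productField, pullbackField, cokernel, mem_ofPred_eq, productForm_prodVec,
    mfderiv_fst_prodVec, Pi.zero_apply, zero_mul, add_zero, sub_zero]

lemma mfderiv_slice (b : Torus) (m : M) (v : TangentSpace IM m) :
    mfderiv IM (IM.prod torusModel) (fun m => (slice b m : M × Torus)) m v = prodVec (m, b) v 0 :=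
  DFunLike.congr_fun (mfderiv_prod_left (I := IM) (I' := torusModel) (x₀ := m) (y₀ := b)) v

lemma isFibreDiffeo_slice (b : Torus) :
    IsFibreDiffeo (IM.prod torusModel) IM (slice (M := M) b) := by
  refine ⟨contMDiff_id.prodMk contMDiff_const, fun m v v' hv => ?_⟩
  rw [mfderiv_slice, mfderiv_slice] at hv
  have h1 := congrArg (mfderiv (IM.prod torusModel) IM Prod.fst (m, b)) hv
  rwa [mfderiv_fst_prodVec, mfderiv_fst_prodVec] at h1

lemma pullbackField_slice (f g : M → ℝ) (Θ₁ Θ₂ : OneForm torusModel Torus) (b : Torus) :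
    pullbackField IM (fun m => (slice b m : M × Torus)) (cokernel (productForm β f g Θ₁ Θ₂)) =
      cokernel β := by
  funext m
  ext v
  have h1 : productForm β f g Θ₁ Θ₂ (m, b) (prodVec (m, b) v 0) = β m v := by
    rw [productForm_prodVec, map_zero, map_zero, mul_zero, mul_zero, add_zero, sub_zero]
  have h2 : v ∈ pullbackField IM (fun m => (slice b m : M × Torus))
      (cokernel (productForm β f g Θ₁ Θ₂)) m ↔ 0 < productForm β f g Θ₁ Θ₂ (m, b)
        (mfderiv IM (IM.prod torusModel) (fun m => (slice b m : M × Torus)) m v) := Iff.rfl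
  rw [h2, mfderiv_slice, h1]
  rfl

/-- Two identifications of `M` with a fibre of `M × 𝕋²` differ by a diffeomorphism. -/
lemma exists_diffeomorph_slice [T2Space M] [CompactSpace M] {b : Torus}
    {j : M ≃ Fibre (Prod.snd : M × Torus → Torus) b}
    (hj : IsFibreDiffeo (IM.prod torusModel) IM j) :
    ∃ ψ : M ≃ₘ^∞⟮IM, IM⟯ M, ∀ m, slice b (ψ m) = j m := by
  let e : M ≃ M := j.trans (slice b).symm
  have hsm : ContMDiff IM IM ∞ e := contMDiff_fst.comp hj.1
  let ψ : M ≃ₜ M := hsm.continuous.homeoOfEquivCompactToT2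
  have hinj : ∀ m, Function.Injective (mfderiv IM IM ψ m) := fun m v v' hv => by
    refine hj.2 m (prodVec_ext ?_ ?_)
    · have h1 : ∀ v, mfderiv IM IM ψ m v = mfderiv (IM.prod torusModel) IM Prod.fst (j m : M × Torus)
          (mfderiv IM (IM.prod torusModel) (fun m => (j m : M × Torus)) m v) := fun v =>
        congrArg (fun L : EM →L[ℝ] EM => L v) (mfderiv_comp (I := IM) (I' := IM.prod torusModel)
          (I'' := IM) (g := Prod.fst) (f := fun m => (j m : M × Torus)) m mdifferentiableAt_fst
          ((hj.1 m).mdifferentiableAt (by simp)))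
      rw [← h1, ← h1, hv]
    · have h1 : ∀ v, mfderiv (IM.prod torusModel) torusModel Prod.snd (j m : M × Torus)
          (mfderiv IM (IM.prod torusModel) (fun m => (j m : M × Torus)) m v) = 0 := fun v => by
        have h2 := mfderiv_comp (I := IM) (I' := IM.prod torusModel)
          (I'' := torusModel) (g := Prod.snd) (f := fun m => (j m : M × Torus)) m
          mdifferentiableAt_snd ((hj.1 m).mdifferentiableAt (by simp))
        have h3 : (Prod.snd ∘ fun m => (j m : M × Torus)) = fun _ => b := funext fun m => (j m).2
        rw [h3, mfderiv_const] at h2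
        exact (congrArg (fun L : EM →L[ℝ] _ => L v) h2).symm
      rw [h1, h1]
  refine ⟨⟨e, hsm, contMDiff_symm_of_injective_mfderiv ψ hsm hinj⟩, fun m => ?_⟩
  exact (slice b).apply_symm_apply (j m)

variable {Φ : M → ℂ} {B : OpenBook M}

/-- In the product, the frame `(-∂₁, -∂₂)` gives back the open book of the construction. -/
lemma same_frameOpenBook (h : IsContactForm k β) (hΦ : IsDefinedBy IM B Φ) {b : Torus}
    {u v : TangentSpace torusModel b} (hu₁ : torusForm (fun y => y.1) b u = -1)
    (hu₂ : torusForm (fun y => y.2) b u = 0) (hv₁ : torusForm (fun y => y.1) b v = 0)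
    (hv₂ : torusForm (fun y => y.2) b v = -1) :
    ((frameOpenBook (IM.prod torusModel) torusModel (Prod.snd : M × Torus → Torus)
      (productField IM (cokernel β)) (cokernel (bourgeoisForm IM β Φ)) b u v).pullback
        (slice b)).Same B := by
  have hD := isProductData_torus h (contMDiff_re hΦ.1) (contMDiff_im hΦ.1)
  have hdef := hD.isFibredContactForm.defines
  rw [bourgeoisForm_eq, productField_eq]
  set α := productForm β (fun m => (Φ m).re) (fun m => (Φ m).im) (torusForm fun y => y.1)
    (torusForm fun y => y.2)
  obtain ⟨c, -, hc, hγ⟩ := exists_factor_of_defines hdef (definingForm_defines ⟨α, hdef⟩)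
  have hF : ∀ m, frameFunction (IM.prod torusModel) torusModel (Prod.snd : M × Torus → Torus)
      (cokernel (productForm β 0 0 (torusForm fun y => y.1) (torusForm fun y => y.2)))
      (cokernel α) b u v (slice b m) = c (m, b) * Φ m := fun m => by
    have h1 := hD.productForm_potential (m, b) u
    have h2 := hD.productForm_potential (m, b) v
    have h3 : ∀ w, definingForm (IM.prod torusModel) (cokernel α) (m, b) w =
        c (m, b) * α (m, b) w := fun w => by rw [hγ]; rfl
    have h4 : frameFunction (IM.prod torusModel) torusModel (Prod.snd : M × Torus → Torus)
      (cokernel (productForm β 0 0 (torusForm fun y => y.1) (torusForm fun y => y.2)))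
      (cokernel α) b u v (slice b m) =
      ⟨c (m, b) * (torusForm (fun y => y.2) b u * (Φ m).im - torusForm (fun y => y.1) b u *
        (Φ m).re), -(c (m, b) * (torusForm (fun y => y.2) b v * (Φ m).im -
        torusForm (fun y => y.1) b v * (Φ m).re))⟩ :=
      Complex.ext ((h3 _).trans (congrArg _ h1)) (congrArg Neg.neg ((h3 _).trans (congrArg _ h2)))
    rw [h4, hu₁, hu₂, hv₁, hv₂]
    refine Complex.ext ?_ ?_
    · rw [Complex.re_ofReal_mul]; ring
    · rw [Complex.im_ofReal_mul]; ring
  refine ⟨?_, fun m hm => ?_⟩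
  · rw [hΦ.2.2.1]
    ext m
    change frameFunction _ _ _ _ _ _ _ _ (slice b m) = 0 ↔ Φ m = 0
    rw [hF, mul_eq_zero, Complex.ofReal_eq_zero, or_iff_right (hc _).ne']
  · have h0 : Φ m ≠ 0 := fun h0 => hm (by
      change frameFunction _ _ _ _ _ _ _ _ (slice b m) = 0
      rw [hF, h0, mul_zero])
    have h1 : Φ m = ‖Φ m‖ * (Circle.exp (Complex.arg (Φ m)) : ℂ) := by
      rw [Circle.coe_exp, Complex.norm_mul_exp_arg_mul_I]
    change Circle.exp (Complex.arg (frameFunction _ _ _ _ _ _ _ _ (slice b m))) = _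
    rw [hF, Complex.arg_real_mul _ (hc _), (hΦ.map_eq (norm_pos_iff.2 h0) h1).2]

/-- The contact form of a supported contact structure. -/
lemma isContactForm_of_defines {ξ : HyperplaneField IM M} (hdim : finrank ℝ EM = 2 * k + 1)
    (hξ : IsContact k ξ) (hβ : Defines β ξ) : IsContactForm k β := by
  obtain ⟨γ, hγ, hn⟩ := hξ
  obtain ⟨c, hc, hpos, rfl⟩ := exists_factor_of_defines hγ hβ
  exact IsContactForm.rescale ⟨hdim, hγ.1, hn⟩ hc hpos

/-- The original construction on `M × 𝕋²`. -/
theorem isBourgeois_bourgeoisForm (h : IsContactForm k β) (hΦ : IsDefinedBy IM B Φ)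
    (hp : PagesPositive k B β) (hb : BindingPositive k Φ β) (hw : WedgeNonneg k Φ β) :
    IsBourgeois (IM.prod torusModel) torusModel IM k (Prod.snd : M × Torus → Torus) M
      torusOrientation (productField IM (cokernel β)) (cokernel (bourgeoisForm IM β Φ)) := by
  rw [bourgeoisForm_eq, productField_eq]
  exact (isProductData_torus h (contMDiff_re hΦ.1) (contMDiff_im hΦ.1)).isBourgeois
    isOrientation_torus (fun _ _ _ ho => ho) (h.bracket_pos hΦ hp hb hw)

theorem mem_isotopyClass_bourgeoisForm [T2Space M] [CompactSpace M] (h : IsContactForm k β)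
    (hΦ : IsDefinedBy IM B Φ) (hB : IsBourgeois (IM.prod torusModel) torusModel IM k
      (Prod.snd : M × Torus → Torus) M torusOrientation (productField IM (cokernel β))
      (cokernel (bourgeoisForm IM β Φ))) (b : Torus)
    (B' : OpenBook (Fibre (Prod.snd : M × Torus → Torus) b)) :
    B' ∈ isotopyClass (IM.prod torusModel) torusModel IM k (Prod.snd : M × Torus → Torus) M
      torusOrientation (productField IM (cokernel β)) (cokernel (bourgeoisForm IM β Φ)) b ↔
      IsIsotopic k (cokernel β) B (B'.pullback (slice b)) := by
  have hD := isProductData_torus h (contMDiff_re hΦ.1) (contMDiff_im hΦ.1)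
  obtain ⟨u, hu₁, hu₂⟩ := exists_torus_vector b (-1) 0
  obtain ⟨v, hv₁, hv₂⟩ := exists_torus_vector b 0 (-1)
  have ho : torusOrientation b u v := by
    change 0 < torusForm (fun y => y.1) b u * torusForm (fun y => y.2) b v -
      torusForm (fun y => y.1) b v * torusForm (fun y => y.2) b u
    rw [hu₁, hu₂, hv₁, hv₂]
    norm_num
  have hs := same_frameOpenBook h hΦ hu₁ hu₂ hv₁ hv₂
  have hpull : pullbackField IM (fun m => (slice b m : M × Torus))
      (cokernel (bourgeoisForm IM β Φ)) = cokernel β := by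
    rw [bourgeoisForm_eq, pullbackField_slice]
  rw [hB.mem_isotopyClass h.dim hD.isFibredContactForm.dim_total hD.dim_base ho]
  refine ⟨fun hiso => ?_, fun hiso j hj => ?_⟩
  · have h1 := hiso (slice b) (isFibreDiffeo_slice b)
    rw [hpull] at h1
    exact h1.congr_left hs
  · obtain ⟨ψ, hψ⟩ := exists_diffeomorph_slice hj
    have h1 := (hiso.congr_left hs.symm).pullback (ψ := ψ)
    have h2 : (fun m => (slice b m : M × Torus)) ∘ ψ = fun m => (j m : M × Torus) :=
      funext fun m => congrArg Subtype.val (hψ m)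
    have h4 : ∀ B' : OpenBook (Fibre (Prod.snd : M × Torus → Torus) b),
        (B'.pullback (slice b)).pullback ψ = B'.pullback j := fun B' =>
      congrArg B'.pullback (funext hψ)
    have h5 : pullbackField IM ψ (cokernel β) =
        pullbackField IM (fun m => (j m : M × Torus)) (cokernel (bourgeoisForm IM β Φ)) := by
      rw [← h2, ← pullbackField_comp _ (isFibreDiffeo_slice b).1 ψ.contMDiff, hpull]
    rwa [h5, h4, h4] at h1

end Torus

end ContactBundle

end

theorem mainTheorem8
    -- the closed model fibre `M`, of dimension `2k+1`
    (k : ℕ)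
    {EM : Type*} [NormedAddCommGroup EM] [NormedSpace ℝ EM] [FiniteDimensional ℝ EM]
    (hEM : Module.finrank ℝ EM = 2 * k + 1)
    {HM : Type*} [TopologicalSpace HM] (IM : ModelWithCorners ℝ EM HM) [IM.Boundaryless]
    (M : Type*) [TopologicalSpace M] [ChartedSpace HM M] [IsManifold IM ∞ M]
    [T2Space M] [CompactSpace M] :
    -- Bourgeois contact structures on flat contact bundles
    (∀
      -- the closed total space `V`, of dimension `2k+3`
      {EV : Type*} [NormedAddCommGroup EV] [NormedSpace ℝ EV] [FiniteDimensional ℝ EV]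
      (hEV : Module.finrank ℝ EV = 2 * k + 3)
      {HV : Type*} [TopologicalSpace HV] (IV : ModelWithCorners ℝ EV HV) [IV.Boundaryless]
      (V : Type*) [TopologicalSpace V] [ChartedSpace HV V] [IsManifold IV ∞ V]
      [T2Space V] [CompactSpace V]
      -- the closed surface `S`
      {ES : Type*} [NormedAddCommGroup ES] [NormedSpace ℝ ES] [FiniteDimensional ℝ ES]
      (hES : Module.finrank ℝ ES = 2)
      {HS : Type*} [TopologicalSpace HS] (IS : ModelWithCorners ℝ ES HS) [IS.Boundaryless]
      (S : Type*) [TopologicalSpace S] [ChartedSpace HS S] [IsManifold IS ∞ S]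
      [T2Space S] [CompactSpace S]
      (π : V → S) (o : ∀ x : S, TangentSpace IS x → TangentSpace IS x → Prop)
        (η₀ η : HyperplaneField IV V), IsBourgeois IV IS IM k π M o η₀ η →
      -- positive frames are sent to adapted open books of the fibre
      (∀ (b : S) (u v : TangentSpace IS b), o b u v →
        IsFibreAdapted IV IM k M η (frameOpenBook IV IS π η₀ η b u v)) ∧
      -- smooth paths of positive frames are sent to smooth families of adapted open books
      (∀ (c : ℝ → S) (u v : ∀ t, TangentSpace IS (c t)),
        ContMDiffOn 𝓘(ℝ, ℝ) IS.tangent ∞ (fun t => (⟨c t, u t⟩ : TangentBundle IS S)) (Icc 0 1) →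
        ContMDiffOn 𝓘(ℝ, ℝ) IS.tangent ∞ (fun t => (⟨c t, v t⟩ : TangentBundle IS S)) (Icc 0 1) →
        (∀ t ∈ Icc (0 : ℝ) 1, o (c t) (u t) (v t)) →
        IsSmoothFamily IV IM k M η (Icc 0 1) c
          (fun t => frameOpenBook IV IS π η₀ η (c t) (u t) (v t))) ∧
      -- the isotopy class is well defined: it does not depend on the positive frame
      (∀ b : S, (∃ u v : TangentSpace IS b, o b u v) ∧
        ∀ u v : TangentSpace IS b, o b u v →
          frameOpenBook IV IS π η₀ η b u v ∈ isotopyClass IV IS IM k π M o η₀ η b ∧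
          isotopyClass IV IS IM k π M o η₀ η b =
            {B | IsFibreIsotopic IV IM k M η (frameOpenBook IV IS π η₀ η b u v) B}) ∧
      -- over a trivialized open set, the classes along a path come from an isotopy of open books
      (∀ e : Bundle.Trivialization M π, IsSmoothTrivialization IV IS IM e →
        ∀ ε > 0, ∀ c : ℝ → S, ContMDiffOn 𝓘(ℝ, ℝ) IS ∞ c (Ioo (-ε) ε) →
        ∀ hc : ∀ t ∈ Ioo (-ε) ε, c t ∈ e.baseSet,
        ∃ B : ∀ t, OpenBook (Fibre π (c t)),
          (∀ t ∈ Ioo (-ε) ε, B t ∈ isotopyClass IV IS IM k π M o η₀ η (c t)) ∧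
          IsSmoothFamily IV IM k M η (Ioo (-ε) ε) c B ∧
          ∃ f : ℝ → M ≃ₘ^∞⟮IM, IM⟯ M, IsIsotopyOn (Ioo (-ε) ε) f ∧
            ∀ (h0 : (0 : ℝ) ∈ Ioo (-ε) ε) (t : ℝ) (ht : t ∈ Ioo (-ε) ε),
              (((B 0).pullback (e.preimageSingletonHomeomorph (hc 0 h0)).symm).image
                (f t).toEquiv).Same
              ((B t).pullback (e.preimageSingletonHomeomorph (hc t ht)).symm))) ∧
    -- the original construction on `M × 𝕋² → 𝕋²`
    (∀ (ξ : HyperplaneField IM M), IsContact k ξ →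
      ∀ B : OpenBook M, IsAdapted k ξ B →
      ∀ Φ : M → ℂ, IsDefinedBy IM B Φ →
      ∀ β : OneForm IM M, IsAdaptedForm k ξ B β → WedgeNonneg k Φ β →
        IsBourgeois (IM.prod torusModel) torusModel IM k (Prod.snd : M × Torus → Torus) M
          torusOrientation (productField IM ξ) (cokernel (bourgeoisForm IM β Φ)) ∧
        ∀ (b : Torus) (B' : OpenBook (Fibre (Prod.snd : M × Torus → Torus) b)),
          B' ∈ isotopyClass (IM.prod torusModel) torusModel IM k (Prod.snd : M × Torus → Torus) M
              torusOrientation (productField IM ξ) (cokernel (bourgeoisForm IM β Φ)) b ↔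
            IsIsotopic k ξ B (B'.pullback (slice b))) := by
  refine ⟨?_, ?_⟩
  · intro EV _ _ _ hEV HV _ IV _ V _ _ _ _ _ ES _ _ _ hES HS _ IS _ S _ _ _ _ _ π o η₀ η hB
    refine ⟨fun b u v ho => hB.isFibreAdapted_frameOpenBook hEM hEV hES ho,
      fun c u v hu hv ho => hB.isSmoothFamily_frameOpenBook hEM hEV hES hu hv ho,
      fun b => ⟨hB.orientation.exists_frame b, fun u v ho => ⟨?_, ?_⟩⟩,
      fun e he ε hε c hcs hc => hB.exists_isotopy_of_path hEM hEV hES he hε hcs hc⟩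
    · exact (hB.mem_isotopyClass hEM hEV hES ho).2 (hB.isFibreIsotopic_of_frames hEM hEV hES ho ho)
    · exact Set.ext fun B => hB.mem_isotopyClass hEM hEV hES ho
  · intro ξ hξ B hB Φ hΦ β hβ hw
    have h := isContactForm_of_defines hEM hξ hβ.1
    have hb := hB.2.1 Φ β hΦ hβ.1
    obtain ⟨⟨-, -, rfl⟩, hp⟩ := hβ
    have hbour := isBourgeois_bourgeoisForm h hΦ hp hb hw
    exact ⟨hbour, fun b B' => mem_isotopyClass_bourgeoisForm h hΦ hbour b B'⟩
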